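/- **Setting.** For $\phi\in L^2(\mathbb R^d)$ let $\widehat\phi$ denote the Fourier transform (kernel $e^{-iz\cdot\zeta}$); the frequency variables dual to $(x,y,t)$ are $(\xi,\mu,\tau)$. Let $\omega(\xi,\mu)=\xi^3+\mu^2/\xi$ for $\xi\ne0$. For $s\ge 0$ put $\|\phi\|_{H^{s,0}}=\|(1+|\xi|^2)^{s/2}\widehat\phi(\xi,\mu)\|_{L^2_{\xi,\mu}}$ and $H^{\infty,0}=\bigcap_{\sigma\ge0}H^{\sigma,0}(\mathbb R^2)$ (with the topology given by all these norms). For $k\ge1$ let $P_k$ be the Fourier multiplier with symbol $\mathbf 1_{\{\frac34 2^k\le|\xi|<\frac32 2^k\}}$, and let $P_{\le 0}$ be the one with symbol $\mathbf 1_{\{|\xi|<3/2\}}$. Put $\widetilde I_k=\{2^{k-1}\le|\xi|\le2^{k+1}\}$ for $k\ge1$ and $\widetilde I_{\le0}=\{|\xi|\le2\}$. Fix an even smooth $\eta_0:\mathbb R\to[0,1]$ supported in $[-8/5,8/5]$ and equal to $1$ on $[-5/4,5/4]$, and let $\eta_j(r)=\eta_0(r/2^j)-\eta_0(r/2^{j-1})$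 for $j\ge1$. For $g:\mathbb R^3\to\mathbb C$ and $k\ge 0$ with $g$ supported in $\widetilde I_k\times\mathbb R^2$ ($\widetilde I_{\le0}\times\mathbb R^2$ if $k=0$) let $$\|g\|_{X_k}=\sum_{j\ge0}2^{j/2}\|\eta_j(\tau-\omega(\xi,\mu))\,g(\xi,\mu,\tau)\|_{L^2}.$$ $F_k$ is the space of $f\in L^2(\mathbb R^3)$ with $\widehat f$ supported in $\widetilde I_k\times\mathbb R^2$ ($\widetilde I_{\le0}\times\mathbb R^2$ if $k=0$) and $$\|f\|_{F_k}=\sup_{t_k\in\mathbb R}\big\|\mathcal F[f\cdot\eta_0(2^k(t-t_k))]\big\|_{X_k}<\infty .$$ For $T\in(0,1]$ let $\|f\|_{F_k(T)}=\inf\|\widetilde f\|_{F_k}$, the infimum being over all $\widetilde f\in F_k$ with $\widetilde f=f$ on $\mathbb R^2\times[-T,T]$ (and $\|f\|_{F_k(T)}=\infty$ if there is none). For $u\in C([-T,T]:H^{\infty,0})$ define $$\|u\|_{F^s(T)}^2=\|P_{\le0}u\|_{F_0(T)}^2+\sum_{k\ge1}2^{2sk}\|P_ku\|_{F_k(T)}^2\in[0,\infty],$$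 $$\|u\|_{E^s(T)}^2=\|P_{\le0}u(0)\|_{L^2}^2+\sum_{k\ge1}\ \sup_{t_k\in[-T,T]}2^{2sk}\|P_ku(t_k)\|_{L^2}^2 .$$ The KP-I equation is $\partial_tu+\partial_x^3u-\partial_x^{-1}\partial_y^2u+\partial_x(u^2/2)=0$. It is understood in the sense of distributions, $\partial_x^{-1}\partial_y^2 u$ being defined by $\langle\partial_x^{-1}\partial_y^2u,\partial_x\psi\rangle=-\langle u,\partial_y^2\psi\rangle$ for Schwartz $\psi$ on $\mathbb R^2$; that is, for every such $\psi$ and every $t\in(-T,T)$, $$\frac{d}{dt}\int_{\mathbb R^2} u\,\partial_x\psi\,dx\,dy=\int_{\mathbb R^2} u\,(\partial_x^4\psi-\partial_y^2\psi)\,dx\,dy+\int_{\mathbb R^2}\tfrac12u^2\,\partial_x^2\psi\,dx\,dy .$$ **Proposition 6.2.** Let $s\ge1$. There is a constant $C$, depending only on $s$ (and on the fixed cutoff $\eta_0$), such that for every $T\in(0,1]$ and every real-valued $u\in C([-T,T]:H^{\infty,0})$ that solves the KP-I equation on $\mathbb R^2\times(-T,T)$, with $u_0=u(0)$, $$\|u\|_{E^s(T)}^2\le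 C\big(\|u_0\|_{H^{s,0}}^2+\|u\|_{F^1(T)}\|u\|_{F^s(T)}^2\big),$$ where the right-hand side may be $+\infty$. -/

import Mathlib

open MeasureTheory Filter Topology Set
open scoped ENNReal NNReal FourierTransform SchwartzMap LineDeriv

noncomputable section

namespace KPI

/-- The plane `ℝ²`; a point is `(x, y)` in physical space and `(ξ, μ)` in frequency space. -/
abbrev Plane : Type := EuclideanSpace ℝ (Fin 2)

/-- Space-time `ℝ³`; a point is `(x, y, t)` in physical space and `(ξ, μ, τ)` in frequency space. -/
abbrev SpaceTime : Type := EuclideanSpace ℝ (Fin 3)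

/-! ### Fourier transform and Littlewood-Paley projections -/

open Classical in
/-- The Fourier transform of `f ∈ L²(ℝᵈ)` with the normalisation
`f̂(ζ) = ∫ e^{-i z·ζ} f(z) dz` (extended to `L²` by density).  Mathlib's transform has the kernel
`e^{-2πi z·ζ}`, hence the rescaling of the frequency.  The value is `0` if `f ∉ L²`. -/
def fourierL2 {d : ℕ} (f : EuclideanSpace ℝ (Fin d) → ℂ) : EuclideanSpace ℝ (Fin d) → ℂ :=
  fun ζ => if h : MemLp f 2 volume then
    (𝓕 (h.toLp f) : Lp ℂ 2 (volume : Measure (EuclideanSpace ℝ (Fin d)))) ((2 * Real.pi)⁻¹ • ζ)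
  else 0

open Classical in
/-- The inverse of `fourierL2` on `L²(ℝᵈ)`. -/
def invFourierL2 {d : ℕ} (g : EuclideanSpace ℝ (Fin d) → ℂ) : EuclideanSpace ℝ (Fin d) → ℂ :=
  fun z => if h : MemLp (fun η => g ((2 * Real.pi) • η)) 2 volume then
    (𝓕⁻ (h.toLp (fun η => g ((2 * Real.pi) • η))) :
      Lp ℂ 2 (volume : Measure (EuclideanSpace ℝ (Fin d)))) z
  else 0

/-- The sharp frequency projection `φ ↦ 𝓕⁻¹(1_I(ξ) φ̂(ξ, μ))` in the first variable. -/
def freqProj (I : Set ℝ) (φ : Plane → ℂ) : Plane → ℂ :=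
  invFourierL2 ({ζ : Plane | ζ 0 ∈ I}.indicator (fourierL2 φ))

/-- `I_k = {ξ : (3/4) 2^k ≤ |ξ| < (3/2) 2^k}` for `k ≥ 1`, and `I_{≤0} = {ξ : |ξ| < 3/2}` for
`k = 0`. -/
def freqBand (k : ℕ) : Set ℝ :=
  if k = 0 then {ξ | |ξ| < 3 / 2}
  else {ξ | 3 / 4 * 2 ^ k ≤ |ξ| ∧ |ξ| < 3 / 2 * 2 ^ k}

/-- The fattened band: `{ξ : 2^(k-1) ≤ |ξ| ≤ 2^(k+1)}` for `k ≥ 1`, and `{ξ : |ξ| ≤ 2}` for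
`k = 0`. -/
def wideBand (k : ℕ) : Set ℝ :=
  if k = 0 then {ξ | |ξ| ≤ 2}
  else {ξ | (2 : ℝ) ^ ((k : ℤ) - 1) ≤ |ξ| ∧ |ξ| ≤ (2 : ℝ) ^ (k + 1)}

/-- `P_k` for `k ≥ 1`, and `P_{≤0}` for `k = 0`. -/
def P (k : ℕ) : (Plane → ℂ) → (Plane → ℂ) := freqProj (freqBand k)

/-! ### The cutoff and the dispersion relation -/

/-- An even smooth `η₀ : ℝ → [0,1]`, supported in `[-8/5, 8/5]` and equal to `1` on
`[-5/4, 5/4]`. -/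
structure IsCutoff (η₀ : ℝ → ℝ) : Prop where
  smooth : ContDiff ℝ ((⊤ : ℕ∞) : WithTop ℕ∞) η₀
  even : ∀ x, η₀ (-x) = η₀ x
  mem_Icc : ∀ x, η₀ x ∈ Icc (0 : ℝ) 1
  support : ∀ x, 8 / 5 < |x| → η₀ x = 0
  eq_one : ∀ x, |x| ≤ 5 / 4 → η₀ x = 1

/-- The inhomogeneous dyadic partition of unity: `η_0 = η₀` and
`η_j(x) = η₀(x/2^j) - η₀(x/2^(j-1))` for `j ≥ 1`. -/
def etaPiece (η₀ : ℝ → ℝ) (j : ℕ) (x : ℝ) : ℝ :=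
  if j = 0 then η₀ x else η₀ (x / 2 ^ j) - η₀ (x / (2 : ℝ) ^ ((j : ℤ) - 1))

/-- The dispersion relation `ω(ξ, μ) = ξ³ + μ²/ξ` (defined for `ξ ≠ 0`, that is, almost
everywhere). -/
def omega (ξ μ : ℝ) : ℝ := ξ ^ 3 + μ ^ 2 / ξ

/-! ### Function spaces.  All norms take values in `[0, ∞]`. -/

/-- The norm of the anisotropic Sobolev space `H^{s₁,s₂}(ℝ²)`, for `φ ∈ L²`. -/
def HNorm (s₁ s₂ : ℝ) (φ : Plane → ℂ) : ℝ≥0∞ :=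
  eLpNorm (fun ζ : Plane =>
    fourierL2 φ ζ * (((1 + |ζ 0| ^ 2) ^ (s₁ / 2) * (1 + |ζ 1| ^ 2) ^ (s₂ / 2) : ℝ) : ℂ)) 2 volume

/-- `‖g‖_{X_k} = ∑_{j ≥ 0} 2^{j/2} ‖η_j(τ - ω(ξ,μ)) g(ξ,μ,τ)‖_{L²}`. -/
def XNorm (η₀ : ℝ → ℝ) (g : SpaceTime → ℂ) : ℝ≥0∞ :=
  ∑' j : ℕ, (2 : ℝ≥0∞) ^ ((j : ℝ) / 2) *
    eLpNorm (fun p : SpaceTime => ((etaPiece η₀ j (p 2 - omega (p 0) (p 1)) : ℝ) : ℂ) * g p)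
      2 volume

/-- `‖f‖_{F_k} = sup_{t_k ∈ ℝ} ‖𝓕[f · η₀(2^k (t - t_k))]‖_{X_k}`. -/
def FkNorm (η₀ : ℝ → ℝ) (k : ℕ) (f : SpaceTime → ℂ) : ℝ≥0∞ :=
  ⨆ tk : ℝ, XNorm η₀
    (fourierL2 (fun p : SpaceTime => f p * ((η₀ (2 ^ k * (p 2 - tk)) : ℝ) : ℂ)))

/-- `f ∈ L²(ℝ³)` and `f̂` is supported in (fattened `k`-th band) `× ℝ²`: the conditions for
membership in `F_k` besides the finiteness of the norm. -/
def IsFkLocalized (k : ℕ) (f : SpaceTime → ℂ) : Prop :=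
  MemLp f 2 volume ∧ ∀ᵐ p : SpaceTime, p 0 ∉ wideBand k → fourierL2 f p = 0

/-- `F = f` on `ℝ² × [-T, T]` (almost everywhere). -/
def IsExtension (T : ℝ) (f : ℝ → Plane → ℂ) (F : SpaceTime → ℂ) : Prop :=
  ∀ᵐ t : ℝ, t ∈ Icc (-T) T → (fun z : Plane => F !₂[z 0, z 1, t]) =ᵐ[volume] f t

/-- `‖f‖_{F_k(T)}`: the infimum of `‖F‖_{F_k}` over all extensions `F ∈ F_k` of `f`
(`∞` if there is none). -/
def FkTNorm (η₀ : ℝ → ℝ) (k : ℕ) (T : ℝ) (f : ℝ → Plane → ℂ) : ℝ≥0∞ :=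
  ⨅ (F : SpaceTime → ℂ) (_ : IsFkLocalized k F) (_ : IsExtension T f F), FkNorm η₀ k F

/-- `‖u‖_{F^s(T)}`. -/
def FNorm (η₀ : ℝ → ℝ) (s T : ℝ) (u : ℝ → Plane → ℂ) : ℝ≥0∞ :=
  ((∑' k : ℕ, (2 : ℝ≥0∞) ^ (2 * s * ((k : ℝ) + 1)) *
      FkTNorm η₀ (k + 1) T (fun t => P (k + 1) (u t)) ^ 2)
    + FkTNorm η₀ 0 T (fun t => P 0 (u t)) ^ 2) ^ (1 / 2 : ℝ)

/-- The dyadic energy norm `‖u‖_{E^s(T)}`. -/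
def ENorm (s T : ℝ) (u : ℝ → Plane → ℂ) : ℝ≥0∞ :=
  (eLpNorm (P 0 (u 0)) 2 volume ^ 2
    + ∑' k : ℕ, ⨆ t ∈ Icc (-T) T,
        (2 : ℝ≥0∞) ^ (2 * s * ((k : ℝ) + 1)) *
          eLpNorm (P (k + 1) (u t)) 2 volume ^ 2) ^ (1 / 2 : ℝ)

/-! ### Solutions -/

/-- A real-valued function of `(t, (x, y))` regarded as a complex-valued one. -/
def toC (u : ℝ → Plane → ℝ) : ℝ → Plane → ℂ := fun t z => ((u t z : ℝ) : ℂ)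

/-- `u ∈ C([-T, T] : H^{∞,0})`, where `H^{∞,0} = ⋂_σ H^{σ,0}`. -/
def IsHInfPath (T : ℝ) (u : ℝ → Plane → ℝ) : Prop :=
  (∀ t ∈ Icc (-T) T, MemLp (u t) 2 volume) ∧
  ∀ σ : ℝ, 0 ≤ σ →
    (∀ t ∈ Icc (-T) T, HNorm σ 0 (toC u t) < ⊤) ∧
    ∀ t₀ ∈ Icc (-T) T,
      Tendsto (fun t => HNorm σ 0 (fun z => toC u t z - toC u t₀ z))
        (𝓝[Icc (-T) T] t₀) (𝓝 0)

/-- The unit vector in the `x` direction. -/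
def ex : Plane := !₂[1, 0]

/-- The unit vector in the `y` direction. -/
def ey : Plane := !₂[0, 1]

/-- `u` solves `∂ₜu + ∂ₓ³u - ∂ₓ⁻¹∂_y²u + ∂ₓ(u²/2) = 0` on `ℝ² × (-T, T)`, in the sense of
tempered distributions in `(x, y)`.  Since `∂ₓ⁻¹∂_y²u` (the Fourier multiplier `iμ²/ξ`) need not
be locally integrable in frequency at `ξ = 0`, it is defined by its action
`⟨∂ₓ⁻¹∂_y²u, ∂ₓψ⟩ = -⟨u, ∂_y²ψ⟩` on `x`-derivatives of Schwartz functions `ψ`; the equation is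
accordingly tested against `∂ₓψ`:
`d/dt ∫ u ∂ₓψ = ∫ u (∂ₓ⁴ψ - ∂_y²ψ) + ∫ (u²/2) ∂ₓ²ψ`. -/
def IsKPISolution (T : ℝ) (u : ℝ → Plane → ℝ) : Prop :=
  ∀ ψ : 𝓢(Plane, ℂ), ∀ t ∈ Ioo (-T) T,
    HasDerivAt (fun r => ∫ z, toC u r z * ∂_{ex} ψ z)
      ((∫ z, toC u t z * (∂_{ex} (∂_{ex} (∂_{ex} (∂_{ex} ψ))) z - ∂_{ey} (∂_{ey} ψ) z))
        + ∫ z, toC u t z ^ 2 / 2 * ∂_{ex} (∂_{ex} ψ) z) t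

end KPI

end

open MeasureTheory Filter Topology Set
open scoped ENNReal NNReal FourierTransform SchwartzMap LineDeriv

noncomputable section

namespace KPI

/-! The proof is an energy method at each dyadic frequency. Its cubic error term is controlled by a
trilinear estimate on short time intervals.

Energy. Put h(ξ) = ξ · bump(ξ/2^k)². The linear flow preserves the mass at first frequency about
2^k, so the increment of this mass between two times is a cubic form, the space-time integral of u²
times the multiplier h applied to u (`energy_sub_eq`). Expanding u in Littlewood-Paley pieces and
symmetrizing replaces h by m = h(a) + h(b) + h(c) on a + b + c = 0, where a, b, c are the first
frequencies. Since h is odd and Lipschitz uniformly in k, m is bounded by the smallest of |a|, |b|,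
|c|: the derivative falls on the lowest frequency. The two largest frequencies are comparable, so
min · max² ≤ 2|abc|, and therefore |m| ≲ (√min / max) · √|abc| (`abs_msym_le_sqrt`).

Trilinear estimate. For functions with modulations |τ - ω| at most A₁, A₂, A₃, the integral over
triples of sum zero with weight √|abc| is at most a constant times √(A₁A₂A₃) times the L² norms
(`tri_weight_le`). If |abc| is dominated by A₁ + A₂ + A₃, the weight is absorbed into one of the √Aᵢ
and the bilinear form of the L⁴ Strichartz estimate (`sq_conv_le`) treats the other two functions.
Otherwise the resonance function, which is minus the sum of the modulations, is small against abc,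
and `resonance_eq` makes the slopes μ/ξ differ by about √3 times a frequency. The dispersion
surfaces are then transversal, and a Loomis-Whitney argument applies (`lintegral_nonresRegion_le`).
Summing over dyadic modulations turns √A into the weight 2^{j/2} of the X-norm.

Time localization. The F_k norm controls time windows of length 2^{-k}, so three pieces with largest
index hi and smallest index lo are treated on windows of length 2^{-hi}. The number of windows,
about 2^{hi}, cancels the factor 1/max, which leaves √(2^lo). Windows meeting an endpoint of the
time interval carry a sharp cutoff; there one factor is measured in L² only, which gains 2^{-hi/2},
and the cruder bound |m| ≲ 2^lo suffices (`exists_time_localized_bound`).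

Summation. The symbol m vanishes unless two of the bands are close to each other and not far below
2^k. The weight 2^{2sk} goes to these two pieces and produces the square of the F^s norm; the factor
√(2^lo) goes to the third and is summed by the F^1 norm (`tsum_interaction_le`). All of this is done
for near-optimal extensions of the pieces, and their excess is sent to zero. -/

section

/-! ### Coordinates -/

/-- The coordinates `(x, y) ↦ !₂[x, y]` as a measurable equivalence. -/
def planeEquiv : ℝ × ℝ ≃ᵐ Plane :=
  (MeasurableEquiv.finTwoArrow (α := ℝ)).symm.trans (MeasurableEquiv.toLp 2 (Fin 2 → ℝ))

lemma measurePreserving_planeEquiv : MeasurePreserving planeEquiv volume volume :=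
  ((volume_preserving_finTwoArrow ℝ).symm _).trans (PiLp.volume_preserving_toLp (Fin 2))

/-- The splitting of space-time into space and time as a measurable equivalence. -/
def stEquiv : Plane × ℝ ≃ᵐ SpaceTime :=
  (MeasurableEquiv.prodComm.trans
    ((MeasurableEquiv.refl ℝ).prodCongr (MeasurableEquiv.toLp 2 (Fin 2 → ℝ)).symm)).trans
    ((MeasurableEquiv.piFinSuccAbove (fun _ : Fin 3 => ℝ) (Fin.last 2)).symm.trans
      (MeasurableEquiv.toLp 2 (Fin 3 → ℝ)))

@[simp] lemma stEquiv_apply (w : Plane × ℝ) : stEquiv w = !₂[w.1 0, w.1 1, w.2] := by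
  ext i
  fin_cases i <;> rfl

lemma measurePreserving_stEquiv : MeasurePreserving stEquiv volume volume := by
  have h₁ : MeasurePreserving (MeasurableEquiv.prodComm (α := Plane) (β := ℝ)) volume volume :=
    Measure.measurePreserving_swap
  have h₂ : MeasurePreserving ((MeasurableEquiv.refl ℝ).prodCongr
      (MeasurableEquiv.toLp 2 (Fin 2 → ℝ)).symm) volume volume :=
    (MeasurePreserving.id _).prod
      (EuclideanSpace.volume_preserving_symm_measurableEquiv_toLp (Fin 2))
  exact (h₁.trans h₂).trans (((volume_preserving_piFinSuccAbove (fun _ : Fin 3 => ℝ)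
      (Fin.last 2)).symm _).trans (PiLp.volume_preserving_toLp (Fin 3)))

lemma lintegral_plane {F : Plane → ℝ≥0∞} (hF : Measurable F) :
    ∫⁻ p, F p = ∫⁻ ξ : ℝ, ∫⁻ μ : ℝ, F !₂[ξ, μ] := by
  rw [← measurePreserving_planeEquiv.lintegral_comp hF, Measure.volume_eq_prod,
    lintegral_prod (fun w => F (planeEquiv w)) (hF.comp planeEquiv.measurable).aemeasurable]
  rfl

lemma lintegral_st {F : SpaceTime → ℝ≥0∞} (hF : Measurable F) :
    ∫⁻ p, F p = ∫⁻ z : Plane, ∫⁻ t : ℝ, F !₂[z 0, z 1, t] := by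
  rw [← measurePreserving_stEquiv.lintegral_comp hF, Measure.volume_eq_prod,
    lintegral_prod (fun w => F (stEquiv w)) (hF.comp stEquiv.measurable).aemeasurable]
  simp

lemma lintegral_st' {F : SpaceTime → ℝ≥0∞} (hF : Measurable F) :
    ∫⁻ p, F p = ∫⁻ t : ℝ, ∫⁻ z : Plane, F !₂[z 0, z 1, t] := by
  rw [← measurePreserving_stEquiv.lintegral_comp hF, Measure.volume_eq_prod,
    lintegral_prod_symm (fun w => F (stEquiv w)) (hF.comp stEquiv.measurable).aemeasurable]
  simp

@[fun_prop] lemma measurable_mk3 {α : Type*} [MeasurableSpace α] {a b c : α → ℝ}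
    (ha : Measurable a) (hb : Measurable b) (hc : Measurable c) :
    Measurable fun x => (!₂[a x, b x, c x] : SpaceTime) := by
  refine (MeasurableEquiv.toLp 2 (Fin 3 → ℝ)).measurable.comp ?_
  refine measurable_pi_iff.2 fun i => ?_
  fin_cases i <;> simpa

lemma lintegral_coords {F : SpaceTime → ℝ≥0∞} (hF : Measurable F) :
    ∫⁻ p, F p = ∫⁻ ξ : ℝ, ∫⁻ μ : ℝ, ∫⁻ τ : ℝ, F !₂[ξ, μ, τ] := by
  rw [lintegral_st hF, lintegral_plane]
  · simp
  · refine Measurable.lintegral_prod_right' (f := fun w : Plane × ℝ => F !₂[w.1 0, w.1 1, w.2]) ?_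
    exact hF.comp (measurable_mk3 (by fun_prop) (by fun_prop) (by fun_prop))

/-! ### Cauchy-Schwarz inequalities for convolutions -/

lemma sq_lintegral_mul_le {α : Type*} [MeasurableSpace α] {μ : Measure α} {f g : α → ℝ≥0∞}
    (hf : AEMeasurable f μ) (hg : AEMeasurable g μ) :
    (∫⁻ a, f a * g a ∂μ) ^ 2 ≤ (∫⁻ a, f a ^ 2 ∂μ) * ∫⁻ a, g a ^ 2 ∂μ := by
  have h := ENNReal.lintegral_mul_le_Lp_mul_Lq μ (Real.HolderConjugate.two_two) hf hg
  have h2 := pow_le_pow_left' h 2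
  have e : ∀ x : ℝ≥0∞, (x ^ (1 / 2 : ℝ)) ^ 2 = x := fun x => by
    rw [← ENNReal.rpow_natCast, ← ENNReal.rpow_mul]; norm_num
  rw [mul_pow, e, e] at h2
  simpa using h2

/-- The trilinear Cauchy-Schwarz inequality behind the Loomis-Whitney inequality. -/
lemma sq_trilinear_le {f₁ f₂ f₃ : SpaceTime → ℝ≥0∞} {α β : SpaceTime → SpaceTime → ℝ≥0∞}
    (h₁ : Measurable f₁) (h₂ : Measurable f₂) (h₃ : Measurable f₃)
    (hα : Measurable (Function.uncurry α)) (hβ : Measurable (Function.uncurry β)) {M : ℝ≥0∞}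
    (hM : ∀ a b, f₁ a ≠ 0 → f₂ b ≠ 0 → ∫⁻ p, (α a p * β b p) ^ 2 ≤ M) :
    (∫⁻ p, f₃ p * ∫⁻ a, (f₁ a * α a p) * (f₂ (p - a) * β (p - a) p)) ^ 2
      ≤ M * (∫⁻ a, f₁ a ^ 2) * (∫⁻ a, f₂ a ^ 2) * ∫⁻ a, f₃ a ^ 2 := by
  have mA : Measurable fun w : SpaceTime × SpaceTime => f₁ w.1 * α w.1 w.2 :=
    (h₁.comp measurable_fst).mul hα
  have mB : Measurable fun w : SpaceTime × SpaceTime => f₂ w.1 * β w.1 w.2 :=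
    (h₂.comp measurable_fst).mul hβ
  have mA' : Measurable fun w : SpaceTime × SpaceTime => f₁ w.2 * α w.2 w.1 :=
    mA.comp measurable_swap
  have mB' : Measurable fun w : SpaceTime × SpaceTime => f₂ w.2 * β w.2 w.1 :=
    mB.comp measurable_swap
  have mB'' : Measurable fun w : SpaceTime × SpaceTime =>
      f₂ (w.1 - w.2) * β (w.1 - w.2) w.1 :=
    mB.comp (f := fun w : SpaceTime × SpaceTime => (w.1 - w.2, w.1)) (by fun_prop)
  refine (sq_lintegral_mul_le h₃.aemeasurable
    (mA'.mul mB'').lintegral_prod_right'.aemeasurable).trans ?_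
  rw [mul_comm]
  gcongr
  calc ∫⁻ p, (∫⁻ a, (f₁ a * α a p) * (f₂ (p - a) * β (p - a) p)) ^ 2
      ≤ ∫⁻ p, (∫⁻ a, (f₁ a * α a p) ^ 2) * ∫⁻ b, (f₂ b * β b p) ^ 2 := by
        refine lintegral_mono fun p => ?_
        refine (sq_lintegral_mul_le (by fun_prop) (by fun_prop)).trans ?_
        -- The reflection `b = p - a` decouples the second factor from `a`. Once `a` and `b` are
        -- independent, the integral in `p` can be taken innermost, where `M` bounds it.
        rw [lintegral_sub_left_eq_self (fun b => (f₂ b * β b p) ^ 2) p]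
    _ = ∫⁻ p, ∫⁻ a, ∫⁻ b, (f₁ a * α a p) ^ 2 * (f₂ b * β b p) ^ 2 := by
        refine lintegral_congr fun p => ?_
        rw [← lintegral_mul_const _ (by fun_prop)]
        refine lintegral_congr fun a => ?_
        rw [← lintegral_const_mul _ (by fun_prop)]
    _ = ∫⁻ a, ∫⁻ b, ∫⁻ p, (f₁ a * α a p) ^ 2 * (f₂ b * β b p) ^ 2 := by
        rw [lintegral_lintegral_swap]
        · refine lintegral_congr fun a => ?_
          rw [lintegral_lintegral_swap]
          refine Measurable.aemeasurable ?_
          exact ((mA.comp (f := fun w : SpaceTime × SpaceTime => (a, w.1)) (by fun_prop)).pow_const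
            2).mul (mB'.pow_const 2)
        · refine Measurable.aemeasurable ?_
          refine Measurable.lintegral_prod_right' (f := fun w : (SpaceTime × SpaceTime) × SpaceTime =>
            (f₁ w.1.2 * α w.1.2 w.1.1) ^ 2 * (f₂ w.2 * β w.2 w.1.1) ^ 2) ?_
          exact ((mA.comp (f := fun w : (SpaceTime × SpaceTime) × SpaceTime => (w.1.2, w.1.1))
            (by fun_prop)).pow_const 2).mul ((mB.comp
            (f := fun w : (SpaceTime × SpaceTime) × SpaceTime => (w.2, w.1.1))
            (by fun_prop)).pow_const 2)
    _ ≤ ∫⁻ a, ∫⁻ b, (f₁ a ^ 2 * f₂ b ^ 2) * M := by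
        refine lintegral_mono fun a => lintegral_mono fun b => ?_
        by_cases ha : f₁ a = 0
        · simp [ha]
        by_cases hb : f₂ b = 0
        · simp [hb]
        calc ∫⁻ p, (f₁ a * α a p) ^ 2 * (f₂ b * β b p) ^ 2
            = ∫⁻ p, (f₁ a ^ 2 * f₂ b ^ 2) * (α a p * β b p) ^ 2 :=
              lintegral_congr fun p => by ring
          _ = (f₁ a ^ 2 * f₂ b ^ 2) * ∫⁻ p, (α a p * β b p) ^ 2 := by
              refine lintegral_const_mul _ ?_
              fun_prop
          _ ≤ _ := by gcongr; exact hM a b ha hb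
    _ = M * (∫⁻ a, f₁ a ^ 2) * ∫⁻ a, f₂ a ^ 2 := by
        simp_rw [mul_right_comm _ _ M]
        have : ∀ a, ∫⁻ b, f₁ a ^ 2 * M * f₂ b ^ 2 = f₁ a ^ 2 * (M * ∫⁻ b, f₂ b ^ 2) := fun a => by
          rw [lintegral_const_mul _ (by fun_prop), mul_assoc]
        simp_rw [this]
        rw [lintegral_mul_const _ (by fun_prop)]
        ring

/-- The bilinear Cauchy-Schwarz inequality for convolutions. -/
lemma lintegral_sq_conv_le {f g : SpaceTime → ℝ≥0∞} (hf : Measurable f) (hg : Measurable g)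
    {M : ℝ≥0∞} (hM : ∀ p, volume {a | f a ≠ 0 ∧ g (p - a) ≠ 0} ≤ M) :
    ∫⁻ p, (∫⁻ a, f a * g (p - a)) ^ 2 ≤ M * (∫⁻ a, f a ^ 2) * ∫⁻ a, g a ^ 2 := by
  have mg : Measurable fun w : SpaceTime × SpaceTime => g (w.1 - w.2) := by fun_prop
  calc ∫⁻ p, (∫⁻ a, f a * g (p - a)) ^ 2
      ≤ ∫⁻ p, M * ∫⁻ a, f a ^ 2 * g (p - a) ^ 2 := by
        refine lintegral_mono fun p => ?_
        have hS : MeasurableSet {a | f a ≠ 0 ∧ g (p - a) ≠ 0} :=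
          (hf (measurableSet_singleton 0).compl).inter
            ((show Measurable fun a => g (p - a) by fun_prop) (measurableSet_singleton 0).compl)
        -- The indicator of the joint support is inserted so that Cauchy-Schwarz produces the
        -- measure of that support as its first factor.
        have e : ∀ a, f a * g (p - a)
            = {a | f a ≠ 0 ∧ g (p - a) ≠ 0}.indicator 1 a * (f a * g (p - a)) := fun a => by
          by_cases h : a ∈ {a | f a ≠ 0 ∧ g (p - a) ≠ 0}
          · simp [indicator_of_mem h]
          · rw [indicator_of_notMem h]
            simp only [mem_ofPred_eq, not_and_or, not_not] at h
            rcases h with h | h <;> simp [h]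
        calc (∫⁻ a, f a * g (p - a)) ^ 2
            = (∫⁻ a, {a | f a ≠ 0 ∧ g (p - a) ≠ 0}.indicator 1 a * (f a * g (p - a))) ^ 2 := by
              congr 1; exact lintegral_congr e
          _ ≤ _ := sq_lintegral_mul_le (measurable_one.indicator hS).aemeasurable (by fun_prop)
          _ ≤ _ := by
              gcongr ?_ * ?_
              · refine le_trans (le_of_eq ?_) (hM p)
                rw [← lintegral_indicator_one hS]
                refine lintegral_congr fun a => ?_
                by_cases h : a ∈ {a | f a ≠ 0 ∧ g (p - a) ≠ 0}
                · simp [indicator_of_mem h]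
                · simp [indicator_of_notMem h]
              · exact (lintegral_congr fun a => by ring).le
    _ = M * ∫⁻ a, ∫⁻ p, f a ^ 2 * g (p - a) ^ 2 := by
        rw [lintegral_const_mul _ (by fun_prop), lintegral_lintegral_swap]
        fun_prop
    _ = _ := by
        rw [mul_assoc]
        congr 1
        have : ∀ a, ∫⁻ p, f a ^ 2 * g (p - a) ^ 2 = f a ^ 2 * ∫⁻ p, g p ^ 2 := fun a => by
          rw [lintegral_const_mul _ (by fun_prop),
            lintegral_sub_right_eq_self (fun p => g p ^ 2) a]
        simp_rw [this]
        rw [lintegral_mul_const _ (by fun_prop)]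

/-- Reflecting one factor does not change the `L²` norm of a convolution. -/
lemma lintegral_sq_conv_reflect {f g : SpaceTime → ℝ≥0∞} (hf : Measurable f) (hg : Measurable g) :
    ∫⁻ p, (∫⁻ a, f a * g (-(p - a))) ^ 2 = ∫⁻ p, (∫⁻ a, f a * g (p - a)) ^ 2 := by
  -- Expanding the square expresses the norm through the autocorrelation of `g` alone, and an
  -- autocorrelation is even.
  have key : ∀ g : SpaceTime → ℝ≥0∞, Measurable g → ∫⁻ p, (∫⁻ a, f a * g (p - a)) ^ 2
      = ∫⁻ a, ∫⁻ c, f a * f c * ∫⁻ p, g (p - a) * g (p - c) := by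
    intro g hg
    calc ∫⁻ p, (∫⁻ a, f a * g (p - a)) ^ 2
        = ∫⁻ p, ∫⁻ a, ∫⁻ c, f a * f c * (g (p - a) * g (p - c)) := by
          refine lintegral_congr fun p => ?_
          rw [sq, ← lintegral_mul_const _ (by fun_prop)]
          refine lintegral_congr fun a => ?_
          rw [← lintegral_const_mul _ (by fun_prop)]
          exact lintegral_congr fun c => by ring
      _ = ∫⁻ a, ∫⁻ p, ∫⁻ c, f a * f c * (g (p - a) * g (p - c)) := by
          rw [lintegral_lintegral_swap]
          refine (Measurable.lintegral_prod_right' (f := fun w : (SpaceTime × SpaceTime) × SpaceTime =>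
            f w.1.2 * f w.2 * (g (w.1.1 - w.1.2) * g (w.1.1 - w.2))) ?_).aemeasurable
          fun_prop
      _ = ∫⁻ a, ∫⁻ c, ∫⁻ p, f a * f c * (g (p - a) * g (p - c)) := by
          refine lintegral_congr fun a => ?_
          rw [lintegral_lintegral_swap]
          fun_prop
      _ = _ := by
          refine lintegral_congr fun a => lintegral_congr fun c => ?_
          rw [lintegral_const_mul _ (by fun_prop)]
  rw [key g hg, key (fun x => g (-x)) (by fun_prop)]
  refine lintegral_congr fun a => lintegral_congr fun c => ?_
  congr 1
  -- The substitution `p ↦ a + c - p` exchanges the two factors of the autocorrelation.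
  calc ∫⁻ p, g (-(p - a)) * g (-(p - c))
      = ∫⁻ p, g (-(p + (a + c) - a)) * g (-(p + (a + c) - c)) :=
        (lintegral_add_right_eq_self (fun p => g (-(p - a)) * g (-(p - c))) (a + c)).symm
    _ = ∫⁻ p, (fun p => g (p - a) * g (p - c)) (-p) := by
        refine lintegral_congr fun p => ?_
        simp only
        rw [mul_comm]
        congr 2 <;> abel
    _ = _ := lintegral_neg_eq_self (fun p => g (p - a) * g (p - c))

end

section

/-! ### The bilinear `L²` estimate -/

lemma lintegral_affine {F : ℝ → ℝ≥0∞} (hF : Measurable F) {a : ℝ} (ha : a ≠ 0) (b : ℝ) :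
    ∫⁻ x, F x = ENNReal.ofReal |a| * ∫⁻ w, F (a * w + b) := by
  have h1 : ∫⁻ x, F x = ∫⁻ x, F (x + b) := (lintegral_add_right_eq_self F b).symm
  rw [h1]
  conv_lhs => rw [← Real.smul_map_volume_mul_left ha]
  rw [lintegral_smul_measure, lintegral_map (by fun_prop) (by fun_prop)]
  rfl

lemma add_sq_le_two_mul (x y : ℝ≥0∞) : (x + y) ^ 2 ≤ 2 * (x ^ 2 + y ^ 2) := by
  wlog h : x ≤ y generalizing x y
  · rw [add_comm x, add_comm (x ^ 2)]
    exact this y x (le_of_not_ge h)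
  obtain ⟨d, rfl⟩ := exists_add_of_le h
  calc (x + (x + d)) ^ 2 ≤ (x + (x + d)) ^ 2 + d ^ 2 := le_self_add
    _ = _ := by ring

/-- The set lies between two discs of squared radii `c - d` and `c + d`. Areas are linear in the
squared radius, so the bound does not depend on `c`. -/
lemma volume_annulus_le (c : ℝ) {d : ℝ} (hd : 0 ≤ d) :
    volume {w : ℝ × ℝ | |w.1 ^ 2 + w.2 ^ 2 - c| ≤ d} ≤ ENNReal.ofReal (2 * Real.pi * d) := by
  have hm : MeasurableSet {w : ℝ × ℝ | |w.1 ^ 2 + w.2 ^ 2 - c| ≤ d} :=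
    measurableSet_le (by fun_prop) (by fun_prop)
  rw [← Complex.volume_preserving_equiv_real_prod.measure_preimage hm.nullMeasurableSet]
  have hsub : Complex.measurableEquivRealProd ⁻¹' {w : ℝ × ℝ | |w.1 ^ 2 + w.2 ^ 2 - c| ≤ d}
      ⊆ Metric.closedBall 0 √(c + d) \ Metric.ball 0 √(c - d) := by
    intro z hz
    have hz' : |z.re ^ 2 + z.im ^ 2 - c| ≤ d := hz
    have hn : ‖z‖ ^ 2 = z.re ^ 2 + z.im ^ 2 := by
      rw [← Complex.normSq_eq_norm_sq, Complex.normSq_apply]; ring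
    rw [← hn, abs_le] at hz'
    constructor
    · rw [mem_closedBall_zero_iff]
      exact Real.le_sqrt_of_sq_le (by linarith)
    · rw [mem_ball_zero_iff, not_lt]
      exact Real.sqrt_le_iff.2 ⟨norm_nonneg _, by linarith⟩
  refine (measure_mono hsub).trans ?_
  have hball : ∀ x : ℝ, ENNReal.ofReal √x ^ 2 * (NNReal.pi : ℝ≥0∞)
      = ENNReal.ofReal (max x 0 * Real.pi) := fun x => by
    rw [← ENNReal.ofReal_pow (Real.sqrt_nonneg _), ENNReal.ofReal_mul (le_max_right _ _)]
    congr 1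
    · rcases le_total 0 x with h | h
      · rw [Real.sq_sqrt h, max_eq_left h]
      · rw [Real.sqrt_eq_zero_of_nonpos h, max_eq_right h]; simp
    · rw [ENNReal.ofReal, ← NNReal.coe_real_pi, Real.toNNReal_coe]
  have h : √(c - d) ≤ √(c + d) := Real.sqrt_le_sqrt (by linarith)
  rw [measure_sdiff (Metric.ball_subset_closedBall.trans (Metric.closedBall_subset_closedBall h))
    measurableSet_ball.nullMeasurableSet (by simp [Complex.volume_ball, ENNReal.mul_eq_top]),
    Complex.volume_closedBall, Complex.volume_ball, hball, hball,
    ← ENNReal.ofReal_sub _ (by positivity)]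
  refine ENNReal.ofReal_le_ofReal ?_
  rw [← sub_mul]
  have : max (c + d) 0 - max (c - d) 0 ≤ 2 * d := by
    rcases max_cases (c + d) 0 with h | h <;> rcases max_cases (c - d) 0 with h' | h' <;> linarith
  nlinarith [Real.pi_pos]

/-- Completing the square in both variables. For `0 < ξ₁ < ξ` both square terms have positive
coefficients, so the set where the phase sum is nearly constant is an annulus up to rescaling. -/
lemma omega_add_sub_omega {ξ μ ξ₁ μ₁ : ℝ} (h : ξ ≠ 0) (h₁ : ξ₁ ≠ 0) (h₂ : ξ - ξ₁ ≠ 0) :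
    omega ξ₁ μ₁ + omega (ξ - ξ₁) (μ - μ₁) = omega ξ μ - 3 * ξ ^ 3 / 4 + 3 * ξ * (ξ₁ - ξ / 2) ^ 2
      + ξ * (μ₁ - μ * ξ₁ / ξ) ^ 2 / (ξ₁ * (ξ - ξ₁)) := by
  unfold omega
  field_simp
  ring

@[fun_prop] lemma measurable_omega : Measurable fun w : ℝ × ℝ => omega w.1 w.2 := by
  unfold omega
  fun_prop

@[fun_prop] lemma Measurable.omega' {α : Type*} [MeasurableSpace α] {f g : α → ℝ}
    (hf : Measurable f) (hg : Measurable g) : Measurable fun a => omega (f a) (g a) :=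
  measurable_omega.comp (hf.prodMk hg)

lemma indicator_le_indicator_of_imp {α β : Type*} {s : Set α} {t : Set β} {a : α} {b : β}
    (h : a ∈ s → b ∈ t) : s.indicator (1 : α → ℝ≥0∞) a ≤ t.indicator 1 b := by
  by_cases ha : a ∈ s
  · simp [ha, h ha]
  · simp [ha]

/-- Scaling `ξ₁` by `√3` and `μ₁` by `√(ξ₁(ξ - ξ₁))` turns the set into an annulus of width
parameter `d / ξ`. The Jacobian `√(ξ₁(ξ - ξ₁)) ≤ ξ / 2` compensates the factor `1 / ξ`, which makes
the bound uniform in the frequencies. -/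
lemma volume_plane_resonance_le (ξ μ c : ℝ) {d : ℝ} (hd : 0 ≤ d) :
    ∫⁻ ξ₁ : ℝ, volume {μ₁ : ℝ | 0 < ξ₁ ∧ ξ₁ < ξ ∧
      |omega ξ₁ μ₁ + omega (ξ - ξ₁) (μ - μ₁) - c| ≤ d} ≤ ENNReal.ofReal (4 * d) := by
  by_cases hξ : 0 < ξ
  swap
  · refine le_trans (le_of_eq ?_) zero_le
    rw [lintegral_eq_zero_iff']
    · refine ae_of_all _ fun ξ₁ => ?_
      refine (measure_mono_null (t := ∅) ?_ measure_empty)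
      rintro μ₁ ⟨h1, h2, -⟩
      exact hξ (h1.trans h2)
    · refine (Measurable.aemeasurable ?_)
      exact measurable_measure_prodMk_left (α := ℝ) (β := ℝ) (s := {w : ℝ × ℝ | 0 < w.1 ∧ w.1 < ξ ∧
        |omega w.1 w.2 + omega (ξ - w.1) (μ - w.2) - c| ≤ d}) (by measurability)
  set c' := (c - omega ξ μ + 3 * ξ ^ 3 / 4) / ξ with hc'
  set T : Set (ℝ × ℝ) := {w : ℝ × ℝ | |w.1 ^ 2 + w.2 ^ 2 - c'| ≤ d / ξ} with hT
  have mT : MeasurableSet T := measurableSet_le (by fun_prop) (by fun_prop)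
  have step : ∀ ξ₁ : ℝ, volume {μ₁ : ℝ | 0 < ξ₁ ∧ ξ₁ < ξ ∧
      |omega ξ₁ μ₁ + omega (ξ - ξ₁) (μ - μ₁) - c| ≤ d}
      ≤ ENNReal.ofReal (ξ / 2) * ∫⁻ w : ℝ, T.indicator 1 (√3 * (ξ₁ - ξ / 2), w) := by
    intro ξ₁
    by_cases h : 0 < ξ₁ ∧ ξ₁ < ξ
    swap
    · refine le_trans (le_of_eq (measure_mono_null (t := ∅) ?_ measure_empty)) zero_le
      rintro μ₁ ⟨h1, h2, -⟩
      exact h ⟨h1, h2⟩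
    obtain ⟨h1, h2⟩ := h
    have h3 : 0 < ξ - ξ₁ := by linarith
    have hS : MeasurableSet {μ₁ : ℝ | 0 < ξ₁ ∧ ξ₁ < ξ ∧
        |omega ξ₁ μ₁ + omega (ξ - ξ₁) (μ - μ₁) - c| ≤ d} := by measurability
    have hs : 0 < √(ξ₁ * (ξ - ξ₁)) := Real.sqrt_pos.2 (by positivity)
    have hs2 : √(ξ₁ * (ξ - ξ₁)) ≤ ξ / 2 :=
      Real.sqrt_le_iff.2 ⟨by positivity, by nlinarith [sq_nonneg (ξ₁ - ξ / 2)]⟩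
    rw [← lintegral_indicator_one hS,
      lintegral_affine (measurable_one.indicator hS) hs.ne' (μ * ξ₁ / ξ), abs_of_pos hs]
    gcongr with w
    refine indicator_le_indicator_of_imp ?_
    rintro ⟨-, -, hw⟩
    rw [omega_add_sub_omega hξ.ne' h1.ne' h3.ne'] at hw
    rw [hT, mem_ofPred_eq, le_div_iff₀ hξ]
    calc |(√3 * (ξ₁ - ξ / 2)) ^ 2 + w ^ 2 - c'| * ξ
        = |((√3 * (ξ₁ - ξ / 2)) ^ 2 + w ^ 2 - c') * ξ| := by rw [abs_mul, abs_of_pos hξ]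
      _ ≤ d := by
        convert hw using 2
        rw [mul_pow, Real.sq_sqrt (by norm_num), add_sub_cancel_right, mul_pow,
          Real.sq_sqrt (by positivity), hc']
        field_simp
        ring
  have h3 : (√3 : ℝ) ≠ 0 := by positivity
  have mF : Measurable fun x : ℝ => ∫⁻ w : ℝ, T.indicator 1 (x, w) :=
    Measurable.lintegral_prod_right' (f := fun w : ℝ × ℝ => T.indicator (1 : ℝ × ℝ → ℝ≥0∞) w)
      (measurable_one.indicator mT)
  calc _ ≤ ∫⁻ ξ₁ : ℝ, ENNReal.ofReal (ξ / 2) *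
        ∫⁻ w : ℝ, T.indicator 1 (√3 * (ξ₁ - ξ / 2), w) := lintegral_mono step
    _ = ENNReal.ofReal (ξ / 2) * ∫⁻ ξ₁ : ℝ, (fun x => ∫⁻ w : ℝ, T.indicator 1 (x, w))
          (√3 * ξ₁ + (-(√3 * (ξ / 2)))) := by
        rw [lintegral_const_mul]
        · simp only [sub_eq_add_neg, mul_add, mul_neg]
        · exact mF.comp (by fun_prop)
    _ ≤ ENNReal.ofReal (ξ / 2) * (ENNReal.ofReal |√3| * ∫⁻ ξ₁ : ℝ,
          (fun x => ∫⁻ w : ℝ, T.indicator 1 (x, w)) (√3 * ξ₁ + (-(√3 * (ξ / 2))))) := by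
        gcongr
        refine le_mul_of_one_le_left zero_le ?_
        rw [ENNReal.one_le_ofReal, abs_of_nonneg (by positivity)]
        exact Real.one_le_sqrt.2 (by norm_num)
    _ = ENNReal.ofReal (ξ / 2) * volume T := by
        rw [← lintegral_affine mF h3, ← lintegral_indicator_one mT, Measure.volume_eq_prod,
          lintegral_prod _ (measurable_one.indicator mT).aemeasurable]
    _ ≤ ENNReal.ofReal (ξ / 2) * ENNReal.ofReal (2 * Real.pi * (d / ξ)) := by
        gcongr
        exact volume_annulus_le c' (by positivity)
    _ = ENNReal.ofReal (Real.pi * d) := by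
        rw [← ENNReal.ofReal_mul (by positivity)]
        congr 1
        field_simp
    _ ≤ ENNReal.ofReal (4 * d) := by
        refine ENNReal.ofReal_le_ofReal ?_
        nlinarith [Real.pi_le_four]

lemma volume_abs_sub_le (c r : ℝ) : volume {x : ℝ | |x - c| ≤ r} ≤ ENNReal.ofReal (2 * r) := by
  have : {x : ℝ | |x - c| ≤ r} = Metric.closedBall c r := by
    ext x; simp [Real.dist_eq]
  rw [this, Real.volume_closedBall]

/-- For fixed space frequencies, `τ` lies in an interval of length `2A` and in one of length `2B`,
hence in one of length `2 min(A, B)`. Such a `τ` exists only if the phase sum is within `A + B` of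
`p 2`, a planar set of measure at most `4(A + B)`. The product is at most `16AB` because `min(A,
B)(A + B) ≤ 2AB`. -/
lemma volume_strichartz_le (p : SpaceTime) {A B : ℝ} (hA : 0 ≤ A) (hB : 0 ≤ B) :
    volume {a : SpaceTime | (0 < a 0 ∧ |a 2 - omega (a 0) (a 1)| ≤ A) ∧
      (0 < (p - a) 0 ∧ |(p - a) 2 - omega ((p - a) 0) ((p - a) 1)| ≤ B)}
      ≤ ENNReal.ofReal (16 * A * B) := by
  set S := {a : SpaceTime | (0 < a 0 ∧ |a 2 - omega (a 0) (a 1)| ≤ A) ∧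
      (0 < (p - a) 0 ∧ |(p - a) 2 - omega ((p - a) 0) ((p - a) 1)| ≤ B)} with hSdef
  have hS : MeasurableSet S := by measurability
  set R : ℝ → Set ℝ := fun ξ₁ => {μ₁ : ℝ | 0 < ξ₁ ∧ ξ₁ < p 0 ∧
      |omega ξ₁ μ₁ + omega (p 0 - ξ₁) (p 1 - μ₁) - p 2| ≤ A + B} with hR
  have mR : ∀ ξ₁, MeasurableSet (R ξ₁) := fun ξ₁ => by measurability
  rw [← lintegral_indicator_one hS, lintegral_coords (measurable_one.indicator hS)]
  calc ∫⁻ ξ : ℝ, ∫⁻ μ : ℝ, ∫⁻ τ : ℝ, S.indicator 1 !₂[ξ, μ, τ]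
      ≤ ∫⁻ ξ : ℝ, ∫⁻ μ : ℝ, ENNReal.ofReal (2 * min A B) * (R ξ).indicator 1 μ := by
        refine lintegral_mono fun ξ => lintegral_mono fun μ => ?_
        by_cases hμ : μ ∈ R ξ
        · rw [indicator_of_mem hμ, Pi.one_apply, mul_one]
          have hsec : ∀ U : Set ℝ, MeasurableSet U → (∀ τ, !₂[ξ, μ, τ] ∈ S → τ ∈ U) →
              ∫⁻ τ : ℝ, S.indicator 1 !₂[ξ, μ, τ] ≤ volume U := by
            intro U hU h
            rw [← lintegral_indicator_one hU]
            exact lintegral_mono fun τ => indicator_le_indicator_of_imp (h τ)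
          rcases le_total A B with hAB | hAB
          · rw [min_eq_left hAB]
            refine (hsec {τ | |τ - omega ξ μ| ≤ A} (measurableSet_le (by fun_prop) (by fun_prop))
              ?_).trans (volume_abs_sub_le _ _)
            rintro τ ⟨⟨-, h⟩, -⟩
            simpa using h
          · rw [min_eq_right hAB]
            refine (hsec {τ | |τ - (p 2 - omega (p 0 - ξ) (p 1 - μ))| ≤ B}
              (measurableSet_le (by fun_prop) (by fun_prop)) ?_).trans (volume_abs_sub_le _ _)
            rintro τ ⟨-, -, h⟩
            rw [mem_ofPred_eq, ← abs_neg]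
            convert h using 2
            simp
            ring
        · rw [indicator_of_notMem hμ, mul_zero]
          refine (lintegral_eq_zero_of_ae_eq_zero (ae_of_all _ fun τ => ?_)).le
          refine indicator_of_notMem (fun h => hμ ?_) _
          obtain ⟨⟨h1, h2⟩, h3, h4⟩ := h
          simp only [PiLp.sub_apply, Matrix.cons_val_zero, Matrix.cons_val_one,
            Matrix.cons_val] at h1 h2 h3 h4
          refine ⟨h1, by linarith, ?_⟩
          rw [abs_le] at h2 h4 ⊢
          constructor <;> linarith
    _ = ENNReal.ofReal (2 * min A B) * ∫⁻ ξ : ℝ, volume (R ξ) := by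
        rw [← lintegral_const_mul']
        · refine lintegral_congr fun ξ => ?_
          rw [lintegral_const_mul _ (measurable_one.indicator (mR ξ)),
            lintegral_indicator_one (mR ξ)]
        · exact ENNReal.ofReal_ne_top
    _ ≤ ENNReal.ofReal (2 * min A B) * ENNReal.ofReal (4 * (A + B)) := by
        gcongr
        exact volume_plane_resonance_le (p 0) (p 1) (p 2) (by positivity)
    _ ≤ _ := by
        rw [← ENNReal.ofReal_mul (by positivity)]
        refine ENNReal.ofReal_le_ofReal ?_
        rcases le_total A B with h | h
        · rw [min_eq_left h]; nlinarith
        · rw [min_eq_right h]; nlinarith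

lemma omega_neg (ξ μ : ℝ) : omega (-ξ) (-μ) = -omega ξ μ := by
  unfold omega
  rw [neg_sq, div_neg]
  ring

lemma sq_conv_le_of_pos {f g : SpaceTime → ℝ≥0∞} (hf : Measurable f) (hg : Measurable g)
    {A B : ℝ} (hA : 0 ≤ A) (hB : 0 ≤ B)
    (hf' : ∀ a, f a ≠ 0 → 0 < a 0 ∧ |a 2 - omega (a 0) (a 1)| ≤ A)
    (hg' : ∀ a, g a ≠ 0 → 0 < a 0 ∧ |a 2 - omega (a 0) (a 1)| ≤ B) :
    ∫⁻ p, (∫⁻ a, f a * g (p - a)) ^ 2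
      ≤ ENNReal.ofReal (16 * A * B) * (∫⁻ a, f a ^ 2) * ∫⁻ a, g a ^ 2 :=
  lintegral_sq_conv_le hf hg fun p =>
    (measure_mono (t := {a : SpaceTime | (0 < a 0 ∧ |a 2 - omega (a 0) (a 1)| ≤ A) ∧
      (0 < (p - a) 0 ∧ |(p - a) 2 - omega ((p - a) 0) ((p - a) 1)| ≤ B)})
      fun _ ha => ⟨hf' _ ha.1, hg' _ ha.2⟩).trans (volume_strichartz_le p hA hB)

/-- The convolution is symmetric. -/
lemma conv_comm (f g : SpaceTime → ℝ≥0∞) (p : SpaceTime) :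
    ∫⁻ a, f a * g (p - a) = ∫⁻ a, g a * f (p - a) := by
  rw [← lintegral_sub_left_eq_self (fun a => f a * g (p - a)) p]
  simp [mul_comm]

/-- Estimates for convolutions that are invariant under reflections of the factors. -/
lemma sq_conv_reflect_both {f g : SpaceTime → ℝ≥0∞} (hf : Measurable f) (hg : Measurable g) :
    ∫⁻ p, (∫⁻ a, f (-a) * g (-(p - a))) ^ 2 = ∫⁻ p, (∫⁻ a, f a * g (p - a)) ^ 2 := by
  rw [lintegral_sq_conv_reflect (f := fun a => f (-a)) (by fun_prop) hg]
  simp_rw [fun p => conv_comm (fun a => f (-a)) g p]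
  rw [lintegral_sq_conv_reflect hg hf]
  simp_rw [fun p => conv_comm g f p]

lemma ae_ne_zero_coord : ∀ᵐ a : SpaceTime, a 0 ≠ 0 := by
  have hS : MeasurableSet {a : SpaceTime | a 0 = 0} := measurableSet_eq_fun (by fun_prop) (by fun_prop)
  rw [ae_iff]
  simp only [ne_eq, not_not]
  rw [← lintegral_indicator_one hS, lintegral_coords (measurable_one.indicator hS)]
  refine lintegral_eq_zero_of_ae_eq_zero ?_
  have : ∀ᵐ ξ : ℝ, ξ ≠ 0 := by simp [ae_iff]
  filter_upwards [this] with ξ hξ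
  simp [indicator, hξ]

/-- The bilinear form of the `L⁴` Strichartz estimate, for functions with modulations at most `A`
and `B`. -/
lemma sq_conv_le {f g : SpaceTime → ℝ≥0∞} (hf : Measurable f) (hg : Measurable g)
    {A B : ℝ} (hA : 0 ≤ A) (hB : 0 ≤ B)
    (hf' : ∀ a, f a ≠ 0 → |a 2 - omega (a 0) (a 1)| ≤ A)
    (hg' : ∀ a, g a ≠ 0 → |a 2 - omega (a 0) (a 1)| ≤ B) :
    ∫⁻ p, (∫⁻ a, f a * g (p - a)) ^ 2
      ≤ ENNReal.ofReal (256 * A * B) * (∫⁻ a, f a ^ 2) * ∫⁻ a, g a ^ 2 := by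
  have mS : MeasurableSet {a : SpaceTime | 0 < a 0} := measurableSet_lt (by fun_prop) (by fun_prop)
  have mS' : MeasurableSet {a : SpaceTime | a 0 < 0} := measurableSet_lt (by fun_prop) (by fun_prop)
  -- The measure bound requires positive first frequencies. As `omega` is odd, a part with negative
  -- frequencies satisfies the hypotheses after reflection, and reflecting factors does not change
  -- the norm. The constant is 256 = 4 · 4 · 16: four sign pairs, and a factor 4 from squaring a sum
  -- of four terms.
  set f₁ := {a : SpaceTime | 0 < a 0}.indicator f with hf₁
  set f₂ := {a : SpaceTime | a 0 < 0}.indicator f with hf₂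
  set g₁ := {a : SpaceTime | 0 < a 0}.indicator g with hg₁
  set g₂ := {a : SpaceTime | a 0 < 0}.indicator g with hg₂
  have mf₁ : Measurable f₁ := hf.indicator mS
  have mf₂ : Measurable f₂ := hf.indicator mS'
  have mg₁ : Measurable g₁ := hg.indicator mS
  have mg₂ : Measurable g₂ := hg.indicator mS'
  have ind : ∀ (h : SpaceTime → ℝ≥0∞) (S : Set SpaceTime),
      ∫⁻ a, S.indicator h a ^ 2 ≤ ∫⁻ a, h a ^ 2 := fun h S =>
    lintegral_mono fun a => by gcongr; exact indicator_le_self _ _ _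
  have split : ∀ h : SpaceTime → ℝ≥0∞, ∀ a : SpaceTime, a 0 ≠ 0 →
      h a = {a : SpaceTime | 0 < a 0}.indicator h a + {a : SpaceTime | a 0 < 0}.indicator h a := by
    intro h a ha
    rcases lt_or_gt_of_ne ha with h' | h'
    · simp [indicator, h', h'.not_gt]
    · simp [indicator, h', h'.not_gt]
  set X := (∫⁻ a, f a ^ 2) * ∫⁻ a, g a ^ 2 with hX
  have supp1 : ∀ {h : SpaceTime → ℝ≥0∞} {D : ℝ}, (∀ a, h a ≠ 0 → |a 2 - omega (a 0) (a 1)| ≤ D) →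
      ∀ a, {a : SpaceTime | 0 < a 0}.indicator h a ≠ 0 → 0 < a 0 ∧ |a 2 - omega (a 0) (a 1)| ≤ D := by
    intro h D hh a ha
    have h1 := mem_of_indicator_ne_zero ha
    have h2 : h a ≠ 0 := by rwa [indicator_of_mem h1] at ha
    exact ⟨h1, hh a h2⟩
  have supp2 : ∀ {h : SpaceTime → ℝ≥0∞} {D : ℝ}, (∀ a, h a ≠ 0 → |a 2 - omega (a 0) (a 1)| ≤ D) →
      ∀ a, {a : SpaceTime | a 0 < 0}.indicator h (-a) ≠ 0 →
        0 < a 0 ∧ |a 2 - omega (a 0) (a 1)| ≤ D := by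
    intro h D hh a ha
    have h1 := mem_of_indicator_ne_zero ha
    have h2 : h (-a) ≠ 0 := by rwa [indicator_of_mem h1] at ha
    have h3 := hh _ h2
    simp only [PiLp.neg_apply, mem_ofPred_eq, omega_neg] at h1 h3
    refine ⟨by linarith, ?_⟩
    rw [← abs_neg]
    convert h3 using 2
    ring
  have reflQ : ∀ h : SpaceTime → ℝ≥0∞, ∫⁻ a, h (-a) ^ 2 = ∫⁻ a, h a ^ 2 := fun h =>
    lintegral_neg_eq_self (fun a => h a ^ 2)
  have b11 : ∫⁻ p, (∫⁻ a, f₁ a * g₁ (p - a)) ^ 2 ≤ ENNReal.ofReal (16 * A * B) * X := by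
    refine (sq_conv_le_of_pos mf₁ mg₁ hA hB (supp1 hf') (supp1 hg')).trans ?_
    rw [mul_assoc]
    exact mul_le_mul_right (mul_le_mul' (ind _ _) (ind _ _)) _
  have b12 : ∫⁻ p, (∫⁻ a, f₁ a * g₂ (p - a)) ^ 2 ≤ ENNReal.ofReal (16 * A * B) * X := by
    rw [← lintegral_sq_conv_reflect mf₁ mg₂]
    refine (sq_conv_le_of_pos (g := fun a => g₂ (-a)) mf₁ (by fun_prop) hA hB (supp1 hf')
      (supp2 hg')).trans ?_
    rw [mul_assoc, reflQ]
    exact mul_le_mul_right (mul_le_mul' (ind _ _) (ind _ _)) _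
  have b21 : ∫⁻ p, (∫⁻ a, f₂ a * g₁ (p - a)) ^ 2 ≤ ENNReal.ofReal (16 * A * B) * X := by
    simp_rw [fun p => conv_comm f₂ g₁ p]
    rw [← lintegral_sq_conv_reflect mg₁ mf₂]
    refine (sq_conv_le_of_pos (g := fun a => f₂ (-a)) mg₁ (by fun_prop) hB hA (supp1 hg')
      (supp2 hf')).trans ?_
    rw [mul_assoc, reflQ, hX, mul_comm (∫⁻ a, f a ^ 2), mul_right_comm 16 B A]
    exact mul_le_mul_right (mul_le_mul' (ind _ _) (ind _ _)) _
  have b22 : ∫⁻ p, (∫⁻ a, f₂ a * g₂ (p - a)) ^ 2 ≤ ENNReal.ofReal (16 * A * B) * X := by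
    rw [← sq_conv_reflect_both mf₂ mg₂]
    refine (sq_conv_le_of_pos (f := fun a => f₂ (-a)) (g := fun a => g₂ (-a)) (by fun_prop)
      (by fun_prop) hA hB (supp2 hf') (supp2 hg')).trans ?_
    rw [mul_assoc, reflQ, reflQ]
    exact mul_le_mul_right (mul_le_mul' (ind _ _) (ind _ _)) _
  have four : ∀ x y z w : ℝ≥0∞, (x + y + (z + w)) ^ 2 ≤ 4 * (x ^ 2 + y ^ 2 + (z ^ 2 + w ^ 2)) := by
    intro x y z w
    calc _ ≤ 2 * ((x + y) ^ 2 + (z + w) ^ 2) := add_sq_le_two_mul _ _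
      _ ≤ 2 * (2 * (x ^ 2 + y ^ 2) + 2 * (z ^ 2 + w ^ 2)) := by gcongr <;> exact add_sq_le_two_mul _ _
      _ = _ := by ring
  calc ∫⁻ p, (∫⁻ a, f a * g (p - a)) ^ 2
      = ∫⁻ p, ((∫⁻ a, f₁ a * g₁ (p - a)) + (∫⁻ a, f₁ a * g₂ (p - a))
          + ((∫⁻ a, f₂ a * g₁ (p - a)) + ∫⁻ a, f₂ a * g₂ (p - a))) ^ 2 := by
        refine lintegral_congr fun p => ?_
        congr 1
        rw [← lintegral_add_left (by fun_prop), ← lintegral_add_left (by fun_prop),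
          ← lintegral_add_left (by fun_prop)]
        refine lintegral_congr_ae ?_
        have h2 : ∀ᵐ a : SpaceTime, (p - a) 0 ≠ 0 :=
          ((Measure.measurePreserving_sub_left volume p).quasiMeasurePreserving.ae
            ae_ne_zero_coord)
        filter_upwards [ae_ne_zero_coord, h2] with a ha ha'
        rw [split f a ha, split g _ ha']
        ring
    _ ≤ ∫⁻ p, 4 * ((∫⁻ a, f₁ a * g₁ (p - a)) ^ 2 + (∫⁻ a, f₁ a * g₂ (p - a)) ^ 2
          + ((∫⁻ a, f₂ a * g₁ (p - a)) ^ 2 + (∫⁻ a, f₂ a * g₂ (p - a)) ^ 2)) :=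
        lintegral_mono fun p => four _ _ _ _
    _ = 4 * ((∫⁻ p, (∫⁻ a, f₁ a * g₁ (p - a)) ^ 2) + (∫⁻ p, (∫⁻ a, f₁ a * g₂ (p - a)) ^ 2)
          + ((∫⁻ p, (∫⁻ a, f₂ a * g₁ (p - a)) ^ 2) + (∫⁻ p, (∫⁻ a, f₂ a * g₂ (p - a)) ^ 2))) := by
        rw [lintegral_const_mul _ (by fun_prop), lintegral_add_left (by fun_prop),
          lintegral_add_left (by fun_prop), lintegral_add_left (by fun_prop)]
    _ ≤ 4 * (ENNReal.ofReal (16 * A * B) * X + ENNReal.ofReal (16 * A * B) * X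
          + (ENNReal.ofReal (16 * A * B) * X + ENNReal.ofReal (16 * A * B) * X)) := by gcongr
    _ = _ := by
        rw [mul_assoc _ (∫⁻ a, f a ^ 2), ← hX,
          show (256 * A * B) = 16 * (16 * A * B) by ring, ENNReal.ofReal_mul (p := 16) (by norm_num)]
        rw [show ENNReal.ofReal 16 = 16 by norm_num]
        ring

end

section

/-! ### The nonresonant trilinear estimate -/

lemma lintegral_le_of_diam {F : ℝ → ℝ≥0∞} {c : ℝ≥0∞} {L : ℝ} (hc : ∀ x, F x ≤ c)
    (hL : ∀ x y, F x ≠ 0 → F y ≠ 0 → |x - y| ≤ L) : ∫⁻ x, F x ≤ c * ENNReal.ofReal (2 * L) := by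
  by_cases h : ∃ x₀, F x₀ ≠ 0
  swap
  · push Not at h
    simp [h]
  obtain ⟨x₀, h₀⟩ := h
  calc ∫⁻ x, F x ≤ ∫⁻ x, (Metric.closedBall x₀ L).indicator (fun _ => c) x := by
        refine lintegral_mono fun x => ?_
        by_cases hx : F x = 0
        · simp [hx]
        · rw [indicator_of_mem]
          · exact hc x
          · rw [Metric.mem_closedBall, Real.dist_eq]
            exact hL x x₀ hx h₀
    _ = _ := by rw [lintegral_indicator_const measurableSet_closedBall, Real.volume_closedBall]

/-- Let `x₀` be a support point whose modulus exceeds half the supremum. The whole support satisfies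
`|x| ≤ 2|x₀|` and lies within `K / |x₀|` of `x₀`, so the weight cancels against the length. -/
lemma lintegral_abs_mul_le {G : ℝ → ℝ≥0∞} {c : ℝ≥0∞} {K : ℝ} (hc : ∀ x, G x ≤ c)
    (hK : ∀ x y, G x ≠ 0 → G y ≠ 0 → |x - y| * |x| ≤ K) :
    ∫⁻ x, ENNReal.ofReal |x| * G x ≤ c * ENNReal.ofReal (4 * K) := by
  by_cases h : ∃ x₁, G x₁ ≠ 0 ∧ x₁ ≠ 0
  swap
  · push Not at h
    refine (lintegral_eq_zero_of_ae_eq_zero (ae_of_all _ fun x => ?_)).trans_le zero_le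
    by_cases hx : G x = 0
    · simp [hx]
    · simp [h x hx]
  obtain ⟨x₁, h₁, h₁'⟩ := h
  set V := {r : ℝ | ∃ x, G x ≠ 0 ∧ r = |x|} with hV
  have hx₁ : 0 < |x₁| := abs_pos.2 h₁'
  have bdd : BddAbove V := by
    refine ⟨|x₁| + K / |x₁|, ?_⟩
    rintro r ⟨x, hx, rfl⟩
    have := hK x₁ x h₁ hx
    rw [← le_div_iff₀ hx₁] at this
    have h2 := abs_sub_abs_le_abs_sub x x₁
    rw [abs_sub_comm x x₁] at h2
    linarith
  have hne : V.Nonempty := ⟨|x₁|, x₁, h₁, rfl⟩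
  have hsup : 0 < sSup V := hx₁.trans_le (le_csSup bdd ⟨x₁, h₁, rfl⟩)
  obtain ⟨r, ⟨x₀, h₀, rfl⟩, hr⟩ := exists_lt_of_lt_csSup hne (half_lt_self hsup)
  have hx₀ : 0 < |x₀| := by linarith
  have hK0 : 0 ≤ K := le_trans (by positivity) (hK x₀ x₀ h₀ h₀)
  calc ∫⁻ x, ENNReal.ofReal |x| * G x
      ≤ ∫⁻ x, (Metric.closedBall x₀ (K / |x₀|)).indicator
          (fun _ => ENNReal.ofReal (2 * |x₀|) * c) x := by
        refine lintegral_mono fun x => ?_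
        by_cases hx : G x = 0
        · simp [hx]
        · rw [indicator_of_mem]
          · gcongr
            · have : |x| ≤ sSup V := le_csSup bdd ⟨x, hx, rfl⟩
              linarith
            · exact hc x
          · rw [Metric.mem_closedBall, Real.dist_eq, le_div_iff₀ hx₀, abs_sub_comm]
            exact hK x₀ x h₀ hx
    _ = _ := by
        rw [lintegral_indicator_const measurableSet_closedBall, Real.volume_closedBall,
          mul_right_comm, ← ENNReal.ofReal_mul (by positivity), mul_comm]
        congr 2
        field_simp
        ring

/-- Integration in `τ`, then `μ`, then `ξ`. The `ξ`-diameter is only known to be of size `K / |ξ|`,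
which the weight `|ξ|` exactly compensates. -/
lemma lintegral_weight_le {E : Set SpaceTime} (hE : MeasurableSet E) {K L N : ℝ} (hL : 0 ≤ L)
    (hN : 0 ≤ N)
    (h0 : ∀ p ∈ E, ∀ p' ∈ E, |p 0 - p' 0| * |p 0| ≤ K)
    (h1 : ∀ p ∈ E, ∀ p' ∈ E, p 0 = p' 0 → |p 1 - p' 1| ≤ L)
    (h2 : ∀ p ∈ E, ∀ p' ∈ E, p 0 = p' 0 → p 1 = p' 1 → |p 2 - p' 2| ≤ N) :
    ∫⁻ p, ENNReal.ofReal |p 0| * E.indicator 1 p ≤ ENNReal.ofReal (16 * K * L * N) := by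
  have mE : Measurable (E.indicator (1 : SpaceTime → ℝ≥0∞)) := measurable_one.indicator hE
  have ex : ∀ {α : Type} [MeasurableSpace α] {F : α → ℝ≥0∞} {ν : Measure α},
      ∫⁻ x, F x ∂ν ≠ 0 → ∃ x, F x ≠ 0 := by
    intro α _ F ν h
    by_contra! h'
    simp [h'] at h
  have mem : ∀ {p : SpaceTime}, E.indicator (1 : SpaceTime → ℝ≥0∞) p ≠ 0 → p ∈ E :=
    fun h => mem_of_indicator_ne_zero h
  set F : ℝ → ℝ → ℝ≥0∞ := fun ξ μ => ∫⁻ τ : ℝ, E.indicator 1 !₂[ξ, μ, τ] with hF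
  set G : ℝ → ℝ≥0∞ := fun ξ => ∫⁻ μ : ℝ, F ξ μ with hG
  have bF : ∀ ξ μ, F ξ μ ≤ 1 * ENNReal.ofReal (2 * N) := fun ξ μ => by
    refine lintegral_le_of_diam (fun τ => ?_) fun τ τ' h h' => ?_
    · exact indicator_le_self' (f := (1 : SpaceTime → ℝ≥0∞)) (by simp) _
    · simpa using h2 _ (mem h) _ (mem h') (by simp) (by simp)
  have bG : ∀ ξ, G ξ ≤ 1 * ENNReal.ofReal (2 * N) * ENNReal.ofReal (2 * L) := fun ξ => by
    refine lintegral_le_of_diam (bF ξ) fun μ μ' h h' => ?_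
    obtain ⟨τ, hτ⟩ := ex h
    obtain ⟨τ', hτ'⟩ := ex h'
    simpa using h1 _ (mem hτ) _ (mem hτ') (by simp)
  calc ∫⁻ p, ENNReal.ofReal |p 0| * E.indicator 1 p = ∫⁻ ξ, ENNReal.ofReal |ξ| * G ξ := by
        rw [lintegral_coords (by fun_prop)]
        refine lintegral_congr fun ξ => ?_
        simp only [hG, hF, Matrix.cons_val_zero]
        rw [← lintegral_const_mul' _ _ ENNReal.ofReal_ne_top]
        refine lintegral_congr fun μ => ?_
        rw [← lintegral_const_mul' _ _ ENNReal.ofReal_ne_top]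
    _ ≤ 1 * ENNReal.ofReal (2 * N) * ENNReal.ofReal (2 * L) * ENNReal.ofReal (4 * K) := by
        refine lintegral_abs_mul_le bG fun ξ ξ' h h' => ?_
        obtain ⟨μ, hμ⟩ := ex h
        obtain ⟨μ', hμ'⟩ := ex h'
        obtain ⟨τ, hτ⟩ := ex hμ
        obtain ⟨τ', hτ'⟩ := ex hμ'
        simpa using h0 _ (mem hτ) _ (mem hτ')
    _ = _ := by
        rw [one_mul, ← ENNReal.ofReal_mul (by positivity), ← ENNReal.ofReal_mul (by positivity)]
        congr 1
        ring

/-- `R - R'` is the quotient of `R² - R'²` by `R + R'`, and the numerator equals `(3(Y + Y') + g)(Y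
- Y') + e`. Smallness of `v`, `v'` keeps `R` between `Y` and `9Y/5` and gives `R' ≤ 9Y'/5`. The
quotient `k` is then at least 1, since `3(Y + Y') + g ≥ 9(Y + Y')/5`, and the error is at most `b`.
-/
lemma branch_slope {Y Y' R R' v v' g e b : ℝ} (hY : 0 < Y) (hY' : 0 < Y') (hR : 0 < R)
    (hR' : 0 < R') (h : R ^ 2 = 3 * Y ^ 2 + v) (h' : R' ^ 2 = 3 * Y' ^ 2 + v')
    (hv : |v| ≤ Y ^ 2 / 10) (hv' : |v'| ≤ Y' ^ 2 / 10) (hd : v - v' = e + g * (Y - Y'))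
    (hg : |g| ≤ 3 / 10 * Y') (he : |e| ≤ b * Y) :
    ∃ k, 1 ≤ k ∧ |R - R' - k * (Y - Y')| ≤ b := by
  rw [abs_le] at hv hv' hg
  have r1 : Y ≤ R := by nlinarith
  have r2 : R ≤ 9 / 5 * Y := by nlinarith
  have r2' : R' ≤ 9 / 5 * Y' := by nlinarith
  have hS : 0 < R + R' := by positivity
  have hb : 0 ≤ b := by
    by_contra! hb
    have := (abs_nonneg e).trans he
    nlinarith
  refine ⟨(3 * (Y + Y') + g) / (R + R'), ?_, ?_⟩
  · rw [one_le_div hS]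
    linarith
  · have : R - R' - (3 * (Y + Y') + g) / (R + R') * (Y - Y') = e / (R + R') := by
      field_simp
      linear_combination h - h' + hd
    rw [this, abs_div, abs_of_pos hS, div_le_iff₀ hS]
    refine he.trans ?_
    gcongr
    linarith

/-- The resonance function. -/
def resonance (ξ₁ μ₁ ξ μ : ℝ) : ℝ := omega ξ₁ μ₁ + omega (ξ - ξ₁) (μ - μ₁) - omega ξ μ

/-- The source of transversality: where the resonance is small against `ξ₁ ξ (ξ - ξ₁)`, the slopes
`μ/ξ` and `μ₁/ξ₁` differ by about `√3 |ξ - ξ₁|`. With `ξ₁`, `μ₁` and the signs fixed, `μ/ξ` is then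
nearly a function of `ξ`. -/
lemma resonance_eq {ξ μ ξ₁ μ₁ : ℝ} (h : ξ ≠ 0) (h₁ : ξ₁ ≠ 0) (h₂ : ξ - ξ₁ ≠ 0) :
    (μ / ξ - μ₁ / ξ₁) ^ 2
      = 3 * (ξ - ξ₁) ^ 2 + resonance ξ₁ μ₁ ξ μ / ξ₁ * ((ξ - ξ₁) / ξ) := by
  unfold resonance omega
  field_simp
  ring

/-- By `resonance_eq` the signed slope difference is the positive root of `3Y² + v` with `Y = |ξ -
ξ₁|` and `v` small. Hence `μ/ξ` moves with `ξ` at rate at least 1 in the direction `s`, up to an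
error caused by the variation `2a` of the resonance. -/
lemma branch_estimate {ξ₁ μ₁ ξ μ ξ' μ' σ s a : ℝ} (hσ : σ ^ 2 = 1) (hs : s ^ 2 = 1)
    (h₁ : ξ₁ ≠ 0) (h : ξ ≠ 0) (h' : ξ' ≠ 0)
    (hy : 0 < σ * (ξ - ξ₁)) (hy' : 0 < σ * (ξ' - ξ₁))
    (hq : 0 < s * σ * (μ / ξ - μ₁ / ξ₁)) (hq' : 0 < s * σ * (μ' / ξ' - μ₁ / ξ₁))
    (hD : |resonance ξ₁ μ₁ ξ μ| ≤ |ξ₁ * ξ * (ξ - ξ₁)| / 10)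
    (hD' : |resonance ξ₁ μ₁ ξ' μ'| ≤ |ξ₁ * ξ' * (ξ' - ξ₁)| / 10)
    (hyξ : |ξ - ξ₁| ≤ 2 * |ξ|)
    (hDD : |resonance ξ₁ μ₁ ξ μ - resonance ξ₁ μ₁ ξ' μ'| ≤ 2 * a) :
    ∃ k, 1 ≤ k ∧ |μ / ξ - μ' / ξ' - s * k * (ξ - ξ')| ≤ 2 * a / |ξ₁ * ξ| := by
  have yne : ξ - ξ₁ ≠ 0 := by rintro h0; simp [h0] at hy
  have yne' : ξ' - ξ₁ ≠ 0 := by rintro h0; simp [h0] at hy'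
  have e1 := resonance_eq (μ := μ) (μ₁ := μ₁) h h₁ yne
  have e1' := resonance_eq (μ := μ') (μ₁ := μ₁) h' h₁ yne'
  set D := resonance ξ₁ μ₁ ξ μ
  set D' := resonance ξ₁ μ₁ ξ' μ'
  have aσ : |σ| = 1 := by rw [← sq_eq_sq₀ (abs_nonneg _) one_pos.le, sq_abs]; simpa using hσ
  have as : |s| = 1 := by rw [← sq_eq_sq₀ (abs_nonneg _) one_pos.le, sq_abs]; simpa using hs
  have Yabs : σ * (ξ - ξ₁) = |ξ - ξ₁| := by rw [← abs_of_pos hy, abs_mul, aσ, one_mul]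
  have Yabs' : σ * (ξ' - ξ₁) = |ξ' - ξ₁| := by rw [← abs_of_pos hy', abs_mul, aσ, one_mul]
  have p1 : 0 < |ξ₁| := abs_pos.2 h₁
  have p2 : 0 < |ξ| := abs_pos.2 h
  have p2' : 0 < |ξ'| := abs_pos.2 h'
  have vb : ∀ {D ξ : ℝ}, ξ ≠ 0 → |D| ≤ |ξ₁ * ξ * (ξ - ξ₁)| / 10 →
      |D / ξ₁ * ((ξ - ξ₁) / ξ)| ≤ |ξ - ξ₁| ^ 2 / 10 := by
    intro D ξ hξ hD
    have p2 : 0 < |ξ| := abs_pos.2 hξ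
    rw [abs_mul, abs_div, abs_div]
    rw [abs_mul, abs_mul] at hD
    calc |D| / |ξ₁| * (|ξ - ξ₁| / |ξ|)
        ≤ (|ξ₁| * |ξ| * |ξ - ξ₁| / 10) / |ξ₁| * (|ξ - ξ₁| / |ξ|) := by gcongr
      _ = _ := by field_simp
  have key : ∃ k, 1 ≤ k ∧ |s * σ * (μ / ξ - μ₁ / ξ₁) - s * σ * (μ' / ξ' - μ₁ / ξ₁)
      - k * (σ * (ξ - ξ₁) - σ * (ξ' - ξ₁))| ≤ 2 * a / |ξ₁ * ξ| := by
    -- The difference `v - v'` is split in two. The change of the resonance at fixed `ξ` is the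
    -- error `e`. The change of `(ξ - ξ₁)/ξ = 1 - ξ₁/ξ` at fixed `D'` is proportional to `ξ - ξ'`
    -- and gives the slope correction `g`.
    refine branch_slope (v := D / ξ₁ * ((ξ - ξ₁) / ξ)) (v' := D' / ξ₁ * ((ξ' - ξ₁) / ξ'))
      (g := σ * (D' / (ξ * ξ'))) (e := (D - D') / ξ₁ * ((ξ - ξ₁) / ξ))
      hy hy' hq hq' ?_ ?_ ?_ ?_ ?_ ?_ ?_
    · rw [mul_pow, mul_pow, mul_pow, hσ, hs, e1]; ring
    · rw [mul_pow, mul_pow, mul_pow, hσ, hs, e1']; ring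
    · rw [Yabs]; exact vb h hD
    · rw [Yabs']; exact vb h' hD'
    · have : σ * (D' / (ξ * ξ')) * (σ * (ξ - ξ₁) - σ * (ξ' - ξ₁)) = D' / (ξ * ξ') * (ξ - ξ') := by
        linear_combination D' / (ξ * ξ') * (ξ - ξ') * hσ
      rw [this]
      field_simp
      ring
    · rw [abs_mul, aσ, one_mul, abs_div, abs_mul, Yabs', div_le_iff₀ (by positivity)]
      refine hD'.trans ?_
      rw [abs_mul, abs_mul]
      have : |ξ₁| ≤ 3 * |ξ| := by
        have := abs_sub_abs_le_abs_sub ξ₁ ξ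
        rw [abs_sub_comm] at this
        linarith
      calc |ξ₁| * |ξ'| * |ξ' - ξ₁| / 10 ≤ (3 * |ξ|) * |ξ'| * |ξ' - ξ₁| / 10 := by gcongr
        _ = _ := by ring
    · rw [abs_mul, abs_div, abs_div, Yabs, abs_mul]
      calc |D - D'| / |ξ₁| * (|ξ - ξ₁| / |ξ|) ≤ (2 * a) / |ξ₁| * (|ξ - ξ₁| / |ξ|) := by gcongr
        _ = _ := by field_simp
  obtain ⟨k, hk, hk'⟩ := key
  refine ⟨k, hk, ?_⟩
  have : s * σ * (μ / ξ - μ₁ / ξ₁) - s * σ * (μ' / ξ' - μ₁ / ξ₁)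
      - k * (σ * (ξ - ξ₁) - σ * (ξ' - ξ₁))
      = (s * σ) * (μ / ξ - μ' / ξ' - s * k * (ξ - ξ')) := by
    linear_combination σ * k * (ξ - ξ') * hs
  rw [this, abs_mul, abs_mul, aσ, as] at hk'
  simpa using hk'

/-- The region of nonresonant interactions of `a` and `b` with output `p = a + b` on which the
frequencies and the slopes have prescribed signs. -/
def NonresRegion (A₁ A₂ A₃ σ σ' s : ℝ) (a b p : SpaceTime) : Prop :=
  (0 < σ * b 0 ∧ 0 < σ' * a 0 ∧ 0 < s * σ * (p 1 / p 0 - a 1 / a 0) ∧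
    0 < -s * σ' * (p 1 / p 0 - b 1 / b 0)) ∧
  (|omega (a 0) (a 1) + omega (b 0) (b 1) - omega (p 0) (p 1)| ≤ |a 0 * b 0 * p 0| / 10 ∧
    |b 0| ≤ 2 * |p 0| ∧ |a 0| ≤ 2 * |p 0|) ∧
  |a 2 - omega (a 0) (a 1)| ≤ A₁ ∧ |b 2 - omega (b 0) (b 1)| ≤ A₂ ∧ |p 2 - omega (p 0) (p 1)| ≤ A₃

lemma measurableSet_nonresRegion (A₁ A₂ A₃ σ σ' s : ℝ) {α : Type*} [MeasurableSpace α]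
    {a b p : α → SpaceTime} (ha : Measurable a) (hb : Measurable b) (hp : Measurable p) :
    MeasurableSet {x | NonresRegion A₁ A₂ A₃ σ σ' s (a x) (b x) (p x)} := by
  unfold NonresRegion
  measurability

/-- Two points `p`, `p'` of the set share both the input `a` and the input `b`. The first makes
`μ/ξ` move with `ξ` at rate at least 1 in the direction `s`, the second in the direction `-s`. These
are compatible only if `|p 0 - p' 0| · |p 0|` is at most `α + β`. At equal first frequency the
`μ`-diameter is at most `2 min(α, β)`, and at equal space frequencies the `τ`-diameter is at most `2
min(A₁, A₃)`. The weights `|a 0|` and `|b 0|` cancel the denominators of `α` and `β`. -/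
lemma lintegral_nonresRegion_le {A₁ A₂ A₃ σ σ' s : ℝ} (hσ : σ ^ 2 = 1) (hσ' : σ' ^ 2 = 1)
    (hs : s ^ 2 = 1) (hA₁ : 0 ≤ A₁) (hA₃ : 0 ≤ A₃) (h₃₂ : A₃ ≤ A₂) (a b : SpaceTime) :
    ∫⁻ p, ENNReal.ofReal (|a 0| * |b 0| * |p 0|) *
        {p | NonresRegion A₁ A₂ A₃ σ σ' s a (p - a) p ∧
          NonresRegion A₁ A₂ A₃ σ σ' s (p - b) b p}.indicator 1 p
      ≤ ENNReal.ofReal (512 * A₁ * A₂ * A₃) := by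
  set E := {p | NonresRegion A₁ A₂ A₃ σ σ' s a (p - a) p ∧
    NonresRegion A₁ A₂ A₃ σ σ' s (p - b) b p} with hE
  have mE : MeasurableSet E := (measurableSet_nonresRegion A₁ A₂ A₃ σ σ' s (a := fun _ => a)
      (b := fun p => p - a) (p := fun p => p) (by fun_prop) (by fun_prop) (by fun_prop)).inter
    (measurableSet_nonresRegion A₁ A₂ A₃ σ σ' s (a := fun p => p - b)
      (b := fun p => b) (p := fun p => p) (by fun_prop) (by fun_prop) (by fun_prop))
  by_cases hab : a 0 = 0 ∨ b 0 = 0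
  · refine (lintegral_eq_zero_of_ae_eq_zero (ae_of_all _ fun p => ?_)).trans_le zero_le
    rcases hab with h | h <;> simp [h]
  push Not at hab
  obtain ⟨ha, hb⟩ := hab
  have pa : 0 < |a 0| := abs_pos.2 ha
  have pb : 0 < |b 0| := abs_pos.2 hb
  have hp0 : ∀ p ∈ E, p 0 ≠ 0 := by
    rintro p ⟨⟨⟨h1, -⟩, ⟨-, h2, -⟩, -⟩, -⟩ h0
    rw [h0] at h2
    have : (p - a) 0 = 0 := by simpa using h2
    rw [this] at h1
    simp at h1
  have kA : ∀ p ∈ E, ∀ p' ∈ E, ∃ k, 1 ≤ k ∧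
      |p 1 / p 0 - p' 1 / p' 0 - s * k * (p 0 - p' 0)| ≤ 2 * (A₂ + A₃) / |a 0 * p 0| := by
    intro p hp p' hp'
    have n := hp0 p hp
    have n' := hp0 p' hp'
    obtain ⟨⟨⟨x1, x2, x3, x4⟩, ⟨x5, x6, x7⟩, x8, x9, x10⟩, -⟩ := hp
    obtain ⟨⟨⟨y1, y2, y3, y4⟩, ⟨y5, y6, y7⟩, y8, y9, y10⟩, -⟩ := hp'
    simp only [PiLp.sub_apply] at *
    refine branch_estimate (ξ₁ := a 0) (μ₁ := a 1) hσ hs ha n n' x1 y1 x3 y3 ?_ ?_ x6 ?_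
    · rw [mul_right_comm]; exact x5
    · rw [mul_right_comm]; exact y5
    · unfold resonance
      rw [abs_le] at *
      constructor <;> linarith
  have kB : ∀ p ∈ E, ∀ p' ∈ E, ∃ k, 1 ≤ k ∧
      |p 1 / p 0 - p' 1 / p' 0 - (-s) * k * (p 0 - p' 0)| ≤ 2 * (A₁ + A₃) / |b 0 * p 0| := by
    intro p hp p' hp'
    have n := hp0 p hp
    have n' := hp0 p' hp'
    obtain ⟨-, ⟨x1, x2, x3, x4⟩, ⟨x5, x6, x7⟩, x8, x9, x10⟩ := hp
    obtain ⟨-, ⟨y1, y2, y3, y4⟩, ⟨y5, y6, y7⟩, y8, y9, y10⟩ := hp'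
    simp only [PiLp.sub_apply] at *
    refine branch_estimate (ξ₁ := b 0) (μ₁ := b 1) (σ := σ') hσ' (by rw [neg_sq, hs]) hb n n'
      x2 y2 x4 y4 ?_ ?_ x7 ?_
    · unfold resonance
      rw [mul_right_comm, mul_comm (b 0), add_comm (omega (b 0) (b 1))]; exact x5
    · unfold resonance
      rw [mul_right_comm, mul_comm (b 0), add_comm (omega (b 0) (b 1))]; exact y5
    · unfold resonance
      rw [abs_le] at *
      constructor <;> linarith
  have as : |s| = 1 := by rw [← sq_eq_sq₀ (abs_nonneg _) one_pos.le, sq_abs]; simpa using hs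
  set α := (A₂ + A₃) / |a 0| with hα
  set β := (A₁ + A₃) / |b 0| with hβ
  have α0 : 0 ≤ α := by have : 0 ≤ A₂ := hA₃.trans h₃₂; positivity
  have β0 : 0 ≤ β := by positivity
  have main := lintegral_weight_le mE (K := α + β) (L := 2 * min α β) (N := 2 * min A₁ A₃)
    (by positivity) (by positivity) ?_ ?_ ?_
  · calc ∫⁻ p, ENNReal.ofReal (|a 0| * |b 0| * |p 0|) * E.indicator 1 p
        = ENNReal.ofReal (|a 0| * |b 0|) * ∫⁻ p, ENNReal.ofReal |p 0| * E.indicator 1 p := by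
          rw [← lintegral_const_mul' _ _ ENNReal.ofReal_ne_top]
          refine lintegral_congr fun p => ?_
          rw [ENNReal.ofReal_mul (by positivity), mul_assoc]
      _ ≤ ENNReal.ofReal (|a 0| * |b 0|)
            * ENNReal.ofReal (16 * (α + β) * (2 * min α β) * (2 * min A₁ A₃)) := by
          gcongr
      _ ≤ _ := by
          rw [← ENNReal.ofReal_mul (by positivity)]
          refine ENNReal.ofReal_le_ofReal ?_
          have h1 : (α + β) * min α β ≤ 2 * (α * β) := by
            rcases le_total α β with h | h
            · rw [min_eq_left h]; nlinarith
            · rw [min_eq_right h]; nlinarith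
          have h2 : |a 0| * |b 0| * (α * β) = (A₂ + A₃) * (A₁ + A₃) := by
            rw [hα, hβ]; field_simp
          have h3 : (A₁ + A₃) * min A₁ A₃ ≤ 2 * (A₁ * A₃) := by
            rcases le_total A₁ A₃ with h | h
            · rw [min_eq_left h]; nlinarith
            · rw [min_eq_right h]; nlinarith
          calc |a 0| * |b 0| * (16 * (α + β) * (2 * min α β) * (2 * min A₁ A₃))
              = 64 * (|a 0| * |b 0| * ((α + β) * min α β)) * min A₁ A₃ := by ring
            _ ≤ 64 * (|a 0| * |b 0| * (2 * (α * β))) * min A₁ A₃ := by gcongr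
            _ = 128 * (A₂ + A₃) * ((A₁ + A₃) * min A₁ A₃) := by
                linear_combination 128 * min A₁ A₃ * h2
            -- The ordering `A₃ ≤ A₂` is what removes `A₃` from the sum `A₂ + A₃` and leaves a pure
            -- product of the three bounds.
            _ ≤ 128 * (A₂ + A₂) * (2 * (A₁ * A₃)) := by
                have : 0 ≤ A₂ := hA₃.trans h₃₂
                gcongr
            _ = _ := by ring
  · intro p hp p' hp'
    have pp : 0 < |p 0| := abs_pos.2 (hp0 p hp)
    obtain ⟨k, hk, h1⟩ := kA p hp p' hp'
    obtain ⟨k', hk', h2⟩ := kB p hp p' hp'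
    -- Subtracting the two slope relations eliminates `μ/ξ`. The opposite directions make the rates
    -- add, and `k + k' ≥ 2`.
    have e : (s * (k + k')) * (p 0 - p' 0)
        = (p 1 / p 0 - p' 1 / p' 0 - (-s) * k' * (p 0 - p' 0))
          - (p 1 / p 0 - p' 1 / p' 0 - s * k * (p 0 - p' 0)) := by ring
    have h3 := abs_sub (p 1 / p 0 - p' 1 / p' 0 - (-s) * k' * (p 0 - p' 0))
      (p 1 / p 0 - p' 1 / p' 0 - s * k * (p 0 - p' 0))
    rw [← e, abs_mul, abs_mul, as, one_mul, abs_of_pos (by linarith : 0 < k + k')] at h3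
    have h4 : 2 * |p 0 - p' 0| ≤ (k + k') * |p 0 - p' 0| := by
      gcongr; linarith
    have h5 : 2 * |p 0 - p' 0| ≤ 2 * (A₂ + A₃) / |a 0 * p 0| + 2 * (A₁ + A₃) / |b 0 * p 0| := by
      linarith
    calc |p 0 - p' 0| * |p 0| = (2 * |p 0 - p' 0|) * |p 0| / 2 := by ring
      _ ≤ (2 * (A₂ + A₃) / |a 0 * p 0| + 2 * (A₁ + A₃) / |b 0 * p 0|) * |p 0| / 2 := by gcongr
      _ = _ := by
        rw [abs_mul, abs_mul, hα, hβ]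
        field_simp
  · intro p hp p' hp' hpp
    have pp : 0 < |p 0| := abs_pos.2 (hp0 p hp)
    obtain ⟨k, hk, h1⟩ := kA p hp p' hp'
    obtain ⟨k', hk', h2⟩ := kB p hp p' hp'
    rw [← hpp, sub_self, mul_zero, sub_zero, ← sub_div, abs_div, div_le_iff₀ pp, abs_mul] at h1 h2
    rw [mul_min_of_nonneg _ _ (by norm_num : (0 : ℝ) ≤ 2)]
    · refine le_min (h1.trans_eq ?_) (h2.trans_eq ?_)
      · rw [hα]; field_simp
      · rw [hβ]; field_simp
  · intro p hp p' hp' h0 h1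
    obtain ⟨⟨-, -, -, -, x10⟩, -, -, x8, -, -⟩ := hp
    obtain ⟨⟨-, -, -, -, y10⟩, -, -, y8, -, -⟩ := hp'
    simp only [PiLp.sub_apply, ← h0, ← h1] at x10 x8 y10 y8
    rw [abs_le] at *
    have m1 : A₁ ≤ min A₁ A₃ ∨ A₃ ≤ min A₁ A₃ := by
      rcases le_total A₁ A₃ with h | h
      · left; rw [min_eq_left h]
      · right; rw [min_eq_right h]
    rcases m1 with h | h <;> constructor <;> linarith

end

section

/-! ### The trilinear form -/

/-- The integral of `W` over the triples of frequencies with sum zero. -/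
def tri (W : SpaceTime → SpaceTime → SpaceTime → ℝ≥0∞) : ℝ≥0∞ :=
  ∫⁻ a, ∫⁻ b, W a b (-(a + b))

/-- Joint measurability of a function of three variables. -/
def Meas3 (W : SpaceTime → SpaceTime → SpaceTime → ℝ≥0∞) : Prop :=
  Measurable fun w : SpaceTime × SpaceTime × SpaceTime => W w.1 w.2.1 w.2.2

lemma Meas3.comp {W : SpaceTime → SpaceTime → SpaceTime → ℝ≥0∞} (hW : Meas3 W)
    {α : Type*} [MeasurableSpace α] {a b c : α → SpaceTime} (ha : Measurable a) (hb : Measurable b)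
    (hc : Measurable c) : Measurable fun x => W (a x) (b x) (c x) :=
  Measurable.comp hW (ha.prodMk (hb.prodMk hc))

lemma tri_swap₁₂ {W : SpaceTime → SpaceTime → SpaceTime → ℝ≥0∞} (hW : Meas3 W) :
    tri W = tri fun a b c => W b a c := by
  unfold tri
  have hm : Measurable (Function.uncurry fun a b : SpaceTime => W a b (-(a + b))) :=
    hW.comp (by fun_prop) (by fun_prop) (by fun_prop)
  rw [lintegral_lintegral_swap hm.aemeasurable]
  simp_rw [add_comm]

lemma tri_swap₂₃ (W : SpaceTime → SpaceTime → SpaceTime → ℝ≥0∞) :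
    tri W = tri fun a b c => W a c b := by
  unfold tri
  refine lintegral_congr fun a => ?_
  rw [← lintegral_sub_left_eq_self (fun b => W a b (-(a + b))) (-a)]
  refine lintegral_congr fun b => ?_
  congr 1 <;> abel

lemma Meas3.swap₁₂ {W : SpaceTime → SpaceTime → SpaceTime → ℝ≥0∞} (hW : Meas3 W) :
    Meas3 fun a b c => W b a c :=
  hW.comp (by fun_prop) (by fun_prop) (by fun_prop)

lemma Meas3.swap₂₃ {W : SpaceTime → SpaceTime → SpaceTime → ℝ≥0∞} (hW : Meas3 W) :
    Meas3 fun a b c => W a c b :=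
  hW.comp (by fun_prop) (by fun_prop) (by fun_prop)

lemma tri_mono {W W' : SpaceTime → SpaceTime → SpaceTime → ℝ≥0∞}
    (h : ∀ a b c, a + b + c = 0 → W a b c ≤ W' a b c) : tri W ≤ tri W' :=
  lintegral_mono fun a => lintegral_mono fun b => h a b _ (by abel)

lemma tri_mono_ae {W W' : SpaceTime → SpaceTime → SpaceTime → ℝ≥0∞}
    (h : ∀ a b c, a 0 ≠ 0 → b 0 ≠ 0 → c 0 ≠ 0 → a + b + c = 0 → W a b c ≤ W' a b c) :
    tri W ≤ tri W' := by
  refine lintegral_mono_ae ?_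
  filter_upwards [ae_ne_zero_coord] with a ha
  refine lintegral_mono_ae ?_
  have h2 : ∀ᵐ b : SpaceTime, (-a - b) 0 ≠ 0 :=
    ((Measure.measurePreserving_sub_left volume (-a)).quasiMeasurePreserving.ae ae_ne_zero_coord)
  filter_upwards [ae_ne_zero_coord, h2] with b hb hc
  refine h a b _ ha hb ?_ (by abel)
  rwa [show -(a + b) = -a - b by abel]

lemma tri_add {W W' : SpaceTime → SpaceTime → SpaceTime → ℝ≥0∞} (hW : Meas3 W) :
    (tri fun a b c => W a b c + W' a b c) = tri W + tri W' := by
  unfold tri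
  rw [← lintegral_add_left]
  · refine lintegral_congr fun a => ?_
    rw [← lintegral_add_left]
    exact hW.comp (by fun_prop) (by fun_prop) (by fun_prop)
  · refine Measurable.lintegral_prod_right' (f := fun w : SpaceTime × SpaceTime =>
      W w.1 w.2 (-(w.1 + w.2))) ?_
    exact hW.comp (by fun_prop) (by fun_prop) (by fun_prop)

lemma tri_const_mul {W : SpaceTime → SpaceTime → SpaceTime → ℝ≥0∞} (r : ℝ≥0∞) (hr : r ≠ ⊤) :
    (tri fun a b c => r * W a b c) = r * tri W := by
  unfold tri
  rw [← lintegral_const_mul' _ _ hr]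
  refine lintegral_congr fun a => ?_
  rw [← lintegral_const_mul' _ _ hr]

lemma tri_zero : (tri fun _ _ _ => 0) = 0 := by simp [tri]

lemma tri_tsum {ι : Type*} [Countable ι] {W : ι → SpaceTime → SpaceTime → SpaceTime → ℝ≥0∞}
    (hW : ∀ i, Meas3 (W i)) : (tri fun a b c => ∑' i, W i a b c) = ∑' i, tri (W i) := by
  unfold tri
  rw [← lintegral_tsum]
  · refine lintegral_congr fun a => ?_
    rw [lintegral_tsum]
    exact fun i => ((hW i).comp (by fun_prop) (by fun_prop) (by fun_prop)).aemeasurable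
  · refine fun i => (Measurable.lintegral_prod_right' (f := fun w : SpaceTime × SpaceTime =>
      W i w.1 w.2 (-(w.1 + w.2))) ?_).aemeasurable
    exact (hW i).comp (by fun_prop) (by fun_prop) (by fun_prop)

lemma tri_sum {ι : Type*} {s : Finset ι} {W : ι → SpaceTime → SpaceTime → SpaceTime → ℝ≥0∞}
    (hW : ∀ i, Meas3 (W i)) : (tri fun a b c => ∑ i ∈ s, W i a b c) = ∑ i ∈ s, tri (W i) := by
  classical
  induction s using Finset.induction_on with
  | empty => simp [tri_zero]
  | insert i s hi ih => simp_rw [Finset.sum_insert hi]; rw [tri_add (hW i), ih]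

/-- The `L²` norm of a nonnegative function. -/
def nrm (f : SpaceTime → ℝ≥0∞) : ℝ≥0∞ := (∫⁻ a, f a ^ 2) ^ (1 / 2 : ℝ)

lemma sqrt_sq_ennreal (x : ℝ≥0∞) : (x ^ 2) ^ (1 / 2 : ℝ) = x := by
  rw [← ENNReal.rpow_natCast, ← ENNReal.rpow_mul]; norm_num

lemma sq_sqrt_ennreal (x : ℝ≥0∞) : (x ^ (1 / 2 : ℝ)) ^ 2 = x := by
  rw [← ENNReal.rpow_natCast, ← ENNReal.rpow_mul]; norm_num

lemma sq_nrm (f : SpaceTime → ℝ≥0∞) : nrm f ^ 2 = ∫⁻ a, f a ^ 2 := sq_sqrt_ennreal _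

lemma le_of_sq_le_sq' {x y : ℝ≥0∞} (h : x ^ 2 ≤ y ^ 2) : x ≤ y := by
  exact (ENNReal.pow_le_pow_left_iff two_ne_zero).1 h

lemma ofReal_sqrt_sq {x : ℝ} (hx : 0 ≤ x) : ENNReal.ofReal √x ^ 2 = ENNReal.ofReal x := by
  rw [← ENNReal.ofReal_pow (Real.sqrt_nonneg _), Real.sq_sqrt hx]

lemma ofReal_sqrt_mul_split (x y z : ℝ) : ENNReal.ofReal √|x * y * z|
    = ENNReal.ofReal √(|x| * √|z|) * ENNReal.ofReal √(|y| * √|z|) := by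
  rw [← ENNReal.ofReal_mul (by positivity), ← Real.sqrt_mul (by positivity), abs_mul, abs_mul,
    mul_mul_mul_comm, Real.mul_self_sqrt (abs_nonneg _)]

open Classical in
/-- The indicator function of the nonresonant region. -/
def nrInd (A₁ A₂ A₃ σ σ' s : ℝ) (a b p : SpaceTime) : ℝ≥0∞ :=
  if NonresRegion A₁ A₂ A₃ σ σ' s a b p then 1 else 0

lemma measurable_nrInd (A₁ A₂ A₃ σ σ' s : ℝ) {α : Type*} [MeasurableSpace α]
    {a b p : α → SpaceTime} (ha : Measurable a) (hb : Measurable b) (hp : Measurable p) :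
    Measurable fun x => nrInd A₁ A₂ A₃ σ σ' s (a x) (b x) (p x) :=
  Measurable.ite (measurableSet_nonresRegion _ _ _ _ _ _ ha hb hp) measurable_const
    measurable_const

lemma nrInd_mul_self (A₁ A₂ A₃ σ σ' s : ℝ) (a b p : SpaceTime) :
    nrInd A₁ A₂ A₃ σ σ' s a b p * nrInd A₁ A₂ A₃ σ σ' s a b p = nrInd A₁ A₂ A₃ σ σ' s a b p := by
  unfold nrInd
  split_ifs <;> simp

lemma lintegral_nrInd_le {A₁ A₂ A₃ σ σ' s : ℝ} (hσ : σ ^ 2 = 1) (hσ' : σ' ^ 2 = 1)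
    (hs : s ^ 2 = 1) (hA₁ : 0 ≤ A₁) (hA₃ : 0 ≤ A₃) (h₃₂ : A₃ ≤ A₂) (a b : SpaceTime) :
    ∫⁻ p, ENNReal.ofReal (|a 0| * |b 0| * |p 0|) *
        (nrInd A₁ A₂ A₃ σ σ' s a (p - a) p * nrInd A₁ A₂ A₃ σ σ' s (p - b) b p)
      ≤ ENNReal.ofReal (512 * A₁ * A₂ * A₃) := by
  refine le_trans (le_of_eq ?_) (lintegral_nonresRegion_le hσ hσ' hs hA₁ hA₃ h₃₂ a b)
  refine lintegral_congr fun p => ?_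
  congr 1
  unfold nrInd
  by_cases h : NonresRegion A₁ A₂ A₃ σ σ' s a (p - a) p <;>
  by_cases h' : NonresRegion A₁ A₂ A₃ σ σ' s (p - b) b p <;>
  simp [h, h', indicator]

lemma weight_sq_identity (x y i j : ℝ≥0∞) (hi : i * i = i) (hj : j * j = j) :
    (x * i * (y * j)) ^ 2 = x ^ 2 * y ^ 2 * (i * j) := by
  calc (x * i * (y * j)) ^ 2 = x ^ 2 * y ^ 2 * ((i * i) * (j * j)) := by ring
    _ = _ := by rw [hi, hj]

lemma ofReal_weight_sq (x y z : ℝ) :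
    ENNReal.ofReal √(|x| * √|z|) ^ 2 * ENNReal.ofReal √(|y| * √|z|) ^ 2
      = ENNReal.ofReal (|x| * |y| * |z|) := by
  rw [ofReal_sqrt_sq (by positivity), ofReal_sqrt_sq (by positivity),
    ← ENNReal.ofReal_mul (by positivity), mul_mul_mul_comm, Real.mul_self_sqrt (abs_nonneg _)]

lemma tri_nonresRegion_le {f₁ f₂ f₃ : SpaceTime → ℝ≥0∞} (h₁ : Measurable f₁) (h₂ : Measurable f₂)
    (h₃ : Measurable f₃) {A₁ A₂ A₃ σ σ' s : ℝ} (hσ : σ ^ 2 = 1) (hσ' : σ' ^ 2 = 1)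
    (hs : s ^ 2 = 1) (hA₁ : 0 ≤ A₁) (hA₃ : 0 ≤ A₃) (h₃₂ : A₃ ≤ A₂) :
    (tri fun a b c => f₁ a * f₂ b * f₃ c * ENNReal.ofReal √|a 0 * b 0 * c 0| *
        nrInd A₁ A₂ A₃ σ σ' s a b (-c))
      ≤ ENNReal.ofReal √(512 * A₁ * A₂ * A₃) * nrm f₁ * nrm f₂ * nrm f₃ := by
  have hA₂ : 0 ≤ A₂ := hA₃.trans h₃₂
  refine le_of_sq_le_sq' ?_
  rw [mul_pow, mul_pow, mul_pow, sq_nrm, sq_nrm, sq_nrm, ofReal_sqrt_sq (by positivity)]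
  -- The indicator of the region is used twice, being idempotent, and the weight of the output is
  -- shared equally. At `b = p - a` both kernels carry the same indicator. After Cauchy-Schwarz `a`
  -- and `b` are independent, so both constraints on `p` survive, as `lintegral_nrInd_le` requires.
  set α : SpaceTime → SpaceTime → ℝ≥0∞ := fun a p => ENNReal.ofReal √(|a 0| * √|p 0|) *
    nrInd A₁ A₂ A₃ σ σ' s a (p - a) p with hα
  set β : SpaceTime → SpaceTime → ℝ≥0∞ := fun b p => ENNReal.ofReal √(|b 0| * √|p 0|) *
    nrInd A₁ A₂ A₃ σ σ' s (p - b) b p with hβ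
  have mα : Measurable (Function.uncurry α) := by
    refine Measurable.mul (by fun_prop) ?_
    exact measurable_nrInd _ _ _ _ _ _ (by fun_prop) (by fun_prop) (by fun_prop)
  have mβ : Measurable (Function.uncurry β) := by
    refine Measurable.mul (by fun_prop) ?_
    exact measurable_nrInd _ _ _ _ _ _ (by fun_prop) (by fun_prop) (by fun_prop)
  have key := sq_trilinear_le h₁ h₂ (f₃ := fun p => f₃ (-p)) (by fun_prop) mα mβ
    (M := ENNReal.ofReal (512 * A₁ * A₂ * A₃)) ?_
  · rw [lintegral_neg_eq_self (fun a => f₃ a ^ 2)] at key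
    refine le_trans (le_of_eq ?_) key
    congr 1
    unfold tri
    have step : ∀ p, f₃ (-p) * ∫⁻ a, f₁ a * α a p * (f₂ (p - a) * β (p - a) p)
        = ∫⁻ a, f₃ (-p) * (f₁ a * α a p * (f₂ (p - a) * β (p - a) p)) := fun p => by
      rw [lintegral_const_mul]
      exact ((h₁.comp (by fun_prop)).mul (mα.comp (by fun_prop : Measurable fun a => (a, p)))).mul
        ((h₂.comp (by fun_prop)).mul (mβ.comp (by fun_prop : Measurable fun a => (p - a, p))))
    simp_rw [step]
    symm
    rw [lintegral_lintegral_swap]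
    · refine lintegral_congr fun a => ?_
      symm
      refine Eq.trans (lintegral_congr fun b => ?_) (lintegral_add_left_eq_self _ a)
      rw [ofReal_sqrt_mul_split, PiLp.neg_apply, abs_neg]
      simp only [hα, hβ, neg_neg, add_sub_cancel_left, add_sub_cancel_right]
      nth_rewrite 1 [← nrInd_mul_self]
      ring
    · refine Measurable.aemeasurable ?_
      exact (h₃.comp (f := fun w : SpaceTime × SpaceTime => -w.1) (by fun_prop)).mul
        (((h₁.comp (f := fun w : SpaceTime × SpaceTime => w.2) (by fun_prop)).mul (mα.comp
        (f := fun w : SpaceTime × SpaceTime => (w.2, w.1)) (by fun_prop))).mul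
        ((h₂.comp (f := fun w : SpaceTime × SpaceTime => w.1 - w.2) (by fun_prop)).mul (mβ.comp
        (f := fun w : SpaceTime × SpaceTime => (w.1 - w.2, w.1)) (by fun_prop))))
  · intro a b _ _
    refine le_trans (le_of_eq ?_) (lintegral_nrInd_le hσ hσ' hs hA₁ hA₃ h₃₂ a b)
    refine lintegral_congr fun p => ?_
    simp only [hα, hβ]
    rw [weight_sq_identity _ _ _ _ (nrInd_mul_self _ _ _ _ _ _ _ _ _)
      (nrInd_mul_self _ _ _ _ _ _ _ _ _), ofReal_weight_sq]

end

section

/-! ### The trilinear estimate with the square root of the resonance as weight -/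

/-- The modulation of a frequency. -/
def modu (a : SpaceTime) : ℝ := a 2 - omega (a 0) (a 1)

@[fun_prop] lemma measurable_modu : Measurable modu := by
  unfold modu; fun_prop

lemma modu_neg (a : SpaceTime) : modu (-a) = -modu a := by
  simp only [modu, PiLp.neg_apply, omega_neg]; ring

/-- On triples of sum zero the time frequencies cancel, so the resonance is minus the sum of the
three modulations. -/
lemma abs_resonance_le {a b c : SpaceTime} (h : a + b + c = 0) {A₁ A₂ A₃ : ℝ}
    (h₁ : |modu a| ≤ A₁) (h₂ : |modu b| ≤ A₂) (h₃ : |modu c| ≤ A₃) :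
    |omega (a 0) (a 1) + omega (b 0) (b 1) - omega ((-c) 0) ((-c) 1)| ≤ A₁ + A₂ + A₃ := by
  have e : a 2 + b 2 + c 2 = 0 := by simpa using congrArg (fun v : SpaceTime => v 2) h
  simp only [modu, PiLp.neg_apply, omega_neg] at *
  rw [abs_le] at *
  constructor <;> linarith [h₁.1, h₁.2, h₂.1, h₂.2, h₃.1, h₃.2]

lemma exists_sign {x : ℝ} (hx : x ≠ 0) : ∃ σ ∈ ({1, -1} : Finset ℝ), 0 < σ * x := by
  rcases lt_or_gt_of_ne hx with h | h
  · exact ⟨-1, by simp, by linarith⟩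
  · exact ⟨1, by simp, by linarith⟩

/-- Modulations small against the product make the resonance at most a tenth of it. By
`resonance_eq` the slope difference with `a` is then nonzero and has a sign `s`. The sign of the
difference with `b` is forced: multiplied by `b 0`, it is the negative of the first one multiplied
by `a 0`. -/
lemma exists_nonresRegion {a b c : SpaceTime} (h : a + b + c = 0) (ha : a 0 ≠ 0) (hb : b 0 ≠ 0)
    (hc : c 0 ≠ 0) {A₁ A₂ A₃ : ℝ} (h₁ : |modu a| ≤ A₁) (h₂ : |modu b| ≤ A₂) (h₃ : |modu c| ≤ A₃)
    (hr : 10 * (A₁ + A₂ + A₃) ≤ |a 0 * b 0 * c 0|) (hl : |a 0| ≤ |c 0|) :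
    ∃ σ ∈ ({1, -1} : Finset ℝ), ∃ σ' ∈ ({1, -1} : Finset ℝ), ∃ s ∈ ({1, -1} : Finset ℝ),
      NonresRegion A₁ A₂ A₃ σ σ' s a b (-c) := by
  have hD := abs_resonance_le h h₁ h₂ h₃
  have e0 : a 0 + b 0 + c 0 = 0 := by simpa using congrArg (fun v : SpaceTime => v 0) h
  have e1 : a 1 + b 1 + c 1 = 0 := by simpa using congrArg (fun v : SpaceTime => v 1) h
  have hb' : -c 0 - a 0 = b 0 := by linarith
  have hb1 : -c 1 - a 1 = b 1 := by linarith
  have hc' : -c 0 ≠ 0 := neg_ne_zero.2 hc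
  have hres := resonance_eq (ξ := -c 0) (μ := -c 1) (ξ₁ := a 0) (μ₁ := a 1) hc' ha
    (by rwa [hb'])
  unfold resonance at hres
  rw [hb', hb1] at hres
  simp only [PiLp.neg_apply] at hD
  set D := omega (a 0) (a 1) + omega (b 0) (b 1) - omega (-c 0) (-c 1) with hDdef
  have hD10 : |D| ≤ |a 0 * b 0 * c 0| / 10 := by linarith
  have habc : 0 < |a 0| * |c 0| := mul_pos (abs_pos.2 ha) (abs_pos.2 hc)
  have hq2 : 0 < (-c 1 / -c 0 - a 1 / a 0) ^ 2 := by
    rw [hres]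
    have : |D / a 0 * (b 0 / -c 0)| ≤ b 0 ^ 2 / 10 := by
      rw [div_mul_div_comm, abs_div, div_le_iff₀ (by rw [mul_neg, abs_neg, abs_mul]; exact habc)]
      rw [mul_neg, abs_neg, abs_mul, abs_mul (a 0)]
      rw [abs_mul, abs_mul] at hD10
      nlinarith [abs_nonneg (b 0), sq_abs (b 0)]
    have := (abs_le.1 this).1
    have hb2 : 0 < b 0 ^ 2 := by positivity
    linarith
  have hq : (-c 1 / -c 0 - a 1 / a 0) ≠ 0 := fun h0 => by rw [h0] at hq2; simp at hq2
  obtain ⟨σ, mσ, hσ⟩ := exists_sign hb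
  obtain ⟨σ', mσ', hσ'⟩ := exists_sign ha
  have hσ0 : σ ≠ 0 := fun h0 => by simp [h0] at hσ
  obtain ⟨s, ms, hs⟩ := exists_sign (mul_ne_zero hσ0 hq)
  refine ⟨σ, mσ, σ', mσ', s, ms, ⟨hσ, hσ', by simpa [mul_assoc] using hs, ?_⟩, ⟨?_, ?_, ?_⟩,
    h₁, h₂, ?_⟩
  · simp only [PiLp.neg_apply]
    have e : (-c 1 / -c 0 - b 1 / b 0) * b 0 = -(-c 1 / -c 0 - a 1 / a 0) * a 0 := by
      field_simp
      linear_combination (-c 0) * (e1) + c 1 * e0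
    have hσb : σ * b 0 ≠ 0 := hσ.ne'
    have : 0 < (-s * σ' * (-c 1 / -c 0 - b 1 / b 0)) * (σ * b 0) := by
      have e2 : (-s * σ' * (-c 1 / -c 0 - b 1 / b 0)) * (σ * b 0)
          = (s * (σ * (-c 1 / -c 0 - a 1 / a 0))) * (σ' * a 0) := by
        linear_combination (-s * σ' * σ) * e
      rw [e2]
      exact mul_pos hs hσ'
    exact (pos_iff_pos_of_mul_pos this).2 hσ
  · simp only [PiLp.neg_apply]
    rwa [mul_neg, abs_neg]
  · rw [PiLp.neg_apply, abs_neg, ← hb']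
    have := abs_sub (-c 0) (a 0)
    rw [abs_neg] at this
    linarith
  · rw [PiLp.neg_apply, abs_neg]
    linarith [abs_nonneg (c 0)]
  · have := modu_neg c
    unfold modu at this
    rw [this, abs_neg]
    exact h₃

/-- A function supported in `|τ - ω| ≤ A`. -/
def ModSupp (f : SpaceTime → ℝ≥0∞) (A : ℝ) : Prop := ∀ a, f a ≠ 0 → |modu a| ≤ A

open Classical in
/-- The indicator function of a proposition. -/
def ind (p : Prop) : ℝ≥0∞ := if p then 1 else 0

lemma ind_of {p : Prop} (h : p) : ind p = 1 := by simp [ind, h]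
lemma ind_of_not {p : Prop} (h : ¬p) : ind p = 0 := by simp [ind, h]
lemma measurable_ind {α : Type*} [MeasurableSpace α] {p : α → Prop} (h : MeasurableSet {x | p x}) :
    Measurable fun x => ind (p x) := by
  unfold ind
  exact Measurable.ite h measurable_const measurable_const

/-- The set of sign triples. -/
def signs : Finset (ℝ × ℝ × ℝ) := ({1, -1} : Finset ℝ) ×ˢ ({1, -1} : Finset ℝ) ×ˢ {1, -1}

lemma card_signs : signs.card = 8 := by
  have : ({1, -1} : Finset ℝ).card = 2 := Finset.card_pair (by norm_num)
  simp [signs, Finset.card_product, this]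

lemma sq_of_mem_signs {σ : ℝ} (h : σ ∈ ({1, -1} : Finset ℝ)) : σ ^ 2 = 1 := by
  simp only [Finset.mem_insert, Finset.mem_singleton] at h
  rcases h with rfl | rfl <;> norm_num

lemma meas3_prod {f₁ f₂ f₃ : SpaceTime → ℝ≥0∞} (h₁ : Measurable f₁) (h₂ : Measurable f₂)
    (h₃ : Measurable f₃) : Meas3 fun a b c => f₁ a * f₂ b * f₃ c := by
  unfold Meas3
  exact ((h₁.comp measurable_fst).mul (h₂.comp (measurable_fst.comp measurable_snd))).mul
    (h₃.comp (measurable_snd.comp measurable_snd))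

lemma tri_nonres_le_of_le {f₁ f₂ f₃ : SpaceTime → ℝ≥0∞} (h₁ : Measurable f₁) (h₂ : Measurable f₂)
    (h₃ : Measurable f₃) {A₁ A₂ A₃ : ℝ} (s₁ : ModSupp f₁ A₁) (s₂ : ModSupp f₂ A₂)
    (s₃ : ModSupp f₃ A₃) (hA₁ : 0 ≤ A₁) (hA₃ : 0 ≤ A₃) (h₃₂ : A₃ ≤ A₂) :
    (tri fun a b c => f₁ a * f₂ b * f₃ c * ENNReal.ofReal √|a 0 * b 0 * c 0| *
        ind (10 * (A₁ + A₂ + A₃) ≤ |a 0 * b 0 * c 0| ∧ |a 0| ≤ |b 0| ∧ |a 0| ≤ |c 0|))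
      ≤ 8 * (ENNReal.ofReal √(512 * A₁ * A₂ * A₃) * nrm f₁ * nrm f₂ * nrm f₃) := by
  calc _ ≤ tri fun a b c => ∑ σ ∈ signs, f₁ a * f₂ b * f₃ c * ENNReal.ofReal √|a 0 * b 0 * c 0| *
        nrInd A₁ A₂ A₃ σ.1 σ.2.1 σ.2.2 a b (-c) := by
        refine tri_mono_ae fun a b c ha hb hc h => ?_
        by_cases hi : 10 * (A₁ + A₂ + A₃) ≤ |a 0 * b 0 * c 0| ∧ |a 0| ≤ |b 0| ∧ |a 0| ≤ |c 0|
        swap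
        · rw [ind_of_not hi, mul_zero]; exact zero_le
        by_cases hf : f₁ a * f₂ b * f₃ c = 0
        · rw [hf, zero_mul, zero_mul]; exact zero_le
        have hf1 : f₁ a ≠ 0 := fun h0 => hf (by simp [h0])
        have hf2 : f₂ b ≠ 0 := fun h0 => hf (by simp [h0])
        have hf3 : f₃ c ≠ 0 := fun h0 => hf (by simp [h0])
        obtain ⟨σ, mσ, σ', mσ', s, ms, hN⟩ := exists_nonresRegion h ha hb hc (s₁ a hf1) (s₂ b hf2)
          (s₃ c hf3) hi.1 hi.2.2
        refine le_trans ?_ (Finset.single_le_sum (f := fun σ : ℝ × ℝ × ℝ => f₁ a * f₂ b * f₃ c *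
          ENNReal.ofReal √|a 0 * b 0 * c 0| * nrInd A₁ A₂ A₃ σ.1 σ.2.1 σ.2.2 a b (-c))
          (fun _ _ => zero_le) (a := (σ, σ', s))
          (Finset.mem_product.2 ⟨mσ, Finset.mem_product.2 ⟨mσ', ms⟩⟩))
        rw [ind_of hi, nrInd, if_pos hN]
    _ = ∑ σ ∈ signs, tri fun a b c => f₁ a * f₂ b * f₃ c * ENNReal.ofReal √|a 0 * b 0 * c 0| *
        nrInd A₁ A₂ A₃ σ.1 σ.2.1 σ.2.2 a b (-c) := by
        refine tri_sum fun σ => ?_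
        refine Measurable.mul ((meas3_prod h₁ h₂ h₃).mul (by fun_prop)) ?_
        exact measurable_nrInd _ _ _ _ _ _ (by fun_prop) (by fun_prop) (by fun_prop)
    _ ≤ ∑ σ ∈ signs, ENNReal.ofReal √(512 * A₁ * A₂ * A₃) * nrm f₁ * nrm f₂ * nrm f₃ := by
        refine Finset.sum_le_sum fun σ mσ => ?_
        have m := Finset.mem_product.1 mσ
        have m' := Finset.mem_product.1 m.2
        exact tri_nonresRegion_le h₁ h₂ h₃ (sq_of_mem_signs m.1) (sq_of_mem_signs m'.1)
          (sq_of_mem_signs m'.2) hA₁ hA₃ h₃₂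
    _ = _ := by rw [Finset.sum_const, card_signs, nsmul_eq_mul]; norm_num

/-- The condition on `a` is symmetric in `b` and `c`, so exchanging these two removes the ordering
of `A₂` and `A₃`. -/
lemma tri_nonres_le_low {f₁ f₂ f₃ : SpaceTime → ℝ≥0∞} (h₁ : Measurable f₁) (h₂ : Measurable f₂)
    (h₃ : Measurable f₃) {A₁ A₂ A₃ : ℝ} (s₁ : ModSupp f₁ A₁) (s₂ : ModSupp f₂ A₂)
    (s₃ : ModSupp f₃ A₃) (hA₁ : 0 ≤ A₁) (hA₂ : 0 ≤ A₂) (hA₃ : 0 ≤ A₃) :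
    (tri fun a b c => f₁ a * f₂ b * f₃ c * ENNReal.ofReal √|a 0 * b 0 * c 0| *
        ind (10 * (A₁ + A₂ + A₃) ≤ |a 0 * b 0 * c 0| ∧ |a 0| ≤ |b 0| ∧ |a 0| ≤ |c 0|))
      ≤ 8 * (ENNReal.ofReal √(512 * A₁ * A₂ * A₃) * nrm f₁ * nrm f₂ * nrm f₃) := by
  rcases le_total A₃ A₂ with h | h
  · exact tri_nonres_le_of_le h₁ h₂ h₃ s₁ s₂ s₃ hA₁ hA₃ h
  · have := tri_nonres_le_of_le h₁ h₃ h₂ s₁ s₃ s₂ hA₁ hA₂ h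
    rw [tri_swap₂₃]
    refine le_trans (le_of_eq ?_) (this.trans (le_of_eq ?_))
    · congr 1
      ext a b c
      have e1 : a 0 * c 0 * b 0 = a 0 * b 0 * c 0 := by ring
      have e2 : A₁ + A₃ + A₂ = A₁ + A₂ + A₃ := by ring
      rw [mul_right_comm (f₁ a), e1, e2, and_comm (a := |a 0| ≤ |b 0|)]
    · rw [mul_right_comm _ (nrm f₃), mul_right_comm (512 * A₁)]

/-- The Strichartz estimate puts the convolution of the first two functions in L². The third is
paired by Cauchy-Schwarz, so nothing is required of its modulation. -/
lemma tri_res_le {f₁ f₂ f₃ : SpaceTime → ℝ≥0∞} (h₁ : Measurable f₁) (h₂ : Measurable f₂)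
    (h₃ : Measurable f₃) {A₁ A₂ : ℝ} (s₁ : ModSupp f₁ A₁) (s₂ : ModSupp f₂ A₂)
    (hA₁ : 0 ≤ A₁) (hA₂ : 0 ≤ A₂) :
    (tri fun a b c => f₁ a * f₂ b * f₃ c)
      ≤ ENNReal.ofReal √(256 * A₁ * A₂) * nrm f₁ * nrm f₂ * nrm f₃ := by
  refine le_of_sq_le_sq' ?_
  rw [mul_pow, mul_pow, mul_pow, sq_nrm, sq_nrm, sq_nrm, ofReal_sqrt_sq (by positivity)]
  have e : (tri fun a b c => f₁ a * f₂ b * f₃ c) = ∫⁻ p, (∫⁻ a, f₁ a * f₂ (p - a)) * f₃ (-p) := by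
    have step : ∀ p, (∫⁻ a, f₁ a * f₂ (p - a)) * f₃ (-p)
        = ∫⁻ a, f₁ a * f₂ (p - a) * f₃ (-p) := fun p => by
      rw [lintegral_mul_const]
      exact h₁.mul (h₂.comp (by fun_prop))
    simp_rw [step]
    rw [lintegral_lintegral_swap]
    · unfold tri
      refine lintegral_congr fun a => ?_
      refine Eq.trans (lintegral_congr fun b => ?_) (lintegral_add_left_eq_self _ a)
      rw [add_sub_cancel_left]
    · exact (((h₁.comp (f := fun w : SpaceTime × SpaceTime => w.2) (by fun_prop)).mul
        (h₂.comp (f := fun w : SpaceTime × SpaceTime => w.1 - w.2) (by fun_prop))).mul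
        (h₃.comp (f := fun w : SpaceTime × SpaceTime => -w.1) (by fun_prop))).aemeasurable
  rw [e]
  refine (sq_lintegral_mul_le (Measurable.aemeasurable ?_) (by fun_prop)).trans ?_
  · refine Measurable.lintegral_prod_right' (f := fun w : SpaceTime × SpaceTime =>
      f₁ w.2 * f₂ (w.1 - w.2)) ?_
    exact (h₁.comp (by fun_prop)).mul (h₂.comp (by fun_prop))
  rw [lintegral_neg_eq_self (fun a => f₃ a ^ 2)]
  gcongr
  exact sq_conv_le h₁ h₂ hA₁ hA₂ s₁ s₂

end

/-! ### The full trilinear estimate, for localized modulations and in the X-norms -/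

section

lemma ofReal_sqrt_add_le {x y : ℝ} (hx : 0 ≤ x) (hy : 0 ≤ y) :
    ENNReal.ofReal √(x + y) ≤ ENNReal.ofReal √x + ENNReal.ofReal √y := by
  rw [← ENNReal.ofReal_add (Real.sqrt_nonneg _) (Real.sqrt_nonneg _)]
  refine ENNReal.ofReal_le_ofReal (Real.sqrt_le_iff.2 ⟨by positivity, ?_⟩)
  nlinarith [Real.sq_sqrt hx, Real.sq_sqrt hy, mul_nonneg (Real.sqrt_nonneg x) (Real.sqrt_nonneg y)]

lemma ofReal_sqrt_mul {x y : ℝ} (hx : 0 ≤ x) :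
    ENNReal.ofReal √(x * y) = ENNReal.ofReal √x * ENNReal.ofReal √y := by
  rw [Real.sqrt_mul hx, ENNReal.ofReal_mul (Real.sqrt_nonneg _)]

lemma ofReal_sqrt_const {c d : ℝ} (h : c ≤ d ^ 2) (hd : 0 ≤ d) :
    ENNReal.ofReal √c ≤ ENNReal.ofReal d :=
  ENNReal.ofReal_le_ofReal (Real.sqrt_le_iff.2 ⟨hd, h⟩)

/-- The trilinear estimate for functions with localized modulations. -/
lemma tri_weight_le {f₁ f₂ f₃ : SpaceTime → ℝ≥0∞} (h₁ : Measurable f₁) (h₂ : Measurable f₂)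
    (h₃ : Measurable f₃) {A₁ A₂ A₃ : ℝ} (s₁ : ModSupp f₁ A₁) (s₂ : ModSupp f₂ A₂)
    (s₃ : ModSupp f₃ A₃) (hA₁ : 0 ≤ A₁) (hA₂ : 0 ≤ A₂) (hA₃ : 0 ≤ A₃) :
    (tri fun a b c => f₁ a * f₂ b * f₃ c * ENNReal.ofReal √|a 0 * b 0 * c 0|)
      ≤ 800 * (ENNReal.ofReal √(A₁ * A₂ * A₃) * nrm f₁ * nrm f₂ * nrm f₃) := by
  set R := ENNReal.ofReal √(A₁ * A₂ * A₃) * nrm f₁ * nrm f₂ * nrm f₃ with hR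
  have hW : Meas3 fun a b c => f₁ a * f₂ b * f₃ c * ENNReal.ofReal √|a 0 * b 0 * c 0| :=
    (meas3_prod h₁ h₂ h₃).mul (by fun_prop)
  have c512 : ENNReal.ofReal √(512 * A₁ * A₂ * A₃) ≤ 23 * ENNReal.ofReal √(A₁ * A₂ * A₃) := by
    rw [show 512 * A₁ * A₂ * A₃ = 512 * (A₁ * A₂ * A₃) by ring, ofReal_sqrt_mul (by norm_num)]
    gcongr
    refine (ofReal_sqrt_const (d := 23) (by norm_num) (by norm_num)).trans (by simp)
  have low : ∀ x : ℝ≥0∞, x ≤ 8 * (ENNReal.ofReal √(512 * A₁ * A₂ * A₃) * nrm f₁ * nrm f₂ * nrm f₃)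
      → x ≤ 184 * R := fun x hx => by
    refine hx.trans ?_
    calc _ ≤ 8 * (23 * ENNReal.ofReal √(A₁ * A₂ * A₃) * nrm f₁ * nrm f₂ * nrm f₃) := by gcongr
      _ = 8 * 23 * R := by rw [hR]; ring
      _ = 184 * R := by norm_num
  -- Above the threshold `N` any of the three first frequencies may be the smallest, which gives
  -- `L₁`, `L₂`, `L₃`. Below it the weight is at most `√N ≤ ∑ √(10 Aᵢ)`, and for each term
  -- `tri_res_le` is applied to the two functions other than the `i`-th. The total is 3 · 184 + 3 ·
  -- 51, below 800.
  set N : ℝ := 10 * (A₁ + A₂ + A₃) with hN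
  set L₁ := fun a b c : SpaceTime => f₁ a * f₂ b * f₃ c * ENNReal.ofReal √|a 0 * b 0 * c 0| *
    ind (N ≤ |a 0 * b 0 * c 0| ∧ |a 0| ≤ |b 0| ∧ |a 0| ≤ |c 0|) with hL₁
  set L₂ := fun a b c : SpaceTime => f₁ a * f₂ b * f₃ c * ENNReal.ofReal √|a 0 * b 0 * c 0| *
    ind (N ≤ |a 0 * b 0 * c 0| ∧ |b 0| ≤ |a 0| ∧ |b 0| ≤ |c 0|) with hL₂
  set L₃ := fun a b c : SpaceTime => f₁ a * f₂ b * f₃ c * ENNReal.ofReal √|a 0 * b 0 * c 0| *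
    ind (N ≤ |a 0 * b 0 * c 0| ∧ |c 0| ≤ |b 0| ∧ |c 0| ≤ |a 0|) with hL₃
  have m₁ : Meas3 L₁ := hW.mul (measurable_ind (by measurability))
  have m₂ : Meas3 L₂ := hW.mul (measurable_ind (by measurability))
  have m₃ : Meas3 L₃ := hW.mul (measurable_ind (by measurability))
  have b₁ : tri L₁ ≤ 184 * R := low _ (tri_nonres_le_low h₁ h₂ h₃ s₁ s₂ s₃ hA₁ hA₂ hA₃)
  have b₂ : tri L₂ ≤ 184 * R := by
    refine low _ ?_
    rw [tri_swap₁₂ m₂]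
    refine le_trans (le_of_eq ?_) ((tri_nonres_le_low h₂ h₁ h₃ s₂ s₁ s₃ hA₂ hA₁ hA₃).trans
      (le_of_eq ?_))
    · congr 1
      ext a b c
      have e1 : b 0 * a 0 * c 0 = a 0 * b 0 * c 0 := by ring
      have e2 : 10 * (A₂ + A₁ + A₃) = N := by rw [hN]; ring
      rw [hL₂, e2]
      simp only [e1, mul_comm (f₁ b)]
    · rw [mul_right_comm _ (nrm f₂), mul_right_comm 512 A₁]
  have b₃ : tri L₃ ≤ 184 * R := by
    refine low _ ?_
    rw [tri_swap₂₃ L₃, tri_swap₁₂ m₃.swap₂₃]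
    refine le_trans (le_of_eq ?_) ((tri_nonres_le_low h₃ h₁ h₂ s₃ s₁ s₂ hA₃ hA₁ hA₂).trans
      (le_of_eq ?_))
    · congr 1
      ext a b c
      have e1 : b 0 * c 0 * a 0 = a 0 * b 0 * c 0 := by ring
      have e2 : 10 * (A₃ + A₁ + A₂) = N := by rw [hN]; ring
      have e3 : f₁ b * f₂ c * f₃ a = f₃ a * f₁ b * f₂ c := by ring
      rw [hL₃, e2]
      simp only [e1, e3, and_comm]
    · have e : 512 * A₃ * A₁ * A₂ = 512 * A₁ * A₂ * A₃ := by ring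
      rw [e]; ring
  have c256 : ∀ x y z : ℝ, 0 ≤ x → 0 ≤ y → 0 ≤ z → ENNReal.ofReal √(10 * z) *
      ENNReal.ofReal √(256 * x * y) ≤ 51 * ENNReal.ofReal √(x * y * z) := by
    intro x y z hx hy hz
    rw [← ofReal_sqrt_mul (by positivity), show 10 * z * (256 * x * y) = 2560 * (x * y * z) by ring,
      ofReal_sqrt_mul (by norm_num)]
    gcongr
    refine (ofReal_sqrt_const (d := 51) (by norm_num) (by norm_num)).trans (by simp)
  set V := fun a b c : SpaceTime => f₁ a * f₂ b * f₃ c with hV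
  have mV : Meas3 V := meas3_prod h₁ h₂ h₃
  have d₃ : ENNReal.ofReal √(10 * A₃) * tri V ≤ 51 * R := by
    calc _ ≤ ENNReal.ofReal √(10 * A₃) *
          (ENNReal.ofReal √(256 * A₁ * A₂) * nrm f₁ * nrm f₂ * nrm f₃) := by
          gcongr
          exact tri_res_le h₁ h₂ h₃ s₁ s₂ hA₁ hA₂
      _ = (ENNReal.ofReal √(10 * A₃) * ENNReal.ofReal √(256 * A₁ * A₂)) *
          (nrm f₁ * nrm f₂ * nrm f₃) := by ring
      _ ≤ (51 * ENNReal.ofReal √(A₁ * A₂ * A₃)) * (nrm f₁ * nrm f₂ * nrm f₃) :=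
          mul_le_mul_left (c256 _ _ _ hA₁ hA₂ hA₃) _
      _ = _ := by rw [hR]; ring
  have d₂ : ENNReal.ofReal √(10 * A₂) * tri V ≤ 51 * R := by
    calc _ ≤ ENNReal.ofReal √(10 * A₂) *
          (ENNReal.ofReal √(256 * A₁ * A₃) * nrm f₁ * nrm f₃ * nrm f₂) := by
          gcongr
          rw [tri_swap₂₃]
          refine le_trans (le_of_eq ?_) (tri_res_le h₁ h₃ h₂ s₁ s₃ hA₁ hA₃)
          congr 1
          ext a b c
          rw [hV]
          ring
      _ = (ENNReal.ofReal √(10 * A₂) * ENNReal.ofReal √(256 * A₁ * A₃)) *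
          (nrm f₁ * nrm f₂ * nrm f₃) := by ring
      _ ≤ (51 * ENNReal.ofReal √(A₁ * A₃ * A₂)) * (nrm f₁ * nrm f₂ * nrm f₃) :=
          mul_le_mul_left (c256 _ _ _ hA₁ hA₃ hA₂) _
      _ = _ := by rw [hR, mul_right_comm A₁]; ring
  have d₁ : ENNReal.ofReal √(10 * A₁) * tri V ≤ 51 * R := by
    calc _ ≤ ENNReal.ofReal √(10 * A₁) *
          (ENNReal.ofReal √(256 * A₃ * A₂) * nrm f₃ * nrm f₂ * nrm f₁) := by
          gcongr
          rw [tri_swap₁₂ mV, tri_swap₂₃, tri_swap₁₂ mV.swap₁₂.swap₂₃]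
          refine le_trans (le_of_eq ?_) (tri_res_le h₃ h₂ h₁ s₃ s₂ hA₃ hA₂)
          congr 1
          ext a b c
          rw [hV]
          ring
      _ = (ENNReal.ofReal √(10 * A₁) * ENNReal.ofReal √(256 * A₃ * A₂)) *
          (nrm f₁ * nrm f₂ * nrm f₃) := by ring
      _ ≤ (51 * ENNReal.ofReal √(A₃ * A₂ * A₁)) * (nrm f₁ * nrm f₂ * nrm f₃) :=
          mul_le_mul_left (c256 _ _ _ hA₃ hA₂ hA₁) _
      _ = _ := by rw [hR, show A₃ * A₂ * A₁ = A₁ * A₂ * A₃ by ring]; ring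
  have hNle : ENNReal.ofReal √N * tri V ≤ 153 * R := by
    have : ENNReal.ofReal √N ≤ ENNReal.ofReal √(10 * A₁) + ENNReal.ofReal √(10 * A₂)
        + ENNReal.ofReal √(10 * A₃) := by
      rw [hN, mul_add, mul_add]
      refine (ofReal_sqrt_add_le (by positivity) (by positivity)).trans ?_
      gcongr
      exact ofReal_sqrt_add_le (by positivity) (by positivity)
    calc _ ≤ (ENNReal.ofReal √(10 * A₁) + ENNReal.ofReal √(10 * A₂)
        + ENNReal.ofReal √(10 * A₃)) * tri V := by gcongr
      _ ≤ 51 * R + 51 * R + 51 * R := by rw [add_mul, add_mul]; gcongr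
      _ = (51 + 51 + 51) * R := by ring
      _ = _ := by norm_num
  calc _ ≤ tri fun a b c => L₁ a b c + (L₂ a b c + (L₃ a b c + ENNReal.ofReal √N * V a b c)) := by
        refine tri_mono fun a b c _ => ?_
        by_cases hn : N ≤ |a 0 * b 0 * c 0|
        · have hmin : (|a 0| ≤ |b 0| ∧ |a 0| ≤ |c 0|) ∨ (|b 0| ≤ |a 0| ∧ |b 0| ≤ |c 0|) ∨
              (|c 0| ≤ |b 0| ∧ |c 0| ≤ |a 0|) := by grind
          rcases hmin with h | h | h
          · refine le_trans (le_of_eq ?_) le_self_add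
            simp only [hL₁]
            rw [ind_of ⟨hn, h⟩, mul_one]
          · refine le_trans (le_of_eq ?_) (le_self_add.trans le_add_self)
            simp only [hL₂]
            rw [ind_of ⟨hn, h⟩, mul_one]
          · refine le_trans (le_of_eq ?_) ((le_self_add.trans le_add_self).trans le_add_self)
            simp only [hL₃]
            rw [ind_of ⟨hn, h⟩, mul_one]
        · refine le_trans ?_ ((le_add_self.trans le_add_self).trans le_add_self)
          rw [mul_comm]
          gcongr
          exact (not_le.1 hn).le
    _ = tri L₁ + (tri L₂ + (tri L₃ + ENNReal.ofReal √N * tri V)) := by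
        rw [tri_add m₁, tri_add m₂, tri_add m₃, tri_const_mul _ ENNReal.ofReal_ne_top]
    _ ≤ 184 * R + (184 * R + (184 * R + 153 * R)) := by gcongr
    _ = (184 + (184 + (184 + 153))) * R := by ring
    _ ≤ 800 * R := by gcongr; norm_num

/-! ### Decomposition in the modulation -/

/-- The partition of unity telescopes. -/
lemma sum_etaPiece (η₀ : ℝ → ℝ) (n : ℕ) (r : ℝ) :
    ∑ j ∈ Finset.range (n + 1), etaPiece η₀ j r = η₀ (r / 2 ^ n) := by
  induction n with
  | zero => simp [etaPiece]
  | succ n ih =>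
    rw [Finset.sum_range_succ, ih, etaPiece, if_neg (Nat.succ_ne_zero n)]
    have : ((2 : ℝ) ^ (((n + 1 : ℕ) : ℤ) - 1)) = 2 ^ n := by
      rw [Nat.cast_add, Nat.cast_one, add_sub_cancel_right, zpow_natCast]
    rw [this]
    ring

lemma etaPiece_support {η₀ : ℝ → ℝ} (hη : IsCutoff η₀) {j : ℕ} {r : ℝ}
    (h : etaPiece η₀ j r ≠ 0) : |r| ≤ 2 ^ (j + 1) := by
  by_contra! hr
  apply h
  have h2 : (0 : ℝ) < 2 ^ j := by positivity
  have key : ∀ n : ℝ, 0 < n → n ≤ 2 ^ j → η₀ (r / n) = 0 := fun n hn hle => by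
    apply hη.support
    rw [abs_div, abs_of_pos hn, lt_div_iff₀ hn]
    rw [pow_succ] at hr
    nlinarith
  unfold etaPiece
  split_ifs with hj
  · subst hj
    simpa using key 1 one_pos (by simp)
  · rw [key _ h2 le_rfl, key _ (by positivity) ?_, sub_zero]
    rw [← zpow_natCast]
    exact zpow_le_zpow_right₀ (by norm_num) (by omega)

/-- The telescoped sum is `η₀ (r / 2 ^ n)`, which equals 1 once `2 ^ n` exceeds `|r|`. A lower bound
is enough, because all forms in play have nonnegative integrands. -/
lemma one_le_tsum_etaPiece {η₀ : ℝ → ℝ} (hη : IsCutoff η₀) (r : ℝ) :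
    1 ≤ ∑' j, ‖etaPiece η₀ j r‖ₑ := by
  obtain ⟨n, hn⟩ := pow_unbounded_of_one_lt |r| (by norm_num : (1 : ℝ) < 2)
  have h1 : η₀ (r / 2 ^ n) = 1 := by
    apply hη.eq_one
    rw [abs_div, abs_of_pos (by positivity : (0 : ℝ) < 2 ^ n)]
    exact ((div_le_one (by positivity)).2 hn.le).trans (by norm_num)
  calc (1 : ℝ≥0∞) = ‖∑ j ∈ Finset.range (n + 1), etaPiece η₀ j r‖ₑ := by
        rw [sum_etaPiece, h1]; simp
    _ ≤ ∑ j ∈ Finset.range (n + 1), ‖etaPiece η₀ j r‖ₑ := enorm_sum_le _ _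
    _ ≤ _ := ENNReal.sum_le_tsum _

lemma IsCutoff.measurable {η₀ : ℝ → ℝ} (hη : IsCutoff η₀) : Measurable η₀ :=
  hη.smooth.continuous.measurable

lemma IsCutoff.measurable_etaPiece {η₀ : ℝ → ℝ} (hη : IsCutoff η₀) (j : ℕ) :
    Measurable (etaPiece η₀ j) := by
  unfold etaPiece
  have := hη.measurable
  split_ifs
  · exact this
  · fun_prop

/-- The piece of a nonnegative function with modulation about `2 ^ j`. -/
def modPiece (η₀ : ℝ → ℝ) (f : SpaceTime → ℝ≥0∞) (j : ℕ) (a : SpaceTime) : ℝ≥0∞ :=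
  ‖etaPiece η₀ j (modu a)‖ₑ * f a

/-- The `X`-norm of a nonnegative function. -/
def xnrm (η₀ : ℝ → ℝ) (f : SpaceTime → ℝ≥0∞) : ℝ≥0∞ :=
  ∑' j : ℕ, (2 : ℝ≥0∞) ^ ((j : ℝ) / 2) * nrm (modPiece η₀ f j)

lemma xnrm_enorm (η₀ : ℝ → ℝ) (g : SpaceTime → ℂ) : xnrm η₀ (fun a => ‖g a‖ₑ) = XNorm η₀ g := by
  unfold xnrm XNorm
  congr 1
  ext j
  congr 1
  rw [eLpNorm_eq_lintegral_rpow_enorm_toReal two_ne_zero ENNReal.ofNat_ne_top, nrm]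
  have e : ∀ r : ℝ, ‖(r : ℂ)‖ₑ = ‖r‖ₑ := fun r => by
    rw [← ofReal_norm, ← ofReal_norm, Complex.norm_real]
  simp [modPiece, modu, enorm_mul, e]

lemma measurable_modPiece {η₀ : ℝ → ℝ} (hη : IsCutoff η₀) {f : SpaceTime → ℝ≥0∞}
    (hf : Measurable f) (j : ℕ) : Measurable (modPiece η₀ f j) := by
  unfold modPiece
  have := hη.measurable_etaPiece j
  fun_prop

lemma modSupp_modPiece {η₀ : ℝ → ℝ} (hη : IsCutoff η₀) (f : SpaceTime → ℝ≥0∞) (j : ℕ) :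
    ModSupp (modPiece η₀ f j) (2 ^ (j + 1)) := by
  intro a ha
  apply etaPiece_support hη
  intro h0
  simp [modPiece, h0] at ha

lemma le_tsum_modPiece {η₀ : ℝ → ℝ} (hη : IsCutoff η₀) (f : SpaceTime → ℝ≥0∞) (a : SpaceTime) :
    f a ≤ ∑' j, modPiece η₀ f j a := by
  unfold modPiece
  rw [ENNReal.tsum_mul_right]
  exact le_mul_of_one_le_left zero_le (one_le_tsum_etaPiece hη _)

lemma tsum_mul_tsum_mul_tsum (x y z : ℕ → ℝ≥0∞) :
    (∑' i, x i) * (∑' j, y j) * (∑' k, z k) = ∑' i, ∑' j, ∑' k, x i * y j * z k := by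
  rw [mul_assoc, ← ENNReal.tsum_mul_right]
  congr 1; ext i
  rw [← ENNReal.tsum_mul_right, ← ENNReal.tsum_mul_left]
  congr 1; ext j
  rw [← ENNReal.tsum_mul_left, ← ENNReal.tsum_mul_left]
  congr 1; ext k
  ring

lemma tsum_mul_tsum (x y : ℕ → ℝ≥0∞) :
    (∑' i, x i) * (∑' j, y j) = ∑' i, ∑' j, x i * y j := by
  rw [← ENNReal.tsum_mul_right]
  congr 1; ext i
  rw [← ENNReal.tsum_mul_left]

lemma ofReal_sqrt_two_pow (j : ℕ) :
    ENNReal.ofReal √(2 ^ (j + 1)) = ENNReal.ofReal √2 * (2 : ℝ≥0∞) ^ ((j : ℝ) / 2) := by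
  rw [pow_succ, mul_comm, ofReal_sqrt_mul (by norm_num), Real.sqrt_eq_rpow (2 ^ j),
    ← Real.rpow_natCast, ← Real.rpow_mul (by norm_num),
    ← ENNReal.ofReal_rpow_of_pos (by norm_num)]
  congr 2
  · simp
  · ring

/-- The trilinear estimate in the `X`-norms. -/
lemma tri_weight_le_xnrm {η₀ : ℝ → ℝ} (hη : IsCutoff η₀) {f₁ f₂ f₃ : SpaceTime → ℝ≥0∞}
    (h₁ : Measurable f₁) (h₂ : Measurable f₂) (h₃ : Measurable f₃) :
    (tri fun a b c => f₁ a * f₂ b * f₃ c * ENNReal.ofReal √|a 0 * b 0 * c 0|)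
      ≤ 2400 * (xnrm η₀ f₁ * xnrm η₀ f₂ * xnrm η₀ f₃) := by
  have m : ∀ i j k, Meas3 fun a b c => modPiece η₀ f₁ i a * modPiece η₀ f₂ j b * modPiece η₀ f₃ k c *
      ENNReal.ofReal √|a 0 * b 0 * c 0| := fun i j k =>
    (meas3_prod (measurable_modPiece hη h₁ i) (measurable_modPiece hη h₂ j)
      (measurable_modPiece hη h₃ k)).mul (by fun_prop)
  have m' : ∀ i j, Meas3 fun a b c => ∑' k, modPiece η₀ f₁ i a * modPiece η₀ f₂ j b *
      modPiece η₀ f₃ k c * ENNReal.ofReal √|a 0 * b 0 * c 0| := fun i j =>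
    Measurable.tsum (m i j)
  have m'' : ∀ i, Meas3 fun a b c => ∑' j, ∑' k, modPiece η₀ f₁ i a * modPiece η₀ f₂ j b *
      modPiece η₀ f₃ k c * ENNReal.ofReal √|a 0 * b 0 * c 0| := fun i =>
    Measurable.tsum (m' i)
  have hc : (ENNReal.ofReal √2) ^ 3 ≤ 3 := by
    rw [← ENNReal.ofReal_pow (Real.sqrt_nonneg _), pow_succ, Real.sq_sqrt (by norm_num)]
    refine (ENNReal.ofReal_le_ofReal (q := 3) ?_).trans (by simp)
    nlinarith [Real.sq_sqrt (show (0 : ℝ) ≤ 2 by norm_num), Real.sqrt_nonneg 2]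
  calc _ ≤ tri fun a b c => ∑' i, ∑' j, ∑' k, modPiece η₀ f₁ i a * modPiece η₀ f₂ j b *
        modPiece η₀ f₃ k c * ENNReal.ofReal √|a 0 * b 0 * c 0| := by
        refine tri_mono fun a b c _ => ?_
        simp_rw [ENNReal.tsum_mul_right]
        rw [← tsum_mul_tsum_mul_tsum]
        gcongr <;> exact le_tsum_modPiece hη _ _
    _ = ∑' i, ∑' j, ∑' k, tri fun a b c => modPiece η₀ f₁ i a * modPiece η₀ f₂ j b *
        modPiece η₀ f₃ k c * ENNReal.ofReal √|a 0 * b 0 * c 0| := by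
        rw [tri_tsum m'']
        congr 1; ext i
        rw [tri_tsum (m' i)]
        congr 1; ext j
        rw [tri_tsum (m i j)]
    _ ≤ ∑' i : ℕ, ∑' j : ℕ, ∑' k : ℕ, 2400 * ((2 : ℝ≥0∞) ^ ((i : ℝ) / 2) * nrm (modPiece η₀ f₁ i) *
        ((2 : ℝ≥0∞) ^ ((j : ℝ) / 2) * nrm (modPiece η₀ f₂ j)) *
        ((2 : ℝ≥0∞) ^ ((k : ℝ) / 2) * nrm (modPiece η₀ f₃ k))) := by
        refine ENNReal.tsum_le_tsum fun i => ENNReal.tsum_le_tsum fun j =>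
          ENNReal.tsum_le_tsum fun k => ?_
        refine (tri_weight_le (measurable_modPiece hη h₁ i) (measurable_modPiece hη h₂ j)
          (measurable_modPiece hη h₃ k) (modSupp_modPiece hη f₁ i) (modSupp_modPiece hη f₂ j)
          (modSupp_modPiece hη f₃ k) (by positivity) (by positivity) (by positivity)).trans ?_
        -- The modulation bound is `2 ^ (j + 1)`, so each root is `√2` times the weight `2^{j/2}` of
        -- the X-norm. The three extra factors `√2` multiply to at most 3, and 800 · 3 = 2400.
        rw [ofReal_sqrt_mul (by positivity), ofReal_sqrt_mul (by positivity), ofReal_sqrt_two_pow,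
          ofReal_sqrt_two_pow, ofReal_sqrt_two_pow]
        calc _ = 800 * (ENNReal.ofReal √2) ^ 3 * ((2 : ℝ≥0∞) ^ ((i : ℝ) / 2) * nrm (modPiece η₀ f₁ i) *
              ((2 : ℝ≥0∞) ^ ((j : ℝ) / 2) * nrm (modPiece η₀ f₂ j)) *
              ((2 : ℝ≥0∞) ^ ((k : ℝ) / 2) * nrm (modPiece η₀ f₃ k))) := by ring
          _ ≤ 800 * 3 * ((2 : ℝ≥0∞) ^ ((i : ℝ) / 2) * nrm (modPiece η₀ f₁ i) *
              ((2 : ℝ≥0∞) ^ ((j : ℝ) / 2) * nrm (modPiece η₀ f₂ j)) *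
              ((2 : ℝ≥0∞) ^ ((k : ℝ) / 2) * nrm (modPiece η₀ f₃ k))) := by gcongr
          _ = _ := by norm_num
    _ = _ := by
        unfold xnrm
        rw [tsum_mul_tsum_mul_tsum]
        simp_rw [ENNReal.tsum_mul_left]

/-- The bilinear `L⁴`-type estimate in the `X`-norms. -/
lemma tri_le_xnrm {η₀ : ℝ → ℝ} (hη : IsCutoff η₀) {f₁ f₂ f₃ : SpaceTime → ℝ≥0∞}
    (h₁ : Measurable f₁) (h₂ : Measurable f₂) (h₃ : Measurable f₃) :
    (tri fun a b c => f₁ a * f₂ b * f₃ c) ≤ 32 * (xnrm η₀ f₁ * xnrm η₀ f₂ * nrm f₃) := by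
  have m : ∀ i j, Meas3 fun a b c => modPiece η₀ f₁ i a * modPiece η₀ f₂ j b * f₃ c := fun i j =>
    meas3_prod (measurable_modPiece hη h₁ i) (measurable_modPiece hη h₂ j) h₃
  have m' : ∀ i, Meas3 fun a b c => ∑' j, modPiece η₀ f₁ i a * modPiece η₀ f₂ j b * f₃ c :=
    fun i => Measurable.tsum (m i)
  calc _ ≤ tri fun a b c => ∑' i, ∑' j, modPiece η₀ f₁ i a * modPiece η₀ f₂ j b * f₃ c := by
        refine tri_mono fun a b c _ => ?_
        simp_rw [ENNReal.tsum_mul_right]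
        rw [← tsum_mul_tsum]
        gcongr <;> exact le_tsum_modPiece hη _ _
    _ = ∑' i, ∑' j, tri fun a b c => modPiece η₀ f₁ i a * modPiece η₀ f₂ j b * f₃ c := by
        rw [tri_tsum m']
        congr 1; ext i
        rw [tri_tsum (m i)]
    _ ≤ ∑' i : ℕ, ∑' j : ℕ, 32 * ((2 : ℝ≥0∞) ^ ((i : ℝ) / 2) * nrm (modPiece η₀ f₁ i) *
        ((2 : ℝ≥0∞) ^ ((j : ℝ) / 2) * nrm (modPiece η₀ f₂ j))) * nrm f₃ := by
        refine ENNReal.tsum_le_tsum fun i => ENNReal.tsum_le_tsum fun j => ?_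
        refine (tri_res_le (measurable_modPiece hη h₁ i) (measurable_modPiece hη h₂ j)
          h₃ (modSupp_modPiece hη f₁ i) (modSupp_modPiece hη f₂ j)
          (by positivity) (by positivity)).trans ?_
        rw [mul_assoc 256, ofReal_sqrt_mul (by norm_num), ofReal_sqrt_mul (by positivity),
          ofReal_sqrt_two_pow, ofReal_sqrt_two_pow, show (256 : ℝ) = 16 ^ 2 by norm_num,
          Real.sqrt_sq (by norm_num)]
        refine le_of_eq ?_
        calc _ = ENNReal.ofReal 16 * (ENNReal.ofReal √2) ^ 2 *
              ((2 : ℝ≥0∞) ^ ((i : ℝ) / 2) * nrm (modPiece η₀ f₁ i) *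
              ((2 : ℝ≥0∞) ^ ((j : ℝ) / 2) * nrm (modPiece η₀ f₂ j))) * nrm f₃ := by ring
          _ = _ := by
            rw [ofReal_sqrt_sq (by norm_num), ← ENNReal.ofReal_mul (by norm_num)]
            norm_num
    _ = _ := by
        unfold xnrm
        rw [tsum_mul_tsum]
        simp_rw [ENNReal.tsum_mul_right, ENNReal.tsum_mul_left]
        ring

end

section

/-! ### The Fourier transform on `L²` -/

section General

variable {α : Type*} [MeasurableSpace α] {μ : Measure α}

lemma eLpNorm_mul_le_one {f g : α → ℂ} (hf : AEStronglyMeasurable f μ)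
    (hg : AEStronglyMeasurable g μ) :
    ∫⁻ x, ‖f x * g x‖ₑ ∂μ ≤ eLpNorm f 2 μ * eLpNorm g 2 μ := by
  have := eLpNorm_smul_le_mul_eLpNorm (p := 2) (q := 2) (r := 1) (μ := μ) hg hf
  rwa [eLpNorm_one_eq_lintegral_enorm] at this

lemma enorm_integral_mul_le {f g : α → ℂ} (hf : AEStronglyMeasurable f μ)
    (hg : AEStronglyMeasurable g μ) :
    ‖∫ x, f x * g x ∂μ‖ₑ ≤ eLpNorm f 2 μ * eLpNorm g 2 μ :=
  (enorm_integral_le_lintegral_enorm _).trans (eLpNorm_mul_le_one hf hg)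

lemma integrable_mul_of_memLp {f g : α → ℂ} (hf : MemLp f 2 μ) (hg : MemLp g 2 μ) :
    Integrable (fun x => f x * g x) μ :=
  ⟨hf.1.mul hg.1, (eLpNorm_mul_le_one hf.1 hg.1).trans_lt (ENNReal.mul_lt_top hf.2 hg.2)⟩

lemma tendsto_integral_mul {f : ℕ → α → ℂ} {f₀ g : α → ℂ} (hf : ∀ n, MemLp (f n) 2 μ)
    (hf₀ : MemLp f₀ 2 μ) (hg : MemLp g 2 μ)
    (h : Tendsto (fun n => eLpNorm (fun x => f n x - f₀ x) 2 μ) atTop (𝓝 0)) :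
    Tendsto (fun n => ∫ x, f n x * g x ∂μ) atTop (𝓝 (∫ x, f₀ x * g x ∂μ)) := by
  rw [tendsto_iff_edist_tendsto_0]
  refine tendsto_of_tendsto_of_tendsto_of_le_of_le tendsto_const_nhds
    (h := fun n => eLpNorm (fun x => f n x - f₀ x) 2 μ * eLpNorm g 2 μ) ?_ (fun _ => zero_le) ?_
  · have := ENNReal.Tendsto.mul_const h (b := eLpNorm g 2 μ) (Or.inr hg.2.ne)
    rwa [zero_mul] at this
  · intro n
    simp only
    rw [edist_eq_enorm_sub, ← integral_sub (integrable_mul_of_memLp (hf n) hg)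
      (integrable_mul_of_memLp hf₀ hg)]
    simp_rw [← sub_mul]
    exact enorm_integral_mul_le ((hf n).sub hf₀).1 hg.1

lemma memLp_add {f g : α → ℂ} {p : ℝ≥0∞} (hf : MemLp f p μ) (hg : MemLp g p μ) :
    MemLp (fun x => f x + g x) p μ := hf.add hg

lemma memLp_sub {f g : α → ℂ} {p : ℝ≥0∞} (hf : MemLp f p μ) (hg : MemLp g p μ) :
    MemLp (fun x => f x - g x) p μ := hf.sub hg

end General

/-- Euclidean space of dimension `d`. -/
abbrev Euc (d : ℕ) : Type := EuclideanSpace ℝ (Fin d)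

variable {d : ℕ}

lemma exists_schwartz_seq {f : Euc d → ℂ} (hf : MemLp f 2 volume) :
    ∃ φ : ℕ → 𝓢(Euc d, ℂ), Tendsto (fun n => eLpNorm (fun x => φ n x - f x) 2 volume)
      atTop (𝓝 0) := by
  have hd := SchwartzMap.denseRange_toLpCLM (E := Euc d) (F := ℂ) (p := 2) (μ := volume)
    ENNReal.ofNat_ne_top
  obtain ⟨x, hx, hlim⟩ := mem_closure_iff_seq_limit.1 (hd (hf.toLp f))
  choose φ hφ using hx
  refine ⟨φ, ?_⟩
  have := (Lp.tendsto_Lp_iff_tendsto_eLpNorm' x (hf.toLp f)).1 hlim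
  refine this.congr fun n => eLpNorm_congr_ae ?_
  have h1 : (x n : Euc d → ℂ) =ᵐ[volume] φ n := by
    rw [← hφ n]
    exact SchwartzMap.coeFn_toLp (φ n) 2 volume
  filter_upwards [h1, hf.coeFn_toLp] with z hz1 hz2
  simp [hz1, hz2]

/-- The scaling factor of the Plancherel identity. -/
def cpi (d : ℕ) : ℝ := (2 * Real.pi) ^ d

lemma cpi_pos (d : ℕ) : 0 < cpi d := by unfold cpi; positivity

lemma map_smul_volume {r : ℝ} (hr : r ≠ 0) :
    Measure.map (fun x : Euc d => r • x) volume = ENNReal.ofReal |(r ^ d)⁻¹| • volume := by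
  have := Measure.map_addHaar_smul (volume : Measure (Euc d)) hr
  rwa [finrank_euclideanSpace_fin] at this

lemma quasi_smul {r : ℝ} (hr : r ≠ 0) :
    Measure.QuasiMeasurePreserving (fun x : Euc d => r • x) volume volume := by
  refine ⟨measurable_const_smul r, ?_⟩
  rw [map_smul_volume hr]
  exact Measure.smul_absolutelyContinuous

lemma eLpNorm_comp_smul {f : Euc d → ℂ} (hf : AEStronglyMeasurable f volume) {r : ℝ} (hr : r ≠ 0) :
    eLpNorm (fun x => f (r • x)) 2 volume
      = ENNReal.ofReal |(r ^ d)⁻¹| ^ (1 / 2 : ℝ) * eLpNorm f 2 volume := by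
  have h2 : AEStronglyMeasurable f (Measure.map (fun x : Euc d => r • x) volume) := by
    rw [map_smul_volume hr]
    exact hf.mono_ac Measure.smul_absolutelyContinuous
  have := eLpNorm_map_measure (p := 2) h2 (measurable_const_smul r).aemeasurable
  rw [map_smul_volume hr, eLpNorm_smul_measure_of_ne_top ENNReal.ofNat_ne_top] at this
  rw [show (fun x => f (r • x)) = f ∘ fun x : Euc d => r • x from rfl, ← this]
  simp

lemma memLp_comp_smul {f : Euc d → ℂ} (hf : MemLp f 2 volume) {r : ℝ} (hr : r ≠ 0) :
    MemLp (fun x => f (r • x)) 2 volume := by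
  refine ⟨hf.1.comp_quasiMeasurePreserving (quasi_smul hr), ?_⟩
  rw [eLpNorm_comp_smul hf.1 hr]
  exact ENNReal.mul_lt_top (ENNReal.rpow_lt_top_of_nonneg (by norm_num) ENNReal.ofReal_ne_top) hf.2

lemma two_pi_ne : (2 * Real.pi) ≠ 0 := by positivity

lemma two_pi_inv_ne : (2 * Real.pi)⁻¹ ≠ 0 := inv_ne_zero two_pi_ne

lemma fourierL2_of_memLp {f : Euc d → ℂ} (h : MemLp f 2 volume) :
    fourierL2 f = fun ζ => (𝓕 (h.toLp f) : Lp ℂ 2 (volume : Measure (Euc d)))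
      ((2 * Real.pi)⁻¹ • ζ) := by
  ext ζ; simp [fourierL2, h]

lemma measurable_fourierL2 (f : Euc d → ℂ) : Measurable (fourierL2 f) := by
  by_cases h : MemLp f 2 volume
  · rw [fourierL2_of_memLp h]
    exact (Lp.stronglyMeasurable _).measurable.comp (measurable_const_smul _)
  · have : fourierL2 f = fun _ => 0 := by ext ζ; simp [fourierL2, h]
    rw [this]
    exact measurable_const

lemma memLp_fourierL2 (f : Euc d → ℂ) : MemLp (fourierL2 f) 2 volume := by
  by_cases h : MemLp f 2 volume
  · rw [fourierL2_of_memLp h]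
    exact memLp_comp_smul (Lp.memLp _) two_pi_inv_ne
  · have : fourierL2 f = fun _ => 0 := by ext ζ; simp [fourierL2, h]
    rw [this]
    exact MemLp.zero

lemma eLpNorm_fourierL2 {f : Euc d → ℂ} (h : MemLp f 2 volume) :
    eLpNorm (fourierL2 f) 2 volume
      = ENNReal.ofReal (cpi d) ^ (1 / 2 : ℝ) * eLpNorm f 2 volume := by
  rw [fourierL2_of_memLp h, eLpNorm_comp_smul (Lp.aestronglyMeasurable _) two_pi_inv_ne]
  have e : |((2 * Real.pi)⁻¹ ^ d)⁻¹| = cpi d := by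
    rw [inv_pow, inv_inv, abs_of_pos (by positivity)]; rfl
  rw [e]
  congr 1
  have h1 := Lp.norm_fourier_eq (h.toLp f)
  rw [Lp.norm_def, Lp.norm_def] at h1
  have h2 := (ENNReal.toReal_eq_toReal_iff' (Lp.eLpNorm_ne_top _) (Lp.eLpNorm_ne_top _)).1 h1
  rw [h2]
  exact eLpNorm_congr_ae h.coeFn_toLp

lemma fourierL2_congr {f g : Euc d → ℂ} (h : f =ᵐ[volume] g) : fourierL2 f = fourierL2 g := by
  by_cases hf : MemLp f 2 volume
  · have hg : MemLp g 2 volume := (memLp_congr_ae h).1 hf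
    rw [fourierL2_of_memLp hf, fourierL2_of_memLp hg, (MemLp.toLp_eq_toLp_iff hf hg).2 h]
  · have hg : ¬MemLp g 2 volume := fun hg => hf ((memLp_congr_ae h).2 hg)
    ext ζ
    simp [fourierL2, hf, hg]

lemma fourierL2_add {f g : Euc d → ℂ} (hf : MemLp f 2 volume) (hg : MemLp g 2 volume) :
    fourierL2 (fun x => f x + g x) =ᵐ[volume] fun ζ => fourierL2 f ζ + fourierL2 g ζ := by
  have e : (memLp_add hf hg).toLp (fun x => f x + g x) = hf.toLp f + hg.toLp g := MemLp.toLp_add hf hg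
  rw [fourierL2_of_memLp (memLp_add hf hg), fourierL2_of_memLp hf, fourierL2_of_memLp hg]
  erw [e]
  rw [FourierTransform.fourier_add]
  exact (quasi_smul two_pi_inv_ne).ae_eq_comp (Lp.coeFn_add _ _)

lemma fourierL2_const_mul {f : Euc d → ℂ} (hf : MemLp f 2 volume) (c : ℂ) :
    fourierL2 (fun x => c * f x) =ᵐ[volume] fun ζ => c * fourierL2 f ζ := by
  have e : (hf.const_mul c).toLp (fun x => c * f x) = c • hf.toLp f := MemLp.toLp_const_smul c hf
  rw [fourierL2_of_memLp (hf.const_mul c), fourierL2_of_memLp hf]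
  erw [e]
  rw [FourierTransform.fourier_smul]
  exact (quasi_smul two_pi_inv_ne).ae_eq_comp (Lp.coeFn_smul _ _)

lemma fourierL2_sub {f g : Euc d → ℂ} (hf : MemLp f 2 volume) (hg : MemLp g 2 volume) :
    fourierL2 (fun x => f x - g x) =ᵐ[volume] fun ζ => fourierL2 f ζ - fourierL2 g ζ := by
  have h := fourierL2_add hf (hg.const_mul (-1))
  have e : (fun x => f x - g x) = fun x => f x + -1 * g x := by ext x; ring
  rw [e]
  filter_upwards [h, fourierL2_const_mul hg (-1)] with ζ h1 h2
  rw [h1, h2]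
  ring

lemma fourierL2_zero : fourierL2 (fun _ : Euc d => (0 : ℂ)) =ᵐ[volume] fun _ => 0 := by
  have := fourierL2_const_mul (MemLp.zero (ε := ℂ) (μ := (volume : Measure (Euc d))) (p := 2)) 0
  simpa using this

lemma fourierL2_sum {ι : Type*} (s : Finset ι) {f : ι → Euc d → ℂ}
    (hf : ∀ i, MemLp (f i) 2 volume) :
    fourierL2 (fun x => ∑ i ∈ s, f i x) =ᵐ[volume] fun ζ => ∑ i ∈ s, fourierL2 (f i) ζ := by
  classical
  induction s using Finset.induction_on with
  | empty => simpa using fourierL2_zero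
  | insert i s hi ih =>
    have h := fourierL2_add (hf i) (memLp_finsetSum s fun j _ => hf j)
    simp_rw [Finset.sum_insert hi]
    filter_upwards [h, ih] with ζ h1 h2
    rw [h1, h2]

lemma ae_eq_of_fourierL2 {f g : Euc d → ℂ} (hf : MemLp f 2 volume) (hg : MemLp g 2 volume)
    (h : fourierL2 f =ᵐ[volume] fourierL2 g) : f =ᵐ[volume] g := by
  have h0 : eLpNorm (fourierL2 (fun x => f x - g x)) 2 volume = 0 := by
    rw [eLpNorm_eq_zero_iff (memLp_fourierL2 _).1 two_ne_zero]
    filter_upwards [h, fourierL2_sub hf hg] with ζ h1 h2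
    rw [h2, h1, sub_self]; rfl
  rw [eLpNorm_fourierL2 (memLp_sub hf hg)] at h0
  have hc : ENNReal.ofReal (cpi d) ^ (1 / 2 : ℝ) ≠ 0 := by
    simp [cpi_pos]
  have h1 := (mul_eq_zero.1 h0).resolve_left hc
  rw [eLpNorm_eq_zero_iff (memLp_sub hf hg).1 two_ne_zero] at h1
  filter_upwards [h1] with x hx
  exact sub_eq_zero.1 hx

lemma tendsto_fourierL2 {f : ℕ → Euc d → ℂ} {f₀ : Euc d → ℂ} (hf : ∀ n, MemLp (f n) 2 volume)
    (hf₀ : MemLp f₀ 2 volume)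
    (h : Tendsto (fun n => eLpNorm (fun x => f n x - f₀ x) 2 volume) atTop (𝓝 0)) :
    Tendsto (fun n => eLpNorm (fun ζ => fourierL2 (f n) ζ - fourierL2 f₀ ζ) 2 volume)
      atTop (𝓝 0) := by
  have e : ∀ n, eLpNorm (fun ζ => fourierL2 (f n) ζ - fourierL2 f₀ ζ) 2 volume
      = ENNReal.ofReal (cpi d) ^ (1 / 2 : ℝ) * eLpNorm (fun x => f n x - f₀ x) 2 volume := fun n => by
    rw [← eLpNorm_fourierL2 (memLp_sub (hf n) hf₀)]
    exact eLpNorm_congr_ae (fourierL2_sub (hf n) hf₀).symm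
  simp_rw [e]
  have := ENNReal.Tendsto.const_mul h (a := ENNReal.ofReal (cpi d) ^ (1 / 2 : ℝ))
    (Or.inr (ENNReal.rpow_ne_top_of_nonneg (by norm_num) ENNReal.ofReal_ne_top))
  rwa [mul_zero] at this

/-- The phase `e^{-i z·ζ}`. -/
def phase (z ζ : Euc d) : ℂ := Complex.exp (((-(inner ℝ z ζ) : ℝ) : ℂ) * Complex.I)

lemma norm_phase (z ζ : Euc d) : ‖phase z ζ‖ = 1 := by
  unfold phase; exact Complex.norm_exp_ofReal_mul_I _

lemma phase_comm (z ζ : Euc d) : phase z ζ = phase ζ z := by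
  unfold phase; rw [real_inner_comm]

lemma phase_add (z w ζ : Euc d) : phase (z + w) ζ = phase z ζ * phase w ζ := by
  unfold phase
  rw [← Complex.exp_add, inner_add_left]
  congr 1; push_cast; ring

lemma phase_add_right (z ζ ξ : Euc d) : phase z (ζ + ξ) = phase z ζ * phase z ξ := by
  rw [phase_comm, phase_add, phase_comm z, phase_comm z]

lemma phase_neg_right (z ζ : Euc d) : phase z (-ζ) = phase (-z) ζ := by
  unfold phase; rw [inner_neg_left, inner_neg_right]

lemma conj_phase (z ζ : Euc d) : (starRingEnd ℂ) (phase z ζ) = phase (-z) ζ := by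
  unfold phase
  rw [← Complex.exp_conj, map_mul, Complex.conj_ofReal, Complex.conj_I, inner_neg_left]
  congr 1; push_cast; ring

lemma continuous_phase : Continuous fun w : Euc d × Euc d => phase w.1 w.2 := by
  unfold phase; fun_prop

lemma continuous_phase' {β : Type*} [TopologicalSpace β] {f g : β → Euc d}
    (hf : Continuous f) (hg : Continuous g) : Continuous fun x => phase (f x) (g x) :=
  continuous_phase.comp (hf.prodMk hg)

lemma measurable_phase' {β : Type*} [MeasurableSpace β] {f g : β → Euc d}
    (hf : Measurable f) (hg : Measurable g) : Measurable fun x => phase (f x) (g x) := by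
  unfold phase
  exact Complex.measurable_exp.comp
    ((Complex.measurable_ofReal.comp (hf.inner hg).neg).mul_const _)

/-- The Fourier integral. -/
def fint (f : Euc d → ℂ) (ζ : Euc d) : ℂ := ∫ z, phase z ζ * f z

lemma fint_eq_fourier (f : Euc d → ℂ) (ζ : Euc d) : fint f ζ = 𝓕 f ((2 * Real.pi)⁻¹ • ζ) := by
  rw [Real.fourier_eq', fint]
  refine integral_congr_ae (ae_of_all _ fun z => ?_)
  simp only [phase, smul_eq_mul, inner_smul_right]
  congr 3
  have := two_pi_ne
  push_cast
  field_simp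

lemma integrable_phase_mul {f : Euc d → ℂ} (hf : Integrable f) (ζ : Euc d) :
    Integrable fun z => phase z ζ * f z :=
  hf.bdd_mul (c := 1) (continuous_phase' continuous_id continuous_const).aestronglyMeasurable
    (ae_of_all _ fun z => (norm_phase z ζ).le)

lemma continuous_fint {f : Euc d → ℂ} (hf : Integrable f) : Continuous (fint f) := by
  refine continuous_of_dominated (bound := fun z => ‖f z‖) ?_ ?_ hf.norm ?_
  · exact fun ζ => (integrable_phase_mul hf ζ).1
  · exact fun ζ => ae_of_all _ fun z => by rw [norm_mul, norm_phase, one_mul]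
  · exact ae_of_all _ fun z => (continuous_phase' continuous_const continuous_id).mul continuous_const

lemma integral_fint_mul {f g : Euc d → ℂ} (hf : Integrable f) (hg : Integrable g) :
    ∫ ζ, fint f ζ * g ζ = ∫ z, f z * fint g z := by
  have hp : Integrable (fun w : Euc d × Euc d => phase w.1 w.2 * (f w.1 * g w.2)) :=
    (hf.mul_prod hg).bdd_mul (c := 1) continuous_phase.aestronglyMeasurable
      (ae_of_all _ fun w => (norm_phase _ _).le)
  unfold fint
  calc _ = ∫ ζ, ∫ z, phase z ζ * (f z * g ζ) := by
        refine integral_congr_ae (ae_of_all _ fun ζ => ?_)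
        simp only
        rw [← integral_mul_const]
        congr 1; ext z; ring
    _ = ∫ z, ∫ ζ, phase z ζ * (f z * g ζ) := integral_integral_swap hp.swap
    _ = _ := by
        refine integral_congr_ae (ae_of_all _ fun z => ?_)
        simp only
        rw [← integral_const_mul]
        congr 1; ext ζ; rw [phase_comm]; ring

lemma memLp_schwartz (φ : 𝓢(Euc d, ℂ)) : MemLp φ 2 volume := φ.memLp 2 volume

lemma fourierL2_schwartz (φ : 𝓢(Euc d, ℂ)) : fourierL2 φ =ᵐ[volume] fint φ := by
  rw [fourierL2_of_memLp (memLp_schwartz φ)]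
  have e : (memLp_schwartz φ).toLp φ = φ.toLp 2 := rfl
  rw [e, SchwartzMap.toLp_fourier_eq]
  have := (quasi_smul (d := d) two_pi_inv_ne).ae_eq_comp (SchwartzMap.coeFn_toLp (𝓕 φ) 2 volume)
  filter_upwards [this] with ζ hζ
  rw [fint_eq_fourier]
  exact hζ

/-- The Fourier transform is symmetric. -/
lemma integral_fourierL2_mul {f g : Euc d → ℂ} (hf : MemLp f 2 volume) (hg : MemLp g 2 volume) :
    ∫ ζ, fourierL2 f ζ * g ζ = ∫ z, f z * fourierL2 g z := by
  -- For Schwartz functions the identity is Fubini. It extends by density in one argument and then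
  -- in the other.
  have key : ∀ φ ψ : 𝓢(Euc d, ℂ), ∫ ζ, fourierL2 φ ζ * ψ ζ = ∫ z, φ z * fourierL2 ψ z := by
    intro φ ψ
    have e1 : (fun ζ => fourierL2 φ ζ * ψ ζ) =ᵐ[volume] fun ζ => fint φ ζ * ψ ζ := by
      filter_upwards [fourierL2_schwartz φ] with ζ h
      rw [h]
    have e2 : (fun ζ => φ ζ * fourierL2 ψ ζ) =ᵐ[volume] fun ζ => φ ζ * fint ψ ζ := by
      filter_upwards [fourierL2_schwartz ψ] with ζ h
      rw [h]
    rw [integral_congr_ae e1, integral_congr_ae e2]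
    exact integral_fint_mul φ.integrable ψ.integrable
  have key2 : ∀ φ : 𝓢(Euc d, ℂ), ∫ ζ, fourierL2 φ ζ * g ζ = ∫ z, φ z * fourierL2 g z := by
    intro φ
    obtain ⟨ψ, hψ⟩ := exists_schwartz_seq hg
    have l1 := tendsto_integral_mul (fun n => memLp_schwartz (ψ n)) hg (memLp_fourierL2 φ) hψ
    have l2 := tendsto_integral_mul (fun n => memLp_fourierL2 (ψ n)) (memLp_fourierL2 g)
      (memLp_schwartz φ) (tendsto_fourierL2 (fun n => memLp_schwartz (ψ n)) hg hψ)
    simp_rw [mul_comm _ (fourierL2 φ _), key, mul_comm (φ _)] at l1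
    simp_rw [mul_comm (φ _)]
    exact tendsto_nhds_unique l1 l2
  obtain ⟨φ, hφ⟩ := exists_schwartz_seq hf
  have l1 := tendsto_integral_mul (fun n => memLp_schwartz (φ n)) hf (memLp_fourierL2 g) hφ
  have l2 := tendsto_integral_mul (fun n => memLp_fourierL2 (φ n)) (memLp_fourierL2 f)
      hg (tendsto_fourierL2 (fun n => memLp_schwartz (φ n)) hf hφ)
  simp_rw [key2] at l2
  exact tendsto_nhds_unique l2 l1

end

/-! ### Inversion, Parseval and reality for the Fourier transform on L² -/

section

variable {d : ℕ}

lemma ae_eq_of_schwartz {f g : Euc d → ℂ} (hf : LocallyIntegrable f) (hg : LocallyIntegrable g)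
    (H : ∀ ψ : 𝓢(Euc d, ℂ), ∫ z, f z * ψ z = ∫ z, g z * ψ z) : f =ᵐ[volume] g := by
  refine ae_eq_of_integral_contDiff_smul_eq hf hg fun θ hθ hc => ?_
  have hc' : HasCompactSupport fun z => (θ z : ℂ) := hc.comp_left (g := Complex.ofReal) rfl
  have hs : ContDiff ℝ ((⊤ : ℕ∞) : WithTop ℕ∞) fun z => (θ z : ℂ) :=
    Complex.ofRealCLM.contDiff.comp hθ
  have := H (hc'.toSchwartzMap hs)
  simpa [mul_comm] using this

lemma locallyIntegrable_of_memLp {f : Euc d → ℂ} (hf : MemLp f 2 volume) : LocallyIntegrable f :=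
  hf.locallyIntegrable (by norm_num)

/-- Identification by duality: testing the transform of `f` against `ψ` is testing `f` against the
transform of `ψ`. Inversion, conjugation and superposition of translates are all derived in this
way. -/
lemma fourierL2_eq_of_schwartz {f h : Euc d → ℂ} (hf : MemLp f 2 volume) (hh : LocallyIntegrable h)
    (H : ∀ ψ : 𝓢(Euc d, ℂ), ∫ z, f z * fint ψ z = ∫ z, h z * ψ z) : fourierL2 f =ᵐ[volume] h := by
  refine ae_eq_of_schwartz (locallyIntegrable_of_memLp (memLp_fourierL2 f)) hh fun ψ => ?_
  rw [integral_fourierL2_mul hf (memLp_schwartz ψ), ← H]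
  refine integral_congr_ae ?_
  filter_upwards [fourierL2_schwartz ψ] with z hz
  rw [hz]

lemma fourierL2_eq_fint {f : Euc d → ℂ} (hf : MemLp f 2 volume) (hi : Integrable f) :
    fourierL2 f =ᵐ[volume] fint f :=
  fourierL2_eq_of_schwartz hf (continuous_fint hi).locallyIntegrable fun ψ =>
    (integral_fint_mul hi ψ.integrable).symm

lemma fint_fint_schwartz (φ : 𝓢(Euc d, ℂ)) (z : Euc d) : fint (fint φ) z = cpi d * φ (-z) := by
  have h1 : (𝓕⁻ (𝓕 φ) : 𝓢(Euc d, ℂ)) (-z) = φ (-z) := by rw [FourierTransform.fourierInv_fourier_eq]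
  rw [SchwartzMap.fourierInv_coe, Real.fourierInv_eq'] at h1
  rw [← h1]
  unfold fint
  have h2 := Measure.integral_comp_smul_of_nonneg volume
    (fun η : Euc d => phase η z * fint φ η) (2 * Real.pi) (hR := by positivity)
  rw [finrank_euclideanSpace_fin] at h2
  have h3 : (∫ η : Euc d, phase η z * fint φ η)
      = (2 * Real.pi) ^ d • ∫ x : Euc d, phase ((2 * Real.pi) • x) z * fint φ ((2 * Real.pi) • x) := by
    rw [h2, smul_smul, mul_inv_cancel₀ (pow_ne_zero _ two_pi_ne), one_smul]
  unfold fint at h3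
  rw [h3, Complex.real_smul]
  unfold cpi
  congr 1
  refine integral_congr_ae (ae_of_all _ fun x => ?_)
  have h4 := fint_eq_fourier φ ((2 * Real.pi) • x)
  rw [smul_smul, inv_mul_cancel₀ two_pi_ne, one_smul] at h4
  simp only
  rw [← fint, h4, smul_eq_mul]
  congr 1
  unfold phase
  congr 1
  rw [inner_smul_left, inner_neg_right]
  simp

lemma integrable_fint_schwartz (φ : 𝓢(Euc d, ℂ)) : Integrable (fint φ) := by
  have e : fint φ = fun ζ => (𝓕 φ : 𝓢(Euc d, ℂ)) ((2 * Real.pi)⁻¹ • ζ) := by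
    ext ζ; rw [fint_eq_fourier]; rfl
  rw [e]
  exact (𝓕 φ : 𝓢(Euc d, ℂ)).integrable.comp_smul two_pi_inv_ne

lemma memLp_fint_schwartz (φ : 𝓢(Euc d, ℂ)) : MemLp (fint φ) 2 volume :=
  (memLp_congr_ae (fourierL2_schwartz φ)).1 (memLp_fourierL2 φ)

lemma memLp_comp_neg {f : Euc d → ℂ} (hf : MemLp f 2 volume) :
    MemLp (fun z => f (-z)) 2 volume :=
  hf.comp_measurePreserving (Measure.measurePreserving_neg volume)

/-- Fourier inversion. -/
lemma fourierL2_fourierL2 {f : Euc d → ℂ} (hf : MemLp f 2 volume) :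
    fourierL2 (fourierL2 f) =ᵐ[volume] fun z => cpi d * f (-z) := by
  refine fourierL2_eq_of_schwartz (memLp_fourierL2 f)
    (locallyIntegrable_of_memLp ((memLp_comp_neg hf).const_mul _)) fun ψ => ?_
  rw [integral_fourierL2_mul hf (memLp_fint_schwartz ψ)]
  have e : ∫ z, f z * fourierL2 (fint ψ) z = ∫ z, f z * (cpi d * ψ (-z)) := by
    refine integral_congr_ae ?_
    filter_upwards [fourierL2_eq_fint (memLp_fint_schwartz ψ) (integrable_fint_schwartz ψ)] with z hz
    rw [hz, fint_fint_schwartz]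
  rw [e, ← integral_neg_eq_self]
  congr 1; ext z; rw [neg_neg]; ring

/-- The bilinear Parseval identity. -/
lemma integral_mul_eq {f g : Euc d → ℂ} (hf : MemLp f 2 volume) (hg : MemLp g 2 volume) :
    ∫ z, f z * g z = (cpi d : ℂ)⁻¹ * ∫ ζ, fourierL2 f ζ * fourierL2 g (-ζ) := by
  have hc : (cpi d : ℂ) ≠ 0 := by exact_mod_cast (cpi_pos d).ne'
  -- The pairing with the threefold transform of `g` is computed twice. Inverting the outer two
  -- transforms gives the frequency side; moving the outermost one to `f` and inverting both factors
  -- gives the physical side.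
  have h1 : ∫ ζ, fourierL2 f ζ * fourierL2 (fourierL2 (fourierL2 g)) ζ
      = ∫ ζ, fourierL2 f ζ * (cpi d * fourierL2 g (-ζ)) := by
    refine integral_congr_ae ?_
    filter_upwards [fourierL2_fourierL2 (memLp_fourierL2 g)] with ζ hζ
    rw [hζ]
  have h2 : ∫ ζ, fourierL2 f ζ * fourierL2 (fourierL2 (fourierL2 g)) ζ
      = ∫ z, (cpi d * f (-z)) * (cpi d * g (-z)) := by
    simp_rw [mul_comm (fourierL2 f _)]
    rw [integral_fourierL2_mul (memLp_fourierL2 _) (memLp_fourierL2 _)]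
    refine integral_congr_ae ?_
    filter_upwards [fourierL2_fourierL2 hf, fourierL2_fourierL2 hg] with z h1 h2
    rw [h1, h2]
    ring
  have h3 : ∫ z, (cpi d * f (-z)) * (cpi d * g (-z)) = (cpi d : ℂ) ^ 2 * ∫ z, f z * g z := by
    rw [integral_neg_eq_self (fun z => (cpi d * f z) * (cpi d * g z)), ← integral_const_mul]
    congr 1; ext z; ring
  have h4 : ∫ ζ, fourierL2 f ζ * (cpi d * fourierL2 g (-ζ))
      = (cpi d : ℂ) * ∫ ζ, fourierL2 f ζ * fourierL2 g (-ζ) := by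
    rw [← integral_const_mul]; congr 1; ext z; ring
  rw [h2, h3, h4] at h1
  field_simp
  refine mul_left_cancel₀ hc ?_
  linear_combination h1

lemma fint_conj_neg (g : Euc d → ℂ) (z : Euc d) :
    fint (fun ζ => (starRingEnd ℂ) (g (-ζ))) z = (starRingEnd ℂ) (fint g z) := by
  unfold fint
  rw [← integral_conj, ← integral_neg_eq_self]
  congr 1; ext ζ
  simp only [neg_neg, map_mul, conj_phase]

lemma memLp_conj {f : Euc d → ℂ} (hf : MemLp f 2 volume) :
    MemLp (fun z => (starRingEnd ℂ) (f z)) 2 volume := hf.star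

lemma fourierL2_conj {f : Euc d → ℂ} (hf : MemLp f 2 volume) :
    fourierL2 (fun z => (starRingEnd ℂ) (f z))
      =ᵐ[volume] fun ζ => (starRingEnd ℂ) (fourierL2 f (-ζ)) := by
  refine fourierL2_eq_of_schwartz (memLp_conj hf)
    (locallyIntegrable_of_memLp (memLp_conj (memLp_comp_neg (memLp_fourierL2 f)))) fun ψ => ?_
  have m : MemLp (fun ζ => (starRingEnd ℂ) (ψ (-ζ))) 2 volume :=
    memLp_conj (memLp_comp_neg (memLp_schwartz ψ))
  have i : Integrable (fun ζ => (starRingEnd ℂ) (ψ (-ζ))) :=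
    (Complex.conjCLE.toContinuousLinearMap.integrable_comp ψ.integrable.comp_neg)
  have h1 := integral_fourierL2_mul hf m
  have h2 : ∫ z, f z * fourierL2 (fun ζ => (starRingEnd ℂ) (ψ (-ζ))) z
      = ∫ z, f z * (starRingEnd ℂ) (fint ψ z) := by
    refine integral_congr_ae ?_
    filter_upwards [fourierL2_eq_fint m i] with z hz
    rw [hz, fint_conj_neg]
  rw [h2] at h1
  have h3 := congrArg (starRingEnd ℂ) h1
  rw [← integral_conj, ← integral_conj] at h3
  simp only [map_mul, Complex.conj_conj] at h3
  rw [← h3, ← integral_neg_eq_self]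
  simp

lemma fourierL2_real {f : Euc d → ℂ} (hf : MemLp f 2 volume)
    (h : ∀ z, (starRingEnd ℂ) (f z) = f z) :
    ∀ᵐ ζ, fourierL2 f (-ζ) = (starRingEnd ℂ) (fourierL2 f ζ) := by
  have h1 := fourierL2_conj hf
  simp_rw [h] at h1
  filter_upwards [h1] with ζ hζ
  rw [hζ, Complex.conj_conj]

lemma memLp_comp_two_pi {g : Euc d → ℂ} (hg : MemLp g 2 volume) :
    MemLp (fun η => g ((2 * Real.pi) • η)) 2 volume := memLp_comp_smul hg two_pi_ne

lemma invFourierL2_of_memLp {g : Euc d → ℂ} (hg : MemLp g 2 volume) :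
    invFourierL2 g = (𝓕⁻ ((memLp_comp_two_pi hg).toLp _) :
      Lp ℂ 2 (volume : Measure (Euc d))) := by
  ext z
  have := memLp_comp_two_pi hg
  simp [invFourierL2, this]

lemma memLp_invFourierL2 {g : Euc d → ℂ} (hg : MemLp g 2 volume) :
    MemLp (invFourierL2 g) 2 volume := by
  rw [invFourierL2_of_memLp hg]; exact Lp.memLp _

lemma fourierL2_invFourierL2 {g : Euc d → ℂ} (hg : MemLp g 2 volume) :
    fourierL2 (invFourierL2 g) =ᵐ[volume] g := by
  rw [fourierL2_of_memLp (memLp_invFourierL2 hg)]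
  have e : (memLp_invFourierL2 hg).toLp (invFourierL2 g)
      = 𝓕⁻ ((memLp_comp_two_pi hg).toLp _) := by
    apply Lp.ext
    refine (MemLp.coeFn_toLp _).trans ?_
    rw [invFourierL2_of_memLp hg]
  rw [e, FourierTransform.fourier_fourierInv_eq]
  have := (quasi_smul (d := d) two_pi_inv_ne).ae_eq_comp (memLp_comp_two_pi hg).coeFn_toLp
  refine this.trans (ae_of_all _ fun ζ => ?_)
  simp only [Function.comp, smul_smul, mul_inv_cancel₀ two_pi_ne, one_smul]

lemma eq_fint_of_fourierL2 {v f : Euc d → ℂ} (hv : MemLp v 2 volume) (h : fourierL2 v =ᵐ[volume] f)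
    (hi : Integrable f) : v =ᵐ[volume] fun z => (cpi d : ℂ)⁻¹ * fint f (-z) := by
  have hc : (cpi d : ℂ) ≠ 0 := by exact_mod_cast (cpi_pos d).ne'
  have h2 : MemLp f 2 volume := (memLp_congr_ae h).1 (memLp_fourierL2 v)
  have h1 := fourierL2_fourierL2 hv
  rw [fourierL2_congr h] at h1
  have h3 := (Measure.measurePreserving_neg (volume : Measure (Euc d))).quasiMeasurePreserving.ae
    (h1.symm.trans (fourierL2_eq_fint h2 hi))
  filter_upwards [h3] with z hz
  rw [neg_neg] at hz
  rw [← hz]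
  field_simp

end

/-! ### Minkowski's inequality and convolution operators on L² -/

section

section Minkowski

variable {α : Type*} [MeasurableSpace α] {μ : Measure α}

lemma lintegral_mul_le_sqrt {f g : α → ℝ≥0∞} (hf : AEMeasurable f μ) (hg : AEMeasurable g μ) :
    ∫⁻ x, f x * g x ∂μ ≤ (∫⁻ x, f x ^ 2 ∂μ) ^ (1 / 2 : ℝ) * (∫⁻ x, g x ^ 2 ∂μ) ^ (1 / 2 : ℝ) := by
  refine le_of_sq_le_sq' ?_
  rw [mul_pow, sq_sqrt_ennreal, sq_sqrt_ennreal]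
  exact sq_lintegral_mul_le hf hg

/-- Minkowski's inequality in `L²` for countable sums. -/
lemma lintegral_sq_tsum_le {ι : Type*} [Countable ι] {h : ι → α → ℝ≥0∞}
    (hm : ∀ i, AEMeasurable (h i) μ) :
    ∫⁻ x, (∑' i, h i x) ^ 2 ∂μ ≤ (∑' i, (∫⁻ x, h i x ^ 2 ∂μ) ^ (1 / 2 : ℝ)) ^ 2 := by
  calc _ = ∫⁻ x, ∑' i, ∑' j, h i x * h j x ∂μ := by
        refine lintegral_congr fun x => ?_
        rw [sq, ← ENNReal.tsum_mul_right]
        congr 1; ext i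
        rw [← ENNReal.tsum_mul_left]
    _ = ∑' i, ∑' j, ∫⁻ x, h i x * h j x ∂μ := by
        have m : ∀ i j, AEMeasurable (fun x => h i x * h j x) μ := fun i j => (hm i).mul (hm j)
        rw [lintegral_tsum fun i => AEMeasurable.tsum (m i)]
        congr 1; ext i
        rw [lintegral_tsum (m i)]
    _ ≤ ∑' i, ∑' j, (∫⁻ x, h i x ^ 2 ∂μ) ^ (1 / 2 : ℝ) * (∫⁻ x, h j x ^ 2 ∂μ) ^ (1 / 2 : ℝ) :=
        ENNReal.tsum_le_tsum fun i => ENNReal.tsum_le_tsum fun j =>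
          lintegral_mul_le_sqrt (hm i) (hm j)
    _ = _ := by
        simp_rw [ENNReal.tsum_mul_left, ENNReal.tsum_mul_right]
        rw [sq]

lemma sq_lintegral_weight_le' {κ A : α → ℝ≥0∞} (hκ : AEMeasurable κ μ) (hA : AEMeasurable A μ) :
    (∫⁻ x, κ x * A x ∂μ) ^ 2 ≤ (∫⁻ x, κ x ∂μ) * ∫⁻ x, κ x * A x ^ 2 ∂μ := by
  have h := sq_lintegral_mul_le (μ := μ) (f := fun x => κ x ^ (1 / 2 : ℝ))
    (g := fun x => κ x ^ (1 / 2 : ℝ) * A x) (hκ.pow_const _) ((hκ.pow_const _).mul hA)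
  simp_rw [mul_pow, sq_sqrt_ennreal, ← mul_assoc, ← sq, sq_sqrt_ennreal] at h
  exact h

lemma eLpNorm_two_sq {f : α → ℂ} : eLpNorm f 2 μ ^ 2 = ∫⁻ x, ‖f x‖ₑ ^ 2 ∂μ := by
  rw [eLpNorm_eq_lintegral_rpow_enorm_toReal two_ne_zero ENNReal.ofNat_ne_top]
  simp only [ENNReal.toReal_ofNat, ENNReal.rpow_ofNat]
  exact sq_sqrt_ennreal _

lemma eLpNorm_two_eq {f : α → ℂ} : eLpNorm f 2 μ = (∫⁻ x, ‖f x‖ₑ ^ 2 ∂μ) ^ (1 / 2 : ℝ) := by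
  rw [← eLpNorm_two_sq, sqrt_sq_ennreal]

end Minkowski

variable {d : ℕ}

/-! ### Superpositions of translates -/

section Conv

variable {X : Type*} [MeasurableSpace X] (ν : Measure X) [SFinite ν]

/-- The superposition of the translates of `V` along `γ` with density `k`. -/
def cv (k : X → ℂ) (γ : X → Euc d) (V : Euc d → ℂ) (z : Euc d) : ℂ := ∫ r, k r * V (z - γ r) ∂ν

/-- The symbol of the operator `cv k γ`. -/
def cvSymbol (k : X → ℂ) (γ : X → Euc d) (ζ : Euc d) : ℂ := ∫ r, k r * phase (γ r) ζ ∂ν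

variable {ν} {k : X → ℂ} {γ : X → Euc d} {V : Euc d → ℂ}

lemma measurable_cv_kernel (hk : Measurable k) (hγ : Measurable γ) (hV : Measurable V) :
    Measurable fun w : Euc d × X => k w.2 * V (w.1 - γ w.2) :=
  (hk.comp measurable_snd).mul (hV.comp (measurable_fst.sub (hγ.comp measurable_snd)))

lemma stronglyMeasurable_cv (hk : Measurable k) (hγ : Measurable γ) (hV : Measurable V) :
    StronglyMeasurable (cv ν k γ V) :=
  (measurable_cv_kernel hk hγ hV).stronglyMeasurable.integral_prod_right

/-- Young's inequality `L¹ * L² → L²`: Cauchy-Schwarz for the measure with density `κ`, followed by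
translation invariance. -/
lemma lintegral_sq_cv_le {κ : X → ℝ≥0∞} {A : Euc d → ℝ≥0∞} (hκ : Measurable κ) (hγ : Measurable γ)
    (hA : Measurable A) :
    ∫⁻ z, (∫⁻ r, κ r * A (z - γ r) ∂ν) ^ 2 ≤ (∫⁻ r, κ r ∂ν) ^ 2 * ∫⁻ z, A z ^ 2 := by
  have m : Measurable fun w : Euc d × X => κ w.2 * A (w.1 - γ w.2) ^ 2 :=
    (hκ.comp measurable_snd).mul
      ((hA.comp (measurable_fst.sub (hγ.comp measurable_snd))).pow_const 2)
  calc _ ≤ ∫⁻ z, (∫⁻ r, κ r ∂ν) * ∫⁻ r, κ r * A (z - γ r) ^ 2 ∂ν :=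
        lintegral_mono fun z => sq_lintegral_weight_le' hκ.aemeasurable
          (hA.comp (measurable_const.sub hγ)).aemeasurable
    _ = (∫⁻ r, κ r ∂ν) * ∫⁻ z, ∫⁻ r, κ r * A (z - γ r) ^ 2 ∂ν :=
        lintegral_const_mul _ m.lintegral_prod_right'
    _ = (∫⁻ r, κ r ∂ν) * ∫⁻ r, (∫⁻ z : Euc d, κ r * A (z - γ r) ^ 2) ∂ν := by
        rw [lintegral_lintegral_swap m.aemeasurable]
    _ = (∫⁻ r, κ r ∂ν) * ∫⁻ r, κ r * (∫⁻ z, A z ^ 2) ∂ν := by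
        congr 1
        refine lintegral_congr fun r => ?_
        rw [lintegral_const_mul _ (by fun_prop), lintegral_sub_right_eq_self (fun z => A z ^ 2)]
    _ = _ := by rw [lintegral_mul_const _ hκ, sq, mul_assoc]

lemma enorm_cv_le (z : Euc d) : ‖cv ν k γ V z‖ₑ ≤ ∫⁻ r, ‖k r‖ₑ * ‖V (z - γ r)‖ₑ ∂ν := by
  refine (enorm_integral_le_lintegral_enorm _).trans (le_of_eq ?_)
  simp_rw [enorm_mul]

lemma eLpNorm_cv_le (hk : Measurable k) (hγ : Measurable γ) (hV : Measurable V) :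
    eLpNorm (cv ν k γ V) 2 volume ≤ (∫⁻ r, ‖k r‖ₑ ∂ν) * eLpNorm V 2 volume := by
  refine le_of_sq_le_sq' ?_
  rw [mul_pow, eLpNorm_two_sq, eLpNorm_two_sq]
  refine (lintegral_mono fun z => ?_).trans (lintegral_sq_cv_le (ν := ν) hk.enorm hγ hV.enorm)
  gcongr
  exact enorm_cv_le z

lemma memLp_cv (hk : Measurable k) (hki : Integrable k ν) (hγ : Measurable γ) (hV : Measurable V)
    (hV2 : MemLp V 2 volume) : MemLp (cv ν k γ V) 2 volume :=
  ⟨(stronglyMeasurable_cv hk hγ hV).aestronglyMeasurable,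
    (eLpNorm_cv_le hk hγ hV).trans_lt (ENNReal.mul_lt_top hki.2 hV2.2)⟩

lemma measurable_cvSymbol (hk : Measurable k) (hγ : Measurable γ) :
    StronglyMeasurable (cvSymbol ν k γ) := by
  have m : Measurable fun w : Euc d × X => k w.2 * phase (γ w.2) w.1 :=
    (hk.comp measurable_snd).mul (measurable_phase' (hγ.comp measurable_snd) measurable_fst)
  exact m.stronglyMeasurable.integral_prod_right

lemma norm_cvSymbol_le (ζ : Euc d) : ‖cvSymbol ν k γ ζ‖ ≤ ∫ r, ‖k r‖ ∂ν := by
  refine (norm_integral_le_integral_norm _).trans (le_of_eq ?_)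
  simp [norm_phase]

lemma memLp_symbol_mul {a f : Euc d → ℂ} (ha : AEStronglyMeasurable a volume) {C : ℝ}
    (hC : ∀ ζ, ‖a ζ‖ ≤ C) (hf : MemLp f 2 volume) : MemLp (fun ζ => a ζ * f ζ) 2 volume := by
  refine MemLp.of_le_mul (c := C) hf (ha.mul hf.1) (ae_of_all _ fun ζ => ?_)
  rw [norm_mul]
  gcongr
  exact hC ζ

lemma integrable_cv_mul {g : Euc d → ℂ} (hk : Measurable k) (hki : Integrable k ν)
    (hγ : Measurable γ) (hV : Measurable V) (hg : Measurable g)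
    (hV2 : MemLp V 2 volume) (hg2 : MemLp g 2 volume) :
    Integrable (fun w : Euc d × X => k w.2 * V (w.1 - γ w.2) * g w.1) (volume.prod ν) := by
  have m : Measurable fun w : Euc d × X => k w.2 * V (w.1 - γ w.2) * g w.1 :=
    (measurable_cv_kernel hk hγ hV).mul (hg.comp measurable_fst)
  refine ⟨m.aestronglyMeasurable, ?_⟩
  unfold HasFiniteIntegral
  rw [lintegral_prod _ m.enorm.aemeasurable]
  calc _ = ∫⁻ z, (∫⁻ r, ‖k r‖ₑ * ‖V (z - γ r)‖ₑ ∂ν) * ‖g z‖ₑ := by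
        refine lintegral_congr fun z => ?_
        rw [← lintegral_mul_const]
        · simp_rw [enorm_mul]
        · exact hk.enorm.mul (hV.enorm.comp (measurable_const.sub hγ))
    _ ≤ (∫⁻ z, (∫⁻ r, ‖k r‖ₑ * ‖V (z - γ r)‖ₑ ∂ν) ^ 2) ^ (1 / 2 : ℝ)
        * (∫⁻ z, ‖g z‖ₑ ^ 2) ^ (1 / 2 : ℝ) := by
        refine lintegral_mul_le_sqrt (Measurable.aemeasurable ?_) hg.enorm.aemeasurable
        refine Measurable.lintegral_prod_right' (f := fun w : Euc d × X =>
          ‖k w.2‖ₑ * ‖V (w.1 - γ w.2)‖ₑ) ?_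
        exact (hk.enorm.comp measurable_snd).mul
          (hV.enorm.comp (measurable_fst.sub (hγ.comp measurable_snd)))
    _ < ⊤ := by
        rw [← eLpNorm_two_eq]
        refine ENNReal.mul_lt_top (ENNReal.rpow_lt_top_of_nonneg (by norm_num) ?_) hg2.2
        refine ((lintegral_sq_cv_le (ν := ν) hk.enorm hγ hV.enorm).trans_lt ?_).ne
        rw [← eLpNorm_two_sq]
        exact ENNReal.mul_lt_top (ENNReal.pow_lt_top hki.2) (ENNReal.pow_lt_top hV2.2)

lemma fint_add_phase (ψ : Euc d → ℂ) (z w : Euc d) :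
    fint ψ (z + w) = fint (fun ζ => phase w ζ * ψ ζ) z := by
  unfold fint
  congr 1; ext ζ
  rw [phase_add_right, phase_comm ζ w]; ring

/-- The Fourier transform turns superposition of translates into multiplication. -/
lemma fourierL2_cv (hk : Measurable k) (hki : Integrable k ν) (hγ : Measurable γ)
    (hV : Measurable V) (hV2 : MemLp V 2 volume) :
    fourierL2 (cv ν k γ V) =ᵐ[volume] fun ζ => cvSymbol ν k γ ζ * fourierL2 V ζ := by
  refine fourierL2_eq_of_schwartz (memLp_cv hk hki hγ hV hV2) (locallyIntegrable_of_memLp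
    (memLp_symbol_mul (measurable_cvSymbol hk hγ).aestronglyMeasurable norm_cvSymbol_le
      (memLp_fourierL2 V))) fun ψ => ?_
  have mψ : Measurable (fint ψ) := (continuous_fint ψ.integrable).measurable
  have i1 := integrable_cv_mul hk hki hγ hV mψ hV2 (memLp_fint_schwartz ψ)
  have inner_eq : ∀ r, ∫ z, V (z - γ r) * fint ψ z
      = ∫ ζ, fourierL2 V ζ * (phase (γ r) ζ * ψ ζ) := by
    intro r
    have m : MemLp (fun ζ => phase (γ r) ζ * ψ ζ) 2 volume :=
      memLp_symbol_mul (measurable_phase' measurable_const measurable_id).aestronglyMeasurable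
        (C := 1) (fun ζ => (norm_phase _ _).le) (memLp_schwartz ψ)
    have i : Integrable (fun ζ => phase (γ r) ζ * ψ ζ) := by
      have := integrable_phase_mul ψ.integrable (γ r)
      simpa only [phase_comm (γ r)] using this
    rw [integral_fourierL2_mul hV2 m,
      ← integral_add_right_eq_self (fun z => V (z - γ r) * fint ψ z) (γ r)]
    refine integral_congr_ae ?_
    filter_upwards [fourierL2_eq_fint m i] with z hz
    rw [hz, add_sub_cancel_right, fint_add_phase]
  have i2 : Integrable (fun w : X × Euc d => k w.1 * (fourierL2 V w.2 * (phase (γ w.1) w.2 * ψ w.2)))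
      (ν.prod volume) := by
    have h0 := hki.mul_prod (integrable_mul_of_memLp (memLp_fourierL2 V) (memLp_schwartz ψ))
    refine (h0.bdd_mul (c := 1) (f := fun w : X × Euc d => phase (γ w.1) w.2)
      (measurable_phase' (hγ.comp measurable_fst) measurable_snd).aestronglyMeasurable
      (ae_of_all _ fun w => (norm_phase _ _).le)).congr (ae_of_all _ fun w => ?_)
    simp only
    ring
  calc ∫ z, cv ν k γ V z * fint ψ z = ∫ z, ∫ r, k r * V (z - γ r) * fint ψ z ∂ν := by
        congr 1; ext z
        rw [cv, ← integral_mul_const]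
    _ = ∫ r, (∫ z : Euc d, k r * V (z - γ r) * fint ψ z) ∂ν := integral_integral_swap i1
    _ = ∫ r, (∫ ζ : Euc d, k r * (fourierL2 V ζ * (phase (γ r) ζ * ψ ζ))) ∂ν := by
        congr 1; ext r
        rw [integral_const_mul, ← inner_eq, ← integral_const_mul]
        congr 1; ext z; ring
    _ = ∫ ζ, ∫ r, k r * (fourierL2 V ζ * (phase (γ r) ζ * ψ ζ)) ∂ν := integral_integral_swap i2
    _ = _ := by
        congr 1; ext ζ
        rw [cvSymbol, ← integral_mul_const, ← integral_mul_const]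
        congr 1; ext r; ring

end Conv

end

section

variable {d : ℕ}

/-! ### Products -/

lemma exists_subseq_ae {α : Type*} [MeasurableSpace α] {μ : Measure α} {u : ℕ → α → ℂ} {u₀ : α → ℂ}
    (hu : ∀ n, AEStronglyMeasurable (u n) μ) (hu₀ : AEStronglyMeasurable u₀ μ)
    (h : Tendsto (fun n => eLpNorm (fun x => u n x - u₀ x) 2 μ) atTop (𝓝 0)) :
    ∃ ns : ℕ → ℕ, StrictMono ns ∧ ∀ᵐ x ∂μ, Tendsto (fun n => u (ns n) x) atTop (𝓝 (u₀ x)) :=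
  (tendstoInMeasure_of_tendsto_eLpNorm two_ne_zero hu hu₀ h).exists_seq_tendsto_ae

/-- Multiplication is not continuous on L², so the identity is passed to the limit pointwise, along
a subsequence common to the three sequences. -/
lemma ae_eq_mul_of_tendsto {α : Type*} [MeasurableSpace α] {μ : Measure α}
    {u v w : ℕ → α → ℂ} {u₀ v₀ w₀ : α → ℂ}
    (hu : ∀ n, MemLp (u n) 2 μ) (hv : ∀ n, MemLp (v n) 2 μ) (hw : ∀ n, MemLp (w n) 2 μ)
    (hu₀ : MemLp u₀ 2 μ) (hv₀ : MemLp v₀ 2 μ) (hw₀ : MemLp w₀ 2 μ)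
    (cu : Tendsto (fun n => eLpNorm (fun x => u n x - u₀ x) 2 μ) atTop (𝓝 0))
    (cv : Tendsto (fun n => eLpNorm (fun x => v n x - v₀ x) 2 μ) atTop (𝓝 0))
    (cw : Tendsto (fun n => eLpNorm (fun x => w n x - w₀ x) 2 μ) atTop (𝓝 0))
    (h : ∀ n, (fun x => u n x * v n x) =ᵐ[μ] w n) : (fun x => u₀ x * v₀ x) =ᵐ[μ] w₀ := by
  obtain ⟨n₁, m₁, h₁⟩ := exists_subseq_ae (fun n => (hu n).1) hu₀.1 cu
  obtain ⟨n₂, m₂, h₂⟩ := exists_subseq_ae (fun n => (hv (n₁ n)).1) hv₀.1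
    (cv.comp m₁.tendsto_atTop)
  obtain ⟨n₃, m₃, h₃⟩ := exists_subseq_ae (fun n => (hw (n₁ (n₂ n))).1) hw₀.1
    (cw.comp (m₁.comp m₂).tendsto_atTop)
  filter_upwards [h₁, h₂, h₃, ae_all_iff.2 h] with x x₁ x₂ x₃ hx
  have l1 := (x₁.comp (m₂.comp m₃).tendsto_atTop).mul (x₂.comp m₃.tendsto_atTop)
  refine tendsto_nhds_unique l1 (x₃.congr fun n => ?_)
  exact (hx _).symm

/-- Truncation to a ball. -/
def trunc (n : ℕ) (f : Euc d → ℂ) : Euc d → ℂ := (Metric.closedBall 0 (n : ℝ)).indicator f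

lemma measurable_trunc {f : Euc d → ℂ} (hf : Measurable f) (n : ℕ) : Measurable (trunc n f) :=
  hf.indicator measurableSet_closedBall

lemma norm_trunc_le (n : ℕ) (f : Euc d → ℂ) (z : Euc d) : ‖trunc n f z‖ ≤ ‖f z‖ :=
  norm_indicator_le_norm_self _ _

lemma enorm_trunc_le (n : ℕ) (f : Euc d → ℂ) (z : Euc d) : ‖trunc n f z‖ₑ ≤ ‖f z‖ₑ :=
  enorm_indicator_le_enorm_self _ _

lemma memLp_trunc {f : Euc d → ℂ} (hf : MemLp f 2 volume) (n : ℕ) : MemLp (trunc n f) 2 volume :=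
  hf.indicator measurableSet_closedBall

lemma integrable_trunc {f : Euc d → ℂ} (hf : MemLp f 2 volume) (n : ℕ) : Integrable (trunc n f) :=
  ((locallyIntegrable_of_memLp hf).integrableOn_isCompact
    (isCompact_closedBall 0 (n : ℝ))).integrable_indicator measurableSet_closedBall

lemma trunc_eventually (f : Euc d → ℂ) (z : Euc d) : ∀ᶠ n : ℕ in atTop, trunc n f z = f z := by
  filter_upwards [eventually_ge_atTop ⌈‖z‖⌉₊] with n hn
  refine indicator_of_mem ?_ _
  rw [mem_closedBall_zero_iff]
  exact (Nat.le_ceil _).trans (by exact_mod_cast hn)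

lemma tendsto_eLpNorm_of_dominated {α : Type*} [MeasurableSpace α] {μ : Measure α}
    {u : ℕ → α → ℂ} {u₀ : α → ℂ} {g : α → ℝ≥0∞} (hu : ∀ n, AEStronglyMeasurable (u n) μ)
    (hu₀ : AEStronglyMeasurable u₀ μ) (hg : ∫⁻ x, g x ^ 2 ∂μ ≠ ⊤)
    (h1 : ∀ n, ∀ᵐ x ∂μ, ‖u n x - u₀ x‖ₑ ≤ g x)
    (h2 : ∀ᵐ x ∂μ, Tendsto (fun n => u n x) atTop (𝓝 (u₀ x))) :
    Tendsto (fun n => eLpNorm (fun x => u n x - u₀ x) 2 μ) atTop (𝓝 0) := by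
  simp_rw [eLpNorm_two_eq]
  have key : Tendsto (fun n => ∫⁻ x, ‖u n x - u₀ x‖ₑ ^ 2 ∂μ) atTop (𝓝 (∫⁻ _, 0 ∂μ)) := by
    refine tendsto_lintegral_of_dominated_convergence' (fun x => g x ^ 2)
      (fun n => (((hu n).sub hu₀).enorm.pow_const 2)) (fun n => ?_) hg ?_
    · filter_upwards [h1 n] with x hx
      gcongr
    · filter_upwards [h2] with x hx
      have := (tendsto_iff_edist_tendsto_0.1 hx)
      simp_rw [edist_eq_enorm_sub] at this
      have h3 := ENNReal.Tendsto.pow (n := 2) this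
      rwa [zero_pow two_ne_zero] at h3
  rw [lintegral_zero] at key
  have h3 := (ENNReal.continuous_rpow_const (y := (1 / 2 : ℝ))).continuousAt.tendsto.comp key
  rwa [ENNReal.zero_rpow_of_pos (by norm_num)] at h3

lemma tendsto_trunc {f : Euc d → ℂ} (hf : MemLp f 2 volume) :
    Tendsto (fun n => eLpNorm (fun z => trunc n f z - f z) 2 volume) atTop (𝓝 0) := by
  refine tendsto_eLpNorm_of_dominated (g := fun z => ‖f z‖ₑ) (fun n => (memLp_trunc hf n).1) hf.1 ?_
    (fun n => ae_of_all _ fun z => ?_)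
    (ae_of_all _ fun z => tendsto_const_nhds.congr' ?_)
  · rw [← eLpNorm_two_sq]
    exact (ENNReal.pow_lt_top hf.2).ne
  · unfold trunc indicator
    split_ifs <;> simp
  · filter_upwards [trunc_eventually f z] with n hn using hn.symm

lemma tendsto_of_fourierL2 {f : ℕ → Euc d → ℂ} {f₀ : Euc d → ℂ} (hf : ∀ n, MemLp (f n) 2 volume)
    (hf₀ : MemLp f₀ 2 volume)
    (h : Tendsto (fun n => eLpNorm (fun ζ => fourierL2 (f n) ζ - fourierL2 f₀ ζ) 2 volume)
      atTop (𝓝 0)) :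
    Tendsto (fun n => eLpNorm (fun x => f n x - f₀ x) 2 volume) atTop (𝓝 0) := by
  have hc0 : ENNReal.ofReal (cpi d) ^ (1 / 2 : ℝ) ≠ 0 := by simp [cpi_pos]
  have hct : ENNReal.ofReal (cpi d) ^ (1 / 2 : ℝ) ≠ ⊤ :=
    ENNReal.rpow_ne_top_of_nonneg (by norm_num) ENNReal.ofReal_ne_top
  have e : ∀ n, eLpNorm (fun x => f n x - f₀ x) 2 volume = (ENNReal.ofReal (cpi d) ^ (1 / 2 : ℝ))⁻¹ *
      eLpNorm (fun ζ => fourierL2 (f n) ζ - fourierL2 f₀ ζ) 2 volume := fun n => by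
    rw [← eLpNorm_congr_ae (fourierL2_sub (hf n) hf₀), eLpNorm_fourierL2 (memLp_sub (hf n) hf₀),
      ← mul_assoc, ENNReal.inv_mul_cancel hc0 hct, one_mul]
  simp_rw [e]
  have := ENNReal.Tendsto.const_mul h (a := (ENNReal.ofReal (cpi d) ^ (1 / 2 : ℝ))⁻¹)
    (Or.inr (ENNReal.inv_ne_top.2 hc0))
  rwa [mul_zero] at this

/-- The function whose Fourier transform is the truncated one. -/
def freqTrunc (n : ℕ) (v : Euc d → ℂ) : Euc d → ℂ := invFourierL2 (trunc n (fourierL2 v))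

lemma memLp_freqTrunc (n : ℕ) (v : Euc d → ℂ) : MemLp (freqTrunc n v) 2 volume :=
  memLp_invFourierL2 (memLp_trunc (memLp_fourierL2 v) n)

lemma fourierL2_freqTrunc (n : ℕ) (v : Euc d → ℂ) :
    fourierL2 (freqTrunc n v) =ᵐ[volume] trunc n (fourierL2 v) :=
  fourierL2_invFourierL2 (memLp_trunc (memLp_fourierL2 v) n)

lemma tendsto_freqTrunc {v : Euc d → ℂ} (hv : MemLp v 2 volume) :
    Tendsto (fun n => eLpNorm (fun z => freqTrunc n v z - v z) 2 volume) atTop (𝓝 0) := by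
  refine tendsto_of_fourierL2 (fun n => memLp_freqTrunc n v) hv ?_
  refine (tendsto_trunc (memLp_fourierL2 v)).congr fun n => eLpNorm_congr_ae ?_
  filter_upwards [fourierL2_freqTrunc n v] with ζ hζ
  rw [hζ]

lemma freqTrunc_eq (n : ℕ) (v : Euc d → ℂ) :
    freqTrunc n v =ᵐ[volume] fun z => (cpi d : ℂ)⁻¹ * fint (trunc n (fourierL2 v)) (-z) :=
  eq_fint_of_fourierL2 (memLp_freqTrunc n v) (fourierL2_freqTrunc n v)
    (integrable_trunc (memLp_fourierL2 v) n)

/-- The convolution of two functions. -/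
def conv (f g : Euc d → ℂ) (p : Euc d) : ℂ := ∫ a, f a * g (p - a)

lemma fint_conv {f g : Euc d → ℂ} (hf : Integrable f) (hg : Integrable g) (z : Euc d) :
    fint (conv f g) z = fint f z * fint g z := by
  simp_rw [fint_eq_fourier]
  exact Real.fourier_mul_convolution_eq hf hg _

lemma integrable_conv {f g : Euc d → ℂ} (hf : Integrable f) (hg : Integrable g) :
    Integrable (conv f g) :=
  hf.integrable_convolution (ContinuousLinearMap.mul ℂ ℂ) hg

lemma measurable_conv {f g : Euc d → ℂ} (hf : Measurable f) (hg : Measurable g) :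
    StronglyMeasurable (conv f g) := by
  have m : Measurable fun w : Euc d × Euc d => f w.2 * g (w.1 - w.2) :=
    (hf.comp measurable_snd).mul (hg.comp (measurable_fst.sub measurable_snd))
  exact m.stronglyMeasurable.integral_prod_right

lemma enorm_conv_le (f g : Euc d → ℂ) (p : Euc d) :
    ‖conv f g p‖ₑ ≤ ∫⁻ a, ‖f a‖ₑ * ‖g (p - a)‖ₑ := by
  refine (enorm_integral_le_lintegral_enorm _).trans (le_of_eq ?_)
  simp_rw [enorm_mul]

lemma measurable_lconv {f g : Euc d → ℝ≥0∞} (hf : Measurable f) (hg : Measurable g) :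
    Measurable fun p => ∫⁻ a, f a * g (p - a) := by
  refine Measurable.lintegral_prod_right' (f := fun w : Euc d × Euc d => f w.2 * g (w.1 - w.2)) ?_
  exact (hf.comp measurable_snd).mul (hg.comp (measurable_fst.sub measurable_snd))

lemma memLp_conv {f g : Euc d → ℂ} (hf : Measurable f) (hg : Measurable g)
    (h : ∫⁻ p, (∫⁻ a, ‖f a‖ₑ * ‖g (p - a)‖ₑ) ^ 2 ≠ ⊤) : MemLp (conv f g) 2 volume := by
  refine ⟨(measurable_conv hf hg).aestronglyMeasurable, ?_⟩
  rw [eLpNorm_two_eq]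
  refine ENNReal.rpow_lt_top_of_nonneg (by norm_num)
    ((lintegral_mono fun p => ?_).trans_lt h.lt_top).ne
  gcongr
  exact enorm_conv_le f g p

/-- The Fourier transform turns products into convolutions. -/
lemma product_fourierL2 {v₁ v₂ : Euc d → ℂ} (h₁ : MemLp v₁ 2 volume) (h₂ : MemLp v₂ 2 volume)
    (h : ∫⁻ p, (∫⁻ a, ‖fourierL2 v₁ a‖ₑ * ‖fourierL2 v₂ (p - a)‖ₑ) ^ 2 ≠ ⊤) :
    MemLp (fun z => v₁ z * v₂ z) 2 volume ∧ fourierL2 (fun z => v₁ z * v₂ z)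
      =ᵐ[volume] fun p => (cpi d : ℂ)⁻¹ * conv (fourierL2 v₁) (fourierL2 v₂) p := by
  set f₁ := fourierL2 v₁ with hf₁
  set f₂ := fourierL2 v₂ with hf₂
  have m₁ : Measurable f₁ := measurable_fourierL2 v₁
  have m₂ : Measurable f₂ := measurable_fourierL2 v₂
  set H : Euc d → ℝ≥0∞ := fun p => ∫⁻ a, ‖f₁ a‖ₑ * ‖f₂ (p - a)‖ₑ with hH
  have mH : Measurable H := measurable_lconv m₁.enorm m₂.enorm
  have hle : ∀ n p, (∫⁻ a, ‖trunc n f₁ a‖ₑ * ‖trunc n f₂ (p - a)‖ₑ) ≤ H p := fun n p =>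
    lintegral_mono fun a => mul_le_mul' (enorm_trunc_le _ _ _) (enorm_trunc_le _ _ _)
  have hc2 : MemLp (conv f₁ f₂) 2 volume := memLp_conv m₁ m₂ h
  have hcn : ∀ n, MemLp (conv (trunc n f₁) (trunc n f₂)) 2 volume := fun n =>
    memLp_conv (measurable_trunc m₁ n) (measurable_trunc m₂ n)
      (((lintegral_mono fun p => pow_le_pow_left' (hle n p) 2).trans_lt h.lt_top).ne)
  have lim : Tendsto (fun n => eLpNorm (fun p => conv (trunc n f₁) (trunc n f₂) p - conv f₁ f₂ p)
      2 volume) atTop (𝓝 0) := by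
    refine tendsto_eLpNorm_of_dominated (g := fun p => 2 * H p) (fun n => (hcn n).1) hc2.1 ?_
      (fun n => ae_of_all _ fun p => ?_) ?_
    · simp_rw [mul_pow]
      rw [lintegral_const_mul _ (mH.pow_const 2)]
      exact ENNReal.mul_ne_top (by norm_num) h
    · refine enorm_sub_le.trans ?_
      rw [two_mul]
      exact add_le_add ((enorm_conv_le _ _ p).trans (hle n p)) (enorm_conv_le _ _ p)
    · have hfin : ∀ᵐ p, H p ^ 2 < ⊤ := ae_lt_top (mH.pow_const 2) h
      filter_upwards [hfin] with p hp
      have hp' : H p ≠ ⊤ := fun h0 => by simp [h0] at hp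
      unfold conv
      refine tendsto_integral_of_dominated_convergence (fun a => ‖f₁ a * f₂ (p - a)‖)
        (fun n => ?_) ?_ (fun n => ae_of_all _ fun a => ?_) (ae_of_all _ fun a => ?_)
      · exact ((measurable_trunc m₁ n).mul
          ((measurable_trunc m₂ n).comp (measurable_const.sub measurable_id))).aestronglyMeasurable
      · refine Integrable.norm ⟨(m₁.mul (m₂.comp
          (measurable_const.sub measurable_id))).aestronglyMeasurable, ?_⟩
        unfold HasFiniteIntegral
        simp_rw [enorm_mul]
        exact hp'.lt_top
      · rw [norm_mul, norm_mul]
        gcongr <;> exact norm_trunc_le _ _ _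
      · refine tendsto_const_nhds.congr' ?_
        filter_upwards [trunc_eventually f₁ a, trunc_eventually f₂ (p - a)] with n h1 h2
        rw [h1, h2]
  set c : ℂ := (cpi d : ℂ)⁻¹ with hc
  set w : ℕ → Euc d → ℂ := fun n => invFourierL2 fun p => c * conv (trunc n f₁) (trunc n f₂) p
    with hw
  set w₀ : Euc d → ℂ := invFourierL2 fun p => c * conv f₁ f₂ p with hw₀
  have mw : ∀ n, MemLp (w n) 2 volume := fun n => memLp_invFourierL2 ((hcn n).const_mul c)
  have mw₀ : MemLp w₀ 2 volume := memLp_invFourierL2 (hc2.const_mul c)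
  have Fw : ∀ n, fourierL2 (w n) =ᵐ[volume] fun p => c * conv (trunc n f₁) (trunc n f₂) p :=
    fun n => fourierL2_invFourierL2 ((hcn n).const_mul c)
  have Fw₀ : fourierL2 w₀ =ᵐ[volume] fun p => c * conv f₁ f₂ p :=
    fourierL2_invFourierL2 (hc2.const_mul c)
  have limw : Tendsto (fun n => eLpNorm (fun z => w n z - w₀ z) 2 volume) atTop (𝓝 0) := by
    refine tendsto_of_fourierL2 mw mw₀ ?_
    have h3 := ENNReal.Tendsto.const_mul lim (a := ‖c‖ₑ) (Or.inr enorm_ne_top)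
    rw [mul_zero] at h3
    refine h3.congr fun n => ?_
    have h4 := eLpNorm_const_smul c (fun p => conv (trunc n f₁) (trunc n f₂) p - conv f₁ f₂ p) 2
      (volume : Measure (Euc d))
    rw [← h4]
    refine eLpNorm_congr_ae ?_
    filter_upwards [Fw n, Fw₀] with p h1 h2
    rw [h1, h2, Pi.smul_apply, smul_eq_mul, mul_sub]
  -- The truncated transforms are integrable, so both factors are given by Fourier integrals and the
  -- classical convolution theorem applies.
  have heq : ∀ n, (fun z => freqTrunc n v₁ z * freqTrunc n v₂ z) =ᵐ[volume] w n := by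
    intro n
    have i1 := integrable_trunc (memLp_fourierL2 v₁) n
    have i2 := integrable_trunc (memLp_fourierL2 v₂) n
    have h5 := eq_fint_of_fourierL2 (mw n) (Fw n) ((integrable_conv i1 i2).const_mul c)
    filter_upwards [h5, freqTrunc_eq n v₁, freqTrunc_eq n v₂] with z h6 h7 h8
    rw [h6, h7, h8]
    have h9 : fint (fun p => c * conv (trunc n f₁) (trunc n f₂) p) (-z)
        = c * (fint (trunc n f₁) (-z) * fint (trunc n f₂) (-z)) := by
      rw [← fint_conv i1 i2]
      unfold fint
      rw [← integral_const_mul]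
      congr 1; ext p; ring
    rw [h9]
    ring
  have fin := ae_eq_mul_of_tendsto (fun n => memLp_freqTrunc n v₁) (fun n => memLp_freqTrunc n v₂)
    mw h₁ h₂ mw₀ (tendsto_freqTrunc h₁) (tendsto_freqTrunc h₂) limw heq
  refine ⟨(memLp_congr_ae fin).2 mw₀, ?_⟩
  rw [fourierL2_congr fin]
  exact Fw₀

end

section

/-! ### Consequences of finiteness of the `X`-norm -/

/-- The bilinear estimate for localized modulations, summed by Minkowski. Its main use is
qualitative: finite X-norms provide the square-integrable convolution required by
`product_fourierL2`. -/
lemma nrm_lconv_le {η₀ : ℝ → ℝ} (hη : IsCutoff η₀) {f g : SpaceTime → ℝ≥0∞}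
    (hf : Measurable f) (hg : Measurable g) :
    nrm (fun p => ∫⁻ a, f a * g (p - a)) ≤ 32 * (xnrm η₀ f * xnrm η₀ g) := by
  have mp : ∀ i j, Measurable fun p => ∫⁻ a, modPiece η₀ f i a * modPiece η₀ g j (p - a) :=
    fun i j => measurable_lconv (measurable_modPiece hη hf i) (measurable_modPiece hη hg j)
  refine le_of_sq_le_sq' ?_
  rw [sq_nrm]
  calc _ ≤ ∫⁻ p, (∑' ij : ℕ × ℕ, ∫⁻ a, modPiece η₀ f ij.1 a * modPiece η₀ g ij.2 (p - a)) ^ 2 := by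
        refine lintegral_mono fun p => pow_le_pow_left' ?_ 2
        rw [← lintegral_tsum]
        · refine lintegral_mono fun a => ?_
          rw [ENNReal.tsum_prod']
          refine le_trans ?_ (le_of_eq (tsum_mul_tsum (fun i => modPiece η₀ f i a)
            fun j => modPiece η₀ g j (p - a)))
          exact mul_le_mul' (le_tsum_modPiece hη f a) (le_tsum_modPiece hη g (p - a))
        · exact fun ij => ((measurable_modPiece hη hf ij.1).mul
            ((measurable_modPiece hη hg ij.2).comp
              (measurable_const.sub measurable_id))).aemeasurable
    _ ≤ (∑' ij : ℕ × ℕ, (∫⁻ p, (∫⁻ a, modPiece η₀ f ij.1 a * modPiece η₀ g ij.2 (p - a)) ^ 2) ^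
          (1 / 2 : ℝ)) ^ 2 := lintegral_sq_tsum_le fun ij => (mp ij.1 ij.2).aemeasurable
    _ ≤ (∑' ij : ℕ × ℕ, 32 * (((2 : ℝ≥0∞) ^ ((ij.1 : ℝ) / 2) * nrm (modPiece η₀ f ij.1)) *
          ((2 : ℝ≥0∞) ^ ((ij.2 : ℝ) / 2) * nrm (modPiece η₀ g ij.2)))) ^ 2 := by
        refine pow_le_pow_left' (ENNReal.tsum_le_tsum fun ij => le_of_sq_le_sq' ?_) 2
        rw [sq_sqrt_ennreal]
        refine (sq_conv_le (measurable_modPiece hη hf ij.1) (measurable_modPiece hη hg ij.2)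
          (by positivity) (by positivity) (modSupp_modPiece hη f ij.1)
          (modSupp_modPiece hη g ij.2)).trans (le_of_eq ?_)
        rw [← sq_nrm, ← sq_nrm, ← ofReal_sqrt_sq (by positivity), mul_assoc 256,
          ofReal_sqrt_mul (by norm_num), ofReal_sqrt_mul (by positivity), ofReal_sqrt_two_pow,
          ofReal_sqrt_two_pow, show (256 : ℝ) = 16 ^ 2 by norm_num, Real.sqrt_sq (by norm_num)]
        have e : ENNReal.ofReal 16 * (ENNReal.ofReal √2) ^ 2 = 32 := by
          rw [ofReal_sqrt_sq (by norm_num), ← ENNReal.ofReal_mul (by norm_num)]; norm_num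
        rw [← e]
        ring
    _ = _ := by
        rw [ENNReal.tsum_prod']
        simp_rw [ENNReal.tsum_mul_left]
        rw [ENNReal.tsum_mul_right]
        rfl

/-- The `L²` norm in the space frequencies of the `L¹` norm in `τ`, squared. -/
def slc (f : SpaceTime → ℝ≥0∞) : ℝ≥0∞ := ∫⁻ ζ : Plane, (∫⁻ τ : ℝ, f (stEquiv (ζ, τ))) ^ 2

lemma measurable_slice {f : SpaceTime → ℝ≥0∞} (hf : Measurable f) :
    Measurable fun ζ : Plane => ∫⁻ τ : ℝ, f (stEquiv (ζ, τ)) :=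
  (hf.comp stEquiv.measurable).lintegral_prod_right'

/-- On the `j`-th piece `τ` is confined to an interval of length `4 · 2 ^ j`. Cauchy-Schwarz in `τ`
therefore costs `2 · 2^{j/2}`, twice the weight of the X-norm. -/
lemma slc_le {η₀ : ℝ → ℝ} (hη : IsCutoff η₀) {f : SpaceTime → ℝ≥0∞} (hf : Measurable f) :
    slc f ≤ (2 * xnrm η₀ f) ^ 2 := by
  have m := fun j => measurable_modPiece hη hf j
  have ms : ∀ j (ζ : Plane), Measurable fun τ : ℝ => modPiece η₀ f j (stEquiv (ζ, τ)) := fun j ζ =>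
    (m j).comp (stEquiv.measurable.comp measurable_prodMk_left)
  calc slc f ≤ ∫⁻ ζ : Plane, (∑' j, ∫⁻ τ : ℝ, modPiece η₀ f j (stEquiv (ζ, τ))) ^ 2 := by
        refine lintegral_mono fun ζ => pow_le_pow_left' ?_ 2
        rw [← lintegral_tsum fun j => (ms j ζ).aemeasurable]
        exact lintegral_mono fun τ => le_tsum_modPiece hη f _
    _ ≤ (∑' j, (∫⁻ ζ : Plane, (∫⁻ τ : ℝ, modPiece η₀ f j (stEquiv (ζ, τ))) ^ 2) ^
          (1 / 2 : ℝ)) ^ 2 :=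
        lintegral_sq_tsum_le fun j => (measurable_slice (m j)).aemeasurable
    _ ≤ (∑' j : ℕ, 2 * ((2 : ℝ≥0∞) ^ ((j : ℝ) / 2) * nrm (modPiece η₀ f j))) ^ 2 := by
        refine pow_le_pow_left' (ENNReal.tsum_le_tsum fun j => le_of_sq_le_sq' ?_) 2
        rw [sq_sqrt_ennreal, mul_pow, mul_pow, sq_nrm, lintegral_st ((m j).pow_const 2)]
        have e : ∀ ζ : Plane, ∀ τ : ℝ, !₂[ζ 0, ζ 1, τ] = stEquiv (ζ, τ) := fun ζ τ => by simp
        simp_rw [e]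
        rw [← mul_assoc, ← lintegral_const_mul]
        swap
        · exact ((m j).pow_const 2).comp stEquiv.measurable |>.lintegral_prod_right'
        refine lintegral_mono fun ζ => ?_
        set S : Set ℝ := {τ | |τ - omega (ζ 0) (ζ 1)| ≤ 2 ^ (j + 1)} with hS
        have mS : MeasurableSet S := measurableSet_le (by fun_prop) measurable_const
        have e2 : ∀ τ : ℝ, modPiece η₀ f j (stEquiv (ζ, τ))
            = S.indicator 1 τ * modPiece η₀ f j (stEquiv (ζ, τ)) := fun τ => by
          by_cases h : τ ∈ S
          · rw [indicator_of_mem h, Pi.one_apply, one_mul]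
          · rw [indicator_of_notMem h, zero_mul]
            by_contra h0
            have := modSupp_modPiece hη f j _ h0
            exact h (mem_ofPred_eq.symm ▸ (by simpa [modu] using this : |τ - omega (ζ 0) (ζ 1)| ≤ 2 ^ (j + 1)))
        have e3 : ∫⁻ τ, S.indicator 1 τ ^ 2 ≤ 2 ^ 2 * ((2 : ℝ≥0∞) ^ ((j : ℝ) / 2)) ^ 2 := by
          have : ∀ τ, (S.indicator (1 : ℝ → ℝ≥0∞) τ) ^ 2 = S.indicator 1 τ := fun τ => by
            by_cases h : τ ∈ S <;> simp [h]
          simp_rw [this]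
          rw [lintegral_indicator_one mS]
          refine (volume_abs_sub_le _ _).trans (le_of_eq ?_)
          rw [← ENNReal.rpow_natCast (2 ^ ((j : ℝ) / 2)), ← ENNReal.rpow_mul,
            show (j : ℝ) / 2 * (2 : ℕ) = j by push_cast; ring, ENNReal.rpow_natCast,
            show (2 : ℝ) * 2 ^ (j + 1) = 2 ^ 2 * 2 ^ j by ring, ENNReal.ofReal_mul (by norm_num),
            ENNReal.ofReal_pow (by norm_num), ENNReal.ofReal_pow (by norm_num)]
          norm_num
        calc _ = (∫⁻ τ, S.indicator 1 τ * modPiece η₀ f j (stEquiv (ζ, τ))) ^ 2 := by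
              congr 1
              exact lintegral_congr e2
          _ ≤ (∫⁻ τ, S.indicator 1 τ ^ 2) * ∫⁻ τ, modPiece η₀ f j (stEquiv (ζ, τ)) ^ 2 :=
              sq_lintegral_mul_le (measurable_one.indicator mS).aemeasurable (ms j ζ).aemeasurable
          _ ≤ _ := by gcongr
    _ = _ := by rw [ENNReal.tsum_mul_left]; rfl

lemma phase_stEquiv (w w' : Plane × ℝ) :
    phase (stEquiv w) (stEquiv w') = phase w.1 w'.1 *
      Complex.exp (((-(w.2 * w'.2) : ℝ) : ℂ) * Complex.I) := by
  unfold phase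
  rw [← Complex.exp_add]
  congr 1
  simp [PiLp.inner_apply, Fin.sum_univ_three, Fin.sum_univ_two]
  ring

lemma stEquiv_neg (w : Plane × ℝ) : -stEquiv w = stEquiv (-w.1, -w.2) := by
  simp only [stEquiv_apply]
  ext i
  fin_cases i <;> simp

lemma eLpNorm_fint_le {d : ℕ} {g : Euc d → ℂ} (hg : Integrable g) (h2 : MemLp g 2 volume) :
    eLpNorm (fun z => fint g (-z)) 2 volume ^ 2
      = ENNReal.ofReal (cpi d) * eLpNorm g 2 volume ^ 2 := by
  have h := eLpNorm_fourierL2 h2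
  rw [eLpNorm_congr_ae (fourierL2_eq_fint h2 hg)] at h
  have h3 : eLpNorm (fun z => fint g (-z)) 2 volume = eLpNorm (fint g) 2 volume :=
    eLpNorm_comp_measurePreserving (continuous_fint hg).aestronglyMeasurable
      (Measure.measurePreserving_neg volume)
  rw [h3, h, mul_pow, sq_sqrt_ennreal]

lemma one_le_two_pi : 1 ≤ 2 * Real.pi := by linarith [Real.pi_gt_three]

lemma cpi_ratio : (cpi 3)⁻¹ ^ 2 * cpi 2 ≤ 1 := by
  unfold cpi
  have h := one_le_two_pi
  have h0 : 0 < 2 * Real.pi := by positivity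
  rw [inv_pow, inv_mul_le_iff₀ (by positivity), mul_one, ← pow_mul]
  exact pow_le_pow_right₀ h (by norm_num)

/-- At a fixed time the space-time inversion integral is the inverse transform, in the plane, of the
`τ`-integral of `f` against a unimodular phase. Plancherel in the plane then gives an L² bound
uniform in time. The powers of 2π combine to a constant at most 1. -/
lemma lintegral_slice_fint_le {f : SpaceTime → ℂ} (hf : Measurable f) (hi : Integrable f)
    (h2 : slc (fun p => ‖f p‖ₑ) ≠ ⊤) (t : ℝ) :
    ∫⁻ z : Plane, ‖(cpi 3 : ℂ)⁻¹ * fint f (-stEquiv (z, t))‖ₑ ^ 2 ≤ slc (fun p => ‖f p‖ₑ) := by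
  set e : ℝ → ℂ := fun τ => Complex.exp (((τ * t : ℝ) : ℂ) * Complex.I) with he
  have ne : ∀ τ, ‖e τ‖ = 1 := fun τ => Complex.norm_exp_ofReal_mul_I _
  have me : Measurable e := by fun_prop
  set F : Plane × ℝ → ℂ := fun w => e w.2 * f (stEquiv w) with hF
  have mF : Measurable F := (me.comp measurable_snd).mul (hf.comp stEquiv.measurable)
  have iF : Integrable F := by
    have h1 : Integrable fun w => f (stEquiv w) :=
      (measurePreserving_stEquiv.integrable_comp_emb stEquiv.measurableEmbedding).2 hi
    exact h1.bdd_mul (c := 1) (f := fun w : Plane × ℝ => e w.2)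
      (me.comp measurable_snd).aestronglyMeasurable (ae_of_all _ fun w => (ne _).le)
  set g : Plane → ℂ := fun ζ => ∫ τ, F (ζ, τ) with hg
  have ig : Integrable g := iF.integral_prod_left
  have gle : ∀ ζ, ‖g ζ‖ₑ ≤ ∫⁻ τ, ‖f (stEquiv (ζ, τ))‖ₑ := fun ζ => by
    refine (enorm_integral_le_lintegral_enorm _).trans (le_of_eq ?_)
    refine lintegral_congr fun τ => ?_
    simp only [hF]
    rw [enorm_mul, ← ofReal_norm (e τ), ne, ENNReal.ofReal_one, one_mul]
  have g2 : eLpNorm g 2 volume ^ 2 ≤ slc (fun p => ‖f p‖ₑ) := by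
    rw [eLpNorm_two_sq]
    exact lintegral_mono fun ζ => pow_le_pow_left' (gle ζ) 2
  have mg : MemLp g 2 volume := by
    refine ⟨ig.1, ?_⟩
    by_contra h0
    rw [not_lt, top_le_iff] at h0
    rw [h0] at g2
    simp only [ENNReal.top_pow two_ne_zero, top_le_iff] at g2
    exact h2 g2
  have key : ∀ z : Plane, fint f (-stEquiv (z, t)) = fint g (-z) := by
    intro z
    have i2 : Integrable (fun w : Plane × ℝ => phase w.1 (-z) * F w) :=
      iF.bdd_mul (c := 1) (f := fun w : Plane × ℝ => phase w.1 (-z))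
        (measurable_phase' measurable_fst measurable_const).aestronglyMeasurable
        (ae_of_all _ fun w => (norm_phase _ _).le)
    unfold fint
    rw [← measurePreserving_stEquiv.integral_comp stEquiv.measurableEmbedding, stEquiv_neg]
    calc _ = ∫ w : Plane × ℝ, phase w.1 (-z) * F w := by
          congr 1; ext w
          rw [phase_stEquiv]
          simp only [hF, he, mul_neg, neg_neg]
          ring
      _ = ∫ ζ : Plane, ∫ τ : ℝ, phase ζ (-z) * F (ζ, τ) := integral_prod _ i2
      _ = _ := by
          congr 1; ext ζ
          rw [integral_const_mul]
  simp_rw [key, enorm_mul, mul_pow]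
  rw [lintegral_const_mul' _ _ (ENNReal.pow_ne_top enorm_ne_top), ← eLpNorm_two_sq,
    eLpNorm_fint_le ig mg]
  have hc : ‖((cpi 3 : ℝ) : ℂ)⁻¹‖ₑ ^ 2 * ENNReal.ofReal (cpi 2) ≤ 1 := by
    rw [← ofReal_norm, norm_inv, Complex.norm_real, Real.norm_of_nonneg (cpi_pos 3).le,
      ← ENNReal.ofReal_pow (inv_nonneg.2 (cpi_pos 3).le),
      ← ENNReal.ofReal_mul (pow_nonneg (inv_nonneg.2 (cpi_pos 3).le) 2)]
    rw [← ENNReal.ofReal_one]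
    exact ENNReal.ofReal_le_ofReal cpi_ratio
  rw [← mul_assoc]
  calc _ ≤ 1 * eLpNorm g 2 volume ^ 2 := mul_le_mul_left hc _
    _ ≤ _ := by rw [one_mul]; exact g2

lemma slc_mono {f g : SpaceTime → ℝ≥0∞} (h : ∀ p, f p ≤ g p) : slc f ≤ slc g :=
  lintegral_mono fun _ => pow_le_pow_left' (lintegral_mono fun _ => h _) 2

/-- Short time intervals carry little mass. -/
lemma lintegral_time_le {v : SpaceTime → ℂ} (hv : MemLp v 2 volume) {I : Set ℝ}
    (hI : MeasurableSet I) (h2 : slc (fun p => ‖fourierL2 v p‖ₑ) ≠ ⊤) :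
    ∫⁻ p : SpaceTime, I.indicator 1 (p 2) * ‖v p‖ₑ ^ 2
      ≤ volume I * slc (fun p => ‖fourierL2 v p‖ₑ) := by
  obtain ⟨ns, -, hns⟩ := exists_subseq_ae (fun n => (memLp_freqTrunc n v).1) hv.1
    (tendsto_freqTrunc hv)
  set f := fourierL2 v with hf
  have mf : Measurable f := measurable_fourierL2 v
  have m2 : MemLp f 2 volume := memLp_fourierL2 v
  set E : ℕ → SpaceTime → ℂ := fun n p => (cpi 3 : ℂ)⁻¹ * fint (trunc n f) (-p) with hE
  have mE : ∀ n, Measurable (E n) := fun n =>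
    (((continuous_fint (integrable_trunc m2 n)).comp continuous_neg).measurable).const_mul _
  have mI : Measurable fun p : SpaceTime => I.indicator (1 : ℝ → ℝ≥0∞) (p 2) :=
    (measurable_one.indicator hI).comp (by fun_prop)
  have bound : ∀ n, ∫⁻ p : SpaceTime, I.indicator 1 (p 2) * ‖E n p‖ₑ ^ 2
      ≤ volume I * slc (fun p => ‖f p‖ₑ) := by
    intro n
    have mm : Measurable fun p : SpaceTime => I.indicator 1 (p 2) * ‖E n p‖ₑ ^ 2 :=
      mI.mul ((mE n).enorm.pow_const 2)
    rw [lintegral_st' mm, ← lintegral_indicator_one hI,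
      ← lintegral_mul_const _ (measurable_one.indicator hI)]
    refine lintegral_mono fun t => ?_
    have e : ∀ z : Plane, !₂[z 0, z 1, t] = stEquiv (z, t) := fun z => by simp
    simp_rw [e]
    change ∫⁻ z : Plane, I.indicator 1 t * ‖E n (stEquiv (z, t))‖ₑ ^ 2 ≤ _
    have mE' : Measurable fun z : Plane => ‖E n (stEquiv (z, t))‖ₑ ^ 2 :=
      ((mE n).comp (stEquiv.measurable.comp measurable_prodMk_right)).enorm.pow_const 2
    rw [lintegral_const_mul _ mE']
    have hsl := slc_mono (fun p => enorm_trunc_le n f p)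
    exact mul_le_mul_right ((lintegral_slice_fint_le (measurable_trunc mf n)
      (integrable_trunc m2 n) (hsl.trans_lt h2.lt_top).ne t).trans hsl) _
  -- The slice bound needs an integrable transform, so it is applied to truncations and transferred
  -- to `v` by Fatou's lemma along an almost everywhere convergent subsequence.
  calc _ ≤ ∫⁻ p : SpaceTime, liminf (fun n => I.indicator 1 (p 2) * ‖E (ns n) p‖ₑ ^ 2) atTop := by
        refine lintegral_mono_ae ?_
        filter_upwards [hns, ae_all_iff.2 fun n => freqTrunc_eq n v] with p hp hq
        have l1 : Tendsto (fun n => E (ns n) p) atTop (𝓝 (v p)) :=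
          hp.congr fun n => hq (ns n)
        have l2 := ENNReal.Tendsto.const_mul (a := I.indicator 1 (p 2))
          (ENNReal.Tendsto.pow (n := 2) ((continuous_enorm.tendsto _).comp l1))
          (Or.inr (by by_cases h : p 2 ∈ I <;> simp [h]))
        exact l2.liminf_eq.ge
    _ ≤ liminf (fun n => ∫⁻ p : SpaceTime, I.indicator 1 (p 2) * ‖E (ns n) p‖ₑ ^ 2) atTop :=
        lintegral_liminf_le fun n => mI.mul ((mE (ns n)).enorm.pow_const 2)
    _ ≤ liminf (fun _ : ℕ => volume I * slc (fun p => ‖f p‖ₑ)) atTop :=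
        liminf_le_liminf (Eventually.of_forall fun n => bound (ns n))
    _ = _ := liminf_const _

/-! ### The trilinear form in physical space -/

lemma lconv_ae_congr {f f' g g' : SpaceTime → ℂ} (hf : f =ᵐ[volume] f') (hg : g =ᵐ[volume] g')
    (p : SpaceTime) : (fun a => f a * g (p - a)) =ᵐ[volume] fun a => f' a * g' (p - a) := by
  have h2 := (Measure.measurePreserving_sub_left (volume : Measure SpaceTime) p).quasiMeasurePreserving.ae_eq_comp
    hg
  filter_upwards [hf, h2] with a h3 h4
  simp only [Function.comp] at h4
  rw [h3, h4]

/-- Parseval pairs the transform of `v₁ v₂`, which is a convolution, with that of `v₃`. The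
finiteness hypothesis is what places `v₁ v₂` in L². -/
lemma tri_formula {v₁ v₂ v₃ g₁ g₂ g₃ : SpaceTime → ℂ} (h₁ : MemLp v₁ 2 volume)
    (h₂ : MemLp v₂ 2 volume) (h₃ : MemLp v₃ 2 volume) (e₁ : fourierL2 v₁ =ᵐ[volume] g₁)
    (e₂ : fourierL2 v₂ =ᵐ[volume] g₂) (e₃ : fourierL2 v₃ =ᵐ[volume] g₃)
    (h : ∫⁻ p, (∫⁻ a, ‖g₁ a‖ₑ * ‖g₂ (p - a)‖ₑ) ^ 2 ≠ ⊤) :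
    Integrable (fun z => v₁ z * v₂ z * v₃ z) ∧
    ∫ z, v₁ z * v₂ z * v₃ z = ((cpi 3 : ℂ)⁻¹) ^ 2 * ∫ p, ∫ a, g₁ a * g₂ (p - a) * g₃ (-p) := by
  have hcong := lconv_ae_congr e₁ e₂
  have h' : ∫⁻ p, (∫⁻ a, ‖fourierL2 v₁ a‖ₑ * ‖fourierL2 v₂ (p - a)‖ₑ) ^ 2 ≠ ⊤ := by
    convert h using 3 with p
    congr 1
    refine lintegral_congr_ae ?_
    filter_upwards [hcong p] with a ha
    rw [← enorm_mul, ← enorm_mul, ha]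
  obtain ⟨m, F⟩ := product_fourierL2 h₁ h₂ h'
  refine ⟨integrable_mul_of_memLp m h₃, ?_⟩
  rw [integral_mul_eq m h₃, sq, mul_assoc]
  congr 1
  rw [← integral_const_mul]
  refine integral_congr_ae ?_
  have e₃' := (Measure.measurePreserving_neg (volume : Measure SpaceTime)).quasiMeasurePreserving.ae_eq_comp e₃
  filter_upwards [F, e₃'] with p hp hq
  simp only [Function.comp] at hq
  rw [hp, hq, mul_assoc]
  congr 1
  rw [integral_mul_const]
  congr 1
  exact integral_congr_ae (hcong p)

end

section

/-! ### The symmetrized symbol -/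

/-- A smooth even function which is `1` on the band `3/4 ≤ |r| < 3/2`. -/
def bump (η₀ : ℝ → ℝ) (r : ℝ) : ℝ := η₀ (5 / 6 * r) - η₀ (11 / 5 * r)

variable {η₀ : ℝ → ℝ}

lemma bump_contDiff (hη : IsCutoff η₀) : ContDiff ℝ ((⊤ : ℕ∞) : WithTop ℕ∞) (bump η₀) := by
  unfold bump
  exact (hη.smooth.comp (contDiff_const.mul contDiff_id)).sub
    (hη.smooth.comp (contDiff_const.mul contDiff_id))

lemma bump_even (hη : IsCutoff η₀) (r : ℝ) : bump η₀ (-r) = bump η₀ r := by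
  unfold bump
  rw [mul_neg, mul_neg, hη.even, hη.even]

lemma abs_bump_le (hη : IsCutoff η₀) (r : ℝ) : |bump η₀ r| ≤ 1 := by
  unfold bump
  have h1 := hη.mem_Icc (5 / 6 * r)
  have h2 := hη.mem_Icc (11 / 5 * r)
  rw [abs_le]
  constructor <;> linarith [h1.1, h1.2, h2.1, h2.2]

lemma bump_eq_one (hη : IsCutoff η₀) {r : ℝ} (h1 : 3 / 4 ≤ |r|) (h2 : |r| ≤ 3 / 2) :
    bump η₀ r = 1 := by
  unfold bump
  rw [hη.eq_one, hη.support, sub_zero] <;> rw [abs_mul, abs_of_pos (by norm_num)] <;> linarith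

lemma bump_support (hη : IsCutoff η₀) {r : ℝ} (h : bump η₀ r ≠ 0) : 14 / 25 ≤ |r| ∧ |r| ≤ 48 / 25 := by
  constructor
  · by_contra! hr
    apply h
    unfold bump
    rw [hη.eq_one, hη.eq_one, sub_self] <;> rw [abs_mul, abs_of_pos (by norm_num)] <;> linarith
  · by_contra! hr
    apply h
    unfold bump
    rw [hη.support, hη.support, sub_self] <;> rw [abs_mul, abs_of_pos (by norm_num)] <;> linarith

lemma hasCompactSupport_bump (hη : IsCutoff η₀) : HasCompactSupport (bump η₀) := by
  refine HasCompactSupport.of_support_subset_isCompact (isCompact_Icc (a := (-2 : ℝ)) (b := 2)) ?_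
  intro r hr
  have := (bump_support hη hr).2
  rw [abs_le] at this
  constructor <;> linarith [this.1, this.2]

/-- The real symbol of the smooth derivative at frequency `2 ^ k`. -/
def hsym (η₀ : ℝ → ℝ) (k : ℕ) (ξ : ℝ) : ℝ := ξ * bump η₀ (ξ / 2 ^ k) ^ 2

lemma hsym_neg (hη : IsCutoff η₀) (k : ℕ) (ξ : ℝ) : hsym η₀ k (-ξ) = -hsym η₀ k ξ := by
  unfold hsym
  rw [neg_div, bump_even hη]; ring

lemma hsym_zero (k : ℕ) : hsym η₀ k 0 = 0 := by simp [hsym]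

lemma hsym_support (hη : IsCutoff η₀) {k : ℕ} {ξ : ℝ} (h : hsym η₀ k ξ ≠ 0) :
    14 / 25 * 2 ^ k ≤ |ξ| ∧ |ξ| ≤ 48 / 25 * 2 ^ k := by
  have h1 : bump η₀ (ξ / 2 ^ k) ≠ 0 := fun h0 => h (by simp [hsym, h0])
  have h2 := bump_support hη h1
  have hp : (0 : ℝ) < 2 ^ k := by positivity
  rwa [abs_div, abs_of_pos hp, le_div_iff₀ hp, div_le_iff₀ hp] at h2

lemma abs_hsym_le (hη : IsCutoff η₀) (k : ℕ) (ξ : ℝ) : |hsym η₀ k ξ| ≤ 2 * 2 ^ k := by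
  by_cases h : hsym η₀ k ξ = 0
  · rw [h, abs_zero]; positivity
  · have h1 := (hsym_support hη h).2
    have h2 := abs_bump_le hη (ξ / 2 ^ k)
    have hp : (0 : ℝ) < 2 ^ k := by positivity
    unfold hsym
    rw [abs_mul, abs_pow]
    calc |ξ| * |bump η₀ (ξ / 2 ^ k)| ^ 2 ≤ |ξ| * 1 := by
          gcongr; exact pow_le_one₀ (abs_nonneg _) h2
      _ ≤ _ := by linarith

/-- `hsym η₀ k` is `2 ^ k` times a fixed smooth compactly supported function evaluated at `ξ / 2 ^
k`. This scaling preserves the Lipschitz constant, so one constant serves all `k`. -/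
lemma exists_lipschitz_hsym (hη : IsCutoff η₀) :
    ∃ L : ℝ, 0 < L ∧ ∀ k x y, |hsym η₀ k x - hsym η₀ k y| ≤ L * |x - y| := by
  have hs : HasCompactSupport fun r : ℝ => r * bump η₀ r ^ 2 := by
    refine ((hasCompactSupport_bump hη).comp_left (g := fun x : ℝ => x ^ 2) (by simp)).mul_left
  have hc : ContDiff ℝ 1 fun r : ℝ => r * bump η₀ r ^ 2 := by
    have := (bump_contDiff hη).of_le (n := ((⊤ : ℕ∞) : WithTop ℕ∞)) (m := 1) (by norm_cast)
    exact contDiff_id.mul (this.pow 2)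
  obtain ⟨L, hL⟩ := hc.lipschitzWith_of_hasCompactSupport hs (by norm_num)
  refine ⟨L + 1, by positivity, fun k x y => ?_⟩
  have hp : (0 : ℝ) < 2 ^ k := by positivity
  have h1 := hL.dist_le_mul (x / 2 ^ k) (y / 2 ^ k)
  rw [Real.dist_eq, Real.dist_eq, ← sub_div, abs_div, abs_of_pos hp] at h1
  have e : hsym η₀ k x - hsym η₀ k y = 2 ^ k *
      (x / 2 ^ k * bump η₀ (x / 2 ^ k) ^ 2 - y / 2 ^ k * bump η₀ (y / 2 ^ k) ^ 2) := by
    unfold hsym; field_simp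
  rw [e, abs_mul, abs_of_pos hp]
  calc _ ≤ 2 ^ k * (L * (|x - y| / 2 ^ k)) := by gcongr
    _ = L * |x - y| := by field_simp
    _ ≤ _ := by gcongr; linarith

/-- The symmetrized symbol. -/
def msym (η₀ : ℝ → ℝ) (k : ℕ) (a b c : ℝ) : ℝ := hsym η₀ k a + hsym η₀ k b + hsym η₀ k c

/-- Oddness gives `h(c) = -h(a + b)`, so the symbol is `h(a) + (h(b) - h(a + b))`, and each part is
at most `L |a|`. By symmetry the same holds with `b` or `c`, so the derivative is moved to the
smallest frequency. -/
lemma abs_msym_le {L : ℝ} (hη : IsCutoff η₀)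
    (hL : ∀ k x y, |hsym η₀ k x - hsym η₀ k y| ≤ L * |x - y|) {k : ℕ} {a b c : ℝ}
    (h : a + b + c = 0) : |msym η₀ k a b c| ≤ 2 * L * |a| := by
  have e : c = -(a + b) := by linarith
  have h1 := hL k a 0
  rw [hsym_zero, sub_zero, sub_zero] at h1
  have h2 := hL k b (a + b)
  rw [sub_add_cancel_right, abs_neg] at h2
  unfold msym
  rw [e, hsym_neg hη, add_assoc, ← sub_eq_add_neg]
  exact (abs_add_le _ _).trans (by linarith)

lemma msym_rot (k : ℕ) (a b c : ℝ) : msym η₀ k a b c = msym η₀ k b c a := by unfold msym; ring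
lemma mem_wideBand_le {k : ℕ} {ξ : ℝ} (h : ξ ∈ wideBand k) : |ξ| ≤ 2 * 2 ^ k := by
  unfold wideBand at h
  split_ifs at h with h0
  · subst h0; simpa using h
  · have := h.2
    rw [pow_succ] at this
    linarith

lemma le_of_mem_wideBand {k : ℕ} {ξ : ℝ} (h : ξ ∈ wideBand k) (h0 : k ≠ 0) : 2 ^ k / 2 ≤ |ξ| := by
  unfold wideBand at h
  rw [if_neg h0] at h
  have := h.1
  rwa [zpow_sub_one₀ (by norm_num), zpow_natCast, ← div_eq_mul_inv] at this

lemma pow_lt_imp {m n : ℕ} (h : (2 : ℝ) ^ m < 2 ^ n) : m < n :=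
  (pow_lt_pow_iff_right₀ (by norm_num : (1 : ℝ) < 2)).1 h

/-- `k` is at most about `k₁`, and `k₁`, `k₂` are close. -/
def Adm (k k₁ k₂ : ℕ) : Prop := k ≤ k₁ + 1 ∧ k₁ ≤ k₂ + 3 ∧ k₂ ≤ k₁ + 3

/-- The bands determine a frequency up to a factor 2 on either side, which costs the additive
constants in `Adm`. Band 0 has no lower bound and is treated apart. -/
lemma adm_of_le {k k₁ k₂ : ℕ} {a b : ℝ} (ha : a ∈ wideBand k₁) (hb : b ∈ wideBand k₂)
    (h1 : |b| ≤ |a|) (h2 : |a| ≤ 2 * |b|) (h3 : 14 / 25 * 2 ^ k ≤ |a|) : Adm k k₁ k₂ := by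
  have a1 := mem_wideBand_le ha
  have b1 := mem_wideBand_le hb
  refine ⟨?_, ?_, ?_⟩
  · have : (2 : ℝ) ^ k < 2 ^ (k₁ + 2) := by
      rw [pow_add]
      have : (0 : ℝ) < 2 ^ k₁ := by positivity
      linarith
    have := pow_lt_imp this
    omega
  · rcases eq_or_ne k₁ 0 with h | h
    · omega
    have a2 := le_of_mem_wideBand ha h
    have : (2 : ℝ) ^ k₁ < 2 ^ (k₂ + 4) := by
      rw [pow_add]
      have : (0 : ℝ) < 2 ^ k₂ := by positivity
      linarith
    have := pow_lt_imp this
    omega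
  · rcases eq_or_ne k₂ 0 with h | h
    · omega
    have b2 := le_of_mem_wideBand hb h
    have : (2 : ℝ) ^ k₂ < 2 ^ (k₁ + 3) := by
      rw [pow_add]
      have : (0 : ℝ) < 2 ^ k₁ := by positivity
      linarith
    have := pow_lt_imp this
    omega

lemma exists_le_of_msym_ne (hη : IsCutoff η₀) {k : ℕ} {a b c : ℝ} (h : msym η₀ k a b c ≠ 0) :
    14 / 25 * 2 ^ k ≤ |a| ∨ 14 / 25 * 2 ^ k ≤ |b| ∨ 14 / 25 * 2 ^ k ≤ |c| := by
  by_contra! hc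
  apply h
  have z : ∀ x, |x| < 14 / 25 * 2 ^ k → hsym η₀ k x = 0 := fun x hx => by
    by_contra h0
    linarith [(hsym_support hη h0).1]
  unfold msym
  rw [z _ hc.1, z _ hc.2.1, z _ hc.2.2]; norm_num

/-- The symmetrized symbol vanishes unless two of the bands are close and not far below `k`. -/
lemma adm_of_msym_ne (hη : IsCutoff η₀) {k k₁ k₂ k₃ : ℕ} {a b c : ℝ} (ha : a ∈ wideBand k₁)
    (hb : b ∈ wideBand k₂) (hc : c ∈ wideBand k₃) (h0 : a + b + c = 0)
    (h : msym η₀ k a b c ≠ 0) : (Adm k k₁ k₂ ∨ Adm k k₂ k₁) ∨ (Adm k k₁ k₃ ∨ Adm k k₃ k₁) ∨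
      (Adm k k₂ k₃ ∨ Adm k k₃ k₂) := by
  have hm := exists_le_of_msym_ne hη h
  have t1 : |a| ≤ |b| + |c| := by
    rw [show a = -(b + c) by linarith, abs_neg]; exact abs_add_le _ _
  have t2 : |b| ≤ |a| + |c| := by
    rw [show b = -(a + c) by linarith, abs_neg]; exact abs_add_le _ _
  have t3 : |c| ≤ |a| + |b| := by
    rw [show c = -(a + b) by linarith, abs_neg]; exact abs_add_le _ _
  rcases le_total |a| |b| with hab | hab <;> rcases le_total |a| |c| with hac | hac <;>
    rcases le_total |b| |c| with hbc | hbc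
  · exact Or.inr (Or.inr (Or.inr (adm_of_le hc hb hbc (by linarith) (by grind))))
  · exact Or.inr (Or.inr (Or.inl (adm_of_le hb hc hbc (by linarith) (by grind))))
  · exact Or.inr (Or.inr (Or.inr (adm_of_le hc hb hbc (by linarith) (by grind))))
  · exact Or.inl (Or.inr (adm_of_le hb ha hab (by linarith) (by grind)))
  · exact Or.inr (Or.inl (Or.inr (adm_of_le hc ha hac (by linarith) (by grind))))
  · exact Or.inr (Or.inl (Or.inr (adm_of_le hc ha hac (by linarith) (by grind))))
  · exact Or.inr (Or.inl (Or.inl (adm_of_le ha hc hac (by linarith) (by grind))))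
  · exact Or.inl (Or.inl (adm_of_le ha hb hab (by linarith) (by grind)))

lemma abs_msym_le_min {L : ℝ} (hη : IsCutoff η₀) (hL0 : 0 < L)
    (hL : ∀ k x y, |hsym η₀ k x - hsym η₀ k y| ≤ L * |x - y|) {k : ℕ} {a b c : ℝ}
    (h : a + b + c = 0) : |msym η₀ k a b c| ≤ 2 * L * min |a| (min |b| |c|) := by
  have h1 := abs_msym_le hη hL (k := k) h
  have h2 := abs_msym_le hη hL (k := k) (show b + c + a = 0 by linarith)
  have h3 := abs_msym_le hη hL (k := k) (show c + a + b = 0 by linarith)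
  rw [← msym_rot] at h2
  rw [msym_rot] at h3
  rcases min_choice |a| (min |b| |c|) with e | e
  · rw [e]; exact h1
  · rw [e]
    rcases min_choice |b| |c| with e' | e'
    · rw [e']; exact h2
    · rw [e']; exact h3

lemma min_band_le {k₁ k₂ k₃ : ℕ} {a b c : ℝ} (ha : a ∈ wideBand k₁)
    (hb : b ∈ wideBand k₂) (hc : c ∈ wideBand k₃) :
    min |a| (min |b| |c|) ≤ 2 * 2 ^ (min k₁ (min k₂ k₃)) := by
  rcases min_choice k₁ (min k₂ k₃) with e | e
  · rw [e]; exact (min_le_left _ _).trans (mem_wideBand_le ha)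
  · rw [e]
    rcases min_choice k₂ k₃ with e' | e'
    · rw [e']; exact ((min_le_right _ _).trans (min_le_left _ _)).trans (mem_wideBand_le hb)
    · rw [e']; exact ((min_le_right _ _).trans (min_le_right _ _)).trans (mem_wideBand_le hc)

lemma abs_msym_le_band {L : ℝ} (hη : IsCutoff η₀) (hL0 : 0 < L)
    (hL : ∀ k x y, |hsym η₀ k x - hsym η₀ k y| ≤ L * |x - y|) {k k₁ k₂ k₃ : ℕ} {a b c : ℝ}
    (h : a + b + c = 0) (ha : a ∈ wideBand k₁)
    (hb : b ∈ wideBand k₂) (hc : c ∈ wideBand k₃) :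
    |msym η₀ k a b c| ≤ 4 * L * 2 ^ (min k₁ (min k₂ k₃)) := by
  refine (abs_msym_le_min hη hL0 hL h).trans ?_
  have := min_band_le ha hb hc
  nlinarith

lemma max_band_le (hη : IsCutoff η₀) {k k₁ k₂ k₃ : ℕ} {a b c : ℝ} (ha : a ∈ wideBand k₁)
    (hb : b ∈ wideBand k₂) (hc : c ∈ wideBand k₃) (h : msym η₀ k a b c ≠ 0) :
    2 ^ (max k₁ (max k₂ k₃)) / 2 ≤ max |a| (max |b| |c|) := by
  -- When all three indices are 0 the bands give no lower bound. It comes instead from the symbol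
  -- being nonzero, which forces some frequency to be at least `14/25 · 2 ^ k ≥ 1/2`.
  rcases eq_or_ne (max k₁ (max k₂ k₃)) 0 with h0 | h0
  · rw [h0]
    have h1 : (1 : ℝ) ≤ 2 ^ k := one_le_pow₀ (by norm_num)
    have := exists_le_of_msym_ne hη h
    rw [le_max_iff, le_max_iff]
    rcases this with h | h | h
    · left; linarith
    · right; left; linarith
    · right; right; linarith
  · rcases max_choice k₁ (max k₂ k₃) with e | e
    · rw [e] at h0 ⊢
      exact (le_of_mem_wideBand ha h0).trans (le_max_left _ _)
    · rw [e] at h0 ⊢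
      rcases max_choice k₂ k₃ with e' | e'
      · rw [e'] at h0 ⊢
        exact ((le_of_mem_wideBand hb h0).trans (le_max_left _ _)).trans (le_max_right _ _)
      · rw [e'] at h0 ⊢
        exact ((le_of_mem_wideBand hc h0).trans (le_max_right _ _)).trans (le_max_right _ _)

/-- With zero sum the largest modulus is at most the sum of the other two, hence at most twice the
middle one. -/
lemma min_mul_sq_max_le {a b c : ℝ} (h : a + b + c = 0) :
    min |a| (min |b| |c|) * (max |a| (max |b| |c|)) ^ 2 ≤ 2 * |a * b * c| := by
  have t1 : |a| ≤ |b| + |c| := by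
    rw [show a = -(b + c) by linarith, abs_neg]; exact abs_add_le _ _
  have t2 : |b| ≤ |a| + |c| := by
    rw [show b = -(a + c) by linarith, abs_neg]; exact abs_add_le _ _
  have t3 : |c| ≤ |a| + |b| := by
    rw [show c = -(a + b) by linarith, abs_neg]; exact abs_add_le _ _
  rw [abs_mul, abs_mul]
  have pa := abs_nonneg a
  have pb := abs_nonneg b
  have pc := abs_nonneg c
  generalize |a| = x at *
  generalize |b| = y at *
  generalize |c| = z at *
  have key : ∀ x y z : ℝ, 0 ≤ x → 0 ≤ y → 0 ≤ z → x ≤ y → y ≤ z → z ≤ x + y →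
      x * z ^ 2 ≤ 2 * (x * y * z) := by
    intro x y z hx hy hz h1 h2 h3
    have : z ≤ 2 * y := by linarith
    have h4 : x * z * z ≤ x * z * (2 * y) := mul_le_mul_of_nonneg_left this (mul_nonneg hx hz)
    linarith
  rcases le_total x y with hab | hab <;> rcases le_total x z with hac | hac <;>
    rcases le_total y z with hbc | hbc
  · rw [min_eq_left hbc, min_eq_left hab, max_eq_right hbc, max_eq_right hac]
    exact key x y z pa pb pc hab hbc t3
  · rw [min_eq_right hbc, min_eq_left hac, max_eq_left hbc, max_eq_right hab]
    linarith [key x z y pa pc pb hac hbc (by linarith)]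
  · have : x = z := by linarith
    subst this
    have : y = x := by linarith
    subst this
    simp only [min_self, max_self]
    nlinarith [mul_nonneg (mul_nonneg pa pb) pc]
  · rw [min_eq_right hbc, min_eq_right hac, max_eq_left hbc, max_eq_right hab]
    linarith [key z x y pc pa pb hac hab (by linarith)]
  · rw [min_eq_left hbc, min_eq_right hab, max_eq_right hbc, max_eq_right hac]
    linarith [key y x z pb pa pc hab hac (by linarith)]
  · have : x = z := by linarith
    subst this
    have : y = x := by linarith
    subst this
    simp only [min_self, max_self]
    nlinarith [mul_nonneg (mul_nonneg pa pb) pc]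
  · rw [min_eq_left hbc, min_eq_right hab, max_eq_right hbc, max_eq_left hac]
    linarith [key y z x pb pc pa hbc hac (by linarith)]
  · rw [min_eq_right hbc, min_eq_right hac, max_eq_left hbc, max_eq_left hab]
    linarith [key z y x pc pb pa hbc hab (by linarith)]

/-- The symmetrized symbol is controlled by the square root of the resonance. -/
lemma abs_msym_le_sqrt {L : ℝ} (hη : IsCutoff η₀) (hL0 : 0 < L)
    (hL : ∀ k x y, |hsym η₀ k x - hsym η₀ k y| ≤ L * |x - y|) {k k₁ k₂ k₃ : ℕ} {a b c : ℝ}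
    (h : a + b + c = 0) (ha : a ∈ wideBand k₁)
    (hb : b ∈ wideBand k₂) (hc : c ∈ wideBand k₃) :
    |msym η₀ k a b c| ≤ 8 * L * (√(2 ^ (min k₁ (min k₂ k₃))) / 2 ^ (max k₁ (max k₂ k₃))) *
      √|a * b * c| := by
  by_cases h0 : msym η₀ k a b c = 0
  · rw [h0, abs_zero]; positivity
  have h1 := abs_msym_le_min hη hL0 hL (k := k) h
  have h2 := min_band_le ha hb hc
  have h3 := max_band_le hη ha hb hc h0
  have h4 := min_mul_sq_max_le h
  set x := min |a| (min |b| |c|) with hx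
  set z := max |a| (max |b| |c|) with hz
  set N : ℝ := 2 ^ (min k₁ (min k₂ k₃)) with hN
  set M : ℝ := 2 ^ (max k₁ (max k₂ k₃)) with hM
  have pN : 0 < N := by positivity
  have pM : 0 < M := by positivity
  have px : 0 ≤ x := le_min (abs_nonneg _) (le_min (abs_nonneg _) (abs_nonneg _))
  refine abs_le_of_sq_le_sq ?_ (by positivity)
  have e : (8 * L * (√N / M) * √|a * b * c|) ^ 2 = 64 * L ^ 2 * (N / M ^ 2) * |a * b * c| := by
    rw [mul_pow, mul_pow, mul_pow, div_pow, Real.sq_sqrt pN.le, Real.sq_sqrt (abs_nonneg _)]; ring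
  rw [e]
  have h5 : msym η₀ k a b c ^ 2 ≤ (2 * L * x) ^ 2 := by
    rw [← sq_abs]; exact pow_le_pow_left₀ (abs_nonneg _) h1 2
  have h6 : x * M ^ 2 ≤ 8 * |a * b * c| := by
    have : (M / 2) ^ 2 ≤ z ^ 2 := pow_le_pow_left₀ (by positivity) h3 2
    have := mul_le_mul_of_nonneg_left this px
    nlinarith
  calc msym η₀ k a b c ^ 2 ≤ (2 * L * x) ^ 2 := h5
    _ = 4 * L ^ 2 * (x * x) := by ring
    -- The two copies of the minimum are used differently: one is bounded by its band, the other by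
    -- the product of the frequencies over the square of the maximum.
    _ ≤ 4 * L ^ 2 * ((2 * N) * (8 * |a * b * c| / M ^ 2)) := by
        gcongr
        rw [le_div_iff₀ (by positivity)]; exact h6
    _ = _ := by ring

end

section

/-! ### Multipliers in the first frequency variable -/

/-- The kernel is the inverse transform, rescaled to the convention without 2π in the phase. It is
needed both on the line and on the plane. -/
lemma exists_schwartz_symbol {V : Type*} [NormedAddCommGroup V] [InnerProductSpace ℝ V]
    [FiniteDimensional ℝ V] [MeasurableSpace V] [BorelSpace V] (A : 𝓢(V, ℂ)) :
    ∃ k : 𝓢(V, ℂ), ∀ ζ,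
      ∫ z, Complex.exp (((-(inner ℝ z ζ) : ℝ) : ℂ) * Complex.I) * k z = A ζ := by
  have h0 : (2 * Real.pi)⁻¹ ≠ 0 := two_pi_inv_ne
  set n := Module.finrank ℝ V
  set g : V ≃L[ℝ] V := (LinearEquiv.smulOfNeZero ℝ V (2 * Real.pi)⁻¹ h0).toContinuousLinearEquiv
    with hg
  set B : 𝓢(V, ℂ) := 𝓕⁻ A with hB
  set c : ℂ := (((2 * Real.pi) ^ n : ℝ) : ℂ)⁻¹ with hc
  refine ⟨c • SchwartzMap.compCLMOfContinuousLinearEquiv ℂ g B, fun ζ => ?_⟩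
  have e1 : (𝓕 B : 𝓢(V, ℂ)) ζ = A ζ := by rw [hB, FourierTransform.fourier_fourierInv_eq]
  rw [← e1, SchwartzMap.fourier_coe, Real.fourier_eq']
  have e2 := Measure.integral_comp_smul volume
    (fun v : V => Complex.exp (((-2 * Real.pi * inner ℝ v ζ : ℝ) : ℂ) * Complex.I) • B v)
    (2 * Real.pi)⁻¹
  rw [inv_pow, inv_inv, abs_of_pos (by positivity)] at e2
  have hcn : (((2 * Real.pi) ^ n : ℝ) : ℂ) ≠ 0 := by
    exact_mod_cast (pow_ne_zero _ two_pi_ne)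
  rw [Complex.real_smul] at e2
  rw [eq_comm, ← mul_right_inj' hcn, ← e2, ← integral_const_mul]
  refine integral_congr_ae (ae_of_all _ fun z => ?_)
  have e3 : (SchwartzMap.compCLMOfContinuousLinearEquiv ℂ g B) z = B ((2 * Real.pi)⁻¹ • z) := rfl
  simp only [smul_apply, e3, smul_eq_mul]
  have e4 : (-2 * Real.pi * inner ℝ ((2 * Real.pi)⁻¹ • z) ζ : ℝ) = -(inner ℝ z ζ) := by
    rw [inner_smul_left]
    have := two_pi_ne
    simp
    field_simp
  rw [e4, hc]
  field_simp

/-- The symbol of the convolution with `K` in the first variable. -/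
def ksym (K : ℝ → ℂ) (ξ : ℝ) : ℂ := ∫ r, K r * Complex.exp (((-(r * ξ) : ℝ) : ℂ) * Complex.I)

lemma exists_kernel {A : ℝ → ℂ} (hA : ContDiff ℝ ((⊤ : ℕ∞) : WithTop ℕ∞) A)
    (hc : HasCompactSupport A) :
    ∃ K : ℝ → ℂ, Measurable K ∧ Integrable K ∧ ∀ ξ, ksym K ξ = A ξ := by
  obtain ⟨k, hk⟩ := exists_schwartz_symbol (hc.toSchwartzMap hA)
  refine ⟨k, k.continuous.measurable, k.integrable, fun ξ => ?_⟩
  have h : _ = A ξ := hk ξ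
  rw [← h]
  unfold ksym
  congr 1; ext r
  rw [mul_comm]
  congr 4
  simp [mul_comm]

/-- Shift in the first variable of space-time. -/
def xsh3 (r : ℝ) : SpaceTime := !₂[r, 0, 0]

lemma measurable_xsh3 : Measurable xsh3 := by unfold xsh3; fun_prop
/-- Convolution with `K` in the first variable of space-time. -/
def dop3 (K : ℝ → ℂ) (V : SpaceTime → ℂ) : SpaceTime → ℂ := cv volume K xsh3 V

lemma cvSymbol_xsh3 (K : ℝ → ℂ) (ζ : SpaceTime) : cvSymbol volume K xsh3 ζ = ksym K (ζ 0) := by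
  unfold cvSymbol ksym phase
  congr 1; ext r
  congr 4
  simp [xsh3, PiLp.inner_apply, Fin.sum_univ_three, mul_comm]

variable {K : ℝ → ℂ}

lemma memLp_dop3 (hK : Measurable K) (hKi : Integrable K) {V : SpaceTime → ℂ} (hV : Measurable V)
    (hV2 : MemLp V 2 volume) : MemLp (dop3 K V) 2 volume :=
  memLp_cv hK hKi measurable_xsh3 hV hV2

lemma fourierL2_dop3 (hK : Measurable K) (hKi : Integrable K) {V : SpaceTime → ℂ}
    (hV : Measurable V) (hV2 : MemLp V 2 volume) :
    fourierL2 (dop3 K V) =ᵐ[volume] fun ζ => ksym K (ζ 0) * fourierL2 V ζ := by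
  have := fourierL2_cv (ν := volume) hK hKi measurable_xsh3 hV hV2
  simp_rw [cvSymbol_xsh3] at this
  exact this

/-- Multiplication by functions of time commutes with convolution in `x`. -/
lemma dop3_mul_time (b : ℝ → ℂ) (V : SpaceTime → ℂ) :
    dop3 K (fun p => b (p 2) * V p) = fun p => b (p 2) * dop3 K V p := by
  ext p
  unfold dop3 cv
  rw [← integral_const_mul]
  congr 1; ext r
  have : (p - xsh3 r) 2 = p 2 := by simp [xsh3]
  beta_reduce
  rw [this]; ring

lemma measurable_ksym (hK : Measurable K) : StronglyMeasurable (ksym K) := by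
  have m : Measurable fun w : ℝ × ℝ => K w.2 *
      Complex.exp (((-(w.2 * w.1) : ℝ) : ℂ) * Complex.I) :=
    (hK.comp measurable_snd).mul (by fun_prop)
  exact m.stronglyMeasurable.integral_prod_right

lemma norm_ksym_le (ξ : ℝ) : ‖ksym K ξ‖ ≤ ∫ r, ‖K r‖ := by
  refine (norm_integral_le_integral_norm _).trans (le_of_eq ?_)
  congr 1; ext r
  rw [norm_mul, Complex.norm_exp_ofReal_mul_I, mul_one]

lemma isClosed_wideBand (k : ℕ) : IsClosed (wideBand k) := by
  unfold wideBand
  split_ifs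
  · exact isClosed_le (by fun_prop) (by fun_prop)
  · exact (isClosed_le continuous_const continuous_abs).inter
      (isClosed_le continuous_abs continuous_const)

/-- Multiplication by functions of time preserves the support in `ξ`. -/
lemma support_mul_time {W : Set ℝ} (hW : IsClosed W) {V : SpaceTime → ℂ} (hV : Measurable V)
    (hV2 : MemLp V 2 volume) (hs : ∀ᵐ p : SpaceTime, p 0 ∉ W → fourierL2 V p = 0) {b : ℝ → ℂ}
    (hb : Measurable b) (hbV : MemLp (fun p => b (p 2) * V p) 2 volume) :
    ∀ᵐ p : SpaceTime, p 0 ∉ W → fourierL2 (fun p => b (p 2) * V p) p = 0 := by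
  -- Take a smooth symbol `θ` nonzero exactly on the bounded open set in question. Its convolution
  -- operator in `x` annihilates `V` and commutes with multiplication by functions of time, so it
  -- annihilates the product. The transform of the product must then vanish where `θ` does not.
  have key : ∀ n : ℕ, ∀ᵐ p : SpaceTime, p 0 ∈ Wᶜ ∩ Metric.ball 0 (n : ℝ) →
      fourierL2 (fun p => b (p 2) * V p) p = 0 := by
    intro n
    obtain ⟨θ, hθs, hθ, -⟩ := (hW.isOpen_compl.inter
      (Metric.isOpen_ball (x := (0 : ℝ)) (ε := n))).exists_contDiff_support_eq
      (n := ⊤)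
    have hc : HasCompactSupport θ := by
      refine HasCompactSupport.of_support_subset_isCompact (isCompact_closedBall (0 : ℝ) n) ?_
      rw [hθs]
      exact inter_subset_right.trans Metric.ball_subset_closedBall
    have hc' : HasCompactSupport fun z => (θ z : ℂ) := hc.comp_left (g := Complex.ofReal) rfl
    have hsm : ContDiff ℝ ((⊤ : ℕ∞) : WithTop ℕ∞) fun z => (θ z : ℂ) :=
      Complex.ofRealCLM.contDiff.comp hθ
    obtain ⟨K, hK, hKi, hKs⟩ := exists_kernel hsm hc'
    have hmb : Measurable fun p : SpaceTime => b (p 2) * V p := (hb.comp (by fun_prop)).mul hV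
    have h0 : dop3 K V =ᵐ[volume] fun _ => 0 := by
      refine ae_eq_of_fourierL2 (memLp_dop3 hK hKi hV hV2) MemLp.zero ?_
      filter_upwards [fourierL2_dop3 hK hKi hV hV2, hs, fourierL2_zero (d := 3)] with p h1 h2 h3
      rw [h1, h3, hKs]
      by_cases hp : p 0 ∈ W
      · have : p 0 ∉ Function.support θ := by rw [hθs]; exact fun h => h.1 hp
        rw [Function.notMem_support.1 this]; simp
      · rw [h2 hp, mul_zero]
    have h4 : dop3 K (fun p => b (p 2) * V p) =ᵐ[volume] fun _ => 0 := by
      rw [dop3_mul_time]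
      filter_upwards [h0] with p hp
      rw [hp, mul_zero]
    have h5 := fourierL2_dop3 hK hKi hmb hbV
    rw [fourierL2_congr h4] at h5
    filter_upwards [h5, fourierL2_zero (d := 3)] with p h6 h7 hp
    rw [h7, hKs] at h6
    have : θ (p 0) ≠ 0 := by
      rw [← Function.mem_support, hθs]; exact hp
    have h8 := (mul_eq_zero.1 h6.symm).resolve_left (by exact_mod_cast this)
    exact h8
  filter_upwards [ae_all_iff.2 key] with p hp hpW
  obtain ⟨n, hn⟩ := exists_nat_gt |p 0|
  exact hp n ⟨hpW, by simpa using hn⟩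

/-! ### The trilinear form with the symmetrized symbol -/

lemma tri_eq_conv {W : SpaceTime → SpaceTime → SpaceTime → ℝ≥0∞} (hW : Meas3 W) :
    ∫⁻ p, ∫⁻ a, W a (p - a) (-p) = tri W := by
  rw [lintegral_lintegral_swap]
  · unfold tri
    refine lintegral_congr fun a => ?_
    refine Eq.trans ?_ (lintegral_sub_right_eq_self (fun b => W a b (-(a + b))) a)
    refine lintegral_congr fun b => ?_
    rw [add_sub_cancel]
  · exact (hW.comp (by fun_prop) (by fun_prop) (by fun_prop)).aemeasurable

lemma tri_mono_ae' {W W' : SpaceTime → SpaceTime → SpaceTime → ℝ≥0∞} {Pa Pb Pc : SpaceTime → Prop}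
    (ha : ∀ᵐ a, Pa a) (hb : ∀ᵐ b, Pb b) (hc : ∀ᵐ c, Pc c)
    (h : ∀ a b c, Pa a → Pb b → Pc c → a + b + c = 0 → W a b c ≤ W' a b c) :
    tri W ≤ tri W' := by
  refine lintegral_mono_ae ?_
  filter_upwards [ha] with a ha
  refine lintegral_mono_ae ?_
  have h2 : ∀ᵐ b : SpaceTime, Pc (-a - b) :=
    ((Measure.measurePreserving_sub_left volume (-a)).quasiMeasurePreserving.ae hc)
  filter_upwards [hb, h2] with b hb hc
  refine h a b _ ha hb ?_ (by abel)
  rwa [show -(a + b) = -a - b by abel]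

lemma nrm_enorm (f : SpaceTime → ℂ) : nrm (fun p => ‖f p‖ₑ) = eLpNorm f 2 volume := by
  rw [eLpNorm_two_eq]; rfl

lemma xnrm_const_mul_le {η₀ : ℝ → ℝ} {f g : SpaceTime → ℝ≥0∞} {c : ℝ≥0∞} (hc : c ≠ ⊤)
    (h : ∀ a, f a ≤ c * g a) : xnrm η₀ f ≤ c * xnrm η₀ g := by
  unfold xnrm
  rw [← ENNReal.tsum_mul_left]
  refine ENNReal.tsum_le_tsum fun j => ?_
  rw [mul_left_comm]
  gcongr
  refine le_of_sq_le_sq' ?_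
  rw [mul_pow, sq_nrm, sq_nrm, ← lintegral_const_mul' _ _ (ENNReal.pow_ne_top hc)]
  refine lintegral_mono fun a => ?_
  rw [← mul_pow]
  refine pow_le_pow_left' ?_ 2
  unfold modPiece
  rw [mul_left_comm]
  gcongr
  exact h a

lemma lconv_ne_top {η₀ : ℝ → ℝ} (hη : IsCutoff η₀) {f g : SpaceTime → ℂ}
    (hf : Measurable f) (hg : Measurable g) (xf : xnrm η₀ (fun a => ‖f a‖ₑ) ≠ ⊤)
    (xg : xnrm η₀ (fun a => ‖g a‖ₑ) ≠ ⊤) :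
    ∫⁻ p, (∫⁻ a, ‖f a‖ₑ * ‖g (p - a)‖ₑ) ^ 2 ≠ ⊤ := by
  have h := nrm_lconv_le hη hf.enorm hg.enorm
  rw [← sq_nrm]
  refine ENNReal.pow_ne_top (h.trans_lt ?_).ne
  exact ENNReal.mul_lt_top (by norm_num) (ENNReal.mul_lt_top xf.lt_top xg.lt_top)

-- On the frequency side the three terms have the same integrand, with `ksym` evaluated at `-p`, `p
-- - a` and `a` respectively. They are added before absolute values are taken, so the cancellation
-- in the symmetrized symbol is kept. Finiteness of the two X-norms makes all the integrals
-- absolutely convergent.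
set_option maxHeartbeats 1000000 in
lemma trilinear_bound {η₀ : ℝ → ℝ} (hη : IsCutoff η₀) (hK : Measurable K) (hKi : Integrable K)
    {v₁ v₂ v₃ : SpaceTime → ℂ} (m₁ : Measurable v₁) (m₂ : Measurable v₂) (m₃ : Measurable v₃)
    (h₁ : MemLp v₁ 2 volume) (h₂ : MemLp v₂ 2 volume) (h₃ : MemLp v₃ 2 volume)
    (x₁ : xnrm η₀ (fun a => ‖fourierL2 v₁ a‖ₑ) ≠ ⊤)
    (x₂ : xnrm η₀ (fun a => ‖fourierL2 v₂ a‖ₑ) ≠ ⊤) :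
    ‖∫ z, (v₁ z * v₂ z * dop3 K v₃ z + v₁ z * dop3 K v₂ z * v₃ z + dop3 K v₁ z * v₂ z * v₃ z)‖ₑ
      ≤ tri fun a b c => ‖fourierL2 v₁ a‖ₑ * ‖fourierL2 v₂ b‖ₑ * ‖fourierL2 v₃ c‖ₑ *
        ‖ksym K (a 0) + ksym K (b 0) + ksym K (c 0)‖ₑ := by
  set f₁ := fourierL2 v₁
  set f₂ := fourierL2 v₂
  set f₃ := fourierL2 v₃
  have n₁ : Measurable f₁ := measurable_fourierL2 v₁
  have n₂ : Measurable f₂ := measurable_fourierL2 v₂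
  have n₃ : Measurable f₃ := measurable_fourierL2 v₃
  have mσ : Measurable fun ζ : SpaceTime => ksym K (ζ 0) :=
    (measurable_ksym hK).measurable.comp (by fun_prop)
  have mσ' : ∀ g : SpaceTime × SpaceTime → SpaceTime, Measurable g →
      Measurable fun w => ksym K (g w 0) := fun g hg => mσ.comp hg
  set C : ℝ := ∫ r, ‖K r‖
  have hC : ∀ ξ, ‖ksym K ξ‖ ≤ C := norm_ksym_le
  have xle : ∀ f : SpaceTime → ℂ, xnrm η₀ (fun a => ‖f a‖ₑ) ≠ ⊤ →
      xnrm η₀ (fun a => ‖ksym K (a 0) * f a‖ₑ) ≠ ⊤ := fun f hf => by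
    refine ((xnrm_const_mul_le (c := ENNReal.ofReal C) ENNReal.ofReal_ne_top fun a => ?_).trans_lt
      (ENNReal.mul_lt_top ENNReal.ofReal_lt_top hf.lt_top)).ne
    rw [enorm_mul]
    gcongr
    rw [← ofReal_norm]
    exact ENNReal.ofReal_le_ofReal (hC _)
  have c₁₂ := lconv_ne_top hη n₁ n₂ x₁ x₂
  obtain ⟨i₁, t₁⟩ := tri_formula h₁ h₂ (memLp_dop3 hK hKi m₃ h₃) (ae_eq_refl f₁) (ae_eq_refl f₂)
    (fourierL2_dop3 hK hKi m₃ h₃) c₁₂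
  obtain ⟨i₂, t₂⟩ := tri_formula h₁ (memLp_dop3 hK hKi m₂ h₂) h₃ (ae_eq_refl f₁)
    (fourierL2_dop3 hK hKi m₂ h₂) (ae_eq_refl f₃) (lconv_ne_top hη n₁ (mσ.mul n₂) x₁ (xle _ x₂))
  obtain ⟨i₃, t₃⟩ := tri_formula (memLp_dop3 hK hKi m₁ h₁) h₂ h₃ (fourierL2_dop3 hK hKi m₁ h₁)
    (ae_eq_refl f₂) (ae_eq_refl f₃) (lconv_ne_top hη (mσ.mul n₁) n₂ (xle _ x₁) x₂)
  have i12 : Integrable fun z => v₁ z * v₂ z * dop3 K v₃ z + v₁ z * dop3 K v₂ z * v₃ z := i₁.add i₂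
  rw [integral_add i12 i₃, integral_add i₁ i₂, t₁, t₂, t₃, ← mul_add, ← mul_add]
  set F : SpaceTime × SpaceTime → ℂ := fun w => f₁ w.2 * f₂ (w.1 - w.2) * f₃ (-w.1) with hF
  have mF : Measurable F := ((n₁.comp measurable_snd).mul
    (n₂.comp (measurable_fst.sub measurable_snd))).mul (n₃.comp measurable_fst.neg)
  have iF : Integrable F (volume.prod volume) := by
    refine ⟨mF.aestronglyMeasurable, ?_⟩
    unfold HasFiniteIntegral
    rw [lintegral_prod _ mF.enorm.aemeasurable]
    calc _ = ∫⁻ p, (∫⁻ a, ‖f₁ a‖ₑ * ‖f₂ (p - a)‖ₑ) * ‖f₃ (-p)‖ₑ := by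
          refine lintegral_congr fun p => ?_
          rw [← lintegral_mul_const]
          · simp only [hF, enorm_mul]
          · exact n₁.enorm.mul (n₂.enorm.comp (measurable_const.sub measurable_id))
      _ ≤ _ := lintegral_mul_le_sqrt (measurable_lconv n₁.enorm n₂.enorm).aemeasurable
          (n₃.comp measurable_neg).enorm.aemeasurable
      _ < ⊤ := by
          refine ENNReal.mul_lt_top (ENNReal.rpow_lt_top_of_nonneg (by norm_num) c₁₂) ?_
          rw [lintegral_neg_eq_self (fun p => ‖f₃ p‖ₑ ^ 2), ← eLpNorm_two_eq]
          exact (memLp_fourierL2 v₃).2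
  have iσ : ∀ g : SpaceTime × SpaceTime → SpaceTime, Measurable g →
      Integrable (fun w => ksym K (g w 0) * F w) (volume.prod volume) := fun g hg =>
    iF.bdd_mul (c := C) (f := fun w => ksym K (g w 0)) (mσ' g hg).aestronglyMeasurable
      (ae_of_all _ fun w => hC _)
  have j₁ := iσ (fun w : SpaceTime × SpaceTime => -w.1) measurable_fst.neg
  have j₂ := iσ (fun w : SpaceTime × SpaceTime => w.1 - w.2) (measurable_fst.sub measurable_snd)
  have j₃ := iσ (fun w : SpaceTime × SpaceTime => w.2) measurable_snd
  have j12 : Integrable (fun w : SpaceTime × SpaceTime => ksym K ((-w.1) 0) * F w +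
      ksym K ((w.1 - w.2) 0) * F w) (volume.prod volume) := j₁.add j₂
  have q₁ : ∫ p, ∫ a, f₁ a * f₂ (p - a) * (ksym K ((-p) 0) * f₃ (-p))
      = ∫ w : SpaceTime × SpaceTime, ksym K ((-w.1) 0) * F w ∂(volume.prod volume) := by
    rw [integral_prod _ j₁]
    congr 1; ext p; congr 1; ext a; simp only [hF]; ring
  have q₂ : ∫ p, ∫ a, f₁ a * (ksym K ((p - a) 0) * f₂ (p - a)) * f₃ (-p)
      = ∫ w : SpaceTime × SpaceTime, ksym K ((w.1 - w.2) 0) * F w ∂(volume.prod volume) := by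
    rw [integral_prod _ j₂]
    congr 1; ext p; congr 1; ext a; simp only [hF]; ring
  have q₃ : ∫ p, ∫ a, (ksym K (a 0) * f₁ a) * f₂ (p - a) * f₃ (-p)
      = ∫ w : SpaceTime × SpaceTime, ksym K (w.2 0) * F w ∂(volume.prod volume) := by
    rw [integral_prod _ j₃]
    congr 1; ext p; congr 1; ext a; simp only [hF]; ring
  rw [q₁, q₂, q₃, ← integral_add j₁ j₂, ← integral_add j12 j₃, enorm_mul]
  have hc1 : ‖((cpi 3 : ℂ)⁻¹) ^ 2‖ₑ ≤ 1 := by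
    rw [← ofReal_norm, ← ENNReal.ofReal_one]
    refine ENNReal.ofReal_le_ofReal ?_
    rw [norm_pow, norm_inv, Complex.norm_real, Real.norm_of_nonneg (cpi_pos 3).le]
    refine pow_le_one₀ (inv_nonneg.2 (cpi_pos 3).le) (inv_le_one_of_one_le₀ ?_)
    exact one_le_pow₀ one_le_two_pi
  refine (mul_le_mul' hc1 (enorm_integral_le_lintegral_enorm _)).trans ?_
  have mW : Measurable fun w : SpaceTime × SpaceTime => ‖ksym K ((-w.1) 0) * F w +
      ksym K ((w.1 - w.2) 0) * F w + ksym K (w.2 0) * F w‖ₑ :=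
    (((((mσ' _ measurable_fst.neg).mul mF).add
      ((mσ' _ (measurable_fst.sub measurable_snd)).mul mF))).add
      ((mσ' _ measurable_snd).mul mF)).enorm
  rw [one_mul, lintegral_prod _ mW.aemeasurable]
  have mT : Meas3 fun a b c => ‖f₁ a‖ₑ * ‖f₂ b‖ₑ * ‖f₃ c‖ₑ *
        ‖ksym K (a 0) + ksym K (b 0) + ksym K (c 0)‖ₑ := by
    refine (meas3_prod n₁.enorm n₂.enorm n₃.enorm).mul (Measurable.enorm ?_)
    exact ((mσ.comp measurable_fst).add (mσ.comp (measurable_fst.comp measurable_snd))).add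
      (mσ.comp (measurable_snd.comp measurable_snd))
  rw [← tri_eq_conv mT]
  refine lintegral_mono fun p => lintegral_mono fun a => le_of_eq ?_
  rw [← add_mul, ← add_mul, enorm_mul]
  simp only [hF, enorm_mul]
  rw [mul_comm]
  congr 2
  ring

end

section

/-! ### Time-localized trilinear estimates -/

lemma enorm_ksym_sum {η₀ : ℝ → ℝ} {K : ℝ → ℂ} {k : ℕ} (hKs : ∀ ξ, ksym K ξ = (hsym η₀ k ξ : ℂ))
    (a b c : ℝ) : ‖ksym K a + ksym K b + ksym K c‖ₑ = ENNReal.ofReal |msym η₀ k a b c| := by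
  rw [hKs, hKs, hKs, ← ofReal_norm, ← Complex.ofReal_add, ← Complex.ofReal_add,
    Complex.norm_real]
  rfl

lemma exists_kernel_hsym {η₀ : ℝ → ℝ} (hη : IsCutoff η₀) (k : ℕ) :
    ∃ K : ℝ → ℂ, Measurable K ∧ Integrable K ∧ ∀ ξ, ksym K ξ = (hsym η₀ k ξ : ℂ) := by
  have h1 : ContDiff ℝ ((⊤ : ℕ∞) : WithTop ℕ∞) (hsym η₀ k) := by
    unfold hsym
    exact contDiff_id.mul (((bump_contDiff hη).comp (contDiff_id.div_const _)).pow 2)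
  have h2 : HasCompactSupport (hsym η₀ k) := by
    refine HasCompactSupport.of_support_subset_isCompact
      (isCompact_closedBall (0 : ℝ) (48 / 25 * 2 ^ k)) fun ξ hξ => ?_
    simpa using (hsym_support hη hξ).2
  exact exists_kernel (A := fun ξ => (hsym η₀ k ξ : ℂ)) (Complex.ofRealCLM.contDiff.comp h1)
    (h2.comp_left (g := Complex.ofReal) rfl)

/-- `min (k₁, k₂, k₃)`. -/
abbrev lo (k₁ k₂ k₃ : ℕ) : ℕ := min k₁ (min k₂ k₃)

/-- `max (k₁, k₂, k₃)`. -/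
abbrev hi (k₁ k₂ k₃ : ℕ) : ℕ := max k₁ (max k₂ k₃)

/-- The frequency interactions contributing to the energy at frequency `2^k`. -/
def Adm3 (k k₁ k₂ k₃ : ℕ) : Prop := (Adm k k₁ k₂ ∨ Adm k k₂ k₁) ∨ (Adm k k₁ k₃ ∨ Adm k k₃ k₁) ∨
  (Adm k k₂ k₃ ∨ Adm k k₃ k₂)

section sym

variable {η₀ : ℝ → ℝ} (hη : IsCutoff η₀) {K : ℝ → ℂ} {k k₁ k₂ k₃ : ℕ}
  (hKs : ∀ ξ, ksym K ξ = (hsym η₀ k ξ : ℂ))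
  {f₁ f₂ f₃ : SpaceTime → ℂ} (n₁ : Measurable f₁) (n₂ : Measurable f₂) (n₃ : Measurable f₃)
  (s₁ : ∀ᵐ p : SpaceTime, p 0 ∉ wideBand k₁ → f₁ p = 0)
  (s₂ : ∀ᵐ p : SpaceTime, p 0 ∉ wideBand k₂ → f₂ p = 0)
  (s₃ : ∀ᵐ p : SpaceTime, p 0 ∉ wideBand k₃ → f₃ p = 0)

include s₁ s₂ s₃ in
lemma tri_le_of_band {N N' : SpaceTime → SpaceTime → SpaceTime → ℝ≥0∞}
    (h : ∀ a b c : SpaceTime, a 0 ∈ wideBand k₁ → b 0 ∈ wideBand k₂ → c 0 ∈ wideBand k₃ →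
      a 0 + b 0 + c 0 = 0 → N a b c ≤ N' a b c) :
    (tri fun a b c => ‖f₁ a‖ₑ * ‖f₂ b‖ₑ * ‖f₃ c‖ₑ * N a b c) ≤
      tri fun a b c => ‖f₁ a‖ₑ * ‖f₂ b‖ₑ * ‖f₃ c‖ₑ * N' a b c := by
  refine tri_mono_ae' s₁ s₂ s₃ fun a b c ha hb hc h0 => ?_
  by_cases h1 : a 0 ∈ wideBand k₁
  swap; · simp [ha h1]
  by_cases h2 : b 0 ∈ wideBand k₂
  swap; · simp [hb h2]
  by_cases h3 : c 0 ∈ wideBand k₃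
  swap; · simp [hc h3]
  gcongr
  exact h a b c h1 h2 h3 (by simpa using congrArg (fun x : SpaceTime => x 0) h0)

-- For smooth time windows: the symbol is traded for the root of the product of frequencies, and all
-- three functions enter through their X-norms.
include hη hKs n₁ n₂ n₃ s₁ s₂ s₃ in
lemma tri_ksym_le_weight {L : ℝ} (hL0 : 0 < L)
    (hL : ∀ k x y, |hsym η₀ k x - hsym η₀ k y| ≤ L * |x - y|) :
    (tri fun a b c => ‖f₁ a‖ₑ * ‖f₂ b‖ₑ * ‖f₃ c‖ₑ * ‖ksym K (a 0) + ksym K (b 0) + ksym K (c 0)‖ₑ)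
      ≤ ENNReal.ofReal (8 * L * (√(2 ^ lo k₁ k₂ k₃) / 2 ^ hi k₁ k₂ k₃)) *
        (2400 * (xnrm η₀ (fun a => ‖f₁ a‖ₑ) * xnrm η₀ (fun a => ‖f₂ a‖ₑ) *
          xnrm η₀ (fun a => ‖f₃ a‖ₑ))) := by
  refine le_trans ?_ (mul_le_mul_right (tri_weight_le_xnrm hη n₁.enorm n₂.enorm n₃.enorm) _)
  rw [← tri_const_mul _ ENNReal.ofReal_ne_top]
  refine (tri_le_of_band s₁ s₂ s₃ (N' := fun a b c =>
    ENNReal.ofReal (8 * L * (√(2 ^ lo k₁ k₂ k₃) / 2 ^ hi k₁ k₂ k₃)) *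
      ENNReal.ofReal √|a 0 * b 0 * c 0|) fun a b c ha hb hc h0 => ?_).trans
    (tri_mono fun a b c _ => le_of_eq (by ring))
  rw [enorm_ksym_sum hKs, ← ENNReal.ofReal_mul (by positivity)]
  exact ENNReal.ofReal_le_ofReal (abs_msym_le_sqrt hη hL0 hL h0 ha hb hc)

-- For windows with a sharp cut: the cruder bound on the symbol is used, and the third function
-- enters only through its L² norm.
include hη hKs n₁ n₂ n₃ s₁ s₂ s₃ in
lemma tri_ksym_le_band {L : ℝ} (hL0 : 0 < L)
    (hL : ∀ k x y, |hsym η₀ k x - hsym η₀ k y| ≤ L * |x - y|) :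
    (tri fun a b c => ‖f₁ a‖ₑ * ‖f₂ b‖ₑ * ‖f₃ c‖ₑ * ‖ksym K (a 0) + ksym K (b 0) + ksym K (c 0)‖ₑ)
      ≤ ENNReal.ofReal (4 * L * 2 ^ lo k₁ k₂ k₃) *
        (32 * (xnrm η₀ (fun a => ‖f₁ a‖ₑ) * xnrm η₀ (fun a => ‖f₂ a‖ₑ) *
          nrm (fun a => ‖f₃ a‖ₑ))) := by
  refine le_trans ?_ (mul_le_mul_right (tri_le_xnrm hη n₁.enorm n₂.enorm n₃.enorm) _)
  rw [← tri_const_mul _ ENNReal.ofReal_ne_top]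
  refine (tri_le_of_band s₁ s₂ s₃ (N' := fun _ _ _ =>
    ENNReal.ofReal (4 * L * 2 ^ lo k₁ k₂ k₃)) fun a b c ha hb hc h0 => ?_).trans
    (tri_mono fun a b c _ => le_of_eq (by ring))
  rw [enorm_ksym_sum hKs]
  exact ENNReal.ofReal_le_ofReal (abs_msym_le_band hη hL0 hL h0 ha hb hc)

include hη hKs s₁ s₂ s₃ in
lemma tri_ksym_eq_zero (hA : ¬ Adm3 k k₁ k₂ k₃) :
    (tri fun a b c => ‖f₁ a‖ₑ * ‖f₂ b‖ₑ * ‖f₃ c‖ₑ * ‖ksym K (a 0) + ksym K (b 0) + ksym K (c 0)‖ₑ)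
      = 0 := by
  refine le_antisymm ((tri_le_of_band s₁ s₂ s₃ (N' := fun _ _ _ => 0)
    fun a b c ha hb hc h0 => ?_).trans ?_) (zero_le)
  · rw [enorm_ksym_sum hKs]
    have : msym η₀ k (a 0) (b 0) (c 0) = 0 := by
      by_contra h
      exact hA (adm_of_msym_ne hη ha hb hc h0 h)
    simp [this]
  · simp [tri]

end sym

/-- The symmetrized trilinear integrand. -/
def gform (K : ℝ → ℂ) (v₁ v₂ v₃ : SpaceTime → ℂ) (p : SpaceTime) : ℂ :=
  v₁ p * v₂ p * dop3 K v₃ p + v₁ p * dop3 K v₂ p * v₃ p + dop3 K v₁ p * v₂ p * v₃ p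

/-- Each of the three terms contains every function once, and convolution in `x` commutes with
functions of time, so time cutoffs factor out of the symmetrized integrand. -/
lemma gform_mul_time {K : ℝ → ℂ} (b₁ b₂ b₃ : ℝ → ℂ) (F₁ F₂ F₃ : SpaceTime → ℂ) (p : SpaceTime) :
    gform K (fun p => b₁ (p 2) * F₁ p) (fun p => b₂ (p 2) * F₂ p) (fun p => b₃ (p 2) * F₃ p) p
      = b₁ (p 2) * b₂ (p 2) * b₃ (p 2) * gform K F₁ F₂ F₃ p := by
  unfold gform
  rw [dop3_mul_time, dop3_mul_time, dop3_mul_time]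
  ring

/-- `F` localized to a time interval of length about `2^{-k}` around `a`. -/
def tcut (η₀ : ℝ → ℝ) (k : ℕ) (a : ℝ) (F : SpaceTime → ℂ) : SpaceTime → ℂ :=
  fun p => (fun t : ℝ => ((η₀ (2 ^ k * (t - a)) : ℝ) : ℂ)) (p 2) * F p

lemma memLp_mul_time {b : ℝ → ℂ} (hb : Measurable b) (hb1 : ∀ t, ‖b t‖ ≤ 1) {F : SpaceTime → ℂ}
    (hF : MemLp F 2 volume) : MemLp (fun p => b (p 2) * F p) 2 volume := by
  refine MemLp.of_le hF ((hb.comp (by fun_prop)).aestronglyMeasurable.mul hF.1)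
    (ae_of_all _ fun p => ?_)
  rw [norm_mul]
  exact mul_le_of_le_one_left (norm_nonneg _) (hb1 _)

section tcut

variable {η₀ : ℝ → ℝ} (hη : IsCutoff η₀) {k : ℕ} (a : ℝ) {F : SpaceTime → ℂ}

include hη in
lemma measurable_cut : Measurable fun t : ℝ => ((η₀ (2 ^ k * (t - a)) : ℝ) : ℂ) := by
  have := hη.measurable
  fun_prop

include hη in
lemma norm_cut_le (t : ℝ) : ‖((η₀ (2 ^ k * (t - a)) : ℝ) : ℂ)‖ ≤ 1 := by
  have := hη.mem_Icc (2 ^ k * (t - a))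
  rw [Complex.norm_real, Real.norm_of_nonneg this.1]
  exact this.2

include hη in
lemma measurable_tcut (hF : Measurable F) : Measurable (tcut η₀ k a F) :=
  ((measurable_cut hη a).comp (by fun_prop)).mul hF

include hη in
lemma memLp_tcut (hF : MemLp F 2 volume) : MemLp (tcut η₀ k a F) 2 volume :=
  memLp_mul_time (measurable_cut hη a) (norm_cut_le hη a) hF

include hη in
lemma support_tcut (mF : Measurable F) (hF : IsFkLocalized k F) :
    ∀ᵐ p : SpaceTime, p 0 ∉ wideBand k → fourierL2 (tcut η₀ k a F) p = 0 :=
  support_mul_time (b := fun t : ℝ => ((η₀ (2 ^ k * (t - a)) : ℝ) : ℂ)) (isClosed_wideBand k) mF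
    hF.1 hF.2 (measurable_cut hη a) (memLp_tcut hη a hF.1)

lemma xnrm_tcut_le : xnrm η₀ (fun p => ‖fourierL2 (tcut η₀ k a F) p‖ₑ) ≤ FkNorm η₀ k F := by
  rw [xnrm_enorm]
  refine le_trans (le_of_eq ?_) (le_iSup _ a)
  congr 2
  ext p
  unfold tcut
  rw [mul_comm]

end tcut

section localized

variable {η₀ : ℝ → ℝ} (hη : IsCutoff η₀) {K : ℝ → ℂ} (hK : Measurable K) (hKi : Integrable K)
  {k k₁ k₂ k₃ : ℕ} (hKs : ∀ ξ, ksym K ξ = (hsym η₀ k ξ : ℂ))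
  {F₁ F₂ F₃ : SpaceTime → ℂ} (m₁ : Measurable F₁) (m₂ : Measurable F₂) (m₃ : Measurable F₃)
  (l₁ : IsFkLocalized k₁ F₁) (l₂ : IsFkLocalized k₂ F₂) (l₃ : IsFkLocalized k₃ F₃)
  (B₁ : FkNorm η₀ k₁ F₁ ≠ ⊤) (B₂ : FkNorm η₀ k₂ F₂ ≠ ⊤)
  (B₃ : FkNorm η₀ k₃ F₃ ≠ ⊤)

include hη hK hKi hKs m₁ m₂ m₃ l₁ l₂ l₃ B₁ B₂ in
lemma enorm_integral_gform_le_interior {L : ℝ} (hL0 : 0 < L)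
    (hL : ∀ k x y, |hsym η₀ k x - hsym η₀ k y| ≤ L * |x - y|) (a : ℝ) :
    ‖∫ p, gform K (tcut η₀ k₁ a F₁) (tcut η₀ k₂ a F₂) (tcut η₀ k₃ a F₃) p‖ₑ ≤
      ENNReal.ofReal (8 * L * (√(2 ^ lo k₁ k₂ k₃) / 2 ^ hi k₁ k₂ k₃)) *
        (2400 * (FkNorm η₀ k₁ F₁ * FkNorm η₀ k₂ F₂ * FkNorm η₀ k₃ F₃)) := by
  refine (trilinear_bound hη hK hKi (measurable_tcut hη a m₁) (measurable_tcut hη a m₂)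
    (measurable_tcut hη a m₃) (memLp_tcut hη a l₁.1) (memLp_tcut hη a l₂.1) (memLp_tcut hη a l₃.1)
    ((xnrm_tcut_le a).trans_lt B₁.lt_top).ne ((xnrm_tcut_le a).trans_lt B₂.lt_top).ne).trans ?_
  refine (tri_ksym_le_weight hη hKs (measurable_fourierL2 _) (measurable_fourierL2 _)
    (measurable_fourierL2 _) (support_tcut hη a m₁ l₁) (support_tcut hη a m₂ l₂)
    (support_tcut hη a m₃ l₃) hL0 hL).trans ?_
  gcongr <;> exact xnrm_tcut_le a

variable {J : Set ℝ} (hJ : MeasurableSet J)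

lemma norm_indicator_one_le (t : ℝ) : ‖J.indicator (1 : ℝ → ℂ) t‖ ≤ 1 := by
  refine (norm_indicator_le_norm_self _ _).trans ?_
  simp

-- The sharp restriction is measured in L² only. Finite X-norm gives an L² bound in space uniform in
-- time, so restricting to `J` gains the square root of its length.
include hη hJ in
lemma nrm_restrict_le (hF : MemLp F₃ 2 volume) (hB : FkNorm η₀ k₃ F₃ ≠ ⊤) (a : ℝ) :
    nrm (fun p => ‖fourierL2 (fun p => J.indicator (1 : ℝ → ℂ) (p 2) * tcut η₀ k₃ a F₃ p) p‖ₑ) ≤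
      ENNReal.ofReal (cpi 3) ^ (1 / 2 : ℝ) * (volume J ^ (1 / 2 : ℝ) * (2 * FkNorm η₀ k₃ F₃)) := by
  set v := tcut η₀ k₃ a F₃ with hv
  have hv2 : MemLp v 2 volume := memLp_tcut hη a hF
  have hw2 : MemLp (fun p : SpaceTime => J.indicator (1 : ℝ → ℂ) (p 2) * v p) 2 volume :=
    memLp_mul_time (measurable_one.indicator hJ) norm_indicator_one_le hv2
  rw [nrm_enorm, eLpNorm_fourierL2 hw2]
  gcongr
  rw [eLpNorm_two_eq]
  have h1 : slc (fun p => ‖fourierL2 v p‖ₑ) ≤ (2 * FkNorm η₀ k₃ F₃) ^ 2 :=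
    (slc_le hη (measurable_fourierL2 v).enorm).trans (by gcongr; exact xnrm_tcut_le a)
  have h2 : slc (fun p => ‖fourierL2 v p‖ₑ) ≠ ⊤ :=
    (h1.trans_lt (ENNReal.pow_lt_top (ENNReal.mul_lt_top (by norm_num) hB.lt_top))).ne
  have h3 := lintegral_time_le hv2 hJ h2
  calc _ ≤ (volume J * (2 * FkNorm η₀ k₃ F₃) ^ 2) ^ (1 / 2 : ℝ) := by
        gcongr
        refine le_trans (lintegral_mono fun p => ?_) (h3.trans (by gcongr))
        by_cases hp : p 2 ∈ J <;> simp [hp]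
    _ = _ := by
        rw [ENNReal.mul_rpow_of_nonneg _ _ (by norm_num), sqrt_sq_ennreal]

include hη hK hKi hKs m₁ m₂ m₃ l₁ l₂ l₃ B₁ B₂ B₃ hJ in
lemma enorm_integral_gform_le_boundary {L : ℝ} (hL0 : 0 < L)
    (hL : ∀ k x y, |hsym η₀ k x - hsym η₀ k y| ≤ L * |x - y|) (a : ℝ) :
    ‖∫ p, gform K (tcut η₀ k₁ a F₁) (tcut η₀ k₂ a F₂)
        (fun p => J.indicator (1 : ℝ → ℂ) (p 2) * tcut η₀ k₃ a F₃ p) p‖ₑ ≤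
      ENNReal.ofReal (4 * L * 2 ^ lo k₁ k₂ k₃) * (32 * (FkNorm η₀ k₁ F₁ * FkNorm η₀ k₂ F₂ *
        (ENNReal.ofReal (cpi 3) ^ (1 / 2 : ℝ) * (volume J ^ (1 / 2 : ℝ) *
          (2 * FkNorm η₀ k₃ F₃))))) ∧
    (¬ Adm3 k k₁ k₂ k₃ → ∫ p, gform K (tcut η₀ k₁ a F₁) (tcut η₀ k₂ a F₂)
        (fun p => J.indicator (1 : ℝ → ℂ) (p 2) * tcut η₀ k₃ a F₃ p) p = 0) := by
  have mJ : Measurable (J.indicator (1 : ℝ → ℂ)) := measurable_one.indicator hJ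
  have hw2 : MemLp (fun p : SpaceTime => J.indicator (1 : ℝ → ℂ) (p 2) * tcut η₀ k₃ a F₃ p) 2
      volume := memLp_mul_time mJ norm_indicator_one_le (memLp_tcut hη a l₃.1)
  have mw : Measurable fun p : SpaceTime => J.indicator (1 : ℝ → ℂ) (p 2) * tcut η₀ k₃ a F₃ p :=
    (mJ.comp (by fun_prop)).mul (measurable_tcut hη a m₃)
  have ht := trilinear_bound hη hK hKi (measurable_tcut hη a m₁) (measurable_tcut hη a m₂) mw
    (memLp_tcut hη a l₁.1) (memLp_tcut hη a l₂.1) hw2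
    ((xnrm_tcut_le a).trans_lt B₁.lt_top).ne ((xnrm_tcut_le a).trans_lt B₂.lt_top).ne
  have sw := support_mul_time (isClosed_wideBand k₃) (measurable_tcut hη a m₃)
    (memLp_tcut hη a l₃.1) (support_tcut hη a m₃ l₃) mJ hw2
  refine ⟨ht.trans ?_, fun hA => ?_⟩
  · refine (tri_ksym_le_band hη hKs (measurable_fourierL2 _) (measurable_fourierL2 _)
      (measurable_fourierL2 _) (support_tcut hη a m₁ l₁) (support_tcut hη a m₂ l₂) sw
      hL0 hL).trans ?_
    gcongr
    · exact xnrm_tcut_le a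
    · exact xnrm_tcut_le a
    · exact nrm_restrict_le hη hJ l₃.1 B₃ a
  · rw [← enorm_eq_zero]
    refine le_antisymm (ht.trans ?_) (zero_le)
    rw [tri_ksym_eq_zero hη hKs (support_tcut hη a m₁ l₁) (support_tcut hη a m₂ l₂) sw hA]

end localized

end

/-! ### Averaging over time windows and the time-localized trilinear bound -/

section

/-- Product of the three time cutoffs. -/
def rho (η₀ : ℝ → ℝ) (k₁ k₂ k₃ : ℕ) (r : ℝ) : ℝ :=
  η₀ (2 ^ k₁ * r) * η₀ (2 ^ k₂ * r) * η₀ (2 ^ k₃ * r)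

section rho

variable {η₀ : ℝ → ℝ} (hη : IsCutoff η₀) {k₁ k₂ k₃ : ℕ}

include hη in
lemma measurable_rho : Measurable (rho η₀ k₁ k₂ k₃) := by
  have := hη.measurable
  unfold rho; fun_prop

include hη in
lemma rho_mem (r : ℝ) : rho η₀ k₁ k₂ k₃ r ∈ Icc (0 : ℝ) 1 := by
  have h₁ := hη.mem_Icc (2 ^ k₁ * r)
  have h₂ := hη.mem_Icc (2 ^ k₂ * r)
  have h₃ := hη.mem_Icc (2 ^ k₃ * r)
  unfold rho
  have h12 := mul_le_one₀ h₁.2 h₂.1 h₂.2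
  exact ⟨mul_nonneg (mul_nonneg h₁.1 h₂.1) h₃.1, mul_le_one₀ h12 h₃.1 h₃.2⟩

include hη in
lemma abs_le_of_rho_ne {r : ℝ} (h : rho η₀ k₁ k₂ k₃ r ≠ 0) : |r| ≤ 8 / 5 / 2 ^ hi k₁ k₂ k₃ := by
  unfold rho at h
  have key : ∀ k : ℕ, η₀ (2 ^ k * r) ≠ 0 → |r| ≤ 8 / 5 / 2 ^ k := fun k hk => by
    by_contra! hc
    refine hk (hη.support _ ?_)
    have h2 : (0 : ℝ) < 2 ^ k := by positivity
    rw [abs_mul, abs_of_pos h2]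
    rwa [div_lt_iff₀' h2] at hc
  have h1 := left_ne_zero_of_mul (left_ne_zero_of_mul h)
  have h2 := right_ne_zero_of_mul (left_ne_zero_of_mul h)
  have h3 := right_ne_zero_of_mul h
  rcases max_choice k₁ (max k₂ k₃) with e | e
  · rw [hi, e]; exact key _ h1
  · rw [hi, e]
    rcases max_choice k₂ k₃ with e' | e'
    · rw [e']; exact key _ h2
    · rw [e']; exact key _ h3

include hη in
lemma integrable_rho : Integrable (rho η₀ k₁ k₂ k₃) := by
  refine Integrable.mono' (g := (Icc (-2 : ℝ) 2).indicator fun _ => 1)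
    ((integrable_indicator_iff measurableSet_Icc).2 (integrableOn_const (by simp)))
    (measurable_rho hη).aestronglyMeasurable (ae_of_all _ fun r => ?_)
  have h := rho_mem hη (k₁ := k₁) (k₂ := k₂) (k₃ := k₃) r
  rw [Real.norm_of_nonneg h.1]
  by_cases h0 : rho η₀ k₁ k₂ k₃ r = 0
  · rw [h0]; exact indicator_nonneg (fun _ _ => zero_le_one) _
  · have h1 := abs_le_of_rho_ne hη h0
    have h2 : (8 : ℝ) / 5 / 2 ^ hi k₁ k₂ k₃ ≤ 8 / 5 :=
      div_le_self (by norm_num) (one_le_pow₀ (by norm_num))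
    have h3 := abs_le.1 (h1.trans h2)
    rw [indicator_of_mem (by constructor <;> linarith [h3.1, h3.2])]
    exact h.2

-- The window is governed by the highest of the three frequencies: for `|r| ≤ 2 ^ (-hi)` all three
-- cutoffs equal 1.
include hη in
lemma le_integral_rho : 2 / 2 ^ hi k₁ k₂ k₃ ≤ ∫ r, rho η₀ k₁ k₂ k₃ r := by
  set q : ℝ := (2 ^ hi k₁ k₂ k₃)⁻¹ with hq
  have hq0 : 0 < q := by positivity
  have e : ∫ r, (Icc (-q) q).indicator (fun _ => (1 : ℝ)) r = 2 / 2 ^ hi k₁ k₂ k₃ := by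
    rw [integral_indicator measurableSet_Icc]
    simp only [integral_const, MeasurableSet.univ, measureReal_restrict_apply, univ_inter,
      Real.volume_real_Icc, smul_eq_mul, mul_one]
    rw [max_eq_left (by linarith), hq]
    ring
  rw [← e]
  refine integral_mono ((integrable_indicator_iff measurableSet_Icc).2
    (integrableOn_const (by simp))) (integrable_rho hη) fun r => ?_
  by_cases hr : r ∈ Icc (-q) q
  · rw [indicator_of_mem hr]
    have key : ∀ k : ℕ, k ≤ hi k₁ k₂ k₃ → η₀ (2 ^ k * r) = 1 := fun k hk => by
      refine hη.eq_one _ ?_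
      have h2 : (0 : ℝ) < 2 ^ k := by positivity
      have h3 : (2 : ℝ) ^ k ≤ 2 ^ hi k₁ k₂ k₃ := pow_le_pow_right₀ (by norm_num) hk
      rw [abs_mul, abs_of_pos h2]
      calc (2 : ℝ) ^ k * |r| ≤ 2 ^ hi k₁ k₂ k₃ * q := by
            gcongr; exact abs_le.2 hr
        _ = 1 := by rw [hq]; field_simp
        _ ≤ 5 / 4 := by norm_num
    simp only [rho]
    rw [key k₁ (by simp), key k₂ (by simp), key k₃ (by simp)]
    norm_num
  · rw [indicator_of_notMem hr]
    exact (rho_mem hη r).1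

end rho

/-- The balance at the endpoints: the symbol has size `2 ^ m`, the window has length `16/5 / 2 ^ n`,
and half a power of the latter recovers half a power of the former because `m ≤ n`. -/
lemma two_pow_mul_sqrt_le {m n : ℕ} (h : m ≤ n) :
    (2 : ℝ) ^ m * √(16 / 5 / 2 ^ n) ≤ 2 * √(2 ^ m) := by
  have h1 : (2 : ℝ) ^ m ≤ 2 ^ n := pow_le_pow_right₀ (by norm_num) h
  have h2 : (0 : ℝ) < 2 ^ m := by positivity
  calc (2 : ℝ) ^ m * √(16 / 5 / 2 ^ n) ≤ 2 ^ m * √(4 / 2 ^ m) := by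
        gcongr; norm_num
    _ = √(2 ^ m) * √(2 ^ m) * √(4 / 2 ^ m) := by rw [Real.mul_self_sqrt h2.le]
    _ = √(2 ^ m) * √(2 ^ m * (4 / 2 ^ m)) := by rw [mul_assoc, ← Real.sqrt_mul h2.le]
    _ = 2 * √(2 ^ m) := by
        rw [mul_div_cancel₀ _ h2.ne', show (4 : ℝ) = 2 ^ 2 by norm_num,
          Real.sqrt_sq (by norm_num), mul_comm]

lemma ofReal_rpow_half (x : ℝ) (hx : 0 ≤ x) :
    ENNReal.ofReal x ^ (1 / 2 : ℝ) = ENNReal.ofReal √x := by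
  rw [ENNReal.ofReal_rpow_of_nonneg hx (by norm_num), Real.sqrt_eq_rpow]

/-- Averaging an integral over time translates of the cutoffs. -/
lemma enorm_average_le {η₀ : ℝ → ℝ} (hη : IsCutoff η₀) (k₁ k₂ k₃ : ℕ) {g : SpaceTime → ℂ}
    (hsupp : ∀ p : SpaceTime, g p ≠ 0 → |p 2| ≤ 1) {Φ : ℝ → ℝ≥0∞}
    (hΦ : ∀ a, ‖∫ p : SpaceTime, (rho η₀ k₁ k₂ k₃ (p 2 - a) : ℂ) * g p‖ₑ ≤ Φ a) :
    ENNReal.ofReal (2 / 2 ^ hi k₁ k₂ k₃) * ‖∫ p, g p‖ₑ ≤ ∫⁻ a, Φ a := by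
  by_cases hg : Integrable g
  swap; · simp [integral_undef hg]
  set c := ∫ r, rho η₀ k₁ k₂ k₃ r with hc
  have mr := measurable_rho hη (k₁ := k₁) (k₂ := k₂) (k₃ := k₃)
  have hint : Integrable (fun w : ℝ × SpaceTime => (rho η₀ k₁ k₂ k₃ (w.2 2 - w.1) : ℂ) * g w.2)
      (volume.prod volume) := by
    have h1 : Integrable (fun w : ℝ × SpaceTime =>
        (Icc (-4 : ℝ) 4).indicator (fun _ => (1 : ℝ)) w.1 * ‖g w.2‖) (volume.prod volume) :=
      ((integrable_indicator_iff measurableSet_Icc).2 (integrableOn_const (by simp))).mul_prod hg.norm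
    refine h1.mono' ?_ (ae_of_all _ fun w => ?_)
    · refine AEStronglyMeasurable.mul ?_ hg.1.comp_snd
      exact (Complex.measurable_ofReal.comp (mr.comp (by fun_prop))).aestronglyMeasurable
    · rw [norm_mul, Complex.norm_real]
      have hm := rho_mem hη (k₁ := k₁) (k₂ := k₂) (k₃ := k₃) (w.2 2 - w.1)
      rw [Real.norm_of_nonneg hm.1]
      by_cases h0 : rho η₀ k₁ k₂ k₃ (w.2 2 - w.1) = 0
      · rw [h0, zero_mul]
        exact mul_nonneg (indicator_nonneg (fun _ _ => zero_le_one) _) (norm_nonneg _)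
      by_cases h1 : g w.2 = 0
      · simp [h1]
      have h2 := abs_le_of_rho_ne hη h0
      have h3 := abs_le.1 (hsupp _ h1)
      have h4 : (8 : ℝ) / 5 / 2 ^ hi k₁ k₂ k₃ ≤ 8 / 5 :=
        div_le_self (by norm_num) (one_le_pow₀ (by norm_num))
      have h5 := abs_le.1 (h2.trans h4)
      rw [indicator_of_mem (by constructor <;> linarith [h3.1, h3.2, h5.1, h5.2])]
      gcongr
      exact hm.2
  have e : ∫ a : ℝ, ∫ p : SpaceTime, (rho η₀ k₁ k₂ k₃ (p 2 - a) : ℂ) * g p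
      = (c : ℂ) * ∫ p, g p := by
    rw [integral_integral_swap hint, ← integral_const_mul]
    congr 1; ext p
    rw [integral_mul_const]
    congr 1
    rw [integral_sub_left_eq_self (fun r => (rho η₀ k₁ k₂ k₃ r : ℂ))]
    exact integral_ofReal
  calc _ ≤ ‖(c : ℂ) * ∫ p, g p‖ₑ := by
        rw [enorm_mul]
        gcongr
        rw [← ofReal_norm, Complex.norm_real]
        exact ENNReal.ofReal_le_ofReal ((le_integral_rho hη).trans (le_abs_self _))
    _ ≤ ∫⁻ a, Φ a := by
        rw [← e]
        exact (enorm_integral_le_lintegral_enorm _).trans (lintegral_mono hΦ)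

/-- The integral is averaged over the centres `a` of windows of radius `δ`, about `2 ^ (-hi)`.
Windows inside the interval have centres in `[-1, 1]` and obey the interior bound `X`, of size
`√(2^lo) / 2^hi`. Windows meeting an endpoint have centres in a set of measure at most `4δ` and obey
the boundary bound `Y`, of size `2^lo √δ`. Dividing by the window mass, at least `2 / 2^hi`, bounds
both contributions by a multiple of `√(2^lo)`. -/
lemma exists_time_localized_bound {η₀ : ℝ → ℝ} (hη : IsCutoff η₀) :
    ∃ C : ℝ≥0, ∀ {K : ℝ → ℂ} (_ : Measurable K) (_ : Integrable K) {k k₁ k₂ k₃ : ℕ}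
      (_ : ∀ ξ, ksym K ξ = (hsym η₀ k ξ : ℂ)) {F₁ F₂ F₃ : SpaceTime → ℂ} (_ : Measurable F₁)
      (_ : Measurable F₂) (_ : Measurable F₃) (_ : IsFkLocalized k₁ F₁) (_ : IsFkLocalized k₂ F₂)
      (_ : IsFkLocalized k₃ F₃) (_ : FkNorm η₀ k₁ F₁ ≠ ⊤) (_ : FkNorm η₀ k₂ F₂ ≠ ⊤)
      (_ : FkNorm η₀ k₃ F₃ ≠ ⊤) {α β : ℝ} (_ : -1 ≤ α) (_ : β ≤ 1),
      ‖∫ p : SpaceTime, (Icc α β).indicator (1 : ℝ → ℂ) (p 2) * gform K F₁ F₂ F₃ p‖ₑ ≤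
        C * ENNReal.ofReal √(2 ^ lo k₁ k₂ k₃) *
          (FkNorm η₀ k₁ F₁ * FkNorm η₀ k₂ F₂ * FkNorm η₀ k₃ F₃) ∧
      (¬ Adm3 k k₁ k₂ k₃ →
        ∫ p : SpaceTime, (Icc α β).indicator (1 : ℝ → ℂ) (p 2) * gform K F₁ F₂ F₃ p = 0) := by
  obtain ⟨L, hL0, hL⟩ := exists_lipschitz_hsym hη
  set M : ℝ := 8 * L * 2400 + 16 / 5 * (4 * L) * 32 * √(cpi 3) * 2 * 2 with hM
  have hM0 : 0 ≤ M := by positivity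
  refine ⟨M.toNNReal, ?_⟩
  intro K hK hKi k k₁ k₂ k₃ hKs F₁ F₂ F₃ m₁ m₂ m₃ l₁ l₂ l₃ B₁ B₂ B₃ α β hα hβ
  set I := Icc α β
  set g : SpaceTime → ℂ := fun p => I.indicator (1 : ℝ → ℂ) (p 2) * gform K F₁ F₂ F₃ p with hg
  set δ : ℝ := 8 / 5 / 2 ^ hi k₁ k₂ k₃ with hδ
  have hδ0 : 0 < δ := by positivity
  have gf : ∀ (J : Set ℝ) (a : ℝ) (p : SpaceTime),
      gform K (tcut η₀ k₁ a F₁) (tcut η₀ k₂ a F₂)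
        (fun p => J.indicator (1 : ℝ → ℂ) (p 2) * tcut η₀ k₃ a F₃ p) p
      = (rho η₀ k₁ k₂ k₃ (p 2 - a) : ℂ) * (J.indicator (1 : ℝ → ℂ) (p 2) * gform K F₁ F₂ F₃ p) := by
    intro J a p
    have := gform_mul_time (K := K) (fun t : ℝ => ((η₀ (2 ^ k₁ * (t - a)) : ℝ) : ℂ))
      (fun t : ℝ => ((η₀ (2 ^ k₂ * (t - a)) : ℝ) : ℂ))
      (fun t : ℝ => J.indicator (1 : ℝ → ℂ) t * ((η₀ (2 ^ k₃ * (t - a)) : ℝ) : ℂ)) F₁ F₂ F₃ p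
    simp only [mul_assoc] at this
    unfold tcut
    rw [this]
    simp only [rho, Complex.ofReal_mul]
    ring
  have gf' : ∀ (a : ℝ) (p : SpaceTime),
      gform K (tcut η₀ k₁ a F₁) (tcut η₀ k₂ a F₂) (tcut η₀ k₃ a F₃) p
      = (rho η₀ k₁ k₂ k₃ (p 2 - a) : ℂ) * gform K F₁ F₂ F₃ p := by
    intro a p
    have := gf univ a p
    simpa using this
  have hsupp : ∀ p : SpaceTime, g p ≠ 0 → |p 2| ≤ 1 := fun p hp => by
    have : p 2 ∈ I := by
      by_contra h
      exact hp (by simp [hg, h])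
    exact abs_le.2 ⟨hα.trans this.1, this.2.trans hβ⟩
  set X : ℝ≥0∞ := ENNReal.ofReal (8 * L * (√(2 ^ lo k₁ k₂ k₃) / 2 ^ hi k₁ k₂ k₃)) *
        (2400 * (FkNorm η₀ k₁ F₁ * FkNorm η₀ k₂ F₂ * FkNorm η₀ k₃ F₃)) with hX
  set Y : ℝ≥0∞ := ENNReal.ofReal (4 * L * 2 ^ lo k₁ k₂ k₃) * (32 * (FkNorm η₀ k₁ F₁ *
    FkNorm η₀ k₂ F₂ * (ENNReal.ofReal (cpi 3) ^ (1 / 2 : ℝ) *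
      (ENNReal.ofReal (2 * δ) ^ (1 / 2 : ℝ) * (2 * FkNorm η₀ k₃ F₃))))) with hY
  refine ⟨?_, fun hA => ?_⟩
  · have h1 : ∀ a, ‖∫ p : SpaceTime, (rho η₀ k₁ k₂ k₃ (p 2 - a) : ℂ) * g p‖ₑ ≤
        (Icc (-1 : ℝ) 1).indicator (fun _ => X) a + ((Metric.closedBall α δ).indicator (fun _ => Y) a
          + (Metric.closedBall β δ).indicator (fun _ => Y) a) := by
      intro a
      by_cases hb : |a - α| ≤ δ ∨ |a - β| ≤ δ
      · have h2 : ‖∫ p : SpaceTime, (rho η₀ k₁ k₂ k₃ (p 2 - a) : ℂ) * g p‖ₑ ≤ Y := by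
          -- Intersecting with the window changes nothing where the cutoffs live, and it bounds the
          -- length of the sharply restricted set by `2δ`.
          have hJ : MeasurableSet (I ∩ Metric.closedBall a δ) :=
            measurableSet_Icc.inter Metric.isClosed_closedBall.measurableSet
          have h3 := (enorm_integral_gform_le_boundary hη hK hKi hKs m₁ m₂ m₃ l₁ l₂ l₃ B₁ B₂ B₃ hJ
            hL0 hL a).1
          simp_rw [gf] at h3
          have h4 : ∀ p : SpaceTime, (rho η₀ k₁ k₂ k₃ (p 2 - a) : ℂ) *
              ((I ∩ Metric.closedBall a δ).indicator (1 : ℝ → ℂ) (p 2) * gform K F₁ F₂ F₃ p)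
              = (rho η₀ k₁ k₂ k₃ (p 2 - a) : ℂ) * g p := fun p => by
            by_cases h0 : rho η₀ k₁ k₂ k₃ (p 2 - a) = 0
            · simp [h0]
            have h5 : p 2 ∈ Metric.closedBall a δ := abs_le_of_rho_ne hη h0
            by_cases h6 : p 2 ∈ I
            · have h7 : p 2 ∈ I ∩ Metric.closedBall a δ := ⟨h6, h5⟩
              simp only [hg, indicator_of_mem h6, indicator_of_mem h7]
            · have h7 : p 2 ∉ I ∩ Metric.closedBall a δ := fun h => h6 h.1
              simp only [hg, indicator_of_notMem h6, indicator_of_notMem h7]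
          simp_rw [h4] at h3
          refine h3.trans ?_
          rw [hY]
          gcongr
          refine (measure_mono inter_subset_right).trans (le_of_eq ?_)
          rw [Real.volume_closedBall]
        refine h2.trans (le_trans ?_ le_add_self)
        rcases hb with hb | hb
        · have : a ∈ Metric.closedBall α δ := hb
          rw [indicator_of_mem this]
          exact le_self_add
        · have : a ∈ Metric.closedBall β δ := hb
          rw [indicator_of_mem this]
          exact le_add_self
      · push Not at hb
        -- A centre farther than `δ` from both endpoints has its window either entirely inside the
        -- interval, where the sharp cutoff is invisible, or disjoint from it.
        by_cases hin : α < a ∧ a < β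
        · have h2 : α + δ < a := by
            have := hb.1; rw [abs_of_pos (by linarith)] at this; linarith
          have h3 : a < β - δ := by
            have := hb.2; rw [abs_of_neg (by linarith)] at this; linarith
          refine le_trans ?_ le_self_add
          rw [indicator_of_mem (show a ∈ Icc (-1 : ℝ) 1 by constructor <;> linarith [hin.1, hin.2])]
          refine le_trans (le_of_eq ?_) (enorm_integral_gform_le_interior hη hK hKi hKs m₁ m₂ m₃ l₁
            l₂ l₃ B₁ B₂ hL0 hL a)
          simp_rw [gf']
          congr 2; ext p
          by_cases h0 : rho η₀ k₁ k₂ k₃ (p 2 - a) = 0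
          · simp [h0]
          have h5 := abs_le.1 (abs_le_of_rho_ne hη h0)
          have h6 : p 2 ∈ I := by constructor <;> linarith [h5.1, h5.2]
          simp [hg, h6]
        · have : ∀ p : SpaceTime, (rho η₀ k₁ k₂ k₃ (p 2 - a) : ℂ) * g p = 0 := fun p => by
            by_cases h0 : rho η₀ k₁ k₂ k₃ (p 2 - a) = 0
            · simp [h0]
            have h5 := abs_le.1 (abs_le_of_rho_ne hη h0)
            have h6 : p 2 ∉ I := fun h6 => by
              refine hin ⟨?_, ?_⟩
              · by_contra! hc
                have := hb.1
                rw [abs_of_nonpos (by linarith)] at this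
                linarith [h6.1, h5.2]
              · by_contra! hc
                have := hb.2
                rw [abs_of_nonneg (by linarith)] at this
                linarith [h6.2, h5.1]
            simp [hg, h6]
          simp [this]
    have h2 := enorm_average_le hη k₁ k₂ k₃ hsupp h1
    have h3 : ∫⁻ a : ℝ, ((Icc (-1 : ℝ) 1).indicator (fun _ => X) a +
        ((Metric.closedBall α δ).indicator (fun _ => Y) a
          + (Metric.closedBall β δ).indicator (fun _ => Y) a))
        = 2 * X + 2 * (Y * ENNReal.ofReal (2 * δ)) := by
      have mb : ∀ x : ℝ, Measurable ((Metric.closedBall x δ).indicator fun _ : ℝ => Y) := fun x =>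
        measurable_const.indicator Metric.isClosed_closedBall.measurableSet
      rw [lintegral_add_left (measurable_const.indicator measurableSet_Icc),
        lintegral_add_left (mb α), lintegral_indicator_const measurableSet_Icc,
        lintegral_indicator_const Metric.isClosed_closedBall.measurableSet,
        lintegral_indicator_const Metric.isClosed_closedBall.measurableSet,
        Real.volume_closedBall, Real.volume_closedBall, Real.volume_Icc,
        show ENNReal.ofReal (1 - -1) = 2 by norm_num, ← two_mul, mul_comm X]
    rw [h3] at h2
    have hq0 : (0 : ℝ) < 2 / 2 ^ hi k₁ k₂ k₃ := by positivity
    have hq1 : ENNReal.ofReal (2 / 2 ^ hi k₁ k₂ k₃) ≠ 0 := by simp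
    rw [← ENNReal.mul_le_mul_iff_right hq1 ENNReal.ofReal_ne_top]
    refine h2.trans ?_
    set B := FkNorm η₀ k₁ F₁ * FkNorm η₀ k₂ F₂ * FkNorm η₀ k₃ F₃ with hB
    have eX : 2 * X = ENNReal.ofReal (2 / 2 ^ hi k₁ k₂ k₃ * (8 * L * 2400 * √(2 ^ lo k₁ k₂ k₃))) * B := by
      rw [show 2 / 2 ^ hi k₁ k₂ k₃ * (8 * L * 2400 * √(2 ^ lo k₁ k₂ k₃)) =
        2 * ((8 * L * (√(2 ^ lo k₁ k₂ k₃) / 2 ^ hi k₁ k₂ k₃)) * 2400) by ring,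
        ENNReal.ofReal_mul (by norm_num), ENNReal.ofReal_mul (by positivity), hX]
      norm_num
      ring
    have eY : 2 * (Y * ENNReal.ofReal (2 * δ)) = ENNReal.ofReal (2 * (4 * L * 2 ^ lo k₁ k₂ k₃ *
        32 * √(cpi 3) * √(2 * δ) * 2 * (2 * δ))) * B := by
      have hc := cpi_pos 3
      have hw : 0 ≤ 2 * δ := by positivity
      rw [hY]
      have hy : 0 ≤ 4 * L * 2 ^ lo k₁ k₂ k₃ := by positivity
      generalize 2 * δ = w at hw
      generalize 4 * L * 2 ^ lo k₁ k₂ k₃ = y at hy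
      rw [ofReal_rpow_half _ hc.le, ofReal_rpow_half _ hw, ENNReal.ofReal_mul (p := 2) (by norm_num),
        ENNReal.ofReal_mul (q := w) (by positivity), ENNReal.ofReal_mul (q := 2) (by positivity),
        ENNReal.ofReal_mul (q := √w) (by positivity),
        ENNReal.ofReal_mul (q := √(cpi 3)) (by positivity),
        ENNReal.ofReal_mul (q := 32) (by positivity), hB]
      norm_num
      ring
    rw [eX, eY, ← add_mul, ← ENNReal.ofReal_add (by positivity) (by positivity),
      show (M.toNNReal : ℝ≥0∞) = ENNReal.ofReal M from rfl, ← ENNReal.ofReal_mul hM0,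
      ← mul_assoc (ENNReal.ofReal (2 / 2 ^ hi k₁ k₂ k₃)), ← ENNReal.ofReal_mul hq0.le]
    refine mul_le_mul_left (ENNReal.ofReal_le_ofReal ?_) _
    have h4 := two_pow_mul_sqrt_le (show lo k₁ k₂ k₃ ≤ hi k₁ k₂ k₃ by simp)
    have e1 : 2 * δ = 16 / 5 / 2 ^ hi k₁ k₂ k₃ := by rw [hδ]; ring
    rw [e1]
    have h5 : 2 * (4 * L * 2 ^ lo k₁ k₂ k₃ * 32 * √(cpi 3) * √(16 / 5 / 2 ^ hi k₁ k₂ k₃) * 2 *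
        (16 / 5 / 2 ^ hi k₁ k₂ k₃)) = 2 / 2 ^ hi k₁ k₂ k₃ * (16 / 5 * (4 * L) * 32 * √(cpi 3) * 2 *
          (2 ^ lo k₁ k₂ k₃ * √(16 / 5 / 2 ^ hi k₁ k₂ k₃))) := by ring
    rw [h5, ← mul_add]
    gcongr
    calc _ ≤ 8 * L * 2400 * √(2 ^ lo k₁ k₂ k₃) + 16 / 5 * (4 * L) * 32 * √(cpi 3) * 2 *
          (2 * √(2 ^ lo k₁ k₂ k₃)) := by gcongr
      _ = M * √(2 ^ lo k₁ k₂ k₃) := by rw [hM]; ring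
  · have h1 : ∀ a, ‖∫ p : SpaceTime, (rho η₀ k₁ k₂ k₃ (p 2 - a) : ℂ) * g p‖ₑ ≤ 0 := by
      intro a
      have h3 := (enorm_integral_gform_le_boundary hη hK hKi hKs m₁ m₂ m₃ l₁ l₂ l₃ B₁ B₂ B₃
        (measurableSet_Icc : MeasurableSet I) hL0 hL a).2 hA
      simp_rw [gf] at h3
      exact le_of_eq (by rw [show (∫ p : SpaceTime, (rho η₀ k₁ k₂ k₃ (p 2 - a) : ℂ) * g p) = 0 from h3,
        enorm_zero])
    have h2 := enorm_average_le hη k₁ k₂ k₃ hsupp h1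
    rw [lintegral_zero, nonpos_iff_eq_zero, mul_eq_zero] at h2
    rcases h2 with h2 | h2
    · exact absurd h2 (by simp)
    · exact enorm_eq_zero.1 h2

end

section

/-! ### Square function bounds over bounded time intervals -/

/-- The unit time slab. -/
def slab : SpaceTime → ℝ≥0∞ := fun p => (Icc (-1 : ℝ) 1).indicator 1 (p 2)

lemma measurable_slab : Measurable slab := by
  have : Measurable ((Icc (-1 : ℝ) 1).indicator (1 : ℝ → ℝ≥0∞)) :=
    measurable_one.indicator measurableSet_Icc
  exact this.comp (by fun_prop)

/-- Each point is seen by centres `a` of measure `2r` with `r = 2 ^ (-K)`, and only centres in `[-2,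
2]` have windows meeting the slab. Hence `2r` times the integral is at most `4A`. -/
lemma lintegral_slab_le {g : SpaceTime → ℝ≥0∞} (hg : Measurable g) (K : ℕ) {A : ℝ≥0∞}
    (h : ∀ a : ℝ, ∫⁻ p : SpaceTime, slab p *
      ((Metric.closedBall a ((2 ^ K)⁻¹)).indicator 1 (p 2) * g p) ≤ A) :
    ∫⁻ p, slab p * g p ≤ 2 * 2 ^ K * A := by
  set r : ℝ := (2 ^ K)⁻¹ with hr
  have hr0 : 0 < r := by positivity
  have hr1 : r ≤ 1 := inv_le_one_of_one_le₀ (one_le_pow₀ (by norm_num))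
  have mI : Measurable fun w : ℝ × SpaceTime =>
      (Metric.closedBall w.1 r).indicator (1 : ℝ → ℝ≥0∞) (w.2 2) := by
    have e : (fun w : ℝ × SpaceTime => (Metric.closedBall w.1 r).indicator (1 : ℝ → ℝ≥0∞) (w.2 2))
        = {w : ℝ × SpaceTime | |w.2 2 - w.1| ≤ r}.indicator 1 := by
      ext w
      simp only [indicator, Metric.mem_closedBall, Real.dist_eq, mem_ofPred_eq]
      rfl
    rw [e]
    exact measurable_one.indicator (measurableSet_le (by fun_prop) (by fun_prop))
  have mm : Measurable fun w : ℝ × SpaceTime => slab w.2 *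
      ((Metric.closedBall w.1 r).indicator 1 (w.2 2) * g w.2) :=
    (measurable_slab.comp measurable_snd).mul (mI.mul (hg.comp measurable_snd))
  have mg : Measurable fun p => slab p * g p := measurable_slab.mul hg
  have h1 : ENNReal.ofReal (2 * r) * ∫⁻ p, slab p * g p
      = ∫⁻ a : ℝ, ∫⁻ p : SpaceTime, slab p *
      ((Metric.closedBall a r).indicator 1 (p 2) * g p) := by
    rw [lintegral_lintegral_swap mm.aemeasurable,
      ← lintegral_const_mul _ mg]
    refine lintegral_congr fun p => ?_
    have e : ∀ a : ℝ, slab p * ((Metric.closedBall a r).indicator 1 (p 2) * g p)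
        = (Metric.closedBall (p 2) r).indicator (1 : ℝ → ℝ≥0∞) a * (slab p * g p) := fun a => by
      have : (Metric.closedBall a r).indicator (1 : ℝ → ℝ≥0∞) (p 2)
          = (Metric.closedBall (p 2) r).indicator 1 a := by
        simp only [indicator, Metric.mem_closedBall, dist_comm]
        rfl
      rw [this]; ring
    simp_rw [e]
    rw [lintegral_mul_const _ (measurable_one.indicator Metric.isClosed_closedBall.measurableSet),
      lintegral_indicator_one Metric.isClosed_closedBall.measurableSet, Real.volume_closedBall]
  have h2 : ∫⁻ a : ℝ, ∫⁻ p : SpaceTime, slab p *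
      ((Metric.closedBall a r).indicator 1 (p 2) * g p) ≤ 4 * A := by
    calc _ ≤ ∫⁻ a : ℝ, (Icc (-2 : ℝ) 2).indicator (fun _ => A) a := by
          refine lintegral_mono fun a => ?_
          by_cases ha : a ∈ Icc (-2 : ℝ) 2
          · rw [indicator_of_mem ha]; exact h a
          · rw [indicator_of_notMem ha]
            refine le_of_eq ?_
            have : ∀ p : SpaceTime, slab p * ((Metric.closedBall a r).indicator 1 (p 2) * g p)
                = 0 := fun p => by
              by_cases h3 : p 2 ∈ Icc (-1 : ℝ) 1
              · have h4 : p 2 ∉ Metric.closedBall a r := fun h4 => by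
                  rw [Metric.mem_closedBall, Real.dist_eq, abs_le] at h4
                  exact ha ⟨by linarith [h3.1, h4.2], by linarith [h3.2, h4.1]⟩
                simp [h4]
              · simp [slab, h3]
            simp [this]
      _ = 4 * A := by
          rw [lintegral_indicator_const measurableSet_Icc, Real.volume_Icc, mul_comm]
          norm_num
  have h3 : (1 : ℝ≥0∞) = 2 ^ K * ENNReal.ofReal r := by
    rw [show (2 : ℝ≥0∞) ^ K = ENNReal.ofReal (2 ^ K) by
      rw [ENNReal.ofReal_pow (by norm_num)]; norm_num, ← ENNReal.ofReal_mul (by positivity), hr,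
      mul_inv_cancel₀ (by positivity), ENNReal.ofReal_one]
  have h4 : ENNReal.ofReal (2 * r) = 2 * ENNReal.ofReal r := by
    rw [ENNReal.ofReal_mul (by norm_num)]; norm_num
  have h5 : 2 * (∫⁻ p, slab p * g p) ≤ 2 * (2 * 2 ^ K * A) := by
    calc _ = 2 ^ K * ENNReal.ofReal r * (2 * ∫⁻ p, slab p * g p) := by rw [← h3, one_mul]
      _ = 2 ^ K * (ENNReal.ofReal (2 * r) * ∫⁻ p, slab p * g p) := by rw [h4]; ring
      _ ≤ 2 ^ K * (4 * A) := by rw [h1]; gcongr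
      _ = _ := by ring
  exact (ENNReal.mul_le_mul_iff_right (by norm_num) (by norm_num)).1 h5

lemma enorm_tcut_eq {η₀ : ℝ → ℝ} (hη : IsCutoff η₀) {k K : ℕ} (hk : k ≤ K) {a : ℝ} {p : SpaceTime}
    (h : p 2 ∈ Metric.closedBall a ((2 ^ K)⁻¹)) (F : SpaceTime → ℂ) : tcut η₀ k a F p = F p := by
  unfold tcut
  have h2 : (0 : ℝ) < 2 ^ k := by positivity
  have h3 : (2 : ℝ) ^ k ≤ 2 ^ K := pow_le_pow_right₀ (by norm_num) hk
  rw [Metric.mem_closedBall, Real.dist_eq] at h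
  have : η₀ (2 ^ k * (p 2 - a)) = 1 := by
    refine hη.eq_one _ ?_
    rw [abs_mul, abs_of_pos h2]
    calc (2 : ℝ) ^ k * |p 2 - a| ≤ 2 ^ K * (2 ^ K)⁻¹ := by gcongr
      _ = 1 := mul_inv_cancel₀ (by positivity)
      _ ≤ 5 / 4 := by norm_num
  simp [this]

lemma lintegral_sq_mul_le {η₀ : ℝ → ℝ} (hη : IsCutoff η₀) {v₁ v₂ : SpaceTime → ℂ}
    (h₁ : MemLp v₁ 2 volume) (h₂ : MemLp v₂ 2 volume)
    (x₁ : xnrm η₀ (fun a => ‖fourierL2 v₁ a‖ₑ) ≠ ⊤)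
    (x₂ : xnrm η₀ (fun a => ‖fourierL2 v₂ a‖ₑ) ≠ ⊤) :
    ∫⁻ p, ‖v₁ p * v₂ p‖ₑ ^ 2 ≤ (32 * (xnrm η₀ (fun a => ‖fourierL2 v₁ a‖ₑ) *
      xnrm η₀ (fun a => ‖fourierL2 v₂ a‖ₑ))) ^ 2 := by
  have m₁ := measurable_fourierL2 v₁
  have m₂ := measurable_fourierL2 v₂
  obtain ⟨hm, hf⟩ := product_fourierL2 h₁ h₂ (lconv_ne_top hη m₁ m₂ x₁ x₂)
  rw [← eLpNorm_two_sq]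
  refine pow_le_pow_left' (le_trans ?_ (nrm_lconv_le hη m₁.enorm m₂.enorm)) 2
  have hc1 : 1 ≤ cpi 3 := one_le_pow₀ one_le_two_pi
  calc eLpNorm (fun z => v₁ z * v₂ z) 2 volume
      ≤ ENNReal.ofReal (cpi 3) ^ (1 / 2 : ℝ) * eLpNorm (fun z => v₁ z * v₂ z) 2 volume := by
        refine le_mul_of_one_le_left (zero_le) ?_
        rw [← ENNReal.one_rpow (1 / 2 : ℝ)]
        gcongr
        rwa [ENNReal.one_le_ofReal]
    _ = eLpNorm (fourierL2 fun z => v₁ z * v₂ z) 2 volume := (eLpNorm_fourierL2 hm).symm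
    _ ≤ _ := by
        rw [eLpNorm_congr_ae hf, eLpNorm_two_eq, nrm]
        gcongr with p
        rw [enorm_mul]
        calc _ ≤ 1 * ‖conv (fourierL2 v₁) (fourierL2 v₂) p‖ₑ := by
              gcongr
              rw [← ofReal_norm, ← ENNReal.ofReal_one]
              refine ENNReal.ofReal_le_ofReal ?_
              rw [norm_inv, Complex.norm_real, Real.norm_of_nonneg (cpi_pos 3).le]
              exact inv_le_one_of_one_le₀ hc1
          _ ≤ _ := by
              rw [one_mul]
              refine (enorm_integral_le_lintegral_enorm _).trans (le_of_eq ?_)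
              simp only [enorm_mul]

/-- On windows of radius `2 ^ (-max k₁ k₂)` both time cutoffs equal 1 and the bilinear L² estimate
applies. The number of windows accounts for the factor `2 ^ max k₁ k₂`. -/
lemma lintegral_slab_sq_mul_le {η₀ : ℝ → ℝ} (hη : IsCutoff η₀) {k₁ k₂ : ℕ} {F₁ F₂ : SpaceTime → ℂ}
    (m₁ : Measurable F₁) (m₂ : Measurable F₂) (l₁ : MemLp F₁ 2 volume) (l₂ : MemLp F₂ 2 volume)
    (B₁ : FkNorm η₀ k₁ F₁ ≠ ⊤) (B₂ : FkNorm η₀ k₂ F₂ ≠ ⊤) :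
    ∫⁻ p, slab p * ‖F₁ p * F₂ p‖ₑ ^ 2 ≤
      2 * 2 ^ max k₁ k₂ * (32 * (FkNorm η₀ k₁ F₁ * FkNorm η₀ k₂ F₂)) ^ 2 := by
  refine lintegral_slab_le ((m₁.mul m₂).enorm.pow_const 2) _ fun a => ?_
  calc _ ≤ ∫⁻ p, ‖tcut η₀ k₁ a F₁ p * tcut η₀ k₂ a F₂ p‖ₑ ^ 2 := by
        refine lintegral_mono fun p => ?_
        have h1 : slab p ≤ 1 := indicator_le_self' (fun _ _ => zero_le) _
        refine (mul_le_of_le_one_left (zero_le) h1).trans ?_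
        by_cases hp : p 2 ∈ Metric.closedBall a ((2 ^ max k₁ k₂)⁻¹)
        · rw [enorm_tcut_eq hη (le_max_left _ _) hp, enorm_tcut_eq hη (le_max_right _ _) hp,
            indicator_of_mem hp]
          simp
        · rw [indicator_of_notMem hp]
          simp
    _ ≤ _ := by
        refine (lintegral_sq_mul_le hη (memLp_tcut hη a l₁) (memLp_tcut hη a l₂)
          ((xnrm_tcut_le a).trans_lt B₁.lt_top).ne ((xnrm_tcut_le a).trans_lt B₂.lt_top).ne).trans ?_
        gcongr <;> exact xnrm_tcut_le a

lemma lintegral_slab_sq_le {η₀ : ℝ → ℝ} (hη : IsCutoff η₀) {k : ℕ} {F : SpaceTime → ℂ}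
    (m : Measurable F) (l : MemLp F 2 volume) (B : FkNorm η₀ k F ≠ ⊤) :
    ∫⁻ p, slab p * ‖F p‖ₑ ^ 2 ≤ 2 * 2 ^ k * (2 * (2 * FkNorm η₀ k F) ^ 2) := by
  refine lintegral_slab_le (m.enorm.pow_const 2) _ fun a => ?_
  have h1 : slc (fun p => ‖fourierL2 (tcut η₀ k a F) p‖ₑ) ≤ (2 * FkNorm η₀ k F) ^ 2 :=
    (slc_le hη (measurable_fourierL2 _).enorm).trans (by gcongr; exact xnrm_tcut_le a)
  have h2 : slc (fun p => ‖fourierL2 (tcut η₀ k a F) p‖ₑ) ≠ ⊤ :=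
    (h1.trans_lt (ENNReal.pow_lt_top (ENNReal.mul_lt_top (by norm_num) B.lt_top))).ne
  have h3 := lintegral_time_le (memLp_tcut hη a l) (measurableSet_Icc (a := (-1 : ℝ)) (b := 1)) h2
  refine le_trans (lintegral_mono fun p => ?_) (h3.trans ?_)
  · change slab p * _ ≤ slab p * _
    gcongr
    by_cases hp : p 2 ∈ Metric.closedBall a ((2 ^ k)⁻¹)
    · rw [enorm_tcut_eq hη le_rfl hp, indicator_of_mem hp]
      simp
    · rw [indicator_of_notMem hp]
      simp
  · rw [Real.volume_Icc, show ENNReal.ofReal (1 - -1) = 2 by norm_num]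
    gcongr

end

section

/-! ### Series of functions and the cubic form -/

lemma memLp_of_lintegral_sq {α : Type*} [MeasurableSpace α] {μ : Measure α} {f : α → ℂ}
    (hf : AEStronglyMeasurable f μ) (h : ∫⁻ x, ‖f x‖ₑ ^ 2 ∂μ ≠ ⊤) : MemLp f 2 μ :=
  ⟨hf, by rw [eLpNorm_two_eq]; exact ENNReal.rpow_lt_top_of_nonneg (by norm_num) h⟩

/-- The majorant `G = ∑ ‖h i‖` lies in L² together with its square, by Minkowski over single terms
and over pairs; bounds on pairwise products replace an L⁴ norm. Dominated convergence then gives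
convergence of the partial sums and of their squares. Having `V * V` in L² is what makes the cubic
form meaningful. -/
lemma exists_sum {h : ℕ → SpaceTime → ℂ} (hm : ∀ i, Measurable (h i)) {a : ℕ → ℝ≥0∞}
    (h1 : ∀ i, ∫⁻ p, ‖h i p‖ₑ ^ 2 ≤ a i ^ 2) (h2 : ∀ i j, ∫⁻ p, ‖h i p * h j p‖ₑ ^ 2 ≤ (a i * a j) ^ 2)
    (ha : ∑' i, a i ≠ ⊤) : ∃ V : SpaceTime → ℂ, Measurable V ∧
      (∀ᵐ p, Tendsto (fun N => ∑ i ∈ Finset.range N, h i p) atTop (𝓝 (V p))) ∧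
      MemLp V 2 volume ∧ MemLp (fun p => V p * V p) 2 volume ∧
      Tendsto (fun N => eLpNorm (fun p => (∑ i ∈ Finset.range N, h i p) - V p) 2 volume) atTop
        (𝓝 0) ∧
      Tendsto (fun N => eLpNorm (fun p => (∑ i ∈ Finset.range N, h i p) *
        (∑ i ∈ Finset.range N, h i p) - V p * V p) 2 volume) atTop (𝓝 0) := by
  set G : SpaceTime → ℝ≥0∞ := fun p => ∑' i, ‖h i p‖ₑ with hG
  have mG : Measurable G := Measurable.tsum fun i => (hm i).enorm
  have G2 : ∫⁻ p, G p ^ 2 ≠ ⊤ := by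
    refine ((lintegral_sq_tsum_le fun i => (hm i).enorm.aemeasurable).trans_lt ?_).ne
    refine ENNReal.pow_lt_top (lt_of_le_of_lt (ENNReal.tsum_le_tsum fun i => ?_) ha.lt_top)
    calc _ ≤ (a i ^ 2) ^ (1 / 2 : ℝ) := by gcongr; exact h1 i
      _ = a i := sqrt_sq_ennreal _
  have G4 : ∫⁻ p, (G p * G p) ^ 2 ≠ ⊤ := by
    have e : ∀ p, G p * G p = ∑' ij : ℕ × ℕ, ‖h ij.1 p * h ij.2 p‖ₑ := fun p => by
      simp_rw [enorm_mul]
      rw [ENNReal.tsum_prod (f := fun i j => ‖h i p‖ₑ * ‖h j p‖ₑ)]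
      simp_rw [ENNReal.tsum_mul_left, ENNReal.tsum_mul_right]
      rfl
    simp_rw [e]
    refine ((lintegral_sq_tsum_le fun ij : ℕ × ℕ =>
      ((hm ij.1).mul (hm ij.2)).enorm.aemeasurable).trans_lt ?_).ne
    refine ENNReal.pow_lt_top (lt_of_le_of_lt (ENNReal.tsum_le_tsum
      (g := fun ij : ℕ × ℕ => a ij.1 * a ij.2) fun ij => ?_) ?_)
    · calc _ ≤ ((a ij.1 * a ij.2) ^ 2) ^ (1 / 2 : ℝ) := by gcongr; exact h2 ij.1 ij.2
        _ = _ := sqrt_sq_ennreal _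
    · rw [ENNReal.tsum_prod (f := fun i j => a i * a j)]
      simp_rw [ENNReal.tsum_mul_left, ENNReal.tsum_mul_right]
      exact ENNReal.mul_lt_top ha.lt_top ha.lt_top
  have fin : ∀ᵐ p, G p < ⊤ := by
    have := ae_lt_top (mG.pow_const 2) G2
    filter_upwards [this] with p hp
    exact (ENNReal.pow_lt_top_iff.1 hp).resolve_right two_ne_zero
  have mS : ∀ N, Measurable fun p => ∑ i ∈ Finset.range N, h i p := fun N =>
    Finset.measurable_sum _ fun i _ => hm i
  obtain ⟨V, mV, hV⟩ := measurable_limit_of_tendsto_metrizable_ae (L := atTop)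
    (f := fun N p => ∑ i ∈ Finset.range N, h i p) (μ := (volume : Measure SpaceTime))
    (fun N => (mS N).aemeasurable) (by
      filter_upwards [fin] with p hp
      have : Summable fun i => h i p := by
        refine Summable.of_norm ?_
        have := ENNReal.summable_toReal hp.ne
        simpa [toReal_enorm] using this
      exact ⟨_, this.hasSum.tendsto_sum_nat⟩)
  have bS : ∀ N p, ‖∑ i ∈ Finset.range N, h i p‖ₑ ≤ G p := fun N p =>
    (enorm_sum_le _ _).trans (ENNReal.sum_le_tsum _)
  have bV : ∀ᵐ p, ‖V p‖ₑ ≤ G p := by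
    filter_upwards [hV] with p hp
    exact le_of_tendsto' hp.enorm fun N => bS N p
  have c2 : ∀ f : SpaceTime → ℝ≥0∞, ∫⁻ p, f p ^ 2 ≠ ⊤ → ∫⁻ p, (2 * f p) ^ 2 ≠ ⊤ := fun f hf => by
    simp_rw [mul_pow]
    rw [lintegral_const_mul' _ _ (by norm_num)]
    exact ENNReal.mul_ne_top (by norm_num) hf
  refine ⟨V, mV, hV, memLp_of_lintegral_sq mV.aestronglyMeasurable ?_,
    memLp_of_lintegral_sq (mV.mul mV).aestronglyMeasurable ?_, ?_, ?_⟩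
  · refine ((lintegral_mono_ae ?_).trans_lt G2.lt_top).ne
    filter_upwards [bV] with p hp
    gcongr
  · refine ((lintegral_mono_ae ?_).trans_lt G4.lt_top).ne
    filter_upwards [bV] with p hp
    rw [enorm_mul]
    gcongr
  · refine tendsto_eLpNorm_of_dominated (fun N => (mS N).aestronglyMeasurable)
      mV.aestronglyMeasurable (c2 G G2) (fun N => ?_) hV
    filter_upwards [bV] with p hp
    rw [two_mul]
    exact (enorm_sub_le).trans (add_le_add (bS N p) hp)
  · refine tendsto_eLpNorm_of_dominated (fun N => ((mS N).mul (mS N)).aestronglyMeasurable)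
      (mV.mul mV).aestronglyMeasurable (c2 _ G4) (fun N => ?_) ?_
    · filter_upwards [bV] with p hp
      rw [two_mul]
      refine (enorm_sub_le).trans (add_le_add ?_ ?_)
      · rw [enorm_mul]; exact mul_le_mul' (bS N p) (bS N p)
      · rw [enorm_mul]; exact mul_le_mul' hp hp
    · filter_upwards [hV] with p hp
      exact hp.mul hp

lemma tendsto_dop3 {K : ℝ → ℂ} (hK : Measurable K) (hKi : Integrable K) {v : ℕ → SpaceTime → ℂ}
    {V : SpaceTime → ℂ} (mv : ∀ N, Measurable (v N)) (mV : Measurable V)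
    (hv : ∀ N, MemLp (v N) 2 volume) (hV : MemLp V 2 volume)
    (h : Tendsto (fun N => eLpNorm (fun p => v N p - V p) 2 volume) atTop (𝓝 0)) :
    Tendsto (fun N => eLpNorm (fun p => dop3 K (v N) p - dop3 K V p) 2 volume) atTop (𝓝 0) := by
  refine tendsto_of_fourierL2 (fun N => memLp_dop3 hK hKi (mv N) (hv N)) (memLp_dop3 hK hKi mV hV) ?_
  have h1 := tendsto_fourierL2 hv hV h
  have h2 := ENNReal.Tendsto.const_mul (a := ENNReal.ofReal (∫ r, ‖K r‖)) h1
    (Or.inr ENNReal.ofReal_ne_top)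
  rw [mul_zero] at h2
  refine tendsto_of_tendsto_of_tendsto_of_le_of_le tendsto_const_nhds h2 (fun _ => zero_le)
    fun N => ?_
  refine eLpNorm_le_mul_eLpNorm_of_ae_le_mul ?_ 2
  filter_upwards [fourierL2_dop3 hK hKi (mv N) (hv N), fourierL2_dop3 hK hKi mV hV] with p e1 e2
  rw [e1, e2, ← mul_sub, norm_mul]
  gcongr
  exact norm_ksym_le _

lemma dop3_sum {K : ℝ → ℂ} (hK : Measurable K) (hKi : Integrable K) {h : ℕ → SpaceTime → ℂ}
    (hm : ∀ i, Measurable (h i)) (h2 : ∀ i, MemLp (h i) 2 volume) (s : Finset ℕ) :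
    dop3 K (fun p => ∑ i ∈ s, h i p) =ᵐ[volume] fun p => ∑ i ∈ s, dop3 K (h i) p := by
  have m2 : MemLp (fun p => ∑ i ∈ s, h i p) 2 volume := memLp_finsetSum s fun i _ => h2 i
  have mm : Measurable fun p => ∑ i ∈ s, h i p := Finset.measurable_sum _ fun i _ => hm i
  have d2 : ∀ i, MemLp (dop3 K (h i)) 2 volume := fun i => memLp_dop3 hK hKi (hm i) (h2 i)
  refine ae_eq_of_fourierL2 (memLp_dop3 hK hKi mm m2) (memLp_finsetSum s fun i _ => d2 i) ?_
  filter_upwards [fourierL2_dop3 hK hKi mm m2, fourierL2_sum s h2, fourierL2_sum s d2,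
    ae_all_iff.2 fun i => fourierL2_dop3 hK hKi (hm i) (h2 i)] with p e1 e2 e3 e4
  rw [e1, e2, e3, Finset.mul_sum]
  exact Finset.sum_congr rfl fun i _ => (e4 i).symm

lemma sum_perm (N : ℕ) (T : ℕ → ℕ → ℕ → ℂ) (hT : ∀ i j l, T i j l = T j i l) :
    ∑ i ∈ Finset.range N, ∑ j ∈ Finset.range N, ∑ l ∈ Finset.range N,
      (T i j l + T i l j + T j l i)
      = 3 * ∑ i ∈ Finset.range N, ∑ j ∈ Finset.range N, ∑ l ∈ Finset.range N, T i j l := by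
  simp_rw [Finset.sum_add_distrib]
  have e1 : ∑ i ∈ Finset.range N, ∑ j ∈ Finset.range N, ∑ l ∈ Finset.range N, T i l j
      = ∑ i ∈ Finset.range N, ∑ j ∈ Finset.range N, ∑ l ∈ Finset.range N, T i j l :=
    Finset.sum_congr rfl fun i _ => Finset.sum_comm
  have e2 : ∑ i ∈ Finset.range N, ∑ j ∈ Finset.range N, ∑ l ∈ Finset.range N, T j l i
      = ∑ i ∈ Finset.range N, ∑ j ∈ Finset.range N, ∑ l ∈ Finset.range N, T i j l := by
    rw [Finset.sum_comm]
    exact Finset.sum_congr rfl fun i _ => Finset.sum_comm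
  rw [e1, e2]
  ring

/-- The cubic form of a series is controlled by the symmetrized trilinear forms. -/
lemma enorm_cubic_le {K : ℝ → ℂ} (hK : Measurable K) (hKi : Integrable K) {h : ℕ → SpaceTime → ℂ}
    (hm : ∀ i, Measurable (h i)) (h2 : ∀ i, MemLp (h i) 2 volume)
    (h4 : ∀ i j, MemLp (fun p => h i p * h j p) 2 volume) {V : SpaceTime → ℂ} (mV : Measurable V)
    (hV : MemLp V 2 volume) (hVV : MemLp (fun p => V p * V p) 2 volume)
    (t1 : Tendsto (fun N => eLpNorm (fun p => (∑ i ∈ Finset.range N, h i p) - V p) 2 volume) atTop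
        (𝓝 0))
    (t2 : Tendsto (fun N => eLpNorm (fun p => (∑ i ∈ Finset.range N, h i p) *
        (∑ i ∈ Finset.range N, h i p) - V p * V p) 2 volume) atTop (𝓝 0)) :
    ‖∫ p, V p * V p * dop3 K V p‖ₑ ≤
      ∑' i, ∑' j, ∑' l, ‖∫ p, gform K (h i) (h j) (h l) p‖ₑ := by
  set S : ℕ → SpaceTime → ℂ := fun N p => ∑ i ∈ Finset.range N, h i p with hS
  have mS : ∀ N, Measurable (S N) := fun N => Finset.measurable_sum _ fun i _ => hm i
  have S2 : ∀ N, MemLp (S N) 2 volume := fun N => memLp_finsetSum _ fun i _ => h2 i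
  have d2 : ∀ i, MemLp (dop3 K (h i)) 2 volume := fun i => memLp_dop3 hK hKi (hm i) (h2 i)
  have eSS : ∀ N, (fun p => S N p * S N p)
      = fun p => ∑ i ∈ Finset.range N, ∑ j ∈ Finset.range N, h i p * h j p := fun N => by
    ext p; exact Finset.sum_mul_sum _ _ _ _
  have SS : ∀ N, MemLp (fun p => S N p * S N p) 2 volume := fun N => by
    rw [eSS]
    exact memLp_finsetSum _ fun i _ => memLp_finsetSum _ fun j _ => h4 i j
  have DV := memLp_dop3 hK hKi mV hV
  have DS : ∀ N, MemLp (dop3 K (S N)) 2 volume := fun N => memLp_dop3 hK hKi (mS N) (S2 N)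
  have lim : Tendsto (fun N => ∫ p, S N p * S N p * dop3 K (S N) p) atTop
      (𝓝 (∫ p, V p * V p * dop3 K V p)) := by
    rw [tendsto_iff_edist_tendsto_0]
    have t3 := tendsto_dop3 hK hKi mS mV S2 hV t1
    have b : Tendsto (fun N => eLpNorm (fun p => S N p * S N p - V p * V p) 2 volume *
        (eLpNorm (fun p => dop3 K (S N) p - dop3 K V p) 2 volume + eLpNorm (dop3 K V) 2 volume)
        + eLpNorm (fun p => V p * V p) 2 volume *
          eLpNorm (fun p => dop3 K (S N) p - dop3 K V p) 2 volume) atTop (𝓝 0) := by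
      have q1 := ENNReal.Tendsto.mul t2 (Or.inr (by simpa using DV.2.ne))
        (t3.add_const (eLpNorm (dop3 K V) 2 volume)) (Or.inr ENNReal.zero_ne_top)
      have q2 := ENNReal.Tendsto.const_mul (a := eLpNorm (fun p => V p * V p) 2 volume) t3
        (Or.inr hVV.2.ne)
      simpa using q1.add q2
    refine tendsto_of_tendsto_of_tendsto_of_le_of_le tendsto_const_nhds b (fun _ => zero_le)
      fun N => ?_
    have i1 := integrable_mul_of_memLp (SS N) (DS N)
    have i2 := integrable_mul_of_memLp hVV DV
    have x1 := memLp_sub (SS N) hVV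
    have x2 := memLp_sub (DS N) DV
    have e : (∫ p, S N p * S N p * dop3 K (S N) p) - ∫ p, V p * V p * dop3 K V p
        = (∫ p, (S N p * S N p - V p * V p) * ((dop3 K (S N) p - dop3 K V p) + dop3 K V p))
          + ∫ p, V p * V p * (dop3 K (S N) p - dop3 K V p) := by
      rw [← integral_sub i1 i2, ← integral_add (integrable_mul_of_memLp x1 (memLp_add x2 DV))
        (integrable_mul_of_memLp hVV x2)]
      congr 1; ext p; ring
    rw [edist_eq_enorm_sub, e]
    refine (enorm_add_le _ _).trans (add_le_add ?_ (enorm_integral_mul_le hVV.1 x2.1))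
    refine (enorm_integral_mul_le x1.1 (memLp_add x2 DV).1).trans ?_
    gcongr
    exact eLpNorm_add_le x2.1 DV.1 (by norm_num)
  refine le_of_tendsto' lim.enorm fun N => ?_
  set T : ℕ → ℕ → ℕ → ℂ := fun i j l => ∫ p, h i p * h j p * dop3 K (h l) p with hT
  have iT : ∀ i j l, Integrable fun p => h i p * h j p * dop3 K (h l) p := fun i j l =>
    integrable_mul_of_memLp (h4 i j) (d2 l)
  have e1 : ∫ p, S N p * S N p * dop3 K (S N) p =
      ∑ i ∈ Finset.range N, ∑ j ∈ Finset.range N, ∑ l ∈ Finset.range N, T i j l := by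
    have : (fun p => S N p * S N p * dop3 K (S N) p) =ᵐ[volume] fun p =>
        ∑ i ∈ Finset.range N, ∑ j ∈ Finset.range N, ∑ l ∈ Finset.range N,
          h i p * h j p * dop3 K (h l) p := by
      filter_upwards [dop3_sum hK hKi hm h2 (Finset.range N)] with p hp
      rw [hp, congrFun (eSS N) p]
      simp_rw [Finset.sum_mul, Finset.mul_sum]
    rw [integral_congr_ae this, integral_finsetSum _ fun i _ =>
      integrable_finsetSum _ fun j _ => integrable_finsetSum _ fun l _ => iT i j l]
    refine Finset.sum_congr rfl fun i _ => ?_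
    rw [integral_finsetSum _ fun j _ => integrable_finsetSum _ fun l _ => iT i j l]
    refine Finset.sum_congr rfl fun j _ => ?_
    rw [integral_finsetSum _ fun l _ => iT i j l]
  have e2 : ∀ i j l, ∫ p, gform K (h i) (h j) (h l) p = T i j l + T i l j + T j l i := by
    intro i j l
    have i12 : Integrable fun p => h i p * h j p * dop3 K (h l) p + h i p * h l p * dop3 K (h j) p :=
      (iT i j l).add (iT i l j)
    simp only [hT]
    rw [← integral_add (iT i j l) (iT i l j), ← integral_add i12 (iT j l i)]
    congr 1; ext p
    unfold gform
    ring
  -- Over all triples of indices each of the three placements of the multiplier has the same sum, so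
  -- the symmetrized forms add up to three times the cubic form.
  have e3 : (3 : ℂ) * ∫ p, S N p * S N p * dop3 K (S N) p =
      ∑ i ∈ Finset.range N, ∑ j ∈ Finset.range N, ∑ l ∈ Finset.range N,
        ∫ p, gform K (h i) (h j) (h l) p := by
    simp_rw [e2]
    rw [e1, sum_perm N T fun i j l => by simp only [hT, mul_comm (h i _)]]
  calc ‖∫ p, S N p * S N p * dop3 K (S N) p‖ₑ
      ≤ ‖(3 : ℂ) * ∫ p, S N p * S N p * dop3 K (S N) p‖ₑ := by
        rw [enorm_mul]
        refine le_mul_of_one_le_left (zero_le) ?_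
        rw [← ofReal_norm, ENNReal.one_le_ofReal]
        norm_num
    _ ≤ ∑ i ∈ Finset.range N, ∑ j ∈ Finset.range N, ∑ l ∈ Finset.range N,
        ‖∫ p, gform K (h i) (h j) (h l) p‖ₑ := by
        rw [e3]
        refine (enorm_sum_le _ _).trans (Finset.sum_le_sum fun i _ => ?_)
        refine (enorm_sum_le _ _).trans (Finset.sum_le_sum fun j _ => ?_)
        exact enorm_sum_le _ _
    _ ≤ _ := by
        refine (Finset.sum_le_sum fun i _ => ?_).trans (ENNReal.sum_le_tsum _)
        refine (Finset.sum_le_sum fun j _ => ?_).trans (ENNReal.sum_le_tsum _)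
        exact ENNReal.sum_le_tsum _

end

section

/-! ### Convolution with Schwartz functions on the plane -/

lemma fint_lineDeriv {d : ℕ} (f : 𝓢(Euc d, ℂ)) (m ζ : Euc d) :
    fint (∂_{m} f : 𝓢(Euc d, ℂ)) ζ = Complex.I * ((inner ℝ ζ m : ℝ) : ℂ) * fint f ζ := by
  rw [fint_eq_fourier, fint_eq_fourier]
  change (𝓕 (∂_{m} f) : 𝓢(Euc d, ℂ)) _ = _ * (𝓕 f : 𝓢(Euc d, ℂ)) _
  rw [SchwartzMap.fourier_lineDerivOp_eq, smul_apply,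
    SchwartzMap.smulLeftCLM_apply_apply (by fun_prop), inner_smul_left]
  simp only [conj_trivial, smul_eq_mul, Complex.real_smul]
  push_cast
  have : (Real.pi : ℂ) ≠ 0 := by exact_mod_cast Real.pi_ne_zero
  field_simp

lemma exists_reflection (A : 𝓢(Plane, ℂ)) (z : Plane) : ∃ ψ : 𝓢(Plane, ℂ), ∀ w, ψ w = A (z - w) := by
  refine ⟨SchwartzMap.compSubConstCLM ℂ z (SchwartzMap.compCLMOfContinuousLinearEquiv ℂ
    (ContinuousLinearEquiv.neg ℝ) A), fun w => ?_⟩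
  rw [SchwartzMap.compSubConstCLM_apply, SchwartzMap.compCLMOfContinuousLinearEquiv_apply]
  simp

lemma lineDeriv_reflection {A ψ : 𝓢(Plane, ℂ)} {z : Plane} {c : ℂ} (h : ∀ w, ψ w = c * A (z - w))
    (m w : Plane) : (∂_{m} ψ : 𝓢(Plane, ℂ)) w = -c * (∂_{m} A : 𝓢(Plane, ℂ)) (z - w) := by
  have e : (ψ : Plane → ℂ) = fun w => c * A (z - w) := funext h
  rw [SchwartzMap.lineDerivOp_apply_eq_fderiv, SchwartzMap.lineDerivOp_apply_eq_fderiv, e]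
  have h1 : HasFDerivAt (fun w => z - w) (-ContinuousLinearMap.id ℝ Plane) w :=
    (hasFDerivAt_id w).const_sub z
  have h2 := ((A.differentiableAt (x := z - w)).hasFDerivAt.comp w h1).const_mul c
  change HasFDerivAt (fun w => c * A (z - w)) _ w at h2
  rw [h2.fderiv]
  simp

variable {η₀ : ℝ → ℝ}

/-- The bump vanishes near the origin, so the quotient has no singularity there. -/
lemma contDiff_bump_div (hη : IsCutoff η₀) (k : ℕ) :
    ContDiff ℝ ((⊤ : ℕ∞) : WithTop ℕ∞) fun ξ : ℝ => bump η₀ (ξ / 2 ^ k) / ξ := by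
  have hb : ContDiff ℝ ((⊤ : ℕ∞) : WithTop ℕ∞) fun ξ : ℝ => bump η₀ (ξ / 2 ^ k) :=
    (bump_contDiff hη).comp (contDiff_id.div_const _)
  rw [contDiff_iff_contDiffAt]
  intro ξ
  by_cases h0 : ξ = 0
  · have : (fun ξ : ℝ => bump η₀ (ξ / 2 ^ k) / ξ) =ᶠ[𝓝 ξ] fun _ => 0 := by
      rw [h0]
      filter_upwards [Metric.ball_mem_nhds (0 : ℝ) (ε := 14 / 25) (by norm_num)] with x hx
      have h1 : bump η₀ (x / 2 ^ k) = 0 := by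
        by_contra h
        have h2 := (bump_support hη h).1
        rw [abs_div, abs_of_pos (by positivity : (0 : ℝ) < 2 ^ k)] at h2
        have h3 : |x| / 2 ^ k ≤ |x| := div_le_self (abs_nonneg _) (one_le_pow₀ (by norm_num))
        have h4 : |x| < 14 / 25 := by simpa using hx
        linarith
      rw [h1, zero_div]
    exact contDiffAt_const.congr_of_eventuallyEq this
  · exact hb.contDiffAt.div contDiffAt_id h0

/-- The frequency cutoff used in the energy estimate. -/
def kap (η₀ : ℝ → ℝ) (k : ℕ) (M : ℝ) (ζ : Plane) : ℝ := bump η₀ (ζ 0 / 2 ^ k) * η₀ (ζ 1 / M)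

lemma kap_neg (hη : IsCutoff η₀) (k : ℕ) (M : ℝ) (ζ : Plane) :
    kap η₀ k M (-ζ) = kap η₀ k M ζ := by
  simp only [kap, PiLp.neg_apply, neg_div, bump_even hη, hη.even]

/-- The equation is tested only against `x`-derivatives, so the kernel of the localization must
itself be an `x`-derivative. Division by `iξ` is harmless since the bump vanishes near `ξ = 0`, and
the cutoff in `μ` makes the symbol compactly supported. The oddness of the symbol of `A` is what
eliminates the linear terms in `integral_linear`. -/
lemma exists_energy_kernel (hη : IsCutoff η₀) (k : ℕ) {M : ℝ} (hM : 0 < M) :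
    ∃ A : 𝓢(Plane, ℂ), (∀ ζ, fint A (-ζ) = - fint A ζ) ∧
      ∀ ζ, Complex.I * (ζ 0 : ℂ) * fint A ζ = kap η₀ k M ζ := by
  set f : Plane → ℝ := fun ζ => bump η₀ (ζ 0 / 2 ^ k) / ζ 0 * η₀ (ζ 1 / M) with hf
  have hp : (0 : ℝ) < 2 ^ k := by positivity
  have c1 : ContDiff ℝ ((⊤ : ℕ∞) : WithTop ℕ∞) f := by
    refine ContDiff.mul ?_ ?_
    · exact (contDiff_bump_div hη k).comp (by fun_prop : ContDiff ℝ _ fun ζ : Plane => ζ 0)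
    · exact hη.smooth.comp (by fun_prop : ContDiff ℝ _ fun ζ : Plane => ζ 1 / M)
  have c2 : HasCompactSupport fun ζ => -Complex.I * (f ζ : ℂ) := by
    refine HasCompactSupport.of_support_subset_isCompact
      (isCompact_closedBall (0 : Plane) (2 * 2 ^ k + 2 * M)) fun ζ hζ => ?_
    have h0 : f ζ ≠ 0 := fun h => hζ (by simp [h])
    have h1 : bump η₀ (ζ 0 / 2 ^ k) ≠ 0 := fun h => h0 (by simp [hf, h])
    have h2 : η₀ (ζ 1 / M) ≠ 0 := fun h => h0 (by simp [hf, h])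
    have h3 := (bump_support hη h1).2
    have h4 : |ζ 1 / M| ≤ 8 / 5 := by
      by_contra! h; exact h2 (hη.support _ h)
    rw [abs_div, abs_of_pos hp, div_le_iff₀ hp] at h3
    rw [abs_div, abs_of_pos hM, div_le_iff₀ hM] at h4
    have h5 : ‖ζ‖ ≤ |ζ 0| + |ζ 1| := by
      rw [EuclideanSpace.norm_eq, Fin.sum_univ_two]
      refine Real.sqrt_le_iff.2 ⟨by positivity, ?_⟩
      simp only [Real.norm_eq_abs]
      nlinarith [abs_nonneg (ζ 0), abs_nonneg (ζ 1)]
    simp only [Metric.mem_closedBall, dist_zero_right]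
    linarith
  have c3 : ContDiff ℝ ((⊤ : ℕ∞) : WithTop ℕ∞) fun ζ => -Complex.I * (f ζ : ℂ) :=
    contDiff_const.mul (Complex.ofRealCLM.contDiff.comp c1)
  obtain ⟨A, hA⟩ := exists_schwartz_symbol (c2.toSchwartzMap c3)
  have hA' : ∀ ζ, fint A ζ = -Complex.I * (f ζ : ℂ) := hA
  refine ⟨A, fun ζ => ?_, fun ζ => ?_⟩
  · have : f (-ζ) = - f ζ := by
      simp only [hf, PiLp.neg_apply, neg_div, bump_even hη, hη.even, div_neg, neg_mul]
    rw [hA', hA', this]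
    push_cast; ring
  · rw [hA']
    have : (ζ 0) * f ζ = kap η₀ k M ζ := by
      simp only [hf, kap]
      by_cases h : ζ 0 = 0
      · have : bump η₀ (0 / 2 ^ k) = 0 := by
          by_contra h
          have := (bump_support hη h).1
          norm_num at this
        rw [h, this]; simp
      · field_simp
    rw [← this]
    push_cast
    linear_combination (-(ζ 0 : ℂ) * f ζ) * Complex.I_mul_I

/-- Convolution on the plane. -/
def pconv (k V : Plane → ℂ) : Plane → ℂ := cv volume k id V

lemma pconv_eq (k V : Plane → ℂ) (z : Plane) : pconv k V z = ∫ w, k (z - w) * V w := by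
  unfold pconv cv
  rw [← integral_sub_left_eq_self _ volume z]
  simp

lemma pconv_congr {k V V' : Plane → ℂ} (h : V =ᵐ[volume] V') : pconv k V = pconv k V' := by
  ext z
  rw [pconv_eq, pconv_eq]
  refine integral_congr_ae ?_
  filter_upwards [h] with w hw
  rw [hw]

section pconv

variable (k : 𝓢(Plane, ℂ)) {V : Plane → ℂ}

lemma measurable_pconv (hV : Measurable V) : Measurable (pconv k V) :=
  (stronglyMeasurable_cv k.continuous.measurable measurable_id hV).measurable

lemma memLp_pconv (hV : Measurable V) (h2 : MemLp V 2 volume) : MemLp (pconv k V) 2 volume :=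
  memLp_cv k.continuous.measurable k.integrable measurable_id hV h2

lemma eLpNorm_pconv_le (hV : Measurable V) :
    eLpNorm (pconv k V) 2 volume ≤ (∫⁻ r, ‖k r‖ₑ) * eLpNorm V 2 volume :=
  eLpNorm_cv_le k.continuous.measurable measurable_id hV

lemma fourierL2_pconv (hV : Measurable V) (h2 : MemLp V 2 volume) :
    fourierL2 (pconv k V) =ᵐ[volume] fun ζ => fint k ζ * fourierL2 V ζ := by
  have h := fourierL2_cv (ν := volume) k.continuous.measurable k.integrable measurable_id hV h2
  have e : ∀ ζ, cvSymbol volume k id ζ = fint k ζ := fun ζ => by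
    unfold cvSymbol fint
    congr 1; ext r
    rw [mul_comm]; rfl
  simp_rw [e] at h
  exact h

/-- Young's inequality `L¹ * L² → L²`. -/
lemma eLpNorm_pconv_le' (hV : Measurable V) :
    eLpNorm (pconv k V) 2 volume ≤ (∫⁻ r, ‖V r‖ₑ) * eLpNorm k 2 volume := by
  have e : pconv k V = pconv V k := by
    ext z
    rw [pconv_eq]
    unfold pconv cv
    congr 1; ext w
    rw [mul_comm]; rfl
  rw [e]
  exact eLpNorm_cv_le hV measurable_id k.continuous.measurable

lemma memLp_comp_const_sub (z : Plane) : MemLp (fun w => k (z - w)) 2 volume :=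
  (memLp_schwartz k).comp_measurePreserving (Measure.measurePreserving_sub_left volume z)

/-- Moving a convolution to the other factor. -/
lemma integral_mul_pconv {f g : Plane → ℂ} (mf : Measurable f) (mg : Measurable g)
    (hf : MemLp f 2 volume) (hg : Integrable g) :
    ∫ z, f z * pconv k g z = ∫ w, g w * pconv (fun r => k (-r)) f w := by
  have mk := k.continuous.measurable
  have m : Measurable fun p : Plane × Plane => f p.1 * (k (p.1 - p.2) * g p.2) :=
    (mf.comp measurable_fst).mul ((mk.comp (measurable_fst.sub measurable_snd)).mul
      (mg.comp measurable_snd))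
  have hi : Integrable (fun p : Plane × Plane => f p.1 * (k (p.1 - p.2) * g p.2))
      (volume.prod volume) := by
    refine ⟨m.aestronglyMeasurable, ?_⟩
    unfold HasFiniteIntegral
    rw [lintegral_prod_symm _ m.enorm.aemeasurable]
    calc _ ≤ ∫⁻ w, ‖g w‖ₑ * (eLpNorm f 2 volume * eLpNorm k 2 volume) := by
          refine lintegral_mono fun w => ?_
          have e : ∀ z, ‖f z * (k (z - w) * g w)‖ₑ = ‖g w‖ₑ * ‖f z * k (z - w)‖ₑ := fun z => by
            simp only [enorm_mul]; ring
          have mm : Measurable fun z => f z * k (z - w) :=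
            mf.mul (mk.comp (measurable_id.sub_const w))
          simp_rw [e]
          rw [lintegral_const_mul _ mm.enorm]
          gcongr
          refine (eLpNorm_mul_le_one mf.aestronglyMeasurable
            (mk.comp (measurable_id.sub_const w)).aestronglyMeasurable).trans (le_of_eq ?_)
          congr 1
          exact eLpNorm_comp_measurePreserving (memLp_schwartz k).1
            (measurePreserving_sub_right volume w)
      _ < ⊤ := by
          rw [lintegral_mul_const _ mg.enorm]
          exact ENNReal.mul_lt_top hg.2 (ENNReal.mul_lt_top hf.2 (memLp_schwartz k).2)
  have e1 : ∀ z, f z * pconv k g z = ∫ w, f z * (k (z - w) * g w) := fun z => by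
    rw [pconv_eq, integral_const_mul]
  have e2 : ∀ w, g w * pconv (fun r => k (-r)) f w = ∫ z, f z * (k (z - w) * g w) := fun w => by
    rw [pconv_eq, ← integral_const_mul]
    congr 1; ext z
    rw [neg_sub]; ring
  simp_rw [e1, e2]
  exact integral_integral_swap hi

end pconv

end

section

/-! ### The localized energy identity -/

/-- A real-valued continuous path in `L²` solving the equation on `(-T, T)`. -/
structure IsSolutionPath (T : ℝ) (v : ℝ → Plane → ℂ) : Prop where
  meas : ∀ s, Measurable (v s)
  memLp : ∀ s, MemLp (v s) 2 volume
  real : ∀ s z, (starRingEnd ℂ) (v s z) = v s z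
  cont : ∀ s₀, Tendsto (fun s => eLpNorm (fun z => v s z - v s₀ z) 2 volume) (𝓝 s₀) (𝓝 0)
  eqn : ∀ ψ : 𝓢(Plane, ℂ), ∀ t ∈ Ioo (-T) T,
    HasDerivAt (fun r => ∫ z, v r z * ∂_{ex} ψ z)
      ((∫ z, v t z * (∂_{ex} (∂_{ex} (∂_{ex} (∂_{ex} ψ))) z - ∂_{ey} (∂_{ey} ψ) z))
        + ∫ z, v t z ^ 2 / 2 * ∂_{ex} (∂_{ex} ψ) z) t

namespace IsSolutionPath

variable {T : ℝ} {v : ℝ → Plane → ℂ} (hv : IsSolutionPath T v)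
include hv

lemma memLp_sub' (s s₀ : ℝ) : MemLp (fun z => v s z - v s₀ z) 2 volume :=
  memLp_sub (hv.memLp s) (hv.memLp s₀)

lemma integrable_sq (s : ℝ) : Integrable fun z => v s z * v s z :=
  integrable_mul_of_memLp (hv.memLp s) (hv.memLp s)

lemma continuous_pconv (k : 𝓢(Plane, ℂ)) (z : Plane) : Continuous fun s => pconv k (v s) z := by
  refine continuous_iff_continuousAt.2 fun s₀ => ?_
  have hk := memLp_comp_const_sub k z
  rw [ContinuousAt, tendsto_iff_edist_tendsto_0]
  have h := ENNReal.Tendsto.const_mul (a := eLpNorm (fun w => k (z - w)) 2 volume) (hv.cont s₀)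
    (Or.inr hk.2.ne)
  rw [mul_zero] at h
  refine tendsto_of_tendsto_of_tendsto_of_le_of_le tendsto_const_nhds h (fun _ => zero_le) fun s => ?_
  rw [edist_eq_enorm_sub, pconv_eq, pconv_eq, ← integral_sub
    (integrable_mul_of_memLp hk (hv.memLp s)) (integrable_mul_of_memLp hk (hv.memLp s₀))]
  simp_rw [← mul_sub]
  exact enorm_integral_mul_le hk.1 (hv.memLp_sub' s s₀).1

lemma continuous_pconv_sq (k : 𝓢(Plane, ℂ)) (z : Plane) :
    Continuous fun s => pconv k (fun w => v s w * v s w) z := by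
  refine continuous_iff_continuousAt.2 fun s₀ => ?_
  obtain ⟨C, hC⟩ : ∃ C, ∀ x, ‖k x‖ ≤ C := ⟨_, fun x => k.norm_le_seminorm ℝ x⟩
  have hkv : ∀ s, MemLp (fun w => k (z - w) * v s w) 2 volume := fun s =>
    MemLp.of_le_mul (c := C) (hv.memLp s) ((memLp_comp_const_sub k z).1.mul (hv.memLp s).1)
      (ae_of_all _ fun w => by rw [norm_mul]; gcongr; exact hC _)
  have bkv : ∀ s, eLpNorm (fun w => k (z - w) * v s w) 2 volume
      ≤ ENNReal.ofReal C * eLpNorm (v s) 2 volume := fun s =>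
    eLpNorm_le_mul_eLpNorm_of_ae_le_mul (ae_of_all _ fun w => by
      rw [norm_mul]; gcongr; exact hC _) 2
  have ht : ∀ s, eLpNorm (v s) 2 volume ≤
      eLpNorm (fun w => v s w - v s₀ w) 2 volume + eLpNorm (v s₀) 2 volume := fun s => by
    refine le_trans (le_of_eq ?_) (eLpNorm_add_le (hv.memLp_sub' s s₀).1 (hv.memLp s₀).1 (by norm_num))
    congr 1; ext w; simp
  rw [ContinuousAt, tendsto_iff_edist_tendsto_0]
  have h : Tendsto (fun s => (ENNReal.ofReal C * (eLpNorm (fun w => v s w - v s₀ w) 2 volume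
      + eLpNorm (v s₀) 2 volume) + ENNReal.ofReal C * eLpNorm (v s₀) 2 volume) *
      eLpNorm (fun w => v s w - v s₀ w) 2 volume) (𝓝 s₀) (𝓝 0) := by
    have h1 := ENNReal.Tendsto.mul ((ENNReal.Tendsto.const_mul (a := ENNReal.ofReal C)
      ((hv.cont s₀).add_const (eLpNorm (v s₀) 2 volume)) (Or.inr ENNReal.ofReal_ne_top)).add_const
        (ENNReal.ofReal C * eLpNorm (v s₀) 2 volume)) (Or.inr ENNReal.zero_ne_top) (hv.cont s₀)
        (Or.inr (ENNReal.add_lt_top.2 ⟨ENNReal.mul_lt_top ENNReal.ofReal_lt_top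
          (by rw [zero_add]; exact (hv.memLp s₀).2), ENNReal.mul_lt_top ENNReal.ofReal_lt_top
          (hv.memLp s₀).2⟩).ne)
    simpa using h1
  refine tendsto_of_tendsto_of_tendsto_of_le_of_le tendsto_const_nhds h (fun _ => zero_le) fun s => ?_
  have e : ∀ s, ∫ w, k (z - w) * (v s w * v s w) = ∫ w, k (z - w) * v s w * v s w := fun s => by
    simp_rw [mul_assoc]
  have i1 := fun s s' => integrable_mul_of_memLp (hkv s) (hv.memLp s')
  have d := hv.memLp_sub' s s₀
  have e2 : (∫ w, k (z - w) * v s w * v s w) - ∫ w, k (z - w) * v s₀ w * v s₀ w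
      = (∫ w, k (z - w) * v s w * (v s w - v s₀ w)) + ∫ w, k (z - w) * v s₀ w * (v s w - v s₀ w) := by
    rw [← integral_sub (i1 s s) (i1 s₀ s₀), ← integral_add (integrable_mul_of_memLp (hkv s) d)
      (integrable_mul_of_memLp (hkv s₀) d)]
    congr 1; ext w; ring
  rw [edist_eq_enorm_sub, pconv_eq, pconv_eq, e, e, e2, add_mul]
  refine (enorm_add_le _ _).trans (add_le_add ?_ ?_)
  · refine (enorm_integral_mul_le (hkv s).1 d.1).trans ?_
    gcongr
    exact (bkv s).trans (by gcongr; exact ht s)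
  · refine (enorm_integral_mul_le (hkv s₀).1 d.1).trans ?_
    gcongr
    exact bkv s₀

lemma exists_bound (α β : ℝ) : ∃ M : ℝ≥0∞, M ≠ ⊤ ∧ ∀ s ∈ Icc α β, eLpNorm (v s) 2 volume ≤ M := by
  refine (isCompact_Icc (a := α) (b := β)).induction_on
    (p := fun S => ∃ M : ℝ≥0∞, M ≠ ⊤ ∧ ∀ s ∈ S, eLpNorm (v s) 2 volume ≤ M) ?_ ?_ ?_ ?_
  · exact ⟨0, ENNReal.zero_ne_top, by simp⟩
  · rintro S S' h ⟨M, hM, h'⟩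
    exact ⟨M, hM, fun s hs => h' s (h hs)⟩
  · rintro S S' ⟨M, hM, h⟩ ⟨M', hM', h'⟩
    refine ⟨max M M', (max_lt hM.lt_top hM'.lt_top).ne, fun s hs => ?_⟩
    rcases hs with hs | hs
    · exact (h s hs).trans (le_max_left _ _)
    · exact (h' s hs).trans (le_max_right _ _)
  · intro s₀ _
    have h1 : ∀ᶠ s in 𝓝 s₀, eLpNorm (fun z => v s z - v s₀ z) 2 volume < 1 :=
      (hv.cont s₀).eventually_lt_const (by norm_num)
    refine ⟨_, mem_nhdsWithin_of_mem_nhds h1, 1 + eLpNorm (v s₀) 2 volume,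
      (ENNReal.add_lt_top.2 ⟨ENNReal.one_lt_top, (hv.memLp s₀).2⟩).ne, fun s hs => ?_⟩
    calc eLpNorm (v s) 2 volume = eLpNorm (fun z => (v s z - v s₀ z) + v s₀ z) 2 volume := by
          congr 1; ext z; ring
      _ ≤ _ := (eLpNorm_add_le (hv.memLp_sub' s s₀).1 (hv.memLp s₀).1 (by norm_num))
      _ ≤ _ := by gcongr; exact le_of_lt hs

omit hv in
/-- The linear part of the equation, applied to `A`. -/
def linKer (A : 𝓢(Plane, ℂ)) : 𝓢(Plane, ℂ) :=
  ∂_{ex} (∂_{ex} (∂_{ex} (∂_{ex} A))) - ∂_{ey} (∂_{ey} A)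

/-- The time derivative of the convolution of the solution with `∂ₓA`. -/
lemma hasDerivAt_pconv (A : 𝓢(Plane, ℂ)) (z : Plane) {t : ℝ} (ht : t ∈ Ioo (-T) T) :
    HasDerivAt (fun s => pconv (∂_{ex} A : 𝓢(Plane, ℂ)) (v s) z)
      (-pconv (linKer A) (v t) z - 1 / 2 * pconv (∂_{ex} (∂_{ex} A) : 𝓢(Plane, ℂ))
        (fun w => v t w * v t w) z) t := by
  obtain ⟨ψ, hψ⟩ := exists_reflection A z
  have d0 : ∀ w, ψ w = 1 * A (z - w) := fun w => by rw [hψ, one_mul]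
  have d1 := lineDeriv_reflection d0 ex
  have d2 := lineDeriv_reflection d1 ex
  have d3 := lineDeriv_reflection d2 ex
  have d4 := lineDeriv_reflection d3 ex
  have y1 := lineDeriv_reflection d0 ey
  have y2 := lineDeriv_reflection y1 ey
  have h := (hv.eqn ψ t ht).neg
  have e1 : (fun s => pconv (∂_{ex} A : 𝓢(Plane, ℂ)) (v s) z)
      = -fun r => ∫ w, v r w * ∂_{ex} ψ w := by
    ext s
    rw [pconv_eq, Pi.neg_apply, ← integral_neg]
    congr 1; ext w
    rw [d1]; ring
  rw [e1]
  refine h.congr_deriv ?_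
  rw [neg_add, sub_eq_add_neg, pconv_eq, pconv_eq, ← integral_const_mul]
  congr 2
  · congr 1; ext w
    rw [d4, y2]
    have e3 : linKer A (z - w) = (∂_{ex} (∂_{ex} (∂_{ex} (∂_{ex} A))) : 𝓢(Plane, ℂ)) (z - w)
      - (∂_{ey} (∂_{ey} A) : 𝓢(Plane, ℂ)) (z - w) := rfl
    rw [e3]
    ring
  · congr 1; ext w
    rw [d2]
    ring

/-- The linear part does not contribute to the energy. -/
lemma integral_linear {A : 𝓢(Plane, ℂ)} (hA : ∀ ζ, fint A (-ζ) = - fint A ζ) (s : ℝ) :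
    ∫ z, pconv (∂_{ex} A : 𝓢(Plane, ℂ)) (v s) z * pconv (linKer A) (v s) z = 0 := by
  rw [integral_mul_eq (memLp_pconv _ (hv.meas s) (hv.memLp s))
    (memLp_pconv _ (hv.meas s) (hv.memLp s))]
  have f1 := fourierL2_pconv (∂_{ex} A) (hv.meas s) (hv.memLp s)
  have f2 := (Measure.measurePreserving_neg (volume : Measure Plane)).quasiMeasurePreserving.ae
    (fourierL2_pconv (linKer A) (hv.meas s) (hv.memLp s))
  set a : Plane → ℂ := fint (∂_{ex} A : 𝓢(Plane, ℂ))
  set b : Plane → ℂ := fint (linKer A)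
  have inn : ∀ m ζ : Plane, (inner ℝ (-ζ) m : ℝ) = -inner ℝ ζ m := fun m ζ => inner_neg_left _ _
  have ha : ∀ ζ, a (-ζ) = a ζ := fun ζ => by
    simp only [a, fint_lineDeriv, inn, hA]
    push_cast; ring
  have hb : ∀ ζ, b (-ζ) = -b ζ := fun ζ => by
    have e : ∀ ζ, b ζ = fint (∂_{ex} (∂_{ex} (∂_{ex} (∂_{ex} A))) : 𝓢(Plane, ℂ)) ζ
        - fint (∂_{ey} (∂_{ey} A) : 𝓢(Plane, ℂ)) ζ := fun ζ => by
      unfold fint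
      rw [← integral_sub (integrable_phase_mul (SchwartzMap.integrable _) ζ)
        (integrable_phase_mul (SchwartzMap.integrable _) ζ)]
      refine integral_congr_ae (ae_of_all _ fun z => ?_)
      beta_reduce
      rw [← mul_sub]
      rfl
    rw [e, e]
    simp only [fint_lineDeriv, inn, hA]
    push_cast; ring
  have e : ∫ ζ, fourierL2 (pconv (∂_{ex} A : 𝓢(Plane, ℂ)) (v s)) ζ *
      fourierL2 (pconv (linKer A) (v s)) (-ζ)
      = ∫ ζ, a ζ * b (-ζ) * (fourierL2 (v s) ζ * fourierL2 (v s) (-ζ)) := by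
    refine integral_congr_ae ?_
    filter_upwards [f1, f2] with ζ h1 h2
    rw [h1, h2]; ring
  rw [e]
  -- The symbol of `∂ₓA` is even, and that of `linKer A` is odd because it involves an even number
  -- of derivatives of `A`. The integrand is therefore odd.
  have odd : ∫ ζ, a ζ * b (-ζ) * (fourierL2 (v s) ζ * fourierL2 (v s) (-ζ))
      = -∫ ζ, a ζ * b (-ζ) * (fourierL2 (v s) ζ * fourierL2 (v s) (-ζ)) := by
    conv_lhs => rw [← integral_neg_eq_self]
    rw [← integral_neg]
    congr 1; ext ζ
    rw [ha, neg_neg, hb]; ring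
  rw [self_eq_neg.1 odd, mul_zero]

/-- The energy identity for the frequency-localized solution. -/
lemma energy_identity {A : 𝓢(Plane, ℂ)} (hA : ∀ ζ, fint A (-ζ) = - fint A ζ) {α β : ℝ}
    (hα : -T ≤ α) (hαβ : α ≤ β) (hβ : β ≤ T) :
    (∫ z, pconv (∂_{ex} A : 𝓢(Plane, ℂ)) (v β) z * pconv (∂_{ex} A : 𝓢(Plane, ℂ)) (v β) z)
      - ∫ z, pconv (∂_{ex} A : 𝓢(Plane, ℂ)) (v α) z * pconv (∂_{ex} A : 𝓢(Plane, ℂ)) (v α) z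
    = -∫ s in Icc α β, ∫ z, v s z * v s z *
        pconv (fun r => (∂_{ex} (∂_{ex} A) : 𝓢(Plane, ℂ)) (-r))
          (pconv (∂_{ex} A : 𝓢(Plane, ℂ)) (v s)) z := by
  set a : 𝓢(Plane, ℂ) := ∂_{ex} A
  set b : 𝓢(Plane, ℂ) := linKer A
  set c : 𝓢(Plane, ℂ) := ∂_{ex} a
  set w : ℝ → Plane → ℂ := fun s => pconv a (v s) with hw
  set q : ℝ → Plane → ℂ := fun s z => v s z * v s z with hq
  set wp : ℝ → Plane → ℂ := fun s z => -pconv b (v s) z - 1 / 2 * pconv c (q s) z with hwp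
  have mq : ∀ s, Measurable (q s) := fun s => (hv.meas s).mul (hv.meas s)
  have mw : ∀ s, Measurable (w s) := fun s => measurable_pconv a (hv.meas s)
  have mwp : ∀ s, Measurable (wp s) := fun s =>
    (measurable_pconv b (hv.meas s)).neg.sub ((measurable_pconv c (mq s)).const_mul _)
  have w2 : ∀ s, MemLp (w s) 2 volume := fun s => memLp_pconv a (hv.meas s) (hv.memLp s)
  have q1 : ∀ s, ∫⁻ z, ‖q s z‖ₑ ≤ eLpNorm (v s) 2 volume * eLpNorm (v s) 2 volume := fun s =>
    eLpNorm_mul_le_one (hv.memLp s).1 (hv.memLp s).1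
  have cw : ∀ z, Continuous fun s => w s z := fun z => hv.continuous_pconv a z
  have cwp : ∀ z, Continuous fun s => wp s z := fun z =>
    (hv.continuous_pconv b z).neg.sub (continuous_const.mul (hv.continuous_pconv_sq c z))
  have cq2 : ∀ s, MemLp (pconv c (q s)) 2 volume := fun s =>
    ⟨(measurable_pconv c (mq s)).aestronglyMeasurable, (eLpNorm_pconv_le' c (mq s)).trans_lt
      (ENNReal.mul_lt_top ((q1 s).trans_lt (ENNReal.mul_lt_top (hv.memLp s).2 (hv.memLp s).2))
        (memLp_schwartz c).2)⟩
  have b2 : ∀ s, MemLp (pconv b (v s)) 2 volume := fun s => memLp_pconv b (hv.meas s) (hv.memLp s)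
  obtain ⟨N, hN, hNs⟩ := hv.exists_bound α β
  -- The fundamental theorem of calculus is used pointwise in space. The equation holds only at
  -- interior times; continuity of the convolutions in time includes the endpoints.
  have ftc : ∀ z, w β z * w β z - w α z * w α z = ∫ s in Icc α β, 2 * (w s z * wp s z) := by
    intro z
    rw [integral_Icc_eq_integral_Ioc, ← intervalIntegral.integral_of_le hαβ]
    refine (intervalIntegral.integral_eq_sub_of_hasDerivAt_of_le hαβ
      (f := fun s => w s z * w s z) ((cw z).mul (cw z)).continuousOn (fun s hs => ?_)
      (Continuous.intervalIntegrable (u := fun s => 2 * (w s z * wp s z))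
        (continuous_const.mul ((cw z).mul (cwp z))) _ _)).symm
    have hd := hv.hasDerivAt_pconv A z (t := s) ⟨hα.trans_lt hs.1, hs.2.trans_le hβ⟩
    refine (hd.mul hd).congr_deriv ?_
    change wp s z * w s z + w s z * wp s z = 2 * (w s z * wp s z)
    ring
  have mjw : Measurable (Function.uncurry w) := measurable_uncurry_of_continuous_of_measurable cw mw
  have mjwp : Measurable (Function.uncurry wp) :=
    measurable_uncurry_of_continuous_of_measurable cwp mwp
  have mj : Measurable fun p : ℝ × Plane => 2 * (w p.1 p.2 * wp p.1 p.2) :=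
    (mjw.mul mjwp).const_mul 2
  have wpb : ∀ s, eLpNorm (wp s) 2 volume ≤ (∫⁻ r, ‖b r‖ₑ) * eLpNorm (v s) 2 volume +
      eLpNorm (v s) 2 volume * eLpNorm (v s) 2 volume * eLpNorm c 2 volume := by
    intro s
    refine (eLpNorm_sub_le (b2 s).neg.1 ((cq2 s).const_mul (1 / 2)).1 (by norm_num)).trans ?_
    refine add_le_add ?_ ?_
    · rw [eLpNorm_neg]; exact eLpNorm_pconv_le b (hv.meas s)
    · calc _ ≤ eLpNorm (pconv c (q s)) 2 volume := by
            refine eLpNorm_mono fun z => ?_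
            rw [norm_mul]
            refine mul_le_of_le_one_left (norm_nonneg _) ?_
            norm_num
        _ ≤ _ := (eLpNorm_pconv_le' c (mq s)).trans (by gcongr; exact q1 s)
  -- The bound `N` on the L² norms over the compact time interval supplies the integrability needed
  -- to exchange time and space.
  have int : Integrable (fun p : ℝ × Plane => 2 * (w p.1 p.2 * wp p.1 p.2))
      ((volume.restrict (Icc α β)).prod volume) := by
    refine ⟨mj.aestronglyMeasurable, ?_⟩
    unfold HasFiniteIntegral
    rw [lintegral_prod _ mj.enorm.aemeasurable]
    set D : ℝ≥0∞ := 2 * ((∫⁻ r, ‖a r‖ₑ) * N * ((∫⁻ r, ‖b r‖ₑ) * N + N * N * eLpNorm c 2 volume))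
    have hD : D < ⊤ := by
      have h1 : ∫⁻ r, ‖a r‖ₑ < ⊤ := a.integrable.2
      have h2 : ∫⁻ r, ‖b r‖ₑ < ⊤ := b.integrable.2
      have h3 := (memLp_schwartz c).2
      exact ENNReal.mul_lt_top (by norm_num) (ENNReal.mul_lt_top (ENNReal.mul_lt_top h1 hN.lt_top)
        (ENNReal.add_lt_top.2 ⟨ENNReal.mul_lt_top h2 hN.lt_top, ENNReal.mul_lt_top
          (ENNReal.mul_lt_top hN.lt_top hN.lt_top) h3⟩))
    calc _ ≤ ∫⁻ s in Icc α β, D := by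
          refine setLIntegral_mono measurable_const fun s hs => ?_
          have e : ∀ z, ‖2 * (w s z * wp s z)‖ₑ = 2 * ‖w s z * wp s z‖ₑ := fun z => by
            rw [enorm_mul]; congr 1
            rw [← ofReal_norm]; norm_num
          simp only [e]
          rw [lintegral_const_mul' _ _ (by norm_num)]
          refine mul_le_mul_right ?_ _
          refine (eLpNorm_mul_le_one (mw s).aestronglyMeasurable (mwp s).aestronglyMeasurable).trans ?_
          gcongr
          · exact (eLpNorm_pconv_le a (hv.meas s)).trans (by gcongr; exact hNs s hs)
          · exact (wpb s).trans (by gcongr <;> exact hNs s hs)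
      _ < ⊤ := by
          rw [setLIntegral_const]
          exact ENNReal.mul_lt_top hD (by simp)
  rw [← integral_sub (integrable_mul_of_memLp (w2 β) (w2 β)) (integrable_mul_of_memLp (w2 α) (w2 α))]
  change ∫ z, (w β z * w β z - w α z * w α z) = _
  simp_rw [ftc]
  rw [← integral_integral_swap int, ← integral_neg]
  congr 1; ext s
  have i1 := integrable_mul_of_memLp (w2 s) (b2 s)
  have i2 := integrable_mul_of_memLp (w2 s) (cq2 s)
  have e1 : ∫ z, 2 * (w s z * wp s z) = -2 * (∫ z, w s z * pconv b (v s) z)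
      - ∫ z, w s z * pconv c (q s) z := by
    rw [← integral_const_mul, ← integral_sub (i1.const_mul _) i2]
    congr 1; ext z
    simp only [hwp]; ring
  rw [e1, hv.integral_linear hA s, integral_mul_pconv c (mw s) (mq s) (w2 s) (hv.integrable_sq s)]
  simp only [mul_zero, zero_sub]
  rfl

end IsSolutionPath

end

section

/-! ### The energy identity in the limit -/

/-- The inclusion of the plane into space-time. -/
def incl (r : Plane) : SpaceTime := !₂[r 0, r 1, 0]

lemma measurable_incl : Measurable incl := by unfold incl; fun_prop

lemma cvSymbol_incl (k : Plane → ℂ) (ζ : SpaceTime) :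
    cvSymbol volume k incl ζ = fint k !₂[ζ 0, ζ 1] := by
  unfold cvSymbol fint phase
  congr 1; ext r
  rw [mul_comm]
  congr 4
  simp [incl, PiLp.inner_apply, Fin.sum_univ_three, Fin.sum_univ_two]

lemma cv_incl_slice (k : Plane → ℂ) (V : SpaceTime → ℂ) (z : Plane) (t : ℝ) :
    cv volume k incl V (stEquiv (z, t)) = pconv k (fun z => V (stEquiv (z, t))) z := by
  unfold pconv cv
  congr 1; ext r
  have : stEquiv (z, t) - incl r = stEquiv (z - id r, t) := by
    ext i
    fin_cases i <;> simp [incl]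
  rw [this]

lemma integral_st {f : SpaceTime → ℂ} (hf : Integrable f) :
    ∫ p, f p = ∫ t : ℝ, ∫ z : Plane, f (stEquiv (z, t)) := by
  rw [← measurePreserving_stEquiv.integral_comp' f]
  exact integral_prod_symm _ ((measurePreserving_stEquiv.integrable_comp_emb
    stEquiv.measurableEmbedding).2 hf)

variable {η₀ : ℝ → ℝ} {T : ℝ} {v : ℝ → Plane → ℂ}

/-- The energy at frequency about `2^k`. -/
def energy (η₀ : ℝ → ℝ) (k : ℕ) (φ : Plane → ℂ) : ℝ :=
  ∫ ζ : Plane, bump η₀ (ζ 0 / 2 ^ k) ^ 2 * ‖fourierL2 φ ζ‖ ^ 2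

lemma integral_sq_pconv (hη : IsCutoff η₀) (hv : IsSolutionPath T v) {k : ℕ} {M : ℝ}
    {a : 𝓢(Plane, ℂ)} (ha : ∀ ζ, fint a ζ = kap η₀ k M ζ) (s : ℝ) :
    ∫ z, pconv a (v s) z * pconv a (v s) z =
      (cpi 2 : ℂ)⁻¹ * ((∫ ζ : Plane, kap η₀ k M ζ ^ 2 * ‖fourierL2 (v s) ζ‖ ^ 2 : ℝ) : ℂ) := by
  rw [integral_mul_eq (memLp_pconv _ (hv.meas s) (hv.memLp s))
    (memLp_pconv _ (hv.meas s) (hv.memLp s))]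
  congr 1
  refine Eq.trans ?_ integral_complex_ofReal
  have f1 := fourierL2_pconv a (hv.meas s) (hv.memLp s)
  have f2 := (Measure.measurePreserving_neg (volume : Measure Plane)).quasiMeasurePreserving.ae f1
  refine integral_congr_ae ?_
  filter_upwards [f1, f2, fourierL2_real (hv.memLp s) (hv.real s)] with ζ h1 h2 h3
  rw [h1, h2, h3, ha, ha, kap_neg hη]
  push_cast
  rw [← Complex.mul_conj']
  ring

lemma abs_kap_le (hη : IsCutoff η₀) (k : ℕ) (M : ℝ) (ζ : Plane) :
    kap η₀ k M ζ ^ 2 ≤ bump η₀ (ζ 0 / 2 ^ k) ^ 2 := by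
  have h := hη.mem_Icc (ζ 1 / M)
  unfold kap
  rw [mul_pow]
  exact mul_le_of_le_one_right (sq_nonneg _) (pow_le_one₀ h.1 h.2)

lemma tendsto_kap (hη : IsCutoff η₀) (k : ℕ) (ζ : Plane) :
    Tendsto (fun n : ℕ => kap η₀ k (n + 1) ζ) atTop (𝓝 (bump η₀ (ζ 0 / 2 ^ k))) := by
  have h1 : Tendsto (fun n : ℕ => ζ 1 * (1 / ((n : ℝ) + 1))) atTop (𝓝 (ζ 1 * 0)) :=
    tendsto_one_div_add_atTop_nhds_zero_nat.const_mul _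
  rw [mul_zero] at h1
  have h2 := (hη.smooth.continuous.tendsto 0).comp h1
  rw [hη.eq_one 0 (by norm_num)] at h2
  have h3 := h2.const_mul (bump η₀ (ζ 0 / 2 ^ k))
  rw [mul_one] at h3
  refine h3.congr fun n => ?_
  simp only [kap, Function.comp]
  congr 2
  ring

lemma measurable_bump_freq (hη : IsCutoff η₀) (k : ℕ) :
    Measurable fun ζ : Plane => bump η₀ (ζ 0 / 2 ^ k) :=
  (bump_contDiff hη).continuous.measurable.comp (by fun_prop)

lemma integrable_energy (hη : IsCutoff η₀) (k : ℕ) (φ : Plane → ℂ) :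
    Integrable fun ζ : Plane => bump η₀ (ζ 0 / 2 ^ k) ^ 2 * ‖fourierL2 φ ζ‖ ^ 2 := by
  have h := (memLp_fourierL2 φ).integrable_norm_pow (by norm_num)
  have h' : Integrable fun ζ => ‖fourierL2 φ ζ‖ ^ 2 := by simpa using h
  refine h'.bdd_mul (c := 1) ((measurable_bump_freq hη k).pow_const 2).aestronglyMeasurable
    (ae_of_all _ fun ζ => ?_)
  rw [norm_pow, Real.norm_eq_abs]
  exact pow_le_one₀ (abs_nonneg _) (abs_bump_le hη _)

lemma tendsto_energy (hη : IsCutoff η₀) (k : ℕ) (φ : Plane → ℂ) :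
    Tendsto (fun n : ℕ => ∫ ζ : Plane, kap η₀ k (n + 1) ζ ^ 2 * ‖fourierL2 φ ζ‖ ^ 2) atTop
      (𝓝 (energy η₀ k φ)) := by
  refine tendsto_integral_of_dominated_convergence _ (fun n => ?_) (integrable_energy hη k φ)
    (fun n => ae_of_all _ fun ζ => ?_) (ae_of_all _ fun ζ => ?_)
  · refine Measurable.aestronglyMeasurable ?_
    refine Measurable.mul (Measurable.pow_const ?_ 2) ((measurable_fourierL2 φ).norm.pow_const 2)
    exact (measurable_bump_freq hη k).mul (hη.measurable.comp (by fun_prop))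
  · rw [Real.norm_of_nonneg (by positivity)]
    exact mul_le_mul_of_nonneg_right (abs_kap_le hη k _ ζ) (by positivity)
  · exact ((tendsto_kap hη k ζ).pow 2).mul_const _

/-- The energy identity holds with a cutoff in `μ`, and the multiplier in its cubic term is then
`-iξ · kap²`. As the cutoff is removed this converges to `-i · hsym`, a bounded symbol depending on
`ξ` alone. Since `V` agrees with the solution on `[α, β]` and vanishes outside, the time integral
becomes one over space-time. -/
lemma energy_sub_eq (hη : IsCutoff η₀) (hv : IsSolutionPath T v) {K : ℝ → ℂ} (hK : Measurable K)
    (hKi : Integrable K) {k : ℕ} (hKs : ∀ ξ, ksym K ξ = (hsym η₀ k ξ : ℂ)) {α β : ℝ} (hα : -T ≤ α)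
    (hαβ : α ≤ β) (hβ : β ≤ T) {V : SpaceTime → ℂ} (mV : Measurable V) (V2 : MemLp V 2 volume)
    (VV : MemLp (fun p => V p * V p) 2 volume)
    (hin : ∀ᵐ t : ℝ, t ∈ Icc α β → (fun z => V (stEquiv (z, t))) =ᵐ[volume] v t)
    (hout : ∀ᵐ t : ℝ, t ∉ Icc α β → (fun z => V (stEquiv (z, t))) =ᵐ[volume] 0) :
    (cpi 2 : ℂ)⁻¹ * ((energy η₀ k (v β) - energy η₀ k (v α) : ℝ) : ℂ)
      = Complex.I * ∫ p, V p * V p * dop3 K V p := by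
  -- Here the cutoff in `μ` is at scale `n + 1`. The symbol of `Q` has one factor `kap` from each of
  -- the two convolutions in the energy identity.
  have step : ∀ n : ℕ, ∃ Q : SpaceTime → ℂ, MemLp Q 2 volume ∧
      (fourierL2 Q =ᵐ[volume] fun ζ =>
        -Complex.I * ζ 0 * (kap η₀ k (n + 1) !₂[ζ 0, ζ 1] : ℂ) ^ 2 * fourierL2 V ζ) ∧
      (cpi 2 : ℂ)⁻¹ * (((∫ ζ : Plane, kap η₀ k (n + 1) ζ ^ 2 * ‖fourierL2 (v β) ζ‖ ^ 2) -
        ∫ ζ : Plane, kap η₀ k (n + 1) ζ ^ 2 * ‖fourierL2 (v α) ζ‖ ^ 2 : ℝ) : ℂ)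
        = -∫ p, Q p * (V p * V p) := by
    intro n
    obtain ⟨A, hA, hA'⟩ := exists_energy_kernel hη k (M := (n : ℝ) + 1) (by positivity)
    set a : 𝓢(Plane, ℂ) := ∂_{ex} A with ha
    obtain ⟨c, hc⟩ := exists_reflection (∂_{ex} a) 0
    have hc' : (fun r => (∂_{ex} a : 𝓢(Plane, ℂ)) (-r)) = c := by
      ext r; rw [hc, zero_sub]
    have iex : ∀ ζ : Plane, inner ℝ ζ ex = ζ 0 := fun ζ => by
      simp [ex, PiLp.inner_apply, Fin.sum_univ_two]
    have sa : ∀ ζ, fint a ζ = kap η₀ k (n + 1) ζ := fun ζ => by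
      rw [ha, fint_lineDeriv, iex, hA']
    have sc : ∀ ζ : Plane, fint c ζ = -Complex.I * ζ 0 * kap η₀ k (n + 1) ζ := fun ζ => by
      have : fint c ζ = fint (∂_{ex} a : 𝓢(Plane, ℂ)) (-ζ) := by
        rw [← hc']
        unfold fint
        rw [← integral_neg_eq_self]
        congr 1; ext r
        simp only [neg_neg, phase_neg_right]
      rw [this, fint_lineDeriv, iex, sa, kap_neg hη]
      simp
    have mc := c.continuous.measurable
    have ma := a.continuous.measurable
    set W : SpaceTime → ℂ := cv volume a incl V with hW
    have mW : Measurable W := (stronglyMeasurable_cv ma measurable_incl mV).measurable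
    have W2 : MemLp W 2 volume := memLp_cv ma a.integrable measurable_incl mV V2
    set Q : SpaceTime → ℂ := cv volume c incl W with hQ
    have Q2 : MemLp Q 2 volume := memLp_cv mc c.integrable measurable_incl mW W2
    refine ⟨Q, Q2, ?_, ?_⟩
    · filter_upwards [fourierL2_cv (ν := volume) mc c.integrable measurable_incl mW W2,
        fourierL2_cv (ν := volume) ma a.integrable measurable_incl mV V2] with ζ h1 h2
      rw [h1, h2, cvSymbol_incl, cvSymbol_incl, sa, sc]
      simp only [Matrix.cons_val_zero]
      ring
    · have h1 := hv.energy_identity hA hα hαβ hβ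
      rw [integral_sq_pconv hη hv sa, integral_sq_pconv hη hv sa, ← mul_sub, ← Complex.ofReal_sub,
        hc'] at h1
      rw [h1, integral_st (integrable_mul_of_memLp Q2 VV),
        ← integral_indicator measurableSet_Icc]
      congr 1
      refine integral_congr_ae ?_
      filter_upwards [hin, hout] with t h2 h3
      by_cases ht : t ∈ Icc α β
      · rw [indicator_of_mem ht]
        refine integral_congr_ae ?_
        have e : ∀ z, Q (stEquiv (z, t)) = pconv c (pconv a (v t)) z := fun z => by
          rw [hQ, cv_incl_slice]
          simp only [hW, cv_incl_slice]
          rw [pconv_congr (h2 ht)]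
        filter_upwards [h2 ht] with z hz
        rw [e, hz, mul_comm]
      · rw [indicator_of_notMem ht]
        symm
        refine integral_eq_zero_of_ae ?_
        filter_upwards [h3 ht] with z hz
        simp only [hz]
        simp
  choose Q Q2 QF hQ using step
  have D2 := memLp_dop3 hK hKi mV V2
  -- The compact support of the bump bounds both symbols by `2 · 2 ^ k`, so the transforms converge
  -- by domination.
  have lim1 : Tendsto (fun n => eLpNorm (fun p => Q n p - -Complex.I * dop3 K V p) 2 volume) atTop
      (𝓝 0) := by
    refine tendsto_of_fourierL2 Q2 (D2.const_mul _) ?_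
    have mF := measurable_fourierL2 V
    refine tendsto_eLpNorm_of_dominated (g := fun ζ => ENNReal.ofReal (4 * 2 ^ k) * ‖fourierL2 V ζ‖ₑ)
      (fun n => (memLp_fourierL2 _).1) (memLp_fourierL2 _).1 ?_ (fun n => ?_) ?_
    · simp_rw [mul_pow]
      rw [lintegral_const_mul' _ _ (by finiteness), ← eLpNorm_two_sq]
      exact ENNReal.mul_ne_top (by finiteness) (ENNReal.pow_ne_top (memLp_fourierL2 V).2.ne)
    · filter_upwards [QF n, fourierL2_const_mul D2 (-Complex.I), fourierL2_dop3 hK hKi mV V2]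
        with ζ h1 h2 h3
      rw [h1, h2, h3, hKs]
      have e : -Complex.I * ζ 0 * (kap η₀ k (n + 1) !₂[ζ 0, ζ 1] : ℂ) ^ 2 * fourierL2 V ζ
          - -Complex.I * ((hsym η₀ k (ζ 0) : ℂ) * fourierL2 V ζ)
          = Complex.I * ((hsym η₀ k (ζ 0) - ζ 0 * kap η₀ k (n + 1) !₂[ζ 0, ζ 1] ^ 2 : ℝ) : ℂ) *
            fourierL2 V ζ := by push_cast; ring
      rw [e, enorm_mul]
      gcongr
      rw [← ofReal_norm, norm_mul, Complex.norm_I, one_mul, Complex.norm_real]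
      refine ENNReal.ofReal_le_ofReal ((norm_sub_le _ _).trans ?_)
      have h4 := abs_hsym_le hη k (ζ 0)
      have h5 : |ζ 0 * kap η₀ k (n + 1) !₂[ζ 0, ζ 1] ^ 2| ≤ |hsym η₀ k (ζ 0)| := by
        unfold hsym
        rw [abs_mul, abs_mul, abs_of_nonneg (sq_nonneg (kap _ _ _ _)),
          abs_of_nonneg (sq_nonneg (bump _ _))]
        exact mul_le_mul_of_nonneg_left (abs_kap_le hη k _ _) (abs_nonneg _)
      rw [Real.norm_eq_abs, Real.norm_eq_abs]
      linarith
    · filter_upwards [ae_all_iff.2 QF, fourierL2_const_mul D2 (-Complex.I),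
        fourierL2_dop3 hK hKi mV V2] with ζ h1 h2 h3
      simp only [h1, h2, h3, hKs]
      have h4 := tendsto_kap hη k !₂[ζ 0, ζ 1]
      have h5 := ((((Complex.continuous_ofReal.tendsto _).comp h4).pow 2).const_mul
        (-Complex.I * (ζ 0 : ℂ))).mul_const (fourierL2 V ζ)
      refine (h5.congr fun n => rfl).trans (le_of_eq ?_)
      simp only [hsym, Matrix.cons_val_zero]
      congr 1
      push_cast; ring
  have lim2 := (tendsto_integral_mul Q2 (D2.const_mul _) VV lim1).neg
  have lim3 : Tendsto (fun n : ℕ => (cpi 2 : ℂ)⁻¹ * (((∫ ζ : Plane, kap η₀ k (n + 1) ζ ^ 2 *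
      ‖fourierL2 (v β) ζ‖ ^ 2) - ∫ ζ : Plane, kap η₀ k (n + 1) ζ ^ 2 * ‖fourierL2 (v α) ζ‖ ^ 2 : ℝ)
      : ℂ)) atTop (𝓝 ((cpi 2 : ℂ)⁻¹ * ((energy η₀ k (v β) - energy η₀ k (v α) : ℝ) : ℂ))) :=
    ((Complex.continuous_ofReal.tendsto _).comp
      ((tendsto_energy hη k (v β)).sub (tendsto_energy hη k (v α)))).const_mul _
  rw [tendsto_nhds_unique (lim3.congr hQ) lim2, ← integral_neg, ← integral_const_mul]
  congr 1; ext p; ring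

end

section

/-! ### From the solution to a path and to space-time extensions -/

lemma HNorm_zero (φ : Plane → ℂ) : HNorm 0 0 φ = eLpNorm (fourierL2 φ) 2 volume := by
  unfold HNorm
  congr 1; ext ζ
  simp

/-- Measurable representatives are chosen, and the path is extended beyond `[-T, T]` by its endpoint
values. It is then continuous at every real time, and nothing changes on the open interval where the
equation is tested. -/
lemma exists_solutionPath {T : ℝ} (hT : 0 < T) {u : ℝ → Plane → ℝ} (hu : IsHInfPath T u)
    (hsol : IsKPISolution T u) :
    ∃ v, IsSolutionPath T v ∧ ∀ s ∈ Icc (-T) T, v s =ᵐ[volume] toC u s := by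
  have hTT : -T ≤ T := by linarith
  have h0 : ∀ s ∈ Icc (-T) T, ∃ g : Plane → ℝ, Measurable g ∧ g =ᵐ[volume] u s := fun s hs =>
    ⟨(hu.1 s hs).1.mk _, (hu.1 s hs).1.stronglyMeasurable_mk.measurable, (hu.1 s hs).1.ae_eq_mk.symm⟩
  choose! g mg hg using h0
  set r : ℝ → ℝ := fun s => projIcc (-T) T hTT s with hr
  have rm : ∀ s, r s ∈ Icc (-T) T := fun s => (projIcc (-T) T hTT s).2
  have re : ∀ s ∈ Icc (-T) T, r s = s := fun s hs => by simp only [hr, projIcc_of_mem hTT hs]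
  have rc : Continuous r := continuous_subtype_val.comp continuous_projIcc
  have hgc : ∀ s ∈ Icc (-T) T, (fun z => (g s z : ℂ)) =ᵐ[volume] toC u s := fun s hs => by
    filter_upwards [hg s hs] with z hz
    simp only [toC, hz]
  have uc : ∀ s ∈ Icc (-T) T, MemLp (toC u s) 2 volume := fun s hs => (hu.1 s hs).ofReal
  set v : ℝ → Plane → ℂ := fun s z => (g (r s) z : ℂ) with hv
  have v2 : ∀ s, MemLp (v s) 2 volume := fun s =>
    (memLp_congr_ae (hgc _ (rm s))).2 (uc _ (rm s))
  have ve : ∀ s ∈ Icc (-T) T, v s =ᵐ[volume] toC u s := fun s hs => by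
    have := hgc _ (rm s)
    rw [re s hs] at this
    simpa only [hv, re s hs] using this
  refine ⟨v, ⟨fun s => Complex.measurable_ofReal.comp (mg _ (rm s)), v2,
    fun s z => Complex.conj_ofReal _, fun s₀ => ?_, fun ψ t ht => ?_⟩, ve⟩
  · have h1 := (hu.2 0 le_rfl).2 (r s₀) (rm s₀)
    have h2 : Tendsto r (𝓝 s₀) (𝓝[Icc (-T) T] (r s₀)) :=
      tendsto_nhdsWithin_of_tendsto_nhds_of_eventually_within _ (rc.tendsto s₀)
        (Eventually.of_forall rm)
    have h3 := h1.comp h2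
    have hc0 : ENNReal.ofReal (cpi 2) ^ (1 / 2 : ℝ) ≠ 0 := by simp [cpi_pos]
    have hct : ENNReal.ofReal (cpi 2) ^ (1 / 2 : ℝ) ≠ ⊤ :=
      ENNReal.rpow_ne_top_of_nonneg (by norm_num) ENNReal.ofReal_ne_top
    have e : ∀ s, eLpNorm (fun z => v s z - v s₀ z) 2 volume
        = (ENNReal.ofReal (cpi 2) ^ (1 / 2 : ℝ))⁻¹ *
          HNorm 0 0 (fun z => toC u (r s) z - toC u (r s₀) z) := fun s => by
      rw [HNorm_zero, eLpNorm_fourierL2 (memLp_sub (uc _ (rm s)) (uc _ (rm s₀))), ← mul_assoc,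
        ENNReal.inv_mul_cancel hc0 hct, one_mul]
      refine eLpNorm_congr_ae ?_
      filter_upwards [hgc _ (rm s), hgc _ (rm s₀)] with z h4 h5
      simp only [hv, ← h4, ← h5]
    simp_rw [e]
    have h4 := ENNReal.Tendsto.const_mul (a := (ENNReal.ofReal (cpi 2) ^ (1 / 2 : ℝ))⁻¹) h3
      (Or.inr (ENNReal.inv_ne_top.2 hc0))
    rwa [mul_zero] at h4
  · have h1 := hsol ψ t ht
    have ht' : t ∈ Icc (-T) T := Ioo_subset_Icc_self ht
    have h2 : (fun s => ∫ z, v s z * ∂_{ex} ψ z) =ᶠ[𝓝 t] fun s => ∫ z, toC u s z * ∂_{ex} ψ z := by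
      filter_upwards [Ioo_mem_nhds ht.1 ht.2] with s hs
      refine integral_congr_ae ?_
      filter_upwards [ve s (Ioo_subset_Icc_self hs)] with z hz
      rw [hz]
    refine (h1.congr_of_eventuallyEq h2).congr_deriv ?_
    congr 1
    · refine integral_congr_ae ?_
      filter_upwards [ve t ht'] with z hz
      rw [hz]
    · refine integral_congr_ae ?_
      filter_upwards [ve t ht'] with z hz
      rw [hz]

lemma ae_slice {R : SpaceTime → Prop} (h : ∀ᵐ p, R p) :
    ∀ᵐ t : ℝ, ∀ᵐ z : Plane, R (stEquiv (z, t)) := by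
  have h1 := measurePreserving_stEquiv.quasiMeasurePreserving.ae h
  have h2 := (Measure.measurePreserving_swap (μ := (volume : Measure ℝ))
    (ν := (volume : Measure Plane))).quasiMeasurePreserving.ae h1
  exact Measure.ae_ae_of_ae_prod h2

/-- The infimum over extensions need not be attained, which is why a positive excess is allowed. -/
lemma exists_extension {η₀ : ℝ → ℝ} {k : ℕ} {T : ℝ} {f : ℝ → Plane → ℂ}
    (h : FkTNorm η₀ k T f ≠ ⊤) {δ : ℝ≥0∞} (hδ : δ ≠ 0) :
    ∃ F, Measurable F ∧ IsFkLocalized k F ∧ IsExtension T f F ∧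
      FkNorm η₀ k F ≤ FkTNorm η₀ k T f + δ := by
  have h1 : FkTNorm η₀ k T f < FkTNorm η₀ k T f + δ := ENNReal.lt_add_right h hδ
  conv_lhs at h1 => unfold FkTNorm
  obtain ⟨F, hF⟩ := iInf_lt_iff.1 h1
  obtain ⟨l, hF⟩ := iInf_lt_iff.1 hF
  obtain ⟨e, hF⟩ := iInf_lt_iff.1 hF
  have ha : F =ᵐ[volume] l.1.1.mk F := l.1.1.ae_eq_mk
  refine ⟨l.1.1.mk F, l.1.1.stronglyMeasurable_mk.measurable, ⟨(memLp_congr_ae ha).1 l.1, ?_⟩, ?_, ?_⟩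
  · rw [← fourierL2_congr ha]; exact l.2
  · filter_upwards [e, ae_slice ha] with t h2 h3 ht
    refine EventuallyEq.trans ?_ (h2 ht)
    filter_upwards [h3] with z hz
    rw [stEquiv_apply] at hz
    exact hz.symm
  · refine le_trans (le_of_eq ?_) hF.le
    unfold FkNorm
    congr 1; ext tk
    congr 1
    refine fourierL2_congr ?_
    filter_upwards [ha] with p hp
    rw [hp]

/-! ### The Littlewood-Paley decomposition -/

/-- The bands tile the line because `3/2 · 2 ^ k = 3/4 · 2 ^ (k + 1)`. The band of `ξ` is the first
one whose upper end exceeds `|ξ|`. -/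
lemma exists_band (ξ : ℝ) : ∃ k, ∀ j, ξ ∈ freqBand j ↔ j = k := by
  have hex : ∃ k : ℕ, |ξ| < 3 / 2 * 2 ^ k := by
    obtain ⟨k, hk⟩ := pow_unbounded_of_one_lt |ξ| (by norm_num : (1 : ℝ) < 2)
    exact ⟨k, by linarith [abs_nonneg ξ]⟩
  have hband : ∀ j, ξ ∈ freqBand j ↔ |ξ| < 3 / 2 * 2 ^ j ∧ (j ≠ 0 → 3 / 4 * 2 ^ j ≤ |ξ|) := by
    intro j
    unfold freqBand
    split_ifs with h
    · simp [h]
    · simp [h, and_comm]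
  refine ⟨Nat.find hex, fun j => ?_⟩
  rw [hband]
  constructor
  · rintro ⟨h1, h2⟩
    refine le_antisymm ?_ (Nat.find_min' hex h1)
    by_contra! hlt
    have h3 := h2 (by omega)
    have h4 := Nat.find_spec hex
    have h5 : (2 : ℝ) ^ (Nat.find hex + 1) ≤ 2 ^ j := pow_le_pow_right₀ (by norm_num) hlt
    rw [pow_succ] at h5
    linarith
  · rintro rfl
    refine ⟨Nat.find_spec hex, fun h => ?_⟩
    obtain ⟨m, hm⟩ := Nat.exists_eq_succ_of_ne_zero h
    have := Nat.find_min hex (m := m) (by omega)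
    rw [hm, Nat.succ_eq_add_one, pow_succ]
    linarith

lemma measurableSet_freqBand (k : ℕ) : MeasurableSet {ζ : Plane | ζ 0 ∈ freqBand k} := by
  have m : Measurable fun ζ : Plane => |ζ 0| := by fun_prop
  unfold freqBand
  split_ifs
  · exact measurableSet_lt m measurable_const
  · exact (measurableSet_le measurable_const m).inter (measurableSet_lt m measurable_const)

lemma memLp_band (k : ℕ) (φ : Plane → ℂ) :
    MemLp ({ζ : Plane | ζ 0 ∈ freqBand k}.indicator (fourierL2 φ)) 2 volume :=
  (memLp_fourierL2 φ).indicator (measurableSet_freqBand k)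

lemma memLp_P (k : ℕ) (φ : Plane → ℂ) : MemLp (P k φ) 2 volume := memLp_invFourierL2 (memLp_band k φ)

lemma fourierL2_P (k : ℕ) (φ : Plane → ℂ) :
    fourierL2 (P k φ) =ᵐ[volume] {ζ : Plane | ζ 0 ∈ freqBand k}.indicator (fourierL2 φ) :=
  fourierL2_invFourierL2 (memLp_band k φ)

lemma tendsto_sum_P {φ : Plane → ℂ} (hφ : MemLp φ 2 volume) :
    Tendsto (fun N => eLpNorm (fun z => (∑ k ∈ Finset.range N, P k φ z) - φ z) 2 volume) atTop
      (𝓝 0) := by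
  have hS : ∀ N, MemLp (fun z => ∑ k ∈ Finset.range N, P k φ z) 2 volume := fun N =>
    memLp_finsetSum _ fun k _ => memLp_P k φ
  refine tendsto_of_fourierL2 hS hφ ?_
  have e : ∀ N, fourierL2 (fun z => ∑ k ∈ Finset.range N, P k φ z) =ᵐ[volume]
      fun ζ => ∑ k ∈ Finset.range N, {ζ : Plane | ζ 0 ∈ freqBand k}.indicator (fourierL2 φ) ζ :=
    fun N => by
      filter_upwards [fourierL2_sum (Finset.range N) fun k => memLp_P k φ,
        ae_all_iff.2 fun k => fourierL2_P k φ] with ζ h1 h2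
      rw [h1]
      exact Finset.sum_congr rfl fun k _ => h2 k
  have key : ∀ ζ : Plane, ∃ k, ∀ N, ∑ j ∈ Finset.range N,
      {ζ : Plane | ζ 0 ∈ freqBand j}.indicator (fourierL2 φ) ζ = if k < N then fourierL2 φ ζ else 0 := by
    intro ζ
    obtain ⟨k, hk⟩ := exists_band (ζ 0)
    refine ⟨k, fun N => ?_⟩
    have : ∀ j, {ζ : Plane | ζ 0 ∈ freqBand j}.indicator (fourierL2 φ) ζ
        = if j = k then fourierL2 φ ζ else 0 := fun j => by
      simp only [indicator, mem_ofPred_eq, hk]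
    simp_rw [this]
    simp [Finset.sum_ite_eq']
  refine tendsto_eLpNorm_of_dominated (g := fun ζ => ‖fourierL2 φ ζ‖ₑ)
    (fun N => (memLp_fourierL2 _).1) (memLp_fourierL2 _).1 ?_ (fun N => ?_) ?_
  · rw [← eLpNorm_two_sq]
    exact ENNReal.pow_ne_top (memLp_fourierL2 φ).2.ne
  · filter_upwards [e N] with ζ h1
    obtain ⟨k, hk⟩ := key ζ
    rw [h1, hk]
    split_ifs <;> simp
  · filter_upwards [ae_all_iff.2 e] with ζ h1
    obtain ⟨k, hk⟩ := key ζ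
    simp_rw [h1, hk]
    refine tendsto_const_nhds.congr' ?_
    filter_upwards [eventually_gt_atTop k] with N hN
    rw [if_pos hN]

/-- The sum of the extensions of the Littlewood-Paley pieces of a path is the path. -/
lemma slice_sum {T α β : ℝ} (hα : -T ≤ α) (hβ : β ≤ T) {f : ℝ → Plane → ℂ}
    (hf : ∀ t ∈ Icc (-T) T, MemLp (f t) 2 volume) {F : ℕ → SpaceTime → ℂ}
    (hF : ∀ k, IsExtension T (fun t => P k (f t)) (F k)) {V : SpaceTime → ℂ} (mV : Measurable V)
    (hV : ∀ᵐ p : SpaceTime, Tendsto (fun N => ∑ k ∈ Finset.range N,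
      (Icc α β).indicator (1 : ℝ → ℂ) (p 2) * F k p) atTop (𝓝 (V p))) :
    (∀ᵐ t : ℝ, t ∈ Icc α β → (fun z => V (stEquiv (z, t))) =ᵐ[volume] f t) ∧
    ∀ᵐ t : ℝ, t ∉ Icc α β → (fun z => V (stEquiv (z, t))) =ᵐ[volume] 0 := by
  have h2 : ∀ (z : Plane) (t : ℝ), (stEquiv (z, t)) 2 = t := fun z t => rfl
  constructor
  · filter_upwards [ae_slice hV, ae_all_iff.2 hF] with t h3 h4 ht
    have htT : t ∈ Icc (-T) T := ⟨hα.trans ht.1, ht.2.trans hβ⟩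
    -- At a fixed time the Littlewood-Paley series is known to converge only in L², so its limit is
    -- compared with `V` along an almost everywhere convergent subsequence.
    obtain ⟨ns, hns, hlim⟩ := exists_subseq_ae (μ := (volume : Measure Plane))
      (fun N => (memLp_finsetSum (Finset.range N) fun k _ => memLp_P k (f t)).1) (hf t htT).1
      (tendsto_sum_P (hf t htT))
    filter_upwards [h3, hlim, ae_all_iff.2 fun k => h4 k htT] with z h5 h6 h7
    refine tendsto_nhds_unique (h5.comp hns.tendsto_atTop) (h6.congr fun n => ?_)
    refine Finset.sum_congr rfl fun k _ => ?_
    rw [h2, indicator_of_mem ht, Pi.one_apply, one_mul, ← h7 k, stEquiv_apply]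
  · filter_upwards [ae_slice hV] with t h3 ht
    filter_upwards [h3] with z h5
    refine tendsto_nhds_unique h5 (tendsto_const_nhds.congr fun N => ?_)
    symm
    refine Finset.sum_eq_zero fun k _ => ?_
    rw [h2, indicator_of_notMem ht, zero_mul]

end

section

/-! ### The dyadic energy estimate -/

variable {η₀ : ℝ → ℝ}

lemma energy_nonneg (k : ℕ) (φ : Plane → ℂ) : 0 ≤ energy η₀ k φ :=
  integral_nonneg fun _ => by positivity

lemma ofReal_energy (hη : IsCutoff η₀) (k : ℕ) (φ : Plane → ℂ) : ENNReal.ofReal (energy η₀ k φ)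
    = ∫⁻ ζ : Plane, ENNReal.ofReal (bump η₀ (ζ 0 / 2 ^ k) ^ 2) * ‖fourierL2 φ ζ‖ₑ ^ 2 := by
  unfold energy
  rw [ofReal_integral_eq_lintegral_ofReal (integrable_energy hη k φ)
    (ae_of_all _ fun _ => by positivity)]
  refine lintegral_congr fun ζ => ?_
  rw [ENNReal.ofReal_mul (sq_nonneg _), ENNReal.ofReal_pow (norm_nonneg _), ofReal_norm]

lemma eLpNorm_P_le (hη : IsCutoff η₀) {k : ℕ} (hk : k ≠ 0) (φ : Plane → ℂ) :
    eLpNorm (P k φ) 2 volume ^ 2 ≤ ENNReal.ofReal ((cpi 2)⁻¹ * energy η₀ k φ) := by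
  have hc := cpi_pos 2
  have h1 : ENNReal.ofReal (cpi 2) * eLpNorm (P k φ) 2 volume ^ 2 ≤
      ENNReal.ofReal (energy η₀ k φ) := by
    have h2 := congrArg (· ^ 2) (eLpNorm_fourierL2 (memLp_P k φ))
    simp only [mul_pow, sq_sqrt_ennreal] at h2
    rw [← h2, eLpNorm_congr_ae (fourierL2_P k φ), eLpNorm_two_sq, ofReal_energy hη]
    refine lintegral_mono fun ζ => ?_
    by_cases hζ : ζ 0 ∈ freqBand k
    · have h3 : ζ ∈ {ζ : Plane | ζ 0 ∈ freqBand k} := hζ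
      rw [indicator_of_mem h3]
      have hp : (0 : ℝ) < 2 ^ k := by positivity
      rw [freqBand, if_neg hk] at hζ
      rw [bump_eq_one hη]
      · simp
      · rw [abs_div, abs_of_pos hp, le_div_iff₀ hp]; exact hζ.1
      · rw [abs_div, abs_of_pos hp, div_le_iff₀ hp]; exact hζ.2.le
    · have h3 : ζ ∉ {ζ : Plane | ζ 0 ∈ freqBand k} := hζ
      rw [indicator_of_notMem h3]
      simp
  rw [ENNReal.ofReal_mul (inv_nonneg.2 hc.le), ENNReal.ofReal_inv_of_pos hc]
  have hc0 : ENNReal.ofReal (cpi 2) ≠ 0 := by simpa using hc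
  calc _ = (ENNReal.ofReal (cpi 2))⁻¹ * (ENNReal.ofReal (cpi 2) * eLpNorm (P k φ) 2 volume ^ 2) := by
        rw [← mul_assoc, ENNReal.inv_mul_cancel hc0 ENNReal.ofReal_ne_top, one_mul]
    _ ≤ _ := by gcongr

/-- `2^{k/2}`. -/
def rt (k : ℕ) : ℝ≥0∞ := ENNReal.ofReal √(2 ^ k)

lemma rt_sq (k : ℕ) : rt k ^ 2 = 2 ^ k := by
  unfold rt
  rw [← ENNReal.ofReal_pow (Real.sqrt_nonneg _), Real.sq_sqrt (by positivity),
    ENNReal.ofReal_pow (by norm_num)]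
  norm_num

open Classical in
/-- The contribution of a frequency interaction to the energy. -/
def interaction (k : ℕ) (B : ℕ → ℝ≥0∞) (i j l : ℕ) : ℝ≥0∞ :=
  if Adm3 k i j l then rt (lo i j l) * (B i * B j * B l) else 0

/-- Between times 0 and `t` the solution is the sum of the truncated extensions of its
Littlewood-Paley pieces. The increment of the energy is the cubic form of this sum, and
`enorm_cubic_le` expands it into the forms that `exists_time_localized_bound` controls or shows to
vanish. The finiteness of `∑ rt i * B i` is used to make the series converge. -/
lemma exists_dyadic_energy_bound (hη : IsCutoff η₀) :
    ∃ C : ℝ≥0, ∀ {T : ℝ}, 0 < T → T ≤ 1 → ∀ {u : ℝ → Plane → ℝ}, IsHInfPath T u →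
      IsKPISolution T u → ∀ {F : ℕ → SpaceTime → ℂ} {B : ℕ → ℝ≥0∞}, (∀ i, Measurable (F i)) →
      (∀ i, IsFkLocalized i (F i)) → (∀ i, IsExtension T (fun t => P i (toC u t)) (F i)) →
      (∀ i, FkNorm η₀ i (F i) ≤ B i) → ∑' i, rt i * B i ≠ ⊤ → ∀ k, k ≠ 0 → ∀ t ∈ Icc (-T) T,
      eLpNorm (P k (toC u t)) 2 volume ^ 2 ≤
        ENNReal.ofReal ((cpi 2)⁻¹ * energy η₀ k (toC u 0)) +
          C * ∑' i, ∑' j, ∑' l, interaction k B i j l := by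
  obtain ⟨C, hC⟩ := exists_time_localized_bound hη
  refine ⟨C, ?_⟩
  intro T hT hT1 u hu hsol F B mF lF eF hB hsum k hk t ht
  obtain ⟨v, hv, hvu⟩ := exists_solutionPath hT hu hsol
  obtain ⟨K, hK, hKi, hKs⟩ := exists_kernel_hsym hη k
  have h0T : (0 : ℝ) ∈ Icc (-T) T := ⟨by linarith, hT.le⟩
  -- Time `t` may be negative. The interval is ordered first, and only the absolute value of the
  -- energy increment is used.
  set α := min 0 t with hα
  set β := max 0 t with hβ
  have hαT : -T ≤ α := le_min h0T.1 ht.1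
  have hβT : β ≤ T := max_le h0T.2 ht.2
  have hαβ : α ≤ β := (min_le_left _ _).trans (le_max_left _ _)
  have Bt : ∀ i, B i ≠ ⊤ := fun i hi => by
    refine hsum (top_le_iff.1 ?_)
    refine le_trans (le_of_eq ?_) (ENNReal.le_tsum i)
    rw [hi, ENNReal.mul_top]
    simp [rt]
  have Ft : ∀ i, FkNorm η₀ i (F i) ≠ ⊤ := fun i => ((hB i).trans_lt (Bt i).lt_top).ne
  set b : ℝ → ℂ := (Icc α β).indicator 1 with hb
  have mb : Measurable b := measurable_one.indicator measurableSet_Icc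
  have b1 : ∀ s, ‖b s‖ ≤ 1 := norm_indicator_one_le
  set h : ℕ → SpaceTime → ℂ := fun i p => b (p 2) * F i p with hh
  have mh : ∀ i, Measurable (h i) := fun i => (mb.comp (by fun_prop)).mul (mF i)
  have bs : ∀ (p : SpaceTime) (x : ℂ), ‖b (p 2) * x‖ₑ ^ 2 ≤ slab p * ‖x‖ₑ ^ 2 := fun p x => by
    by_cases hp : p 2 ∈ Icc α β
    · have : p 2 ∈ Icc (-1 : ℝ) 1 := ⟨by linarith [hp.1], by linarith [hp.2]⟩
      simp [hb, slab, hp, this]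
    · simp [hb, hp]
  have a1 : ∀ i, ∫⁻ p, ‖h i p‖ₑ ^ 2 ≤ (8 * (rt i * B i)) ^ 2 := fun i => by
    refine (lintegral_mono fun p => bs p _).trans
      ((lintegral_slab_sq_le hη (mF i) (lF i).1 (Ft i)).trans ?_)
    calc _ ≤ 2 * 2 ^ i * (2 * (2 * B i) ^ 2) := by gcongr; exact hB i
      _ = 16 * (rt i ^ 2 * B i ^ 2) := by rw [rt_sq]; ring
      _ ≤ 64 * (rt i ^ 2 * B i ^ 2) := by gcongr; norm_num
      _ = _ := by ring
  have hprod : ∀ i j p, h i p * h j p = b (p 2) * (F i p * F j p) := fun i j p => by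
    by_cases hp : p 2 ∈ Icc α β
    · simp [hh, hb, hp]
    · simp [hh, hb, hp]
  -- Replacing `2 ^ max i j` by `2 ^ (i + j)` puts the bound in the product form that `exists_sum`
  -- expects. The factor 8 serves both estimates: 16 ≤ 8² for single terms and 2048 ≤ 8⁴ for
  -- products.
  have a2 : ∀ i j, ∫⁻ p, ‖h i p * h j p‖ₑ ^ 2 ≤ (8 * (rt i * B i) * (8 * (rt j * B j))) ^ 2 :=
    fun i j => by
      simp_rw [hprod]
      refine (lintegral_mono fun p => bs p _).trans ((lintegral_slab_sq_mul_le hη (mF i) (mF j)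
        (lF i).1 (lF j).1 (Ft i) (Ft j)).trans ?_)
      calc _ ≤ 2 * 2 ^ (i + j) * (32 * (B i * B j)) ^ 2 := by
            gcongr
            · norm_num
            · exact max_le (by omega) (by omega)
            · exact hB i
            · exact hB j
        _ = 2048 * (rt i ^ 2 * rt j ^ 2 * (B i * B j) ^ 2) := by rw [rt_sq, rt_sq]; ring
        _ ≤ 4096 * (rt i ^ 2 * rt j ^ 2 * (B i * B j) ^ 2) := by gcongr; norm_num
        _ = _ := by ring
  have asum : ∑' i, 8 * (rt i * B i) ≠ ⊤ := by
    rw [ENNReal.tsum_mul_left]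
    exact ENNReal.mul_ne_top (by norm_num) hsum
  obtain ⟨V, mV, hV, V2, VV, t1, t2⟩ := exists_sum mh a1 a2 asum
  have h2 : ∀ i, MemLp (h i) 2 volume := fun i => memLp_mul_time mb b1 (lF i).1
  have h4 : ∀ i j, MemLp (fun p => h i p * h j p) 2 volume := fun i j =>
    memLp_of_lintegral_sq ((mh i).mul (mh j)).aestronglyMeasurable
      ((a2 i j).trans_lt (ENNReal.pow_lt_top (by
        have hr : ∀ i, rt i < ⊤ := fun i => ENNReal.ofReal_lt_top
        exact ENNReal.mul_lt_top
          (ENNReal.mul_lt_top (by norm_num) (ENNReal.mul_lt_top (hr i) (Bt i).lt_top))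
          (ENNReal.mul_lt_top (by norm_num) (ENNReal.mul_lt_top (hr j) (Bt j).lt_top))))).ne
  have cub := enorm_cubic_le hK hKi mh h2 h4 mV V2 VV t1 t2
  have uc : ∀ s ∈ Icc (-T) T, MemLp (toC u s) 2 volume := fun s hs => (hu.1 s hs).ofReal
  obtain ⟨s1, s2⟩ := slice_sum hαT hβT uc eF mV hV
  have s1' : ∀ᵐ t : ℝ, t ∈ Icc α β → (fun z => V (stEquiv (z, t))) =ᵐ[volume] v t := by
    filter_upwards [s1] with s hs hs'
    exact (hs hs').trans (hvu s ⟨hαT.trans hs'.1, hs'.2.trans hβT⟩).symm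
  have en := energy_sub_eq hη hv hK hKi hKs hαT hαβ hβT mV V2 VV s1' s2
  have bound : ∑' i, ∑' j, ∑' l, ‖∫ p, gform K (h i) (h j) (h l) p‖ₑ ≤
      C * ∑' i, ∑' j, ∑' l, interaction k B i j l := by
    simp_rw [← ENNReal.tsum_mul_left]
    refine ENNReal.tsum_le_tsum fun i => ENNReal.tsum_le_tsum fun j => ENNReal.tsum_le_tsum fun l => ?_
    have e : ∀ p, gform K (h i) (h j) (h l) p = b (p 2) * gform K (F i) (F j) (F l) p := fun p => by
      rw [hh]
      have := gform_mul_time (K := K) b b b (F i) (F j) (F l) p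
      rw [this]
      congr 1
      by_cases hp : p 2 ∈ Icc α β <;> simp [hb, hp]
    simp_rw [e]
    obtain ⟨q1, q2⟩ := hC hK hKi hKs (mF i) (mF j) (mF l) (lF i) (lF j) (lF l) (Ft i) (Ft j) (Ft l)
      (α := α) (β := β) (by linarith) (by linarith)
    unfold interaction
    split_ifs with hA
    · refine q1.trans ?_
      rw [mul_assoc]
      change C * (rt (lo i j l) * _) ≤ _
      gcongr
      · exact hB i
      · exact hB j
      · exact hB l
    · rw [q2 hA]; simp
  have ev : ∀ s ∈ Icc (-T) T, energy η₀ k (v s) = energy η₀ k (toC u s) := fun s hs => by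
    unfold energy
    rw [fourierL2_congr (hvu s hs)]
  have habs : energy η₀ k (v t) ≤ energy η₀ k (v 0) + |energy η₀ k (v β) - energy η₀ k (v α)| := by
    rcases le_total 0 t with h0 | h0
    · rw [hα, hβ, max_eq_right h0, min_eq_left h0]
      linarith [le_abs_self (energy η₀ k (v t) - energy η₀ k (v 0))]
    · rw [hα, hβ, max_eq_left h0, min_eq_right h0]
      linarith [neg_abs_le (energy η₀ k (v 0) - energy η₀ k (v t))]
  have hc : 0 ≤ (cpi 2)⁻¹ := inv_nonneg.2 (cpi_pos 2).le
  calc eLpNorm (P k (toC u t)) 2 volume ^ 2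
      ≤ ENNReal.ofReal ((cpi 2)⁻¹ * energy η₀ k (toC u t)) := eLpNorm_P_le hη hk _
    _ ≤ ENNReal.ofReal ((cpi 2)⁻¹ * energy η₀ k (v 0) +
        (cpi 2)⁻¹ * |energy η₀ k (v β) - energy η₀ k (v α)|) := by
        refine ENNReal.ofReal_le_ofReal ?_
        rw [← ev t ht, ← mul_add]
        gcongr
    _ ≤ _ := by
        rw [ENNReal.ofReal_add (mul_nonneg hc (energy_nonneg _ _)) (mul_nonneg hc (abs_nonneg _)),
          ev 0 h0T]
        gcongr
        refine le_trans (le_of_eq ?_) (cub.trans bound)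
        have e5 : ‖(cpi 2 : ℂ)⁻¹ * ((energy η₀ k (v β) - energy η₀ k (v α) : ℝ) : ℂ)‖ₑ
            = ‖∫ p, V p * V p * dop3 K V p‖ₑ := by
          rw [en, enorm_mul]
          have : ‖Complex.I‖ₑ = 1 := by rw [← ofReal_norm, Complex.norm_I, ENNReal.ofReal_one]
          rw [this, one_mul]
        rw [← e5, ← ofReal_norm, norm_mul, norm_inv, Complex.norm_real, Complex.norm_real,
          Real.norm_of_nonneg (cpi_pos 2).le, Real.norm_eq_abs]

end

section

/-! ### Summation over dyadic frequencies -/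

/-- The square of the dyadic `ℓ²` norm with weight `2^{sk}`. -/
def dsq (s : ℝ) (B : ℕ → ℝ≥0∞) : ℝ≥0∞ := ∑' k : ℕ, (2 : ℝ≥0∞) ^ (2 * s * (k : ℝ)) * B k ^ 2

lemma two_rpow_mul_nat (s : ℝ) (k : ℕ) :
    (2 : ℝ≥0∞) ^ (2 * s * (k : ℝ)) = (((2 : ℝ≥0∞) ^ s) ^ 2) ^ k := by
  rw [← ENNReal.rpow_natCast, ← ENNReal.rpow_natCast, ← ENNReal.rpow_mul, ← ENNReal.rpow_mul]
  congr 1; push_cast; ring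

lemma FNorm_eq (η₀ : ℝ → ℝ) (s T : ℝ) (u : ℝ → Plane → ℂ) :
    FNorm η₀ s T u = (dsq s fun k => FkTNorm η₀ k T (fun t => P k (u t))) ^ (1 / 2 : ℝ) := by
  unfold FNorm dsq
  congr 1
  conv_rhs => rw [tsum_eq_zero_add' ENNReal.summable, add_comm]
  simp

lemma dsq_mono_exponent {s : ℝ} (hs : 1 ≤ s) (B : ℕ → ℝ≥0∞) : dsq 1 B ≤ dsq s B := by
  refine ENNReal.tsum_le_tsum fun k => ?_
  gcongr
  norm_num

lemma dsq_add_le (s : ℝ) (B δ : ℕ → ℝ≥0∞) :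
    dsq s (fun k => B k + δ k) ≤ 2 * dsq s B + 2 * dsq s δ := by
  unfold dsq
  rw [← ENNReal.tsum_mul_left, ← ENNReal.tsum_mul_left, ← ENNReal.tsum_add]
  refine ENNReal.tsum_le_tsum fun k => ?_
  have h : (B k + δ k) ^ 2 ≤ 2 * B k ^ 2 + 2 * δ k ^ 2 := by
    generalize B k = a
    generalize δ k = b
    rcases le_total a b with h | h <;> obtain ⟨c, rfl⟩ := exists_add_of_le h
    · exact le_iff_exists_add.2 ⟨c ^ 2, by ring⟩
    · exact le_iff_exists_add.2 ⟨c ^ 2, by ring⟩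
  calc _ ≤ (2 : ℝ≥0∞) ^ (2 * s * (k : ℝ)) * (2 * B k ^ 2 + 2 * δ k ^ 2) := by gcongr
    _ = _ := by ring

lemma dsq_eq_zero {s s' : ℝ} {B : ℕ → ℝ≥0∞} (h : dsq s B = 0) : dsq s' B = 0 := by
  unfold dsq at *
  rw [ENNReal.tsum_eq_zero] at *
  intro k
  have h1 := h k
  rw [mul_eq_zero] at h1
  rcases h1 with h1 | h1
  · simp [ENNReal.rpow_eq_zero_iff] at h1
  · rw [h1, mul_zero]

/-- These are the excesses allowed to the extensions: positive in every band, and jointly small in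
the weighted norm. -/
lemma exists_small (s : ℝ) (hs : 1 ≤ s) {ε : ℝ≥0∞} (hε : ε ≠ 0) :
    ∃ δ : ℕ → ℝ≥0∞, (∀ k, δ k ≠ 0) ∧ dsq s δ ≤ ε := by
  obtain ⟨e, he, hsum⟩ := ENNReal.exists_pos_sum_of_countable' hε ℕ
  have w0 : ∀ k : ℕ, (2 : ℝ≥0∞) ^ (2 * s * (k : ℝ)) ≠ 0 := fun k => by
    simp [ENNReal.rpow_eq_zero_iff]
  have wt : ∀ k : ℕ, (2 : ℝ≥0∞) ^ (2 * s * (k : ℝ)) ≠ ⊤ := fun k =>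
    ENNReal.rpow_ne_top_of_nonneg (by positivity) (by norm_num)
  refine ⟨fun k => (((2 : ℝ≥0∞) ^ (2 * s * (k : ℝ)))⁻¹ * e k) ^ (1 / 2 : ℝ), fun k => ?_, ?_⟩
  · have : ((2 : ℝ≥0∞) ^ (2 * s * (k : ℝ)))⁻¹ * e k ≠ 0 :=
      mul_ne_zero (ENNReal.inv_ne_zero.2 (wt k)) (he k).ne'
    simp [ENNReal.rpow_eq_zero_iff, this]
  · unfold dsq
    refine le_trans (ENNReal.tsum_le_tsum fun k => ?_) hsum.le
    rw [sq_sqrt_ennreal, ← mul_assoc, ENNReal.mul_inv_cancel (w0 k) (wt k), one_mul]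

lemma tsum_mul_le_sqrt (f g : ℕ → ℝ≥0∞) :
    ∑' k, f k * g k ≤ (∑' k, f k ^ 2) ^ (1 / 2 : ℝ) * (∑' k, g k ^ 2) ^ (1 / 2 : ℝ) := by
  have := lintegral_mul_le_sqrt (μ := (Measure.count : Measure ℕ)) (f := f) (g := g)
    (measurable_from_top).aemeasurable (measurable_from_top).aemeasurable
  simpa [lintegral_count] using this

/-- Cauchy-Schwarz after writing `2^{k/2}` as `2^{-k/2} · 2^k`; the first factors have square sum 2.
-/
lemma tsum_rt_mul_le (B : ℕ → ℝ≥0∞) : ∑' k, rt k * B k ≤ 2 * dsq 1 B ^ (1 / 2 : ℝ) := by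
  have e : ∀ k, rt k * B k = (rt k * (2 ^ k)⁻¹) * (2 ^ k * B k) := fun k => by
    rw [mul_assoc, ← mul_assoc ((2 ^ k)⁻¹ : ℝ≥0∞), ENNReal.inv_mul_cancel (by simp) (by simp), one_mul]
  simp_rw [e]
  refine (tsum_mul_le_sqrt _ _).trans ?_
  have e1 : ∑' k, (rt k * (2 ^ k)⁻¹ : ℝ≥0∞) ^ 2 = 2 := by
    have : ∀ k, (rt k * (2 ^ k)⁻¹ : ℝ≥0∞) ^ 2 = 2⁻¹ ^ k := fun k => by
      rw [mul_pow, rt_sq, sq, ← mul_assoc, ENNReal.mul_inv_cancel (by simp) (by simp), one_mul,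
        ENNReal.inv_pow]
    simp_rw [this]
    rw [ENNReal.tsum_geometric, ENNReal.one_sub_inv_two, inv_inv]
  have e2 : ∑' k, (2 ^ k * B k : ℝ≥0∞) ^ 2 = dsq 1 B := by
    unfold dsq
    congr 1; ext k
    rw [two_rpow_mul_nat, ENNReal.rpow_one, mul_pow, ← pow_mul, ← pow_mul, mul_comm k 2]
  rw [e1, e2]
  gcongr
  calc (2 : ℝ≥0∞) ^ (1 / 2 : ℝ) ≤ 2 ^ (1 : ℝ) := by gcongr <;> norm_num
    _ = 2 := ENNReal.rpow_one 2

lemma sum_pow_le {r : ℝ≥0∞} (hr : 2 ≤ r) (i : ℕ) :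
    ∑ k ∈ Finset.range (i + 1), r ^ (k + 1) ≤ 2 * r ^ (i + 1) := by
  induction i with
  | zero => simp [two_mul]
  | succ n ih =>
    rw [Finset.sum_range_succ]
    calc _ ≤ 2 * r ^ (n + 1) + r ^ (n + 1 + 1) := by gcongr
      _ ≤ r * r ^ (n + 1) + r ^ (n + 1 + 1) := by gcongr
      _ = 2 * r ^ (n + 1 + 1) := by ring

open Classical in
lemma tsum_adm_le {r : ℝ≥0∞} (hr : 2 ≤ r) (i j : ℕ) :
    ∑' k, r ^ (k + 1) * (if Adm (k + 1) i j then 1 else 0) ≤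
      2 * r ^ (i + 1) * (if i ≤ j + 3 ∧ j ≤ i + 3 then 1 else 0) := by
  by_cases h : i ≤ j + 3 ∧ j ≤ i + 3
  · rw [if_pos h, mul_one]
    refine le_trans ?_ (sum_pow_le hr i)
    rw [tsum_eq_sum (s := Finset.range (i + 1))]
    · refine Finset.sum_le_sum fun k _ => ?_
      split_ifs <;> simp
    · intro k hk
      rw [if_neg, mul_zero]
      intro hA
      exact hk (Finset.mem_range.2 (by have := hA.1; omega))
  · have : ∀ k, ¬ Adm (k + 1) i j := fun k hA => h hA.2
    simp [this]

lemma mul_le_sq_add_sq (a b : ℝ≥0∞) : a * b ≤ a ^ 2 + b ^ 2 := by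
  rcases le_total a b with h | h
  · calc a * b ≤ b * b := by gcongr
      _ ≤ _ := by rw [sq b]; exact le_add_self
  · calc a * b ≤ a * a := by gcongr
      _ ≤ _ := by rw [sq a]; exact le_self_add

lemma tsum_near_le (x : ℕ → ℝ≥0∞) :
    ∑' i, ∑' j, (if i ≤ j + 3 ∧ j ≤ i + 3 then 1 else 0) * x i ≤ 7 * ∑' i, x i := by
  rw [← ENNReal.tsum_mul_left]
  refine ENNReal.tsum_le_tsum fun i => ?_
  rw [ENNReal.tsum_mul_right]
  gcongr
  rw [tsum_eq_sum (s := Finset.Icc (i - 3) (i + 3))]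
  · refine (Finset.sum_le_card_nsmul _ _ 1 fun j _ => by split_ifs <;> simp).trans ?_
    rw [Nat.card_Icc, nsmul_one]
    exact_mod_cast (by omega : i + 3 + 1 - (i - 3) ≤ 7)
  · intro j hj
    rw [if_neg]
    intro h
    exact hj (Finset.mem_Icc.2 ⟨by omega, h.2⟩)

-- For fixed close `i`, `j` only `k ≤ i` contribute, and the geometric sum of the weights is at most
-- twice its last term, `2^{2s(i+1)}`. This weight is split evenly between `B i` and `B j`.
-- Replacing `2^{si}` by `2^{s(j+3)}` in the second factor costs `2^{3s}`, and the remaining sum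
-- runs over a diagonal strip of width 7.
open Classical in
lemma tsum_adm_mul_le {s : ℝ} (hs : 1 ≤ s) (B : ℕ → ℝ≥0∞) :
    ∑' k : ℕ, (2 : ℝ≥0∞) ^ (2 * s * ((k : ℝ) + 1)) *
      ∑' i, ∑' j, (if Adm (k + 1) i j then 1 else 0) * (B i * B j)
      ≤ 28 * ((2 : ℝ≥0∞) ^ s) ^ 5 * dsq s B := by
  set q : ℝ≥0∞ := (2 : ℝ≥0∞) ^ s with hq
  have hq2 : 2 ≤ q := by
    calc (2 : ℝ≥0∞) = 2 ^ (1 : ℝ) := (ENNReal.rpow_one 2).symm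
      _ ≤ q := ENNReal.rpow_le_rpow_of_exponent_le (by norm_num) hs
  have hq1 : 1 ≤ q := le_trans (by norm_num) hq2
  have hr : 2 ≤ q ^ 2 := hq2.trans (le_self_pow₀ hq1 two_ne_zero)
  have e0 : ∀ k : ℕ, (2 : ℝ≥0∞) ^ (2 * s * ((k : ℝ) + 1)) = (q ^ 2) ^ (k + 1) := fun k => by
    rw [← two_rpow_mul_nat]; push_cast; rfl
  have e1 : ∑' k : ℕ, (2 : ℝ≥0∞) ^ (2 * s * ((k : ℝ) + 1)) *
      ∑' i, ∑' j, (if Adm (k + 1) i j then 1 else 0) * (B i * B j)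
      = ∑' i, ∑' j, (∑' k, (q ^ 2) ^ (k + 1) * (if Adm (k + 1) i j then 1 else 0)) * (B i * B j) := by
    simp_rw [e0, ← ENNReal.tsum_mul_left, ← ENNReal.tsum_mul_right]
    rw [ENNReal.tsum_comm]
    congr 1; ext i
    rw [ENNReal.tsum_comm]
    simp_rw [mul_assoc]
  rw [e1]
  set x : ℕ → ℝ≥0∞ := fun i => (q ^ i * B i) ^ 2 with hx
  have hxs : ∑' i, x i = dsq s B := by
    unfold dsq
    congr 1; ext i
    rw [two_rpow_mul_nat, hx]
    simp only [mul_pow, ← pow_mul]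
    rw [mul_comm 2 i]
  calc _ ≤ ∑' i, ∑' j, (2 * q ^ 5 * ((if i ≤ j + 3 ∧ j ≤ i + 3 then 1 else 0) * x i) +
        2 * q ^ 5 * ((if j ≤ i + 3 ∧ i ≤ j + 3 then 1 else 0) * x j)) := by
        refine ENNReal.tsum_le_tsum fun i => ENNReal.tsum_le_tsum fun j => ?_
        refine (mul_le_mul_left (tsum_adm_le hr i j) _).trans ?_
        by_cases h : i ≤ j + 3 ∧ j ≤ i + 3
        · rw [if_pos h, if_pos h.symm, mul_one, one_mul, one_mul, ← mul_add]
          calc 2 * (q ^ 2) ^ (i + 1) * (B i * B j) = 2 * q ^ 2 * (q ^ i * B i * (q ^ i * B j)) := by ring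
            _ ≤ 2 * q ^ 2 * (q ^ i * B i * (q ^ (j + 3) * B j)) := by
                gcongr
                exact h.1
            _ = 2 * q ^ 5 * (q ^ i * B i * (q ^ j * B j)) := by ring
            _ ≤ _ := by gcongr; exact mul_le_sq_add_sq _ _
        · rw [if_neg h]; simp
    _ = 2 * q ^ 5 * (∑' i, ∑' j, (if i ≤ j + 3 ∧ j ≤ i + 3 then 1 else 0) * x i) +
        2 * q ^ 5 * (∑' i, ∑' j, (if i ≤ j + 3 ∧ j ≤ i + 3 then 1 else 0) * x i) := by
        simp_rw [ENNReal.tsum_add, ENNReal.tsum_mul_left]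
        congr 2
        exact ENNReal.tsum_comm
    _ ≤ 2 * q ^ 5 * (7 * ∑' i, x i) + 2 * q ^ 5 * (7 * ∑' i, x i) := by
        gcongr <;> exact tsum_near_le x
    _ = _ := by rw [hxs]; ring

lemma rt_mono {m n : ℕ} (h : m ≤ n) : rt m ≤ rt n :=
  ENNReal.ofReal_le_ofReal (Real.sqrt_le_sqrt (pow_le_pow_right₀ (by norm_num) h))

open Classical in
/-- The indicator of a frequency interaction of two functions. -/
def pairInd (k i j : ℕ) : ℝ≥0∞ := (if Adm k i j then 1 else 0) + (if Adm k j i then 1 else 0)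

/-- One admissible pair is singled out. The smallest index is at most the remaining one, so the
factor `rt (lo i j l)` can be given to the third function. -/
lemma interaction_le (k : ℕ) (B : ℕ → ℝ≥0∞) (i j l : ℕ) :
    interaction k B i j l ≤ pairInd k i j * (B i * B j) * (rt l * B l) +
      pairInd k i l * (B i * B l) * (rt j * B j) + pairInd k j l * (B j * B l) * (rt i * B i) := by
  unfold interaction
  split_ifs with h
  swap; · exact zero_le
  have one : ∀ i j, (Adm k i j ∨ Adm k j i) → 1 ≤ pairInd k i j := fun i j h => by
    unfold pairInd
    rcases h with h | h
    · rw [if_pos h]; exact le_self_add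
    · rw [if_pos h]; exact le_add_self
  rcases h with h | h | h
  · refine le_trans ?_ (le_self_add.trans le_self_add)
    calc _ ≤ rt l * (B i * B j * B l) := by
          gcongr; exact rt_mono ((min_le_right _ _).trans (min_le_right _ _))
      _ = 1 * (B i * B j) * (rt l * B l) := by ring
      _ ≤ _ := by gcongr; exact one _ _ h
  · refine le_trans ?_ (le_add_self.trans le_self_add)
    calc _ ≤ rt j * (B i * B j * B l) := by
          gcongr; exact rt_mono ((min_le_right _ _).trans (min_le_left _ _))
      _ = 1 * (B i * B l) * (rt j * B j) := by ring
      _ ≤ _ := by gcongr; exact one _ _ h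
  · refine le_trans ?_ le_add_self
    calc _ ≤ rt i * (B i * B j * B l) := by
          gcongr; exact rt_mono (min_le_left _ _)
      _ = 1 * (B j * B l) * (rt i * B i) := by ring
      _ ≤ _ := by gcongr; exact one _ _ h

lemma tsum_interaction_le {s : ℝ} (hs : 1 ≤ s) (B : ℕ → ℝ≥0∞) :
    ∑' k : ℕ, (2 : ℝ≥0∞) ^ (2 * s * ((k : ℝ) + 1)) * ∑' i, ∑' j, ∑' l, interaction (k + 1) B i j l
      ≤ 336 * ((2 : ℝ≥0∞) ^ s) ^ 5 * (dsq 1 B ^ (1 / 2 : ℝ) * dsq s B) := by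
  set R := ∑' l, rt l * B l with hR
  set E : ℕ → ℝ≥0∞ := fun k => ∑' i, ∑' j, pairInd (k + 1) i j * (B i * B j) with hE
  have h1 : ∀ k, ∑' i, ∑' j, ∑' l, interaction (k + 1) B i j l ≤ 3 * (E k * R) := fun k => by
    calc _ ≤ ∑' i, ∑' j, ∑' l, (pairInd (k + 1) i j * (B i * B j) * (rt l * B l) +
          pairInd (k + 1) i l * (B i * B l) * (rt j * B j) +
          pairInd (k + 1) j l * (B j * B l) * (rt i * B i)) :=
          ENNReal.tsum_le_tsum fun i => ENNReal.tsum_le_tsum fun j => ENNReal.tsum_le_tsum fun l =>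
            interaction_le _ _ _ _ _
      _ = E k * R + E k * R + E k * R := by
          simp_rw [ENNReal.tsum_add]
          congr 1
          · congr 1
            · simp_rw [ENNReal.tsum_mul_left, ENNReal.tsum_mul_right]; rfl
            · have : ∀ i, ∑' j, ∑' l, pairInd (k + 1) i l * (B i * B l) * (rt j * B j)
                  = ∑' l, ∑' j, pairInd (k + 1) i l * (B i * B l) * (rt j * B j) := fun i =>
                ENNReal.tsum_comm
              simp_rw [this, ENNReal.tsum_mul_left, ENNReal.tsum_mul_right]; rfl
          · simp_rw [ENNReal.tsum_mul_right, ENNReal.tsum_mul_left]; rfl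
      _ = _ := by ring
  have h2 : ∀ k, E k = 2 * ∑' i, ∑' j, (open Classical in if Adm (k + 1) i j then 1 else 0) *
      (B i * B j) := fun k => by
    classical
    simp only [hE, pairInd, add_mul]
    simp_rw [ENNReal.tsum_add]
    rw [two_mul]
    congr 1
    rw [ENNReal.tsum_comm]
    simp_rw [mul_comm (B _) (B _)]
  calc _ ≤ ∑' k : ℕ, (2 : ℝ≥0∞) ^ (2 * s * ((k : ℝ) + 1)) * (3 * (E k * R)) := by
        gcongr with k; exact h1 k
    _ = 6 * R * ∑' k : ℕ, (2 : ℝ≥0∞) ^ (2 * s * ((k : ℝ) + 1)) *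
          ∑' i, ∑' j, (open Classical in if Adm (k + 1) i j then 1 else 0) * (B i * B j) := by
        rw [← ENNReal.tsum_mul_left]
        congr 1; ext k
        rw [h2]; ring
    _ ≤ 6 * (2 * dsq 1 B ^ (1 / 2 : ℝ)) * (28 * ((2 : ℝ≥0∞) ^ s) ^ 5 * dsq s B) := by
        gcongr
        · exact tsum_rt_mul_le B
        · exact tsum_adm_mul_le hs B
    _ = _ := by ring

/-! ### The initial data -/

variable {η₀ : ℝ → ℝ}

lemma HNorm_sq (s : ℝ) (φ : Plane → ℂ) :
    HNorm s 0 φ ^ 2 = ∫⁻ ζ : Plane, ENNReal.ofReal ((1 + ζ 0 ^ 2) ^ s) * ‖fourierL2 φ ζ‖ₑ ^ 2 := by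
  unfold HNorm
  rw [eLpNorm_two_sq]
  refine lintegral_congr fun ζ => ?_
  have h : 0 < 1 + ζ 0 ^ 2 := by positivity
  rw [enorm_mul, mul_pow, mul_comm]
  congr 1
  rw [← ofReal_norm, Complex.norm_real, zero_div, Real.rpow_zero, mul_one, sq_abs,
    Real.norm_of_nonneg (by positivity), ← ENNReal.ofReal_pow (by positivity), ← Real.rpow_natCast,
    ← Real.rpow_mul h.le]
  congr 2; push_cast; ring

/-- At a given `ξ` at most two consecutive bumps are nonzero, since the ends of the support have
ratio below 4. Where a bump is nonzero, `2 ^ (k + 1) ≤ 2|ξ|`, so its weight is dominated by `(4(1 +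
ξ²))^s`. -/
lemma tsum_bump_le (hη : IsCutoff η₀) {s : ℝ} (hs : 1 ≤ s) (ξ : ℝ) :
    ∑' k : ℕ, (2 : ℝ≥0∞) ^ (2 * s * ((k : ℝ) + 1)) *
      ENNReal.ofReal (bump η₀ (ξ / 2 ^ (k + 1)) ^ 2) ≤
        2 * ENNReal.ofReal (4 ^ s) * ENNReal.ofReal ((1 + ξ ^ 2) ^ s) := by
  have hterm : ∀ k : ℕ, (2 : ℝ≥0∞) ^ (2 * s * ((k : ℝ) + 1)) *
      ENNReal.ofReal (bump η₀ (ξ / 2 ^ (k + 1)) ^ 2) ≤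
        ENNReal.ofReal (4 ^ s) * ENNReal.ofReal ((1 + ξ ^ 2) ^ s) := fun k => by
    by_cases hb : bump η₀ (ξ / 2 ^ (k + 1)) = 0
    · simp [hb]
    have hp : (0 : ℝ) < 2 ^ (k + 1) := by positivity
    have h1 := (bump_support hη hb).1
    rw [abs_div, abs_of_pos hp, le_div_iff₀ hp] at h1
    have h2 : (2 : ℝ≥0∞) ^ (2 * s * ((k : ℝ) + 1)) = ENNReal.ofReal (((2 : ℝ) ^ (k + 1)) ^ (2 * s)) := by
      rw [← ENNReal.ofReal_rpow_of_pos hp, ENNReal.ofReal_pow (by norm_num),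
        ← ENNReal.rpow_natCast, ← ENNReal.rpow_mul]
      norm_num
      congr 1; ring
    rw [h2, ← ENNReal.ofReal_mul (by positivity), ← ENNReal.ofReal_mul (by positivity)]
    refine ENNReal.ofReal_le_ofReal ?_
    have h3 : bump η₀ (ξ / 2 ^ (k + 1)) ^ 2 ≤ 1 := by
      rw [← sq_abs]; exact pow_le_one₀ (abs_nonneg _) (abs_bump_le hη _)
    calc ((2 : ℝ) ^ (k + 1)) ^ (2 * s) * bump η₀ (ξ / 2 ^ (k + 1)) ^ 2
        ≤ ((2 : ℝ) ^ (k + 1)) ^ (2 * s) := mul_le_of_le_one_right (by positivity) h3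
      _ = (((2 : ℝ) ^ (k + 1)) ^ 2) ^ s := by
          rw [Real.rpow_mul hp.le]; norm_num
      _ ≤ (4 * (1 + ξ ^ 2)) ^ s := by
          refine Real.rpow_le_rpow (by positivity) ?_ (by linarith)
          have h4 : (2 : ℝ) ^ (k + 1) ≤ 2 * |ξ| := by linarith
          calc ((2 : ℝ) ^ (k + 1)) ^ 2 ≤ (2 * |ξ|) ^ 2 := by gcongr
            _ = 4 * ξ ^ 2 := by rw [mul_pow, sq_abs]; norm_num
            _ ≤ _ := by linarith
      _ = _ := Real.mul_rpow (by norm_num) (by positivity)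
  by_cases hex : ∃ k : ℕ, bump η₀ (ξ / 2 ^ (k + 1)) ≠ 0
  swap
  · push Not at hex
    simp [hex]
  classical
  set k₀ := Nat.find hex
  have h0 := (bump_support hη (Nat.find_spec hex)).2
  have hp : ∀ k : ℕ, (0 : ℝ) < 2 ^ (k + 1) := fun k => by positivity
  rw [abs_div, abs_of_pos (hp _), div_le_iff₀ (hp _)] at h0
  rw [tsum_eq_sum (s := {k₀, k₀ + 1})]
  · rw [Finset.sum_pair (by omega)]
    exact (add_le_add (hterm _) (hterm _)).trans (le_of_eq (by ring))
  · intro k hk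
    have : bump η₀ (ξ / 2 ^ (k + 1)) = 0 := by
      by_contra hb
      have h1 := (bump_support hη hb).1
      rw [abs_div, abs_of_pos (hp _), le_div_iff₀ (hp _)] at h1
      have h2 : k₀ ≤ k := Nat.find_min' hex hb
      have h3 : (2 : ℝ) ^ (k + 1) < 2 ^ (k₀ + 1 + 2) := by
        rw [pow_add _ (k₀ + 1)]
        have := hp k₀
        change |ξ| ≤ 48 / 25 * 2 ^ (k₀ + 1) at h0
        linarith
      have h4 := pow_lt_imp h3
      simp only [Finset.mem_insert, Finset.mem_singleton] at hk
      omega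
    simp [this]

lemma tsum_energy_le (hη : IsCutoff η₀) {s : ℝ} (hs : 1 ≤ s) (φ : Plane → ℂ) :
    ∑' k : ℕ, (2 : ℝ≥0∞) ^ (2 * s * ((k : ℝ) + 1)) *
      ENNReal.ofReal ((cpi 2)⁻¹ * energy η₀ (k + 1) φ) ≤
        2 * ENNReal.ofReal (4 ^ s) * HNorm s 0 φ ^ 2 := by
  have h1 : ∀ k : ℕ, ENNReal.ofReal ((cpi 2)⁻¹ * energy η₀ (k + 1) φ) ≤
      ENNReal.ofReal (energy η₀ (k + 1) φ) := fun k => by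
    refine ENNReal.ofReal_le_ofReal (mul_le_of_le_one_left (energy_nonneg _ _) ?_)
    exact inv_le_one_of_one_le₀ (one_le_pow₀ one_le_two_pi)
  have mf := (measurable_fourierL2 φ).enorm.pow_const 2
  calc _ ≤ ∑' k : ℕ, (2 : ℝ≥0∞) ^ (2 * s * ((k : ℝ) + 1)) * ENNReal.ofReal (energy η₀ (k + 1) φ) := by
        exact ENNReal.tsum_le_tsum fun k => mul_le_mul_right (h1 k) _
    _ = ∫⁻ ζ : Plane, ∑' k : ℕ, (2 : ℝ≥0∞) ^ (2 * s * ((k : ℝ) + 1)) *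
          ENNReal.ofReal (bump η₀ (ζ 0 / 2 ^ (k + 1)) ^ 2) * ‖fourierL2 φ ζ‖ₑ ^ 2 := by
        have m : ∀ k : ℕ, Measurable fun ζ : Plane =>
            ENNReal.ofReal (bump η₀ (ζ 0 / 2 ^ (k + 1)) ^ 2) * ‖fourierL2 φ ζ‖ₑ ^ 2 := fun k =>
          ((measurable_bump_freq hη (k + 1)).pow_const 2).ennreal_ofReal.mul mf
        rw [lintegral_tsum]
        · refine tsum_congr fun k => ?_
          rw [ofReal_energy hη, ← lintegral_const_mul _ (m k)]
          simp_rw [mul_assoc]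
        · intro k
          simp_rw [mul_assoc]
          exact ((m k).const_mul _).aemeasurable
    _ ≤ ∫⁻ ζ : Plane, 2 * ENNReal.ofReal (4 ^ s) * (ENNReal.ofReal ((1 + ζ 0 ^ 2) ^ s) *
          ‖fourierL2 φ ζ‖ₑ ^ 2) := by
        refine lintegral_mono fun ζ => ?_
        beta_reduce
        rw [ENNReal.tsum_mul_right, ← mul_assoc]
        gcongr
        exact tsum_bump_le hη hs _
    _ = _ := by
        rw [lintegral_const_mul' _ _ (by finiteness), HNorm_sq]

lemma eLpNorm_P_zero_le {s : ℝ} (hs : 1 ≤ s) (φ : Plane → ℂ) :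
    eLpNorm (P 0 φ) 2 volume ^ 2 ≤ HNorm s 0 φ ^ 2 := by
  have h2 := congrArg (· ^ 2) (eLpNorm_fourierL2 (memLp_P 0 φ))
  simp only [mul_pow, sq_sqrt_ennreal] at h2
  calc _ ≤ ENNReal.ofReal (cpi 2) * eLpNorm (P 0 φ) 2 volume ^ 2 := by
        refine le_mul_of_one_le_left (zero_le) ?_
        rw [ENNReal.one_le_ofReal]
        exact one_le_pow₀ one_le_two_pi
    _ ≤ _ := by
        rw [← h2, eLpNorm_congr_ae (fourierL2_P 0 φ), eLpNorm_two_sq, HNorm_sq]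
        refine lintegral_mono fun ζ => ?_
        have h3 : 1 ≤ ENNReal.ofReal ((1 + ζ 0 ^ 2) ^ s) := by
          rw [ENNReal.one_le_ofReal]
          exact Real.one_le_rpow (by nlinarith [sq_nonneg (ζ 0)]) (by linarith)
        refine le_trans ?_ (le_mul_of_one_le_left (zero_le) h3)
        gcongr
        refine (enorm_indicator_le_enorm_self _ _)

end

/-! ### Near-optimal extensions and removal of their excess -/

section

variable {η₀ : ℝ → ℝ}

lemma ENorm_sq_le {s T : ℝ} {u : ℝ → Plane → ℂ} (hs : 1 ≤ s) (hη : IsCutoff η₀) {K : ℝ≥0∞}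
    {J : ℕ → ℝ≥0∞}
    (h : ∀ k : ℕ, k ≠ 0 → ∀ t ∈ Icc (-T) T, eLpNorm (P k (u t)) 2 volume ^ 2 ≤
      ENNReal.ofReal ((cpi 2)⁻¹ * energy η₀ k (u 0)) + K * J k) :
    ENorm s T u ^ 2 ≤ (1 + 2 * ENNReal.ofReal (4 ^ s)) * HNorm s 0 (u 0) ^ 2 +
      K * ∑' k : ℕ, (2 : ℝ≥0∞) ^ (2 * s * ((k : ℝ) + 1)) * J (k + 1) := by
  unfold ENorm
  rw [sq_sqrt_ennreal]
  calc _ ≤ HNorm s 0 (u 0) ^ 2 + ∑' k : ℕ, ((2 : ℝ≥0∞) ^ (2 * s * ((k : ℝ) + 1)) *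
          ENNReal.ofReal ((cpi 2)⁻¹ * energy η₀ (k + 1) (u 0)) +
          K * ((2 : ℝ≥0∞) ^ (2 * s * ((k : ℝ) + 1)) * J (k + 1))) := by
        refine add_le_add (eLpNorm_P_zero_le hs _) (ENNReal.tsum_le_tsum fun k => ?_)
        refine iSup₂_le fun t ht => ?_
        refine (mul_le_mul_right (h (k + 1) k.succ_ne_zero t ht) _).trans (le_of_eq (by ring))
    _ ≤ HNorm s 0 (u 0) ^ 2 + (2 * ENNReal.ofReal (4 ^ s) * HNorm s 0 (u 0) ^ 2 +
          K * ∑' k : ℕ, (2 : ℝ≥0∞) ^ (2 * s * ((k : ℝ) + 1)) * J (k + 1)) := by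
        rw [ENNReal.tsum_add, ENNReal.tsum_mul_left]
        exact add_le_add le_rfl (add_le_add (tsum_energy_le hη hs _) le_rfl)
    _ = _ := by ring

/-- The energy estimate with the norms `F^1(T)`, `F^s(T)` replaced by those of near-optimal
extensions. -/
lemma exists_approximate_energy_bound (hη : IsCutoff η₀) {s : ℝ} (hs : 1 ≤ s) :
    ∃ K : ℝ≥0, ∀ {T : ℝ}, 0 < T → T ≤ 1 → ∀ {u : ℝ → Plane → ℝ}, IsHInfPath T u →
      IsKPISolution T u → ∀ {b : ℕ → ℝ≥0∞},
      (b = fun k => FkTNorm η₀ k T fun t => P k (toC u t)) → dsq s b ≠ ⊤ →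
      ∀ {ε : ℝ≥0∞}, ε ≠ 0 → ε ≠ ⊤ →
      ENorm s T (toC u) ^ 2 ≤ (1 + 2 * ENNReal.ofReal (4 ^ s)) * HNorm s 0 (toC u 0) ^ 2 +
        K * ((2 * dsq 1 b + 2 * ε) ^ (1 / 2 : ℝ) * (2 * dsq s b + 2 * ε)) := by
  obtain ⟨C, hC⟩ := exists_dyadic_energy_bound hη
  have h2t : (2 : ℝ≥0∞) ^ s ≠ ⊤ := ENNReal.rpow_ne_top_of_nonneg (by linarith) (by norm_num)
  refine ⟨C * (336 * ((2 : ℝ≥0∞) ^ s) ^ 5).toNNReal, ?_⟩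
  intro T hT hT1 u hu hsol b hb hfin ε hε hεt
  have hbk : ∀ k, b k ≠ ⊤ := fun k hk => by
    have h := ENNReal.ne_top_of_tsum_ne_top hfin k
    rw [hk] at h
    refine h ?_
    rw [ENNReal.top_pow two_ne_zero, ENNReal.mul_top]
    simp [ENNReal.rpow_eq_zero_iff]
  obtain ⟨δ, hδ, hδε⟩ := exists_small s hs hε
  have hext : ∀ k, ∃ F : SpaceTime → ℂ, Measurable F ∧ IsFkLocalized k F ∧
      IsExtension T (fun t => P k (toC u t)) F ∧ FkNorm η₀ k F ≤ b k + δ k := fun k => by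
    have := hbk k
    rw [hb] at this ⊢
    exact exists_extension this (hδ k)
  choose F hFm hFl hFe hFb using hext
  have hs' : dsq s (fun k => b k + δ k) ≤ 2 * dsq s b + 2 * ε :=
    (dsq_add_le _ _ _).trans (by gcongr)
  have h1' : dsq 1 (fun k => b k + δ k) ≤ 2 * dsq 1 b + 2 * ε :=
    (dsq_add_le _ _ _).trans (by gcongr; exact (dsq_mono_exponent hs _).trans hδε)
  have h1t : dsq 1 b ≠ ⊤ := ne_top_of_le_ne_top hfin (dsq_mono_exponent hs _)
  have hrt : ∑' k, rt k * (b k + δ k) ≠ ⊤ := by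
    refine ne_top_of_le_ne_top ?_ (tsum_rt_mul_le _)
    refine ENNReal.mul_ne_top (by norm_num) (ENNReal.rpow_ne_top_of_nonneg (by norm_num) ?_)
    exact ne_top_of_le_ne_top (by finiteness) h1'
  refine (ENorm_sq_le hs hη (hC hT hT1 hu hsol hFm hFl hFe hFb hrt)).trans ?_
  gcongr _ + ?_
  rw [ENNReal.coe_mul, ENNReal.coe_toNNReal (by finiteness), mul_assoc (C : ℝ≥0∞)]
  gcongr (C : ℝ≥0∞) * ?_
  refine (tsum_interaction_le hs _).trans ?_
  gcongr

lemma tendsto_approximation {x y : ℝ≥0∞} (hx : x ≠ ⊤) (hy : y ≠ ⊤) (A : ℝ≥0∞) (K : ℝ≥0) :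
    Tendsto (fun n : ℕ => A + K * ((2 * x + 2 * ((n : ℝ≥0∞) + 1)⁻¹) ^ (1 / 2 : ℝ) *
      (2 * y + 2 * ((n : ℝ≥0∞) + 1)⁻¹))) atTop (𝓝 (A + K * ((2 * x) ^ (1 / 2 : ℝ) * (2 * y)))) := by
  have h0 : Tendsto (fun n : ℕ => ((n : ℝ≥0∞) + 1)⁻¹) atTop (𝓝 0) := by
    have := (tendsto_add_atTop_iff_nat 1).2 ENNReal.tendsto_inv_nat_nhds_zero
    simpa using this
  have h1 : ∀ z : ℝ≥0∞, Tendsto (fun n : ℕ => 2 * z + 2 * ((n : ℝ≥0∞) + 1)⁻¹) atTop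
      (𝓝 (2 * z)) := fun z => by
    have := (tendsto_const_nhds (x := 2 * z)).add
      (ENNReal.Tendsto.const_mul h0 (Or.inr (by norm_num : (2 : ℝ≥0∞) ≠ ⊤)))
    simpa using this
  refine tendsto_const_nhds.add (ENNReal.Tendsto.const_mul ?_ (Or.inr ENNReal.coe_ne_top))
  refine ENNReal.Tendsto.mul ((ENNReal.continuous_rpow_const.tendsto _).comp (h1 x)) ?_ (h1 y) ?_
  · exact Or.inr (by finiteness)
  · exact Or.inr (by finiteness)

end

end KPI

end

theorem proposition6p2 (η₀ : ℝ → ℝ) (hη₀ : KPI.IsCutoff η₀) (s : ℝ) (hs : 1 ≤ s) :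
    ∃ C : ℝ≥0, ∀ T : ℝ, 0 < T → T ≤ 1 → ∀ u : ℝ → KPI.Plane → ℝ,
      KPI.IsHInfPath T u → KPI.IsKPISolution T u →
        KPI.ENorm s T (KPI.toC u) ^ 2 ≤
          (C : ℝ≥0∞) * (KPI.HNorm s 0 (KPI.toC u 0) ^ 2
            + KPI.FNorm η₀ 1 T (KPI.toC u) * KPI.FNorm η₀ s T (KPI.toC u) ^ 2) := by
  obtain ⟨K, hK⟩ := KPI.exists_approximate_energy_bound hη₀ hs
  set A : ℝ≥0 := (1 + 2 * ENNReal.ofReal (4 ^ s)).toNNReal with hA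
  have hA' : (A : ℝ≥0∞) = 1 + 2 * ENNReal.ofReal (4 ^ s) :=
    ENNReal.coe_toNNReal (by finiteness)
  have hA0 : (A : ℝ≥0∞) ≠ 0 := by rw [hA']; simp
  refine ⟨A + 4 * K, fun T hT hT1 u hu hsol => ?_⟩
  set b : ℕ → ℝ≥0∞ := fun k => KPI.FkTNorm η₀ k T fun t => KPI.P k (KPI.toC u t) with hb
  rw [KPI.FNorm_eq, KPI.FNorm_eq, KPI.sq_sqrt_ennreal]
  change _ ≤ ((A + 4 * K : ℝ≥0) : ℝ≥0∞) * (_ + KPI.dsq 1 b ^ (1 / 2 : ℝ) * KPI.dsq s b)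
  -- If the F^s norm is infinite, the right side is infinite as soon as the F^1 norm is nonzero,
  -- because `∞ · 0 = 0` in `ℝ≥0∞`. The F^1 norm can vanish only if every piece has norm 0, and then
  -- the F^s norm vanishes too.
  by_cases hfin : KPI.dsq s b = ⊤
  · have h1 : KPI.dsq 1 b ≠ 0 := fun h => by
      rw [KPI.dsq_eq_zero h] at hfin
      exact ENNReal.zero_ne_top hfin
    have h2 : KPI.dsq 1 b ^ (1 / 2 : ℝ) ≠ 0 := by
      simp [ENNReal.rpow_eq_zero_iff, h1]
    rw [hfin, ENNReal.mul_top h2, add_top, ENNReal.mul_top]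
    · exact le_top
    · rw [ENNReal.coe_add]
      exact fun h => hA0 (add_eq_zero.1 h).1
  have h1t : KPI.dsq 1 b ≠ ⊤ := ne_top_of_le_ne_top hfin (KPI.dsq_mono_exponent hs _)
  -- The excess is taken to be `1 / (n + 1)` and tends to 0. The constant `K` does not depend on the
  -- choice of extensions.
  refine (ge_of_tendsto' (KPI.tendsto_approximation h1t hfin _ K) fun n =>
    hK hT hT1 hu hsol hb hfin (ε := ((n : ℝ≥0∞) + 1)⁻¹) (by simp) (by simp)).trans ?_
  rw [← hA', ENNReal.coe_add, ENNReal.coe_mul]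
  have h2 : (2 : ℝ≥0∞) ^ (1 / 2 : ℝ) ≤ 2 := by
    calc (2 : ℝ≥0∞) ^ (1 / 2 : ℝ) ≤ 2 ^ (1 : ℝ) := by gcongr <;> norm_num
      _ = 2 := ENNReal.rpow_one 2
  rw [ENNReal.mul_rpow_of_nonneg _ _ (by norm_num : (0 : ℝ) ≤ 1 / 2), mul_add]
  refine add_le_add (by gcongr; exact le_self_add) ?_
  calc (K : ℝ≥0∞) * ((2 : ℝ≥0∞) ^ (1 / 2 : ℝ) * KPI.dsq 1 b ^ (1 / 2 : ℝ) * (2 * KPI.dsq s b))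
      ≤ K * (2 * KPI.dsq 1 b ^ (1 / 2 : ℝ) * (2 * KPI.dsq s b)) := by gcongr
    _ = 4 * K * (KPI.dsq 1 b ^ (1 / 2 : ℝ) * KPI.dsq s b) := by ring
    _ ≤ _ := by gcongr; exact le_add_self
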